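/- Let $\Bbbk$ be a field of characteristic $0$ and let $n\ge 2$. **Poincaré duality CDGA.** Let $A$ be a connected commutative differential graded $\Bbbk$-algebra of finite type ($A=\Bbbk\oplus A^{\ge1}$, cohomological grading) with a linear form $\varepsilon:A^n\to\Bbbk$, $\varepsilon\circ d=0$, such that the pairings $A^k\otimes A^{n-k}\to\Bbbk$, $a\otimes b\mapsto\varepsilon(ab)$, are non-degenerate for all $k$. Assume that the Euler characteristic $\chi(A)=\sum_i(-1)^i\dim A^i$ is $0$. Let $\Delta_A=\sum_i(-1)^{|a_i|}a_i\otimes a_i^\vee$ for a homogeneous basis $(a_i)$ and its dual basis, $\varepsilon(a_ia_j^\vee)=\delta_{ij}$. **The right module $G_A^\vee$.** For a finite set $U$, let $G_A(U)$ be the CDGA generated by elements $\iota_u(a)$ ($u\in U$, $a\in A$), where $\iota_u:A\to G_A(U)$ is a morphism of algebras, and by elements $\omega_{uv}$ ($u\ne v\in U$) of degree $n-1$, with the relations $$\omega_{vu}=(-1)^n\omega_{uv},\quad \omega_{uv}^2=0,\quad \omega_{uv}\omega_{vw}+\omega_{vw}\omega_{wu}+\omega_{wu}\omega_{uv}=0,\quad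 \iota_u(a)\,\omega_{uv}=\iota_v(a)\,\omega_{uv},$$ and with the differential given by $d\iota_u(a)=\iota_u(da)$ and $d\omega_{uv}=(\iota_u\cdot\iota_v)(\Delta_A)$. Let $\mathtt e_n$ be the homology operad of the little $n$-disks operad (unital version), so that $\mathtt e_n$-algebras are the unital dg $(n-1)$-Poisson algebras: graded commutative unital dg algebras with a Lie bracket of homological degree $n-1$ which is a graded biderivation. Its dual cooperad $\mathtt e_n^\vee$ is the graded commutative algebra $\mathtt e_n^\vee(U)$ generated by the $\omega_{uv}$ alone, subject to the first three relations above, with $d=0$. The collection $G_A$ is a right $\mathtt e_n^\vee$-comodule: for $W\subset U$, the map $G_A(U)\to G_A(U/W)\otimes\mathtt e_n^\vee(W)$ is the morphism of algebras which sends $\iota_u(a)$ to $\iota_{[u]}(a)\otimes 1$, and sends $\omega_{uv}$ to $1\otimes\omega_{uv}$ if $u,v\in W$ and to $\omega_{[u][v]}\otimes 1$ otherwise. Hence the dual $G_A^\vee$ is a right $\mathtt e_n$-module. **The derived circle product.** Let $\mathfrak g$ be a dg Lie algebra over $\Bbbk$ (homologically graded, possibly unbounded). Let $S(\mathfrak g[n-1])$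 be the $\mathtt e_n$-algebra which is the free graded commutative algebra on the shift of $\mathfrak g$ in which $x\in\mathfrak g$ has homological degree $|x|-(n-1)$, with the bracket which extends the shifted bracket of $\mathfrak g$ by the Leibniz rule. Let $C^{\mathrm{CE}}$ denote the Chevalley--Eilenberg complex that computes Lie algebra homology, and let $A^{-*}\otimes\mathfrak g$ be the dg Lie algebra in which $a\otimes x$ has homological degree $|x|-|a|$. For an $\mathtt e_n$-algebra $B$, $G_A^\vee\circ_{\mathtt e_n}B$ is the relative composition product, i.e. the coequalizer of $G_A^\vee\circ\mathtt e_n\circ B\rightrightarrows G_A^\vee\circ B$ in chain complexes. The derived circle product $G_A^\vee\circ^{\mathbb L}_{\mathtt e_n}B$ is $G_A^\vee\circ_{\mathtt e_n}Q$, where $Q\to B$ is a quasi-isomorphism of $\mathtt e_n$-algebras with $Q$ cofibrant (i.e. with the left lifting property with respect to surjective quasi-isomorphisms of $\mathtt e_n$-algebras). **Proposition.** There is a quasi-isomorphism of chain complexes $$G_A^\vee\circ^{\mathbb L}_{\mathtt e_n}S(\mathfrak g[n-1])\ \xrightarrow{\ \sim\ }\ C^{\mathrm{CE}}(A^{-*}\otimes\mathfrak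 g).$$ More precisely, cofibrant resolutions $Q\xrightarrow{\sim}S(\mathfrak g[n-1])$ exist, and there is a chain map $\Phi:G_A^\vee\circ_{\mathtt e_n}S(\mathfrak g[n-1])\to C^{\mathrm{CE}}(A^{-*}\otimes\mathfrak g)$ such that, for every cofibrant resolution $Q\xrightarrow{\sim}S(\mathfrak g[n-1])$, the composite $$G_A^\vee\circ_{\mathtt e_n}Q\to G_A^\vee\circ_{\mathtt e_n}S(\mathfrak g[n-1])\xrightarrow{\ \Phi\ }C^{\mathrm{CE}}(A^{-*}\otimes\mathfrak g)$$ is a quasi-isomorphism. -/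

import Mathlib

open scoped TensorProduct DirectSum

universe u

noncomputable section

namespace GradedLS

set_option linter.all false

/-- The Koszul sign `(-1)^i`, as a scalar. -/
def sg (K : Type u) [Field K] (i : ℤ) : K := if Even i then 1 else -1

section Signs

variable {K : Type u} [Field K]

lemma sg_even {i : ℤ} (h : Even i) : sg K i = 1 := if_pos h

lemma sg_odd {i : ℤ} (h : Odd i) : sg K i = -1 := if_neg (Int.not_even_iff_odd.mpr h)

lemma sg_zero : sg K 0 = 1 := sg_even (by decide)

lemma sg_add (i j : ℤ) : sg K (i + j) = sg K i * sg K j := by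
  rcases Int.even_or_odd i with hi | hi <;> rcases Int.even_or_odd j with hj | hj
  · rw [sg_even hi, sg_even hj, sg_even (hi.add hj), one_mul]
  · rw [sg_even hi, sg_odd hj, sg_odd (hi.add_odd hj), one_mul]
  · rw [sg_odd hi, sg_even hj, sg_odd (hi.add_even hj), mul_one]
  · rw [sg_odd hi, sg_odd hj, sg_even (hi.add_odd hj), neg_one_mul, neg_neg]

lemma sg_mul_self (i : ℤ) : sg K i * sg K i = 1 := by
  rcases Int.even_or_odd i with hi | hi
  · rw [sg_even hi, one_mul]
  · rw [sg_odd hi, neg_one_mul, neg_neg]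

end Signs

section Graded

variable {K : Type u} [Field K] {V W : Type u} [AddCommGroup V] [Module K V]
  [AddCommMonoid W] [Module K W] (gr : ℤ → Submodule K V) [DirectSum.Decomposition gr]

/-- The linear map on a graded module with given restrictions to the homogeneous pieces. -/
def glift (f : ∀ i, gr i →ₗ[K] W) : V →ₗ[K] W :=
  DirectSum.toModule K ℤ W f ∘ₗ (DirectSum.decomposeLinearEquiv gr).toLinearMap

lemma glift_of_mem (f : ∀ i, gr i →ₗ[K] W) {i : ℤ} {x : V} (hx : x ∈ gr i) :
    glift gr f x = f i ⟨x, hx⟩ := by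
  have h := DirectSum.decomposeLinearEquiv_apply_coe (R := K) gr i ⟨x, hx⟩
  rw [glift, LinearMap.comp_apply, LinearEquiv.coe_coe, h, DirectSum.toModule_lof]

variable {gr} in
lemma ghom_ext {f g : V →ₗ[K] W} (h : ∀ i, ∀ x ∈ gr i, f x = g x) : f = g := by
  apply LinearMap.ext
  intro x
  induction x using DirectSum.Decomposition.inductionOn gr with
  | zero => simp
  | homogeneous x => exact h _ _ x.2
  | add x y hx hy => rw [map_add, map_add, hx, hy]

/-- The twist `x ↦ (-1)^(p |x|) x` of a graded module. -/
def tw (p : ℤ) : V →ₗ[K] V := glift gr fun i => sg K (p * i) • (gr i).subtype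

lemma tw_of_mem (p : ℤ) {i : ℤ} {x : V} (hx : x ∈ gr i) : tw gr p x = sg K (p * i) • x := by
  simp [tw, glift_of_mem gr _ hx]

end Graded

section TwMul

variable {K : Type u} [Field K] {R : Type u} [Ring R] [Algebra K R] (𝒜 : ℤ → Submodule K R)
  [GradedAlgebra 𝒜]

lemma tw_one (p : ℤ) : tw 𝒜 p 1 = 1 := by
  rw [tw_of_mem 𝒜 p (SetLike.GradedOne.one_mem (A := 𝒜)), mul_zero, sg_zero, one_smul]

lemma tw_mul (p : ℤ) (x y : R) : tw 𝒜 p (x * y) = tw 𝒜 p x * tw 𝒜 p y := by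
  have h : (LinearMap.mul K R).compr₂ (tw 𝒜 p) =
      (LinearMap.mul K R).compl₁₂ (tw 𝒜 p) (tw 𝒜 p) := by
    refine ghom_ext (gr := 𝒜) fun i x hx => ghom_ext (gr := 𝒜) fun j y hy => ?_
    simp only [LinearMap.compr₂_apply, LinearMap.compl₁₂_apply, LinearMap.mul_apply']
    rw [tw_of_mem 𝒜 p hx, tw_of_mem 𝒜 p hy, tw_of_mem 𝒜 p (SetLike.GradedMul.mul_mem hx hy),
      mul_add, sg_add, smul_mul_smul_comm]
  exact LinearMap.congr_fun (LinearMap.congr_fun h x) y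

end TwMul

/-- A presentation of a graded associative algebra: generators with degrees, and homogeneous
relations between noncommutative polynomials in the generators. -/
structure GPres (K : Type u) [Field K] where
  X : Type u
  deg : X → ℤ
  rel : FreeAlgebra K X → FreeAlgebra K X → Prop
  homog : ∀ a b, rel a b → ∃ i : ℤ,
    a ∈ Submodule.span K {w | ∃ l : List X, (l.map deg).sum = i ∧
      w = (l.map (FreeAlgebra.ι K)).prod} ∧
    b ∈ Submodule.span K {w | ∃ l : List X, (l.map deg).sum = i ∧
      w = (l.map (FreeAlgebra.ι K)).prod}

namespace GPres

variable {K : Type u} [Field K] (P : GPres K)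

/-- The words of degree `i` span the degree `i` part of the free algebra. -/
def free (i : ℤ) : Submodule K (FreeAlgebra K P.X) :=
  Submodule.span K {w | ∃ l : List P.X, (l.map P.deg).sum = i ∧
      w = (l.map (FreeAlgebra.ι K)).prod}

/-- The presented algebra. -/
def Alg : Type u := RingQuot P.rel

instance : Ring P.Alg := inferInstanceAs (Ring (RingQuot P.rel))

instance : Algebra K P.Alg := inferInstanceAs (Algebra K (RingQuot P.rel))

/-- The projection of the free algebra onto the presented algebra. -/
def proj : FreeAlgebra K P.X →ₐ[K] P.Alg := RingQuot.mkAlgHom K P.rel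

lemma proj_rel {a b : FreeAlgebra K P.X} (h : P.rel a b) : P.proj a = P.proj b :=
  RingQuot.mkAlgHom_rel K h

lemma proj_surjective : Function.Surjective P.proj := RingQuot.mkAlgHom_surjective K P.rel

/-- The image of a generator. -/
def gen (x : P.X) : P.Alg := P.proj (FreeAlgebra.ι K x)

/-- The degree `i` part of the presented algebra, spanned by the words of degree `i`. -/
def gr (i : ℤ) : Submodule K P.Alg :=
  Submodule.span K {w | ∃ l : List P.X, (l.map P.deg).sum = i ∧ w = (l.map P.gen).prod}

lemma word_mem (l : List P.X) : (l.map P.gen).prod ∈ P.gr (l.map P.deg).sum :=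
  Submodule.subset_span ⟨l, rfl, rfl⟩

lemma gen_mem (x : P.X) : P.gen x ∈ P.gr (P.deg x) := by
  simpa using P.word_mem [x]

instance : SetLike.GradedMonoid P.gr where
  one_mem := by simpa using P.word_mem []
  mul_mem i j x y hx hy := by
    refine Submodule.span_induction₂ (p := fun x y _ _ => x * y ∈ P.gr (i + j)) ?_ ?_ ?_ ?_ ?_
      ?_ ?_ hx hy
    · rintro _ _ ⟨l, hl, rfl⟩ ⟨m, hm, rfl⟩
      have := P.word_mem (l ++ m)
      simpa [hl, hm] using this
    · intro y _; rw [zero_mul]; exact zero_mem _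
    · intro y _; rw [mul_zero]; exact zero_mem _
    · intro x y z _ _ _ h1 h2; rw [add_mul]; exact add_mem h1 h2
    · intro x y z _ _ _ h1 h2; rw [mul_add]; exact add_mem h1 h2
    · intro r x y _ _ h; rw [smul_mul_assoc]; exact Submodule.smul_mem _ _ h
    · intro r x y _ _ h; rw [mul_smul_comm]; exact Submodule.smul_mem _ _ h

/-- Maps out of the presented algebra. -/
def lift {B : Type u} [Ring B] [Algebra K B] (f : P.X → B)
    (h : ∀ a b, P.rel a b → FreeAlgebra.lift K f a = FreeAlgebra.lift K f b) : P.Alg →ₐ[K] B :=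
  RingQuot.liftAlgHom K ⟨FreeAlgebra.lift K f, fun a b hab => h a b hab⟩

lemma lift_proj {B : Type u} [Ring B] [Algebra K B] (f : P.X → B)
    (h : ∀ a b, P.rel a b → FreeAlgebra.lift K f a = FreeAlgebra.lift K f b)
    (a : FreeAlgebra K P.X) : P.lift f h (P.proj a) = FreeAlgebra.lift K f a :=
  RingQuot.liftAlgHom_mkAlgHom_apply K _ _ a

lemma lift_gen {B : Type u} [Ring B] [Algebra K B] (f : P.X → B)
    (h : ∀ a b, P.rel a b → FreeAlgebra.lift K f a = FreeAlgebra.lift K f b) (x : P.X) :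
    P.lift f h (P.gen x) = f x := by
  rw [gen, lift_proj, FreeAlgebra.lift_ι_apply]

lemma hom_ext {B : Type u} [Ring B] [Algebra K B] {f g : P.Alg →ₐ[K] B}
    (h : ∀ x, f (P.gen x) = g (P.gen x)) : f = g := by
  apply RingQuot.ringQuot_ext'
  apply FreeAlgebra.hom_ext
  funext x
  exact h x

lemma induction {p : P.Alg → Prop} (h1 : p 1) (hadd : ∀ x y, p x → p y → p (x + y))
    (hsmul : ∀ (c : K) x, p x → p (c • x)) (hmul : ∀ x y, p y → p (P.gen x * y)) (a : P.Alg) :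
    p a := by
  have key : ∀ (w : FreeAlgebra K P.X) (y : P.Alg), p y → p (P.proj w * y) := by
    intro w
    induction w using FreeAlgebra.induction with
    | grade0 r =>
      intro y hy
      rw [AlgHom.commutes, ← Algebra.smul_def]
      exact hsmul _ _ hy
    | grade1 x => exact fun y hy => hmul x y hy
    | mul a b ha hb =>
      intro y hy
      rw [map_mul, mul_assoc]
      exact ha _ (hb _ hy)
    | add a b ha hb =>
      intro y hy
      rw [map_add, add_mul]
      exact hadd _ _ (ha _ hy) (hb _ hy)
  obtain ⟨w, rfl⟩ := P.proj_surjective a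
  simpa using key w 1 h1

/-- The splitting of the free algebra into its homogeneous pieces, followed by the projection. -/
def splitFree : FreeAlgebra K P.X →ₐ[K] ⨁ i, P.gr i :=
  FreeAlgebra.lift K fun x => DirectSum.of (fun i => P.gr i) (P.deg x) ⟨P.gen x, P.gen_mem x⟩

lemma splitFree_word (l : List P.X) : P.splitFree (l.map (FreeAlgebra.ι K)).prod =
    DirectSum.of (fun i => P.gr i) (l.map P.deg).sum ⟨(l.map P.gen).prod, P.word_mem l⟩ := by
  induction l with
  | nil => simp only [List.map_nil, List.prod_nil, map_one]; rfl
  | cons x l ih =>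
    simp only [List.map_cons, List.prod_cons, map_mul, ih]
    rw [splitFree, FreeAlgebra.lift_ι_apply, DirectSum.of_mul_of]
    rfl

lemma proj_word (l : List P.X) :
    P.proj (l.map (FreeAlgebra.ι K)).prod = (l.map P.gen).prod := by
  rw [map_list_prod, List.map_map]; rfl

lemma splitFree_of_mem {i : ℤ} {a : FreeAlgebra K P.X} (ha : a ∈ P.free i) :
    ∃ h : P.proj a ∈ P.gr i,
      P.splitFree a = DirectSum.of (fun i => P.gr i) i ⟨P.proj a, h⟩ := by
  induction ha using Submodule.span_induction with
  | mem x hx =>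
    obtain ⟨l, rfl, rfl⟩ := hx
    simp only [P.proj_word]
    exact ⟨P.word_mem l, P.splitFree_word l⟩
  | zero =>
    refine ⟨by rw [map_zero]; exact zero_mem _, ?_⟩
    simp only [map_zero]
    exact (map_zero (DirectSum.of (fun i => P.gr i) i)).symm
  | add x y _ _ hx hy =>
    obtain ⟨hx, ex⟩ := hx
    obtain ⟨hy, ey⟩ := hy
    refine ⟨by rw [map_add]; exact add_mem hx hy, ?_⟩
    rw [map_add, ex, ey, ← map_add]
    congr 1
    apply Subtype.ext
    simp
  | smul c x _ hx =>
    obtain ⟨hx, ex⟩ := hx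
    refine ⟨by rw [map_smul]; exact Submodule.smul_mem _ _ hx, ?_⟩
    rw [map_smul, ex]
    change c • DirectSum.lof K ℤ (fun i => P.gr i) i _ = DirectSum.lof K ℤ (fun i => P.gr i) i _
    rw [← map_smul]
    congr 1
    apply Subtype.ext
    simp

/-- The splitting of the presented algebra into its homogeneous pieces. -/
def split : P.Alg →ₐ[K] ⨁ i, P.gr i :=
  RingQuot.liftAlgHom K ⟨P.splitFree, fun a b hab => by
    obtain ⟨i, ha, hb⟩ := P.homog a b hab
    obtain ⟨h1, e1⟩ := P.splitFree_of_mem (i := i) ha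
    obtain ⟨h2, e2⟩ := P.splitFree_of_mem (i := i) hb
    rw [e1, e2]
    congr 1
    apply Subtype.ext
    exact P.proj_rel hab⟩

lemma split_proj (a : FreeAlgebra K P.X) : P.split (P.proj a) = P.splitFree a :=
  RingQuot.liftAlgHom_mkAlgHom_apply K _ _ a

lemma split_word (l : List P.X) : P.split (l.map P.gen).prod =
    DirectSum.of (fun i => P.gr i) (l.map P.deg).sum ⟨(l.map P.gen).prod, P.word_mem l⟩ := by
  rw [← P.splitFree_word, ← P.proj_word, split_proj]

instance : GradedAlgebra P.gr :=
  GradedAlgebra.ofAlgHom P.gr P.split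
    (by
      apply P.hom_ext
      intro x
      have h := P.split_word [x]
      simp only [List.map_cons, List.map_nil, List.prod_cons, List.prod_nil, mul_one] at h
      rw [AlgHom.comp_apply, h, DirectSum.coeAlgHom_of]
      rfl)
    (by
      rintro i ⟨x, hx⟩
      dsimp only
      induction hx using Submodule.span_induction with
      | mem x hx =>
        obtain ⟨l, rfl, rfl⟩ := hx
        exact P.split_word l
      | zero =>
        rw [map_zero]
        exact (map_zero (DirectSum.of (fun i => P.gr i) i)).symm
      | add x y _ _ h1 h2 =>
        rw [map_add, h1, h2, ← map_add]; rfl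
      | smul c x _ h =>
        rw [map_smul, h]
        change c • DirectSum.lof K ℤ (fun i => P.gr i) i _ =
          DirectSum.lof K ℤ (fun i => P.gr i) i _
        rw [← map_smul]; rfl)

/-- If the generators commute in the graded sense, then so do all homogeneous elements. -/
lemma comm_of_gen (h : ∀ x y, P.gen x * P.gen y =
      sg K (P.deg x * P.deg y) • (P.gen y * P.gen x)) {i j : ℤ} {x y : P.Alg}
    (hx : x ∈ P.gr i) (hy : y ∈ P.gr j) : x * y = sg K (i * j) • (y * x) := by
  have h1 : ∀ (a : P.X) (l : List P.X), P.gen a * (l.map P.gen).prod =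
      sg K (P.deg a * (l.map P.deg).sum) • ((l.map P.gen).prod * P.gen a) := by
    intro a l
    induction l with
    | nil => simp [sg_zero]
    | cons b l ih =>
      simp only [List.map_cons, List.prod_cons, List.sum_cons]
      rw [← mul_assoc, h a b, smul_mul_assoc, mul_assoc, ih, mul_smul_comm, smul_smul, mul_add,
        sg_add, mul_assoc]
  have h2 : ∀ l m : List P.X, (l.map P.gen).prod * (m.map P.gen).prod =
      sg K ((l.map P.deg).sum * (m.map P.deg).sum) •
        ((m.map P.gen).prod * (l.map P.gen).prod) := by
    intro l m
    induction l with
    | nil => simp [sg_zero]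
    | cons b l ih =>
      simp only [List.map_cons, List.prod_cons, List.sum_cons]
      rw [mul_assoc, ih, mul_smul_comm, ← mul_assoc, h1, smul_mul_assoc, smul_smul, add_mul,
        sg_add, mul_assoc, mul_comm (sg K _)]
  refine Submodule.span_induction₂ (p := fun x y _ _ => x * y = sg K (i * j) • (y * x))
    ?_ ?_ ?_ ?_ ?_ ?_ ?_ hx hy
  · rintro _ _ ⟨l, rfl, rfl⟩ ⟨m, rfl, rfl⟩
    exact h2 l m
  · intro y _; simp
  · intro y _; simp
  · intro x y z _ _ _ h1 h2; rw [add_mul, mul_add, h1, h2, smul_add]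
  · intro x y z _ _ _ h1 h2; rw [add_mul, mul_add, h1, h2, smul_add]
  · intro r x y _ _ h; rw [smul_mul_assoc, mul_smul_comm, h, smul_comm]
  · intro r x y _ _ h; rw [smul_mul_assoc, mul_smul_comm, h, smul_comm]

section Derivation

variable (p : ℤ) (δ : P.X → P.Alg)

/-- The upper triangular matrices which encode twisted derivations. -/
def derMat (x : P.X) : Matrix (Fin 2) (Fin 2) P.Alg :=
  !![tw P.gr p (P.gen x), δ x; 0, P.gen x]

variable (h : ∀ a b, P.rel a b →
  FreeAlgebra.lift K (P.derMat p δ) a = FreeAlgebra.lift K (P.derMat p δ) b)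

/-- The derivation of degree `p` which extends `δ`. -/
def der : P.Alg →ₗ[K] P.Alg :=
  (LinearMap.proj (1 : Fin 2) ∘ₗ LinearMap.proj (0 : Fin 2)) ∘ₗ
    (P.lift (P.derMat p δ) h).toLinearMap

lemma der_apply (x : P.Alg) : P.der p δ h x = P.lift (P.derMat p δ) h x 0 1 := rfl

lemma der_gen (x : P.X) : P.der p δ h (P.gen x) = δ x := by
  rw [der_apply, P.lift_gen]; rfl

lemma lift_derMat (x : P.Alg) :
    P.lift (P.derMat p δ) h x = !![tw P.gr p x, P.der p δ h x; 0, x] := by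
  suffices h' : P.lift (P.derMat p δ) h x 0 0 = tw P.gr p x ∧
      P.lift (P.derMat p δ) h x 1 0 = 0 ∧ P.lift (P.derMat p δ) h x 1 1 = x by
    ext i j
    fin_cases i <;> fin_cases j
    · exact h'.1
    · rfl
    · exact h'.2.1
    · exact h'.2.2
  induction x using P.induction with
  | h1 => simp [tw_one]
  | hadd x y hx hy => simp [hx, hy]
  | hsmul c x hx => simp [hx]
  | hmul x y hy =>
    rw [map_mul, P.lift_gen]
    simp [Matrix.mul_apply, derMat, hy, tw_mul]

lemma der_one : P.der p δ h 1 = 0 := by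
  rw [der_apply, map_one]; rfl

lemma der_mul (x y : P.Alg) :
    P.der p δ h (x * y) = P.der p δ h x * y + tw P.gr p x * P.der p δ h y := by
  rw [der_apply, map_mul, lift_derMat, lift_derMat]
  simp [Matrix.mul_apply, Fin.sum_univ_two, add_comm]

lemma der_mem (hδ : ∀ x, δ x ∈ P.gr (P.deg x + p)) {i : ℤ} {x : P.Alg} (hx : x ∈ P.gr i) :
    P.der p δ h x ∈ P.gr (i + p) := by
  induction hx using Submodule.span_induction with
  | zero => rw [map_zero]; exact zero_mem _
  | add x y _ _ h1 h2 => rw [map_add]; exact add_mem h1 h2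
  | smul c x _ h1 => rw [map_smul]; exact Submodule.smul_mem _ _ h1
  | mem x hx =>
    obtain ⟨l, rfl, rfl⟩ := hx
    induction l with
    | nil => simp [der_one]
    | cons a l ih =>
      simp only [List.map_cons, List.prod_cons, List.sum_cons]
      rw [der_mul, der_gen]
      refine add_mem ?_ ?_
      · have := SetLike.GradedMul.mul_mem (hδ a) (P.word_mem l)
        rwa [add_right_comm] at this
      · rw [tw_of_mem _ _ (P.gen_mem a), smul_mul_assoc]
        refine Submodule.smul_mem _ _ ?_
        have := SetLike.GradedMul.mul_mem (P.gen_mem a) ih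
        rwa [← add_assoc] at this

end Derivation

end GPres

/-- A differential graded Lie algebra over `K`, with homological grading (the differential has
degree `-1` and the bracket has degree `0`). -/
structure DGLie (K : Type u) [Field K] where
  V : Type u
  [grp : AddCommGroup V]
  [mod : Module K V]
  gr : ℤ → Submodule K V
  [dec : DirectSum.Decomposition gr]
  d : V →ₗ[K] V
  br : V →ₗ[K] V →ₗ[K] V
  d_mem : ∀ {i x}, x ∈ gr i → d x ∈ gr (i - 1)
  d_d : ∀ x, d (d x) = 0
  br_mem : ∀ {i j x y}, x ∈ gr i → y ∈ gr j → br x y ∈ gr (i + j)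
  br_symm : ∀ {i j x y}, x ∈ gr i → y ∈ gr j → br x y = -(sg K (i * j) • br y x)
  jacobi : ∀ {i j k x y z}, x ∈ gr i → y ∈ gr j → z ∈ gr k →
    br x (br y z) = br (br x y) z + sg K (i * j) • br y (br x z)
  d_br : ∀ {i j x y}, x ∈ gr i → y ∈ gr j →
    d (br x y) = br (d x) y + sg K i • br x (d y)

attribute [instance] DGLie.grp DGLie.mod DGLie.dec

/-- A unital differential graded Poisson algebra whose bracket has (homological) degree `N`; for
`N = n - 1 ≥ 1` these are the algebras over the homology operad of the little `n`-disks operad.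
The bracket is the image of the generating operation `λ` of degree `N`, acting from the left, so
that all signs are given by the Koszul rule; in particular `N = 0`, `N = 1` give (dg) Poisson
algebras and Gerstenhaber algebras. -/
structure PoisAlg (K : Type u) [Field K] (N : ℤ) where
  B : Type u
  [ring : Ring B]
  [alg : Algebra K B]
  gr : ℤ → Submodule K B
  [gra : GradedAlgebra gr]
  d : B →ₗ[K] B
  br : B →ₗ[K] B →ₗ[K] B
  d_mem : ∀ {i x}, x ∈ gr i → d x ∈ gr (i - 1)
  d_d : ∀ x, d (d x) = 0
  mul_comm : ∀ {i j x y}, x ∈ gr i → y ∈ gr j → x * y = sg K (i * j) • (y * x)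
  d_mul : ∀ {i j x y}, x ∈ gr i → y ∈ gr j → d (x * y) = d x * y + sg K i • (x * d y)
  br_mem : ∀ {i j x y}, x ∈ gr i → y ∈ gr j → br x y ∈ gr (i + j + N)
  br_symm : ∀ {i j x y}, x ∈ gr i → y ∈ gr j → br x y = sg K (N + 1 + i * j) • br y x
  d_br : ∀ {i j x y}, x ∈ gr i → y ∈ gr j →
    d (br x y) = sg K N • (br (d x) y + sg K i • br x (d y))
  leibniz : ∀ {i j k x y z}, x ∈ gr i → y ∈ gr j → z ∈ gr k →
    br x (y * z) = br x y * z + sg K ((i + N) * j) • (y * br x z)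
  jacobi : ∀ {i j k x y z}, x ∈ gr i → y ∈ gr j → z ∈ gr k →
    br x (br y z) = sg K ((i + N) * N) • br (br x y) z +
      sg K ((i + N) * (j + N)) • br y (br x z)

attribute [instance] PoisAlg.ring PoisAlg.alg PoisAlg.gra

section IsDer

variable {K : Type u} [Field K] {R : Type u} [Ring R] [Algebra K R] (𝒜 : ℤ → Submodule K R)
  [GradedAlgebra 𝒜]

/-- Derivations of degree `p` of a graded algebra. -/
structure IsDer (p : ℤ) (D : R →ₗ[K] R) : Prop where
  mem : ∀ {i x}, x ∈ 𝒜 i → D x ∈ 𝒜 (i + p)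
  mul : ∀ {i j x y}, x ∈ 𝒜 i → y ∈ 𝒜 j → D (x * y) = D x * y + sg K (p * i) • (x * D y)

variable {𝒜}

lemma IsDer.cast {p q : ℤ} {D : R →ₗ[K] R} (h : IsDer 𝒜 p D) (e : p = q) : IsDer 𝒜 q D := e ▸ h

lemma IsDer.add {p : ℤ} {D E : R →ₗ[K] R} (hD : IsDer 𝒜 p D) (hE : IsDer 𝒜 p E) :
    IsDer 𝒜 p (D + E) where
  mem hx := Submodule.add_mem _ (hD.mem hx) (hE.mem hx)
  mul hx hy := by
    simp only [LinearMap.add_apply, hD.mul hx hy, hE.mul hx hy, add_mul, mul_add, smul_add]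
    abel

lemma IsDer.smul {p : ℤ} {D : R →ₗ[K] R} (hD : IsDer 𝒜 p D) (c : K) : IsDer 𝒜 p (c • D) where
  mem hx := Submodule.smul_mem _ _ (hD.mem hx)
  mul hx hy := by
    simp only [LinearMap.smul_apply, hD.mul hx hy, smul_add, smul_mul_assoc, mul_smul_comm,
      smul_comm c]

lemma IsDer.sub {p : ℤ} {D E : R →ₗ[K] R} (hD : IsDer 𝒜 p D) (hE : IsDer 𝒜 p E) :
    IsDer 𝒜 p (D - E) where
  mem hx := Submodule.sub_mem _ (hD.mem hx) (hE.mem hx)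
  mul hx hy := by
    simp only [LinearMap.sub_apply, hD.mul hx hy, hE.mul hx hy, sub_mul, mul_sub, smul_sub]
    abel

lemma IsDer.commutator {p q : ℤ} {D E : R →ₗ[K] R} (hD : IsDer 𝒜 p D) (hE : IsDer 𝒜 q E) :
    IsDer 𝒜 (p + q) (D ∘ₗ E - sg K (p * q) • (E ∘ₗ D)) where
  mem {i x} hx := by
    refine Submodule.sub_mem _ ?_ (Submodule.smul_mem _ _ ?_)
    · have := hD.mem (hE.mem hx)
      rwa [add_assoc, add_comm q] at this
    · have := hE.mem (hD.mem hx)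
      rwa [add_assoc] at this
  mul {i j x y} hx hy := by
    simp only [LinearMap.sub_apply, LinearMap.smul_apply, LinearMap.comp_apply, hD.mul hx hy,
      hE.mul hx hy, map_add, map_smul, hD.mul hx (hE.mem hy), hD.mul (hE.mem hx) hy,
      hE.mul hx (hD.mem hy), hE.mul (hD.mem hx) hy]
    by_cases hp : Even p <;> by_cases hq : Even q <;> by_cases hi : Even i <;>
    simp [sg, -Int.not_even_iff_odd, ← Int.not_even_iff_odd, Int.even_add, Int.even_sub, Int.even_mul, hp, hq, hi, sub_mul, mul_sub, add_mul, mul_add] <;>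
    module

lemma IsDer.sq {p : ℤ} {D : R →ₗ[K] R} (hD : IsDer 𝒜 p D) (hp : Odd p) :
    IsDer 𝒜 (p + p) (D ∘ₗ D) where
  mem {i x} hx := by
    have := hD.mem (hD.mem hx)
    rwa [add_assoc] at this
  mul {i j x y} hx hy := by
    simp only [LinearMap.comp_apply, hD.mul hx hy, map_add, map_smul, hD.mul hx (hD.mem hy),
      hD.mul (hD.mem hx) hy]
    have hp' : ¬ Even p := Int.not_even_iff_odd.mpr hp
    by_cases hi : Even i <;>
    simp [sg, -Int.not_even_iff_odd, ← Int.not_even_iff_odd, Int.even_add, Int.even_sub, Int.even_mul, hp', hi] <;>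
    module

/-- The product of a derivation with an element of a graded commutative algebra. -/
lemma IsDer.mulLeft (hc : ∀ {i j x y}, x ∈ 𝒜 i → y ∈ 𝒜 j → x * y = sg K (i * j) • (y * x))
    {p a : ℤ} {D : R →ₗ[K] R} (hD : IsDer 𝒜 p D) {z : R} (hz : z ∈ 𝒜 a) :
    IsDer 𝒜 (a + p) (LinearMap.mulLeft K z ∘ₗ D) where
  mem {i x} hx := by
    have := SetLike.GradedMul.mul_mem hz (hD.mem hx)
    rw [add_left_comm] at this
    exact this
  mul {i j x y} hx hy := by
    simp only [LinearMap.comp_apply, LinearMap.mulLeft_apply, hD.mul hx hy, mul_add,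
      mul_smul_comm]
    rw [← mul_assoc, ← mul_assoc z x, hc hz hx, smul_mul_assoc, smul_smul, mul_assoc x z,
      add_mul, sg_add, mul_comm (sg K (p * i))]

end IsDer

namespace DGLie

variable {K : Type u} [Field K] (L : DGLie K) (N : ℤ)

/-- The relations of the symmetric algebra of the shift of `L` in which `x` has degree
`|x| - N`. -/
inductive SymRel : FreeAlgebra K (Σ i, L.gr i) → FreeAlgebra K (Σ i, L.gr i) → Prop
  | add (i : ℤ) (x y : L.gr i) : SymRel (FreeAlgebra.ι K ⟨i, x + y⟩)
      (FreeAlgebra.ι K ⟨i, x⟩ + FreeAlgebra.ι K ⟨i, y⟩)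
  | smul (i : ℤ) (c : K) (x : L.gr i) : SymRel (FreeAlgebra.ι K ⟨i, c • x⟩)
      (c • FreeAlgebra.ι K ⟨i, x⟩)
  | comm (i j : ℤ) (x : L.gr i) (y : L.gr j) :
      SymRel (FreeAlgebra.ι K ⟨i, x⟩ * FreeAlgebra.ι K ⟨j, y⟩)
        (sg K ((i - N) * (j - N)) • (FreeAlgebra.ι K ⟨j, y⟩ * FreeAlgebra.ι K ⟨i, x⟩))

/-- The presentation of the graded symmetric algebra of the shift of `L` in which `x` has degree
`|x| - N`. -/
abbrev symPres : GPres K where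
  X := Σ i, L.gr i
  deg x := x.1 - N
  rel := L.SymRel N
  homog := by
    have h1 : ∀ x : Σ i, L.gr i, FreeAlgebra.ι K x ∈
        Submodule.span K {w | ∃ l : List (Σ i, L.gr i), (l.map fun x => x.1 - N).sum = x.1 - N ∧
          w = (l.map (FreeAlgebra.ι K)).prod} := fun x =>
      Submodule.subset_span ⟨[x], by simp, by simp⟩
    intro a b hab
    cases hab with
    | add i x y => exact ⟨i - N, h1 ⟨i, x + y⟩, add_mem (h1 ⟨i, x⟩) (h1 ⟨i, y⟩)⟩
    | smul i c x => exact ⟨i - N, h1 ⟨i, c • x⟩, Submodule.smul_mem _ _ (h1 ⟨i, x⟩)⟩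
    | comm i j x y =>
      exact ⟨(i - N) + (j - N), Submodule.subset_span ⟨[⟨i, x⟩, ⟨j, y⟩], by simp, by simp⟩,
        Submodule.smul_mem _ _ (Submodule.subset_span ⟨[⟨j, y⟩, ⟨i, x⟩],
          by simp [add_comm], by simp⟩)⟩

/-- The graded symmetric algebra of the shift of `L` in which `x` has degree `|x| - N`. -/
abbrev Sym : Type u := (L.symPres N).Alg

/-- The grading of the symmetric algebra. -/
abbrev sgr : ℤ → Submodule K (L.Sym N) := (L.symPres N).gr

/-- The inclusion of the generators in the symmetric algebra. -/
def s : L.V →ₗ[K] L.Sym N :=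
  glift L.gr fun i =>
    { toFun := fun x => (L.symPres N).gen ⟨i, x⟩
      map_add' := fun x y => by
        have := (L.symPres N).proj_rel (SymRel.add (N := N) i x y)
        rw [map_add] at this
        exact this
      map_smul' := fun c x => by
        have := (L.symPres N).proj_rel (SymRel.smul (N := N) i c x)
        rw [map_smul] at this
        exact this }

lemma s_of_mem {i : ℤ} {x : L.V} (hx : x ∈ L.gr i) :
    L.s N x = (L.symPres N).gen ⟨i, ⟨x, hx⟩⟩ := glift_of_mem _ _ hx

lemma s_mem {i : ℤ} {x : L.V} (hx : x ∈ L.gr i) : L.s N x ∈ L.sgr N (i - N) := by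
  rw [s_of_mem L N hx]
  exact (L.symPres N).gen_mem ⟨i, ⟨x, hx⟩⟩

lemma gen_eq (x : Σ i, L.gr i) : (L.symPres N).gen x = L.s N x.2 := by
  rw [s_of_mem L N x.2.2]

lemma sym_comm {i j : ℤ} {x y : L.Sym N} (hx : x ∈ L.sgr N i) (hy : y ∈ L.sgr N j) :
    x * y = sg K (i * j) • (y * x) := by
  refine (L.symPres N).comm_of_gen ?_ hx hy
  rintro ⟨i, x⟩ ⟨j, y⟩
  have := (L.symPres N).proj_rel (SymRel.comm (N := N) i j x y)
  rw [map_smul, map_mul, map_mul] at this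
  exact this

lemma sym_induction {p : L.Sym N → Prop} (h1 : p 1) (hadd : ∀ x y, p x → p y → p (x + y))
    (hsmul : ∀ (c : K) x, p x → p (c • x))
    (hmul : ∀ i, ∀ x ∈ L.gr i, ∀ j, ∀ y ∈ L.sgr N j, p y → p (L.s N x * y)) (a : L.Sym N) :
    p a := by
  have h0 : p 0 := by simpa using hsmul 0 1 h1
  have hw : ∀ l : List (Σ i, L.gr i), p (l.map (L.symPres N).gen).prod := by
    intro l
    induction l with
    | nil => simpa using h1
    | cons x l ih =>
      rw [List.map_cons, List.prod_cons, gen_eq]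
      exact hmul _ _ x.2.2 _ _ ((L.symPres N).word_mem l) ih
  induction a using DirectSum.Decomposition.inductionOn (L.sgr N) with
  | zero => exact h0
  | add x y hx hy => exact hadd x y hx hy
  | homogeneous x =>
    obtain ⟨x, hx⟩ := x
    induction hx using Submodule.span_induction with
    | mem x hx =>
      obtain ⟨l, -, rfl⟩ := hx
      exact hw l
    | zero => exact h0
    | add x y _ _ h1 h2 => exact hadd x y h1 h2
    | smul c x _ h => exact hsmul c x h

lemma IsDer.map_one {p : ℤ} {D : L.Sym N →ₗ[K] L.Sym N} (hD : IsDer (L.sgr N) p D) : D 1 = 0 := by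
  have := hD.mul (SetLike.GradedOne.one_mem (A := L.sgr N))
    (SetLike.GradedOne.one_mem (A := L.sgr N))
  rw [mul_one, one_mul, mul_zero, sg_zero, one_smul, mul_one, left_eq_add] at this
  exact this

lemma der_ext {p : ℤ} {D E : L.Sym N →ₗ[K] L.Sym N} (hD : IsDer (L.sgr N) p D)
    (hE : IsDer (L.sgr N) p E) (h : ∀ i, ∀ x ∈ L.gr i, D (L.s N x) = E (L.s N x)) : D = E := by
  apply LinearMap.ext
  intro a
  induction a using L.sym_induction N with
  | h1 => rw [IsDer.map_one L N hD, IsDer.map_one L N hE]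
  | hadd x y hx hy => rw [map_add, map_add, hx, hy]
  | hsmul c x hx => rw [map_smul, map_smul, hx]
  | hmul i x hx j y hy ih => rw [hD.mul (L.s_mem N hx) hy, hE.mul (L.s_mem N hx) hy, ih, h i x hx]

/-- The linear maps of degree `p` from the generators to the symmetric algebra. -/
def homs (p : ℤ) : Submodule K (L.V →ₗ[K] L.Sym N) where
  carrier := {δ | ∀ i, ∀ x ∈ L.gr i, δ x ∈ L.sgr N (i - N + p)}
  add_mem' hx hy i v hv := add_mem (hx i v hv) (hy i v hv)
  zero_mem' i v hv := zero_mem _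
  smul_mem' c x hx i v hv := Submodule.smul_mem _ _ (hx i v hv)

lemma symDer_aux (p : ℤ) (δ : L.homs N p) (a b : FreeAlgebra K (Σ i, L.gr i))
    (hab : L.SymRel N a b) :
    FreeAlgebra.lift K ((L.symPres N).derMat p fun x => δ.1 x.2) a =
      FreeAlgebra.lift K ((L.symPres N).derMat p fun x => δ.1 x.2) b := by
  cases hab with
  | add i x y =>
    simp only [map_add, FreeAlgebra.lift_ι_apply, GPres.derMat, gen_eq]
    ext i j; fin_cases i <;> fin_cases j <;> simp
  | smul i c x =>
    simp only [map_smul, FreeAlgebra.lift_ι_apply, GPres.derMat, gen_eq]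
    ext i j; fin_cases i <;> fin_cases j <;> simp
  | comm i j x y =>
    have h1 := L.s_mem N x.2
    have h2 := L.s_mem N y.2
    have h3 := δ.2 i x x.2
    have h4 := δ.2 j y y.2
    simp only [map_smul, map_mul, FreeAlgebra.lift_ι_apply, GPres.derMat, gen_eq,
      Matrix.mul_fin_two, tw_of_mem _ p h1, tw_of_mem _ p h2]
    have e1 := L.sym_comm N h1 h2
    have e2 := L.sym_comm N h1 h4
    have e3 := L.sym_comm N h3 h2
    ext a b
    fin_cases a <;> fin_cases b
    · simp [e1, smul_smul]
      congr 1
      ring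
    · simp [e2, e3, smul_smul]
      by_cases hp : Even p <;> by_cases hi : Even i <;> by_cases hj : Even j <;>
      by_cases hN : Even N <;>
      simp [sg, -Int.not_even_iff_odd, ← Int.not_even_iff_odd, Int.even_add, Int.even_sub, Int.even_mul, hp, hi, hj, hN] <;>
    module
    · simp
    · simp [e1]

/-- The derivation of degree `p` of the symmetric algebra with given restriction to the
generators. -/
def symDer (p : ℤ) (δ : L.homs N p) : L.Sym N →ₗ[K] L.Sym N :=
  (L.symPres N).der p (fun x => δ.1 x.2) (L.symDer_aux N p δ)

lemma symDer_s (p : ℤ) (δ : L.homs N p) {i : ℤ} {x : L.V} (hx : x ∈ L.gr i) :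
    L.symDer N p δ (L.s N x) = δ.1 x := by
  rw [s_of_mem L N hx, symDer, GPres.der_gen]

lemma isDer_symDer (p : ℤ) (δ : L.homs N p) : IsDer (L.sgr N) p (L.symDer N p δ) where
  mem hx := (L.symPres N).der_mem p _ _ (fun x => δ.2 _ _ x.2.2) hx
  mul hx hy := by
    rw [symDer, GPres.der_mul, tw_of_mem _ p hx, smul_mul_assoc]

/-- The extension of linear maps to derivations is linear. -/
def symDerL (p : ℤ) : L.homs N p →ₗ[K] (L.Sym N →ₗ[K] L.Sym N) where
  toFun δ := L.symDer N p δ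
  map_add' δ δ' := by
    refine L.der_ext N (L.isDer_symDer N p _)
      ((L.isDer_symDer N p _).add (L.isDer_symDer N p _)) fun i x hx => ?_
    simp [L.symDer_s N p _ hx]
  map_smul' c δ := by
    refine L.der_ext N (L.isDer_symDer N p _) ((L.isDer_symDer N p _).smul c) fun i x hx => ?_
    simp [L.symDer_s N p _ hx]

/-- The differential of the symmetric algebra: the derivation such that
`d (s x) = (-1)^N s (d x)`. -/
def symD : L.Sym N →ₗ[K] L.Sym N :=
  L.symDer N (-1) ⟨sg K N • (L.s N ∘ₗ L.d), fun i x hx => Submodule.smul_mem _ _ (by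
    have := L.s_mem N (L.d_mem hx)
    rwa [sub_right_comm] at this)⟩

lemma symD_s {i : ℤ} {x : L.V} (hx : x ∈ L.gr i) :
    L.symD N (L.s N x) = sg K N • L.s N (L.d x) := L.symDer_s N _ _ hx

lemma isDer_symD : IsDer (L.sgr N) (-1) (L.symD N) := L.isDer_symDer N _ _

lemma symD_symD (x : L.Sym N) : L.symD N (L.symD N x) = 0 := by
  have h : L.symD N ∘ₗ L.symD N = 0 := by
    refine L.der_ext N ((L.isDer_symD N).sq (by decide))
      (E := 0) ⟨fun _ => zero_mem _, fun _ _ => by simp⟩ fun i x hx => ?_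
    simp [L.symD_s N hx, L.symD_s N (L.d_mem hx), L.d_d]
  exact LinearMap.congr_fun h x

/-- The derivation `{s x, -}` for `x` in `L`: it is given by `{s x, s y} = (-1)^(N |x|) s [x, y]`
on generators. -/
def ad : L.V →ₗ[K] (L.Sym N →ₗ[K] L.Sym N) :=
  glift L.gr fun i => L.symDerL N i ∘ₗ
    LinearMap.codRestrict (L.homs N i) (sg K (N * i) • (L.br.compr₂ (L.s N)) ∘ₗ (L.gr i).subtype)
      (fun x j y hy => Submodule.smul_mem _ _ (by
        have := L.s_mem N (L.br_mem x.2 hy)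
        rwa [add_sub_assoc, add_comm] at this))

lemma isDer_ad {i : ℤ} {x : L.V} (hx : x ∈ L.gr i) : IsDer (L.sgr N) i (L.ad N x) := by
  rw [ad, glift_of_mem _ _ hx]
  exact L.isDer_symDer N _ _

lemma ad_s {i j : ℤ} {x y : L.V} (hx : x ∈ L.gr i) (hy : y ∈ L.gr j) :
    L.ad N x (L.s N y) = sg K (N * i) • L.s N (L.br x y) := by
  rw [ad, glift_of_mem _ _ hx]
  exact L.symDer_s N _ _ hy

/-- The Poisson bracket of the symmetric algebra, extending `ad` to a graded antisymmetric
biderivation. -/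
def symBr : L.Sym N →ₗ[K] L.Sym N →ₗ[K] L.Sym N :=
  glift (L.sgr N) fun j => L.symDerL N (j + N) ∘ₗ
    LinearMap.codRestrict (L.homs N (j + N))
      ((sg K (N + 1 + N * j) • ((L.ad N).comp (tw L.gr j)).flip) ∘ₗ (L.sgr N j).subtype)
      (fun x i y hy => Submodule.smul_mem _ _ (by
        have := (L.isDer_ad N hy).mem x.2
        have e : i - N + (j + N) = j + i := by ring
        rw [e]
        simp only [LinearMap.comp_apply, Submodule.subtype_apply, LinearMap.flip_apply,
          tw_of_mem _ j hy, map_smul, LinearMap.smul_apply]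
        exact Submodule.smul_mem _ _ this))

lemma isDer_symBr {j : ℤ} {x : L.Sym N} (hx : x ∈ L.sgr N j) :
    IsDer (L.sgr N) (j + N) (L.symBr N x) := by
  rw [symBr, glift_of_mem _ _ hx]
  exact L.isDer_symDer N _ _

lemma symBr_s_right {i j : ℤ} {x : L.Sym N} {y : L.V} (hx : x ∈ L.sgr N j) (hy : y ∈ L.gr i) :
    L.symBr N x (L.s N y) = sg K (N + 1 + (i - N) * j) • L.ad N y x := by
  rw [symBr, glift_of_mem _ _ hx]
  refine (L.symDer_s N _ _ hy).trans ?_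
  change sg K (N + 1 + N * j) • L.ad N (tw L.gr j y) x = _
  rw [tw_of_mem _ j hy, map_smul, LinearMap.smul_apply, smul_smul]
  congr 1
  by_cases hj : Even j <;> by_cases hi : Even i <;> by_cases hN : Even N <;>
  simp [sg, -Int.not_even_iff_odd, ← Int.not_even_iff_odd, Int.even_add, Int.even_sub, Int.even_mul, hi, hj, hN] <;>
    module

lemma symBr_s {i : ℤ} {x : L.V} (hx : x ∈ L.gr i) : L.symBr N (L.s N x) = L.ad N x := by
  refine L.der_ext N ((L.isDer_symBr N (L.s_mem N hx)).cast (by ring)) (L.isDer_ad N hx) ?_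
  intro j y hy
  rw [L.symBr_s_right N (L.s_mem N hx) hy, L.ad_s N hx hy, L.ad_s N hy hx, L.br_symm hx hy]
  simp only [map_neg, map_smul, smul_neg, smul_smul]
  by_cases hj : Even j <;> by_cases hi : Even i <;> by_cases hN : Even N <;>
  simp [sg, -Int.not_even_iff_odd, ← Int.not_even_iff_odd, Int.even_add, Int.even_sub, Int.even_mul, hi, hj, hN] <;>
    module

lemma symBr_s_s {i j : ℤ} {x y : L.V} (hx : x ∈ L.gr i) (hy : y ∈ L.gr j) :
    L.symBr N (L.s N x) (L.s N y) = sg K (N * i) • L.s N (L.br x y) := by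
  rw [L.symBr_s N hx, L.ad_s N hx hy]

lemma symBr_mul_left {a b : ℤ} {x y : L.Sym N} (hx : x ∈ L.sgr N a) (hy : y ∈ L.sgr N b)
    (z : L.Sym N) : L.symBr N (x * y) z =
      sg K (N * a) • (x * L.symBr N y z) + sg K (N * b + a * b) • (y * L.symBr N x z) := by
  have h : L.symBr N (x * y) = sg K (N * a) • (LinearMap.mulLeft K x ∘ₗ L.symBr N y) +
      sg K (N * b + a * b) • (LinearMap.mulLeft K y ∘ₗ L.symBr N x) := by
    have hxy := SetLike.GradedMul.mul_mem hx hy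
    refine L.der_ext N (L.isDer_symBr N hxy)
      (((((L.isDer_symBr N hy).mulLeft (L.sym_comm N) hx).cast (by ring)).smul _).add
        ((((L.isDer_symBr N hx).mulLeft (L.sym_comm N) hy).cast (by ring)).smul _)) ?_
    intro i w hw
    simp only [LinearMap.add_apply, LinearMap.smul_apply, LinearMap.comp_apply,
      LinearMap.mulLeft_apply, L.symBr_s_right N hxy hw, L.symBr_s_right N hx hw,
      L.symBr_s_right N hy hw, (L.isDer_ad N hw).mul hx hy]
    rw [L.sym_comm N ((L.isDer_ad N hw).mem hx) hy]
    simp only [mul_smul_comm, smul_smul, smul_add]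
    by_cases ha : Even a <;> by_cases hb : Even b <;> by_cases hi : Even i <;>
    by_cases hN : Even N <;>
    simp [sg, -Int.not_even_iff_odd, ← Int.not_even_iff_odd, Int.even_add, Int.even_sub, Int.even_mul, hi, ha, hb, hN] <;>
    module
  exact LinearMap.congr_fun h z

lemma symBr_symm {i j : ℤ} {x y : L.Sym N} (hx : x ∈ L.sgr N i) (hy : y ∈ L.sgr N j) :
    L.symBr N x y = sg K (N + 1 + i * j) • L.symBr N y x := by
  have h : L.symBr N x = sg K (N + 1) • ((L.symBr N).flip x ∘ₗ tw (L.sgr N) i) := by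
    refine L.der_ext N (L.isDer_symBr N hx) (IsDer.smul ⟨?_, ?_⟩ _) ?_
    · intro k z hz
      simp only [LinearMap.comp_apply, LinearMap.flip_apply, tw_of_mem _ i hz, map_smul,
        LinearMap.smul_apply]
      refine Submodule.smul_mem _ _ ?_
      have := (L.isDer_symBr N hz).mem hx
      have e : k + (i + N) = i + (k + N) := by ring
      rwa [e]
    · intro k l z w hz hw
      simp only [LinearMap.comp_apply, LinearMap.flip_apply, tw_of_mem _ i hz,
        tw_of_mem _ i hw, tw_of_mem _ i (SetLike.GradedMul.mul_mem hz hw), map_smul,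
        LinearMap.smul_apply, L.symBr_mul_left N hz hw]
      rw [L.sym_comm N hw ((L.isDer_symBr N hz).mem hx)]
      simp only [mul_smul_comm, smul_mul_assoc, smul_smul, smul_add]
      by_cases ha : Even i <;> by_cases hb : Even k <;> by_cases hi : Even l <;>
      by_cases hN : Even N <;>
      simp [sg, -Int.not_even_iff_odd, ← Int.not_even_iff_odd, Int.even_add, Int.even_sub, Int.even_mul, hi, ha, hb, hN] <;>
    module
    · intro k z hz
      rw [L.symBr_s_right N hx hz]
      simp only [LinearMap.smul_apply, LinearMap.comp_apply, LinearMap.flip_apply,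
        tw_of_mem _ i (L.s_mem N hz), map_smul, L.symBr_s N hz, smul_smul]
      congr 1
      rw [sg_add, mul_comm i]
  rw [h]
  simp only [LinearMap.smul_apply, LinearMap.comp_apply, LinearMap.flip_apply,
    tw_of_mem _ i hy, map_smul, smul_smul]
  rw [sg_add (N + 1)]

/-- A derivation of the symmetric algebra that is compatible with the brackets of generators is
compatible with all brackets. -/
lemma der_symBr {q : ℤ} {D : L.Sym N →ₗ[K] L.Sym N} (hD : IsDer (L.sgr N) q D)
    (h : ∀ k, ∀ w ∈ L.gr k, ∀ j, ∀ y ∈ L.sgr N j, D (L.symBr N (L.s N w) y) =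
      sg K (q * N) • L.symBr N (D (L.s N w)) y + sg K (q * k) • L.symBr N (L.s N w) (D y))
    {a : ℤ} {x : L.Sym N} (hx : x ∈ L.sgr N a) (y : L.Sym N) :
    D (L.symBr N x y) =
      sg K (q * N) • L.symBr N (D x) y + sg K (q * (a + N)) • L.symBr N x (D y) := by
  have e : D ∘ₗ L.symBr N x - sg K (q * (a + N)) • (L.symBr N x ∘ₗ D) =
      sg K (q * N) • L.symBr N (D x) := by
    refine L.der_ext N (hD.commutator (L.isDer_symBr N hx))
      (((L.isDer_symBr N (hD.mem hx)).cast (by ring)).smul _) ?_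
    intro k w hw
    have hs := L.s_mem N hw
    simp only [LinearMap.sub_apply, LinearMap.smul_apply, LinearMap.comp_apply]
    rw [L.symBr_symm N hx hs, map_smul, h k w hw a x hx, L.symBr_symm N (hD.mem hx) hs,
      L.symBr_symm N hx (hD.mem hs)]
    simp only [smul_smul, smul_add]
    by_cases ha : Even a <;> by_cases hb : Even q <;> by_cases hi : Even k <;>
    by_cases hN : Even N <;>
    simp [sg, -Int.not_even_iff_odd, ← Int.not_even_iff_odd, Int.even_add, Int.even_sub, Int.even_mul, hi, ha, hb, hN] <;>
    module
  have := LinearMap.congr_fun e y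
  simp only [LinearMap.sub_apply, LinearMap.smul_apply, LinearMap.comp_apply] at this
  rw [← this]
  abel

/-- The same criterion, with a condition on pairs of generators only. -/
lemma der_symBr_gen {q : ℤ} {D : L.Sym N →ₗ[K] L.Sym N} (hD : IsDer (L.sgr N) q D)
    (h : ∀ k, ∀ w ∈ L.gr k, ∀ l, ∀ v ∈ L.gr l, D (L.symBr N (L.s N w) (L.s N v)) =
      sg K (q * N) • L.symBr N (D (L.s N w)) (L.s N v) +
        sg K (q * k) • L.symBr N (L.s N w) (D (L.s N v)))
    {a : ℤ} {x : L.Sym N} (hx : x ∈ L.sgr N a) (y : L.Sym N) :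
    D (L.symBr N x y) =
      sg K (q * N) • L.symBr N (D x) y + sg K (q * (a + N)) • L.symBr N x (D y) := by
  refine L.der_symBr N hD ?_ hx y
  intro k w hw j y hy
  have hs := L.s_mem N hw
  have e : D ∘ₗ L.symBr N (L.s N w) - sg K (q * (k - N + N)) • (L.symBr N (L.s N w) ∘ₗ D) =
      sg K (q * N) • L.symBr N (D (L.s N w)) := by
    refine L.der_ext N (hD.commutator (L.isDer_symBr N hs))
      (((L.isDer_symBr N (hD.mem hs)).cast (by ring)).smul _) ?_
    intro l v hv
    simp only [LinearMap.sub_apply, LinearMap.smul_apply, LinearMap.comp_apply, h k w hw l v hv]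
    rw [sub_add_cancel]
    abel
  have := LinearMap.congr_fun e y
  simp only [LinearMap.sub_apply, LinearMap.smul_apply, LinearMap.comp_apply] at this
  rw [← this, sub_add_cancel]
  abel

lemma symBr_ad {i a : ℤ} {v : L.V} (hv : v ∈ L.gr i) {x : L.Sym N} (hx : x ∈ L.sgr N a)
    (y : L.Sym N) : L.ad N v (L.symBr N x y) =
      sg K (i * N) • L.symBr N (L.ad N v x) y + sg K (i * (a + N)) • L.symBr N x (L.ad N v y) := by
  refine L.der_symBr_gen N (L.isDer_ad N hv) ?_ hx y
  intro k w hw l u hu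
  simp only [L.symBr_s N hw, L.ad_s N hv hw, L.ad_s N hv hu, L.ad_s N hw hu, map_smul,
    LinearMap.smul_apply, L.symBr_s N (L.br_mem hv hw), L.ad_s N (L.br_mem hv hw) hu,
    L.ad_s N hv (L.br_mem hw hu), L.ad_s N hw (L.br_mem hv hu)]
  rw [L.jacobi hv hw hu]
  simp only [map_add, map_smul, smul_smul, smul_add]
  by_cases ha : Even i <;> by_cases hb : Even k <;> by_cases hi : Even l <;>
  by_cases hN : Even N <;>
  simp [sg, -Int.not_even_iff_odd, ← Int.not_even_iff_odd, Int.even_add, Int.even_sub, Int.even_mul, hi, ha, hb, hN] <;>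
    module

/-- The symmetric algebra of the shift of `L` by `N`, as a Poisson algebra with bracket of degree
`N`: the bracket is the biderivation which extends the shifted Lie bracket of `L`. -/
def symPois : PoisAlg K N where
  B := L.Sym N
  gr := L.sgr N
  d := L.symD N
  br := L.symBr N
  d_mem hx := (L.isDer_symD N).mem hx
  d_d := L.symD_symD N
  mul_comm := L.sym_comm N
  d_mul {i j x y} hx hy := by
    rw [(L.isDer_symD N).mul hx hy]
    congr 2
    by_cases hi : Even i <;> simp [sg, -Int.not_even_iff_odd, ← Int.not_even_iff_odd, Int.even_add, Int.even_sub, Int.even_mul, hi] <;>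
    module
  br_mem {i j x y} hx hy := by
    have := (L.isDer_symBr N hx).mem hy
    rwa [← add_assoc, add_comm j i] at this
  br_symm := L.symBr_symm N
  d_br {i j x y} hx hy := by
    rw [L.der_symBr_gen N (L.isDer_symD N) _ hx y]
    · by_cases hi : Even i <;> by_cases hN : Even N <;> simp [sg, -Int.not_even_iff_odd, ← Int.not_even_iff_odd, Int.even_add, Int.even_sub, Int.even_mul, hi, hN] <;>
    module
    · intro k w hw l u hu
      simp only [L.symBr_s_s N hw hu, map_smul, L.symD_s N hw, L.symD_s N hu,
        L.symD_s N (L.br_mem hw hu), L.symBr_s_s N hw (L.d_mem hu), L.d_br hw hu,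
        L.symBr_s_s N (L.d_mem hw) hu, LinearMap.smul_apply, map_add]
      by_cases hi : Even k <;> by_cases hN : Even N <;>
        simp [sg, -Int.not_even_iff_odd, ← Int.not_even_iff_odd, Int.even_add, Int.even_sub, Int.even_mul, hi, hN] <;>
    module
  leibniz {i j k x y z} hx hy hz := (L.isDer_symBr N hx).mul hy hz
  jacobi {i j k x y z} hx hy hz := by
    refine L.der_symBr N (L.isDer_symBr N hx) ?_ hy z
    intro k w hw l y hy
    have hs := L.s_mem N hw
    have h1 := L.symBr_ad N hw hx y
    rw [← L.symBr_s N hw] at h1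
    have h2 := L.symBr_symm N hx hs
    rw [h2, map_smul, LinearMap.smul_apply, h1]
    simp only [smul_smul, smul_add]
    by_cases ha : Even i <;> by_cases hi : Even k <;>
    by_cases hN : Even N <;>
    simp [sg, -Int.not_even_iff_odd, ← Int.not_even_iff_odd, Int.even_add, Int.even_sub, Int.even_mul, hi, ha, hN] <;>
    module

end DGLie

/-- Chain complexes: the degree `i` part of the complex is `gr i`, a subspace of an ambient vector
space on which the differential is defined. -/
structure Cpx (K : Type u) [Field K] where
  V : Type u
  [grp : AddCommGroup V]
  [mod : Module K V]
  gr : ℤ → Submodule K V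
  d : V →ₗ[K] V
  d_mem : ∀ {i x}, x ∈ gr i → d x ∈ gr (i - 1)
  d_d : ∀ x, d (d x) = 0

attribute [instance] Cpx.grp Cpx.mod

namespace Cpx

variable {K : Type u} [Field K]

/-- Chain maps. -/
structure Hom (C D : Cpx K) where
  f : C.V →ₗ[K] D.V
  mem : ∀ {i x}, x ∈ C.gr i → f x ∈ D.gr i
  comm : ∀ x, f (C.d x) = D.d (f x)

/-- Composition of chain maps. -/
def Hom.comp {C D E : Cpx K} (g : Hom D E) (f : Hom C D) : Hom C E where
  f := g.f ∘ₗ f.f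
  mem hx := g.mem (f.mem hx)
  comm x := by simp [f.comm, g.comm]

/-- A chain map is a quasi-isomorphism if it is surjective and injective on homology in every
degree. -/
structure Hom.IsQuasiIso {C D : Cpx K} (f : Hom C D) : Prop where
  surj : ∀ i, ∀ y ∈ D.gr i, D.d y = 0 →
    ∃ x ∈ C.gr i, C.d x = 0 ∧ ∃ z ∈ D.gr (i + 1), f.f x = y + D.d z
  inj : ∀ i, ∀ x ∈ C.gr i, C.d x = 0 → (∃ z ∈ D.gr (i + 1), f.f x = D.d z) →
    ∃ w ∈ C.gr (i + 1), x = C.d w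

end Cpx

namespace DGLie

variable {K : Type u} [Field K] (L : DGLie K)

/-- The operator on pairs which encodes the Chevalley-Eilenberg differential of a product with a
generator `s x`, where `s x` has degree `|x| + 1`. -/
def ceOp (i : ℤ) : L.V →ₗ[K] Module.End K (L.Sym (-1) × L.Sym (-1)) where
  toFun x := LinearMap.prod (LinearMap.mulLeft K (L.s (-1) x) ∘ₗ LinearMap.fst K _ _)
    (sg K (i + 1) • (LinearMap.mulLeft K (L.s (-1) x) ∘ₗ LinearMap.snd K _ _) +
      (LinearMap.mulLeft K (L.symD (-1) (L.s (-1) x)) + L.ad (-1) x) ∘ₗ LinearMap.fst K _ _)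
  map_add' x y := by
    apply LinearMap.ext
    rintro ⟨a, b⟩
    ext
    · simp [add_mul]
    · simp [add_mul]
      abel
  map_smul' c x := by
    apply LinearMap.ext
    rintro ⟨a, b⟩
    ext
    · simp
    · simp [smul_comm c]

lemma ceOp_apply (i : ℤ) (x : L.V) (a b : L.Sym (-1)) : L.ceOp i x (a, b) =
    (L.s (-1) x * a, sg K (i + 1) • (L.s (-1) x * b) +
      (L.symD (-1) (L.s (-1) x) * a + L.ad (-1) x a)) := rfl

lemma ce_aux (a b : FreeAlgebra K (Σ i, L.gr i)) (hab : L.SymRel (-1) a b) :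
    FreeAlgebra.lift K (fun x : Σ i, L.gr i => L.ceOp x.1 x.2) a =
      FreeAlgebra.lift K (fun x : Σ i, L.gr i => L.ceOp x.1 x.2) b := by
  cases hab with
  | add i x y => simp
  | smul i c x => simp
  | comm i j x y =>
    obtain ⟨x, hx⟩ := x
    obtain ⟨y, hy⟩ := y
    have sx := L.s_mem (-1) hx
    have sy := L.s_mem (-1) hy
    have dx := (L.isDer_symD (-1)).mem sx
    have dy := (L.isDer_symD (-1)).mem sy
    simp only [map_smul, map_mul, FreeAlgebra.lift_ι_apply]
    apply LinearMap.ext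
    intro p
    obtain ⟨a, b⟩ := p
    rw [Module.End.mul_apply, LinearMap.smul_apply, Module.End.mul_apply]
    simp only [ceOp_apply, Prod.smul_mk, Prod.mk.injEq]
    have e1 := L.sym_comm (-1) sx sy
    have e2 := L.sym_comm (-1) sx dy
    have e3 := L.sym_comm (-1) dx sy
    have hder : ∀ {k : ℤ} {v : L.V}, v ∈ L.gr k → ∀ {l : ℤ} {w : L.V}, w ∈ L.gr l →
        L.ad (-1) v (L.s (-1) w * a) = L.ad (-1) v (L.s (-1) w) * a +
          sg K (k * (l + 1)) • (L.s (-1) w * L.ad (-1) v a) := by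
      intro k v hv l w hw
      induction a using DirectSum.Decomposition.inductionOn (L.sgr (-1)) with
      | zero => simp
      | homogeneous a =>
        have := (L.isDer_ad (-1) hv).mul (L.s_mem (-1) hw) a.2
        rwa [sub_neg_eq_add] at this
      | add a b ha hb =>
        simp only [mul_add, map_add, ha, hb, smul_add]
        abel
    constructor
    · rw [← mul_assoc, e1, smul_mul_assoc, mul_assoc]
    · rw [hder hx hy, hder hy hx, L.ad_s (-1) hx hy, L.ad_s (-1) hy hx, L.br_symm hx hy]
      simp only [mul_add, mul_smul_comm, ← mul_assoc, e1, e2, e3, map_neg, map_smul]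
      by_cases hi : Even i <;> by_cases hj : Even j <;>
      simp [sg, -Int.not_even_iff_odd, ← Int.not_even_iff_odd, Int.even_add, Int.even_sub,
        Int.even_mul, hi, hj] <;>
      abel

/-- The Chevalley-Eilenberg differential, on the graded symmetric algebra on the generators `s x`
of degree `|x| + 1`: it is determined by `ceD 1 = 0` and
`ceD (s x * y) = -s (d x) * y + (-1)^|s x| s x * ceD y + {s x, y}`, where `{s x, -}` is the
derivation with `{s x, s y} = (-1)^|x| s [x, y]`, so that `ceD` is the sum of the differential
induced by that of `L` and of the map which replaces two factors of a product by their bracket. -/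
def ceD : L.Sym (-1) →ₗ[K] L.Sym (-1) :=
  LinearMap.snd K _ _ ∘ₗ LinearMap.applyₗ ((1, 0) : L.Sym (-1) × L.Sym (-1)) ∘ₗ
    ((L.symPres (-1)).lift (fun x => L.ceOp x.1 x.2) L.ce_aux).toLinearMap

lemma ceD_aux (y : L.Sym (-1)) :
    (L.symPres (-1)).lift (fun x => L.ceOp x.1 x.2) L.ce_aux y (1, 0) = (y, L.ceD y) := by
  refine Prod.ext ?_ rfl
  induction y using (L.symPres (-1)).induction with
  | h1 => simp
  | hadd x y hx hy => simp [hx, hy]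
  | hsmul c x hx => simp [hx]
  | hmul x y hy =>
    rw [map_mul, GPres.lift_gen, Module.End.mul_apply, gen_eq]
    exact congrArg (L.s (-1) x.2 * ·) hy

lemma ceD_one : L.ceD 1 = 0 := by
  change ((L.symPres (-1)).lift (fun x => L.ceOp x.1 x.2) L.ce_aux 1 (1, 0)).2 = 0
  rw [map_one]
  rfl

lemma ceD_mul {i : ℤ} {x : L.V} (hx : x ∈ L.gr i) (y : L.Sym (-1)) :
    L.ceD (L.s (-1) x * y) = L.symD (-1) (L.s (-1) x) * y +
      sg K (i + 1) • (L.s (-1) x * L.ceD y) + L.ad (-1) x y := by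
  change ((L.symPres (-1)).lift (fun x => L.ceOp x.1 x.2) L.ce_aux (L.s (-1) x * y) (1, 0)).2 = _
  rw [map_mul, Module.End.mul_apply, ceD_aux, s_of_mem L (-1) hx, GPres.lift_gen]
  simp only [ceOp_apply, ← s_of_mem L (-1) hx]
  abel

lemma ceD_s {i : ℤ} {x : L.V} (hx : x ∈ L.gr i) : L.ceD (L.s (-1) x) = -L.s (-1) (L.d x) := by
  have h := L.ceD_mul hx 1
  rw [mul_one, mul_one, ceD_one, mul_zero, smul_zero, add_zero,
    IsDer.map_one L (-1) (L.isDer_ad (-1) hx), add_zero, L.symD_s (-1) hx] at h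
  rw [h, sg_odd (by decide), neg_one_smul]

lemma ceD_mem {i : ℤ} {x : L.Sym (-1)} (hx : x ∈ L.sgr (-1) i) : L.ceD x ∈ L.sgr (-1) (i - 1) := by
  induction hx using Submodule.span_induction with
  | zero => rw [map_zero]; exact zero_mem _
  | add x y _ _ h1 h2 => rw [map_add]; exact add_mem h1 h2
  | smul c x _ h1 => rw [map_smul]; exact Submodule.smul_mem _ _ h1
  | mem x hx =>
    obtain ⟨l, rfl, rfl⟩ := hx
    induction l with
    | nil => simp [ceD_one]
    | cons a l ih =>
      have hw := (L.symPres (-1)).word_mem l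
      have ha := L.s_mem (-1) a.2.2
      simp only [List.map_cons, List.prod_cons, List.sum_cons]
      rw [gen_eq, L.ceD_mul a.2.2]
      refine add_mem (add_mem ?_ (Submodule.smul_mem _ _ ?_)) ?_
      · have := SetLike.GradedMul.mul_mem ((L.isDer_symD (-1)).mem ha) hw
        rwa [add_right_comm] at this
      · have := SetLike.GradedMul.mul_mem ha ih
        rwa [← add_sub_assoc] at this
      · have := (L.isDer_ad (-1) a.2.2).mem hw
        convert this using 2
        change a.1 - -1 + _ - 1 = _
        ring

/-- The Chevalley-Eilenberg differential is compatible with the brackets with generators. -/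
lemma ceD_ad {i : ℤ} {x : L.V} (hx : x ∈ L.gr i) (y : L.Sym (-1)) :
    L.ceD (L.ad (-1) x y) = L.ad (-1) (L.d x) y + sg K i • L.ad (-1) x (L.ceD y) := by
  induction y using L.sym_induction (-1) with
  | h1 => simp [IsDer.map_one L (-1) (L.isDer_ad (-1) hx),
      IsDer.map_one L (-1) (L.isDer_ad (-1) (L.d_mem hx)), ceD_one]
  | hadd y z hy hz =>
    simp only [map_add, hy, hz, smul_add]
    abel
  | hsmul c y hy => simp only [map_smul, hy, smul_add, smul_neg, smul_comm c]
  | hmul j u hu k y hy ih =>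
    have su := L.s_mem (-1) hu
    have du := (L.isDer_symD (-1)).mem su
    have hxu := L.br_mem hx hu
    have hdx := L.d_mem hx
    rw [(L.isDer_ad (-1) hx).mul su hy, L.ad_s (-1) hx hu, map_add, map_smul, smul_mul_assoc,
      map_smul, L.ceD_mul hxu, L.ceD_mul hu, L.ceD_mul hu, ih,
      (L.isDer_ad (-1) hdx).mul su hy, map_add, map_add,
      (L.isDer_ad (-1) hx).mul du hy, map_smul, (L.isDer_ad (-1) hx).mul su (L.ceD_mem hy),
      L.symD_s (-1) hu, L.symD_s (-1) hxu, L.d_br hx hu, map_smul, L.ad_s (-1) hx hu,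
      L.ad_s (-1) hx (L.d_mem hu), L.ad_s (-1) hdx hu]
    have jac : L.ad (-1) x (L.ad (-1) u y) =
        L.ad (-1) (L.br x u) y + sg K (i * j) • L.ad (-1) u (L.ad (-1) x y) := by
      have h := L.symBr_ad (-1) hx su y
      rw [L.symBr_s (-1) hu, L.ad_s (-1) hx hu, map_smul, LinearMap.smul_apply,
        L.symBr_s (-1) hxu] at h
      rw [h, smul_smul]
      by_cases hi : Even i <;> by_cases hj : Even j <;>
      simp [sg, -Int.not_even_iff_odd, ← Int.not_even_iff_odd, Int.even_add, Int.even_sub,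
        Int.even_mul, hi, hj]
    rw [jac]
    simp only [mul_add, add_mul, mul_smul_comm, smul_mul_assoc, smul_add, smul_smul, map_add,
      mul_neg]
    by_cases hi : Even i <;> by_cases hj : Even j <;>
      simp [sg, -Int.not_even_iff_odd, ← Int.not_even_iff_odd, Int.even_add, Int.even_sub,
        Int.even_mul, hi, hj] <;>
      abel

lemma ceD_ceD (y : L.Sym (-1)) : L.ceD (L.ceD y) = 0 := by
  induction y using L.sym_induction (-1) with
  | h1 => rw [ceD_one, map_zero]
  | hadd y z hy hz => rw [map_add, map_add, hy, hz, add_zero]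
  | hsmul c y hy => rw [map_smul, map_smul, hy, smul_zero]
  | hmul j u hu k y hy ih =>
    have hdu := L.d_mem hu
    rw [L.ceD_mul hu, map_add, map_add, map_smul, L.ceD_mul hu, ih, L.ceD_ad hu,
      L.symD_s (-1) hu, smul_mul_assoc, map_smul, L.ceD_mul hdu, L.symD_s (-1) hdu, L.d_d]
    by_cases hj : Even j <;>
      simp [sg, -Int.not_even_iff_odd, ← Int.not_even_iff_odd, Int.even_add, Int.even_sub,
        Int.even_mul, hj] <;>
      abel

/-- The Chevalley-Eilenberg complex of a dg Lie algebra (computing its homology). -/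
def CE : Cpx K where
  V := L.Sym (-1)
  gr := L.sgr (-1)
  d := L.ceD
  d_mem := L.ceD_mem
  d_d := L.ceD_ceD

end DGLie

/-- A Poincaré duality CDGA of formal dimension `n`: a connected graded commutative differential
graded algebra (with cohomological grading), which is of finite type, with a form `ε` of degree
`-n` which vanishes on coboundaries and induces a nondegenerate pairing between complementary
degrees. -/
structure PDCDGA (K : Type u) [Field K] (n : ℕ) where
  A : Type u
  [ring : Ring A]
  [alg : Algebra K A]
  gr : ℤ → Submodule K A
  [gra : GradedAlgebra gr]
  [ntr : Nontrivial A]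
  [fin : Module.Finite K A]
  d : A →ₗ[K] A
  ε : A →ₗ[K] K
  d_mem : ∀ {i x}, x ∈ gr i → d x ∈ gr (i + 1)
  d_d : ∀ x, d (d x) = 0
  mul_comm : ∀ {i j x y}, x ∈ gr i → y ∈ gr j → x * y = sg K (i * j) • (y * x)
  d_mul : ∀ {i j x y}, x ∈ gr i → y ∈ gr j → d (x * y) = d x * y + sg K i • (x * d y)
  gr_neg : ∀ i : ℤ, i < 0 → gr i = ⊥
  gr_zero : ∀ x ∈ gr 0, ∃ c : K, x = algebraMap K A c
  ε_of_ne : ∀ i : ℤ, i ≠ n → ∀ x ∈ gr i, ε x = 0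
  ε_d : ∀ x, ε (d x) = 0
  nondeg : ∀ i : ℤ, ∀ x ∈ gr i, (∀ y ∈ gr (n - i), ε (x * y) = 0) → x = 0

attribute [instance] PDCDGA.ring PDCDGA.alg PDCDGA.gra PDCDGA.ntr PDCDGA.fin

namespace PDCDGA

variable {K : Type u} [Field K] {n : ℕ} (A : PDCDGA K n)

/-- The Euler characteristic. -/
def euler : ℤ := ∑ i ∈ Finset.range (n + 1), (-1) ^ i * (Module.finrank K (A.gr i) : ℤ)

end PDCDGA

section Glift₂

variable {K : Type u} [Field K] {V V' W : Type u} [AddCommGroup V] [Module K V]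
  [AddCommGroup V'] [Module K V'] [AddCommMonoid W] [Module K W]
  (gr : ℤ → Submodule K V) [DirectSum.Decomposition gr]
  (gr' : ℤ → Submodule K V') [DirectSum.Decomposition gr']

/-- The bilinear map with given restrictions to the homogeneous pieces. -/
def glift₂ (f : ∀ i j, gr i →ₗ[K] gr' j →ₗ[K] W) : V →ₗ[K] V' →ₗ[K] W :=
  glift gr fun i => (glift gr' fun j => (f i j).flip).flip

lemma glift₂_of_mem (f : ∀ i j, gr i →ₗ[K] gr' j →ₗ[K] W) {i j : ℤ} {x : V} {y : V'}
    (hx : x ∈ gr i) (hy : y ∈ gr' j) : glift₂ gr gr' f x y = f i j ⟨x, hx⟩ ⟨y, hy⟩ := by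
  simp [glift₂, glift_of_mem gr _ hx, glift_of_mem gr' _ hy]

end Glift₂

namespace PDCDGA

variable {K : Type u} [Field K] {n : ℕ} (A : PDCDGA K n) (L : DGLie K)

/-- The grading of the tensor product of `A`, with the grading reversed, with `L`. -/
def tgr (m : ℤ) : Submodule K (A.A ⊗[K] L.V) :=
  Submodule.span K {t | ∃ i j : ℤ, j - i = m ∧ ∃ a ∈ A.gr i, ∃ x ∈ L.gr j, t = a ⊗ₜ[K] x}

lemma tmul_mem {i j : ℤ} {a : A.A} {x : L.V} (ha : a ∈ A.gr i) (hx : x ∈ L.gr j) :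
    a ⊗ₜ[K] x ∈ A.tgr L (j - i) := Submodule.subset_span ⟨i, j, rfl, a, ha, x, hx, rfl⟩

lemma tmul_mem' {i j m : ℤ} {a : A.A} {x : L.V} (ha : a ∈ A.gr i) (hx : x ∈ L.gr j)
    (h : j - i = m) : a ⊗ₜ[K] x ∈ A.tgr L m := h ▸ A.tmul_mem L ha hx

variable {A L} in
lemma tgr_induction {m : ℤ} {p : ∀ t, t ∈ A.tgr L m → Prop} (h0 : p 0 (zero_mem _))
    (hadd : ∀ x y hx hy, p x hx → p y hy → p (x + y) (add_mem hx hy))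
    (ht : ∀ i j (hij : j - i = m) a (ha : a ∈ A.gr i) x (hx : x ∈ L.gr j),
      p (a ⊗ₜ x) (A.tmul_mem' L ha hx hij))
    {t : A.A ⊗[K] L.V} (h : t ∈ A.tgr L m) : p t h := by
  suffices h' : ∀ c : K, p (c • t) (Submodule.smul_mem _ _ h) by simpa using h' 1
  induction h using Submodule.span_induction with
  | zero => intro c; simpa using h0
  | add x y _ _ h1 h2 =>
    intro c
    have := hadd _ _ _ _ (h1 c) (h2 c)
    simpa using this
  | smul r x _ h1 =>
    intro c
    have := h1 (c * r)
    simpa [smul_smul] using this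
  | mem x hx =>
    obtain ⟨i, j, hij, a, ha, x, hx, rfl⟩ := hx
    intro c
    have := ht i j hij _ (Submodule.smul_mem _ c ha) x hx
    simpa [TensorProduct.smul_tmul'] using this

/-- The splitting of the tensor product into its homogeneous pieces. -/
def tsplit : A.A ⊗[K] L.V →ₗ[K] ⨁ m, A.tgr L m :=
  TensorProduct.lift (glift₂ A.gr L.gr fun i j => LinearMap.mk₂ K
    (fun a x => DirectSum.lof K ℤ (fun m => A.tgr L m) (j - i) ⟨a.1 ⊗ₜ x.1, A.tmul_mem L a.2 x.2⟩)
    (fun a b x => by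
      rw [← map_add]; congr 1; apply Subtype.ext; simp [TensorProduct.add_tmul])
    (fun c a x => by
      rw [← map_smul]; congr 1)
    (fun a x y => by
      rw [← map_add]; congr 1; apply Subtype.ext; simp [TensorProduct.tmul_add])
    (fun c a x => by
      rw [← map_smul]; congr 1; apply Subtype.ext; simp))

lemma tsplit_of_mem {m : ℤ} {t : A.A ⊗[K] L.V} (ht : t ∈ A.tgr L m) :
    A.tsplit L t = DirectSum.lof K ℤ (fun m => A.tgr L m) m ⟨t, ht⟩ := by
  suffices h : ∃ h : t ∈ A.tgr L m,
      A.tsplit L t = DirectSum.lof K ℤ (fun m => A.tgr L m) m ⟨t, h⟩ from h.2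
  induction ht using tgr_induction with
  | h0 => exact ⟨zero_mem _, by rw [map_zero]; exact (map_zero _).symm⟩
  | hadd x y _ _ hx hy =>
    obtain ⟨hx, ex⟩ := hx
    obtain ⟨hy, ey⟩ := hy
    refine ⟨add_mem hx hy, ?_⟩
    rw [map_add, ex, ey, ← map_add]; rfl
  | ht i j hij a ha x hx =>
    subst hij
    refine ⟨A.tmul_mem L ha hx, ?_⟩
    rw [tsplit, TensorProduct.lift.tmul, glift₂_of_mem _ _ _ ha hx]
    rfl

instance tdec : DirectSum.Decomposition (A.tgr L) :=
  DirectSum.Decomposition.ofLinearMap _ (A.tsplit L)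
    (by
      apply TensorProduct.ext
      refine ghom_ext (gr := A.gr) fun i a ha => ghom_ext (gr := L.gr) fun j x hx => ?_
      have h := A.tsplit_of_mem L (A.tmul_mem L ha hx)
      change DirectSum.coeLinearMap _ (A.tsplit L (a ⊗ₜ x)) = a ⊗ₜ x
      rw [h, DirectSum.coeLinearMap_lof])
    (by
      apply DirectSum.linearMap_ext
      intro m
      apply LinearMap.ext
      rintro ⟨t, ht⟩
      simp only [LinearMap.comp_apply, DirectSum.coeLinearMap_lof, LinearMap.id_apply]
      exact A.tsplit_of_mem L ht)

/-- The bracket of the tensor product: `[a ⊗ x, b ⊗ y] = (-1)^(|x| |b|) a b ⊗ [x, y]`. -/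
def tbr : A.A ⊗[K] L.V →ₗ[K] A.A ⊗[K] L.V →ₗ[K] A.A ⊗[K] L.V :=
  TensorProduct.lift (LinearMap.flip (glift L.gr fun j => LinearMap.mk₂ K
    (fun x a => TensorProduct.map (LinearMap.mulLeft K a ∘ₗ tw A.gr j) (L.br x))
    (fun x y a => by apply TensorProduct.ext'; intro b y; simp [TensorProduct.tmul_add])
    (fun c x a => by apply TensorProduct.ext'; intro b y; simp)
    (fun x a b => by apply TensorProduct.ext'; intro b y; simp [add_mul, TensorProduct.add_tmul])
    (fun c x a => by apply TensorProduct.ext'; intro b y; simp [TensorProduct.smul_tmul'])))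

lemma tbr_tmul {j k : ℤ} {x : L.V} {b : A.A} (hx : x ∈ L.gr j) (hb : b ∈ A.gr k) (a : A.A)
    (y : L.V) : A.tbr L (a ⊗ₜ x) (b ⊗ₜ y) = sg K (j * k) • ((a * b) ⊗ₜ L.br x y) := by
  rw [tbr, TensorProduct.lift.tmul, LinearMap.flip_apply, glift_of_mem _ _ hx]
  simp [tw_of_mem _ _ hb, TensorProduct.smul_tmul']

/-- The differential of the tensor product: `d (a ⊗ x) = d a ⊗ x + (-1)^|a| a ⊗ d x`. -/
def td : A.A ⊗[K] L.V →ₗ[K] A.A ⊗[K] L.V :=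
  TensorProduct.map A.d LinearMap.id + TensorProduct.map (tw A.gr 1) L.d

lemma td_tmul {i : ℤ} {a : A.A} (ha : a ∈ A.gr i) (x : L.V) :
    A.td L (a ⊗ₜ x) = A.d a ⊗ₜ x + sg K i • (a ⊗ₜ L.d x) := by
  simp [td, tw_of_mem _ _ ha, TensorProduct.smul_tmul']

lemma neg_one_tsmul (t : A.A ⊗[K] L.V) : (-1 : K) • t = -t := neg_one_smul K t

/-- The dg Lie algebra `A ⊗ L`, where the grading of `A` is reversed in order to be
homological. -/
def tensor : DGLie K where
  V := A.A ⊗[K] L.V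
  gr := A.tgr L
  d := A.td L
  br := A.tbr L
  d_mem {m t} ht := by
    induction ht using tgr_induction with
    | h0 => rw [map_zero]; exact zero_mem _
    | hadd x y _ _ hx hy => rw [map_add]; exact add_mem hx hy
    | ht i j hij a ha x hx =>
      rw [A.td_tmul L ha]
      exact add_mem (A.tmul_mem' L (A.d_mem ha) hx (by omega))
        (Submodule.smul_mem _ _ (A.tmul_mem' L ha (L.d_mem hx) (by omega)))
  d_d t := by
    have h : A.td L ∘ₗ A.td L = 0 := by
      apply TensorProduct.ext
      refine ghom_ext (gr := A.gr) fun i a ha => ghom_ext (gr := L.gr) fun j x hx => ?_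
      change A.td L (A.td L (a ⊗ₜ x)) = 0
      simp only [A.td_tmul L ha, map_add, map_smul, A.td_tmul L (A.d_mem ha), A.d_d, L.d_d,
        TensorProduct.zero_tmul, TensorProduct.tmul_zero, smul_zero, sg_add,
        sg_odd (K := K) odd_one, LinearMap.zero_apply]
      module
    exact LinearMap.congr_fun h t
  br_mem {m m' s t} hs ht := by
    induction hs using tgr_induction with
    | h0 => rw [map_zero]; exact zero_mem _
    | hadd x y _ _ hx hy => rw [map_add]; exact add_mem hx hy
    | ht i j hij a ha x hx =>
      induction ht using tgr_induction with
      | h0 => rw [map_zero]; exact zero_mem _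
      | hadd x y _ _ hx hy => rw [map_add]; exact add_mem hx hy
      | ht k l hkl b hb y hy =>
        rw [A.tbr_tmul L hx hb]
        exact Submodule.smul_mem _ _ (A.tmul_mem' L (SetLike.GradedMul.mul_mem ha hb)
          (L.br_mem hx hy) (by omega))
  br_symm {m m' s t} hs ht := by
    induction hs using tgr_induction with
    | h0 => simp
    | hadd x y _ _ hx hy => simp only [map_add, LinearMap.add_apply, hx, hy, smul_add, neg_add]
    | ht i j hij a ha x hx =>
      induction ht using tgr_induction with
      | h0 => simp
      | hadd x y _ _ hx hy => simp only [map_add, LinearMap.add_apply, hx, hy, smul_add, neg_add]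
      | ht k l hkl b hb y hy =>
        subst hij hkl
        rw [A.tbr_tmul L hx hb, A.tbr_tmul L hy ha, L.br_symm hx hy, A.mul_comm ha hb]
        simp only [TensorProduct.tmul_neg, TensorProduct.tmul_smul, ← TensorProduct.smul_tmul']
        by_cases hi : Even i <;> by_cases hj : Even j <;> by_cases hk : Even k <;>
        by_cases hl : Even l <;>
        simp [sg, neg_one_tsmul, -Int.not_even_iff_odd, ← Int.not_even_iff_odd, Int.even_add, Int.even_sub,
          Int.even_mul, hi, hj, hk, hl]
  jacobi {m m' m'' s t r} hs ht hr := by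
    induction hs using tgr_induction with
    | h0 => simp
    | hadd x y _ _ hx hy => simp only [map_add, LinearMap.add_apply, hx, hy, smul_add]; abel
    | ht i j hij a ha x hx =>
    induction ht using tgr_induction with
    | h0 => simp
    | hadd x y _ _ hx hy => simp only [map_add, LinearMap.add_apply, hx, hy, smul_add]; abel
    | ht k l hkl b hb y hy =>
    induction hr using tgr_induction with
    | h0 => simp
    | hadd x y _ _ hx hy => simp only [map_add, LinearMap.add_apply, hx, hy, smul_add]; abel
    | ht p q hpq c hc z hz =>
      subst hij hkl hpq
      rw [A.tbr_tmul L hy hc, A.tbr_tmul L hx hb, A.tbr_tmul L hx hc]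
      simp only [map_smul, LinearMap.smul_apply]
      rw [A.tbr_tmul L hx (SetLike.GradedMul.mul_mem hb hc), A.tbr_tmul L (L.br_mem hx hy) hc,
        A.tbr_tmul L hy (SetLike.GradedMul.mul_mem ha hc), L.jacobi hx hy hz, ← mul_assoc,
        ← mul_assoc, A.mul_comm ha hb]
      simp only [TensorProduct.tmul_add, TensorProduct.tmul_smul, smul_mul_assoc,
        ← TensorProduct.smul_tmul', vadd_eq_add]
      by_cases hi : Even i <;> by_cases hj : Even j <;> by_cases hk : Even k <;>
      by_cases hl : Even l <;> by_cases hp : Even p <;>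
      simp [sg, neg_one_tsmul, -Int.not_even_iff_odd, ← Int.not_even_iff_odd, Int.even_add, Int.even_sub,
          Int.even_mul, hi, hj, hk, hl, hp] <;> abel
  d_br {m m' s t} hs ht := by
    induction hs using tgr_induction with
    | h0 => simp
    | hadd x y _ _ hx hy => simp only [map_add, LinearMap.add_apply, hx, hy, smul_add]; abel
    | ht i j hij a ha x hx =>
    induction ht using tgr_induction with
    | h0 => simp
    | hadd x y _ _ hx hy => simp only [map_add, LinearMap.add_apply, hx, hy, smul_add]; abel
    | ht k l hkl b hb y hy =>
      subst hij hkl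
      rw [A.tbr_tmul L hx hb, map_smul, A.td_tmul L (SetLike.GradedMul.mul_mem ha hb),
        A.td_tmul L ha, A.td_tmul L hb, L.d_br hx hy, A.d_mul ha hb]
      simp only [map_add, map_smul, LinearMap.add_apply, LinearMap.smul_apply]
      rw [A.tbr_tmul L hx hb, A.tbr_tmul L (L.d_mem hx) hb, A.tbr_tmul L hx (A.d_mem hb),
        A.tbr_tmul L hx hb]
      simp only [TensorProduct.tmul_add, TensorProduct.tmul_smul, smul_mul_assoc,
        TensorProduct.add_tmul, ← TensorProduct.smul_tmul', smul_add, vadd_eq_add]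
      by_cases hi : Even i <;> by_cases hj : Even j <;> by_cases hk : Even k <;>
      by_cases hl : Even l <;>
      simp [sg, neg_one_tsmul, -Int.not_even_iff_odd, ← Int.not_even_iff_odd, Int.even_add, Int.even_sub,
          Int.even_mul, hi, hj, hk, hl] <;> abel

end PDCDGA

namespace PDCDGA

variable {K : Type u} [Field K] {n : ℕ} (A : PDCDGA K n)

/-- A homogeneous basis of `A`. -/
def basis : Module.Basis (Σ i, Module.Basis.ofVectorSpaceIndex K (A.gr i)) K A.A :=
  (DirectSum.Decomposition.isInternal A.gr).collectedBasis
    fun i => Module.Basis.ofVectorSpace K (A.gr i)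

/-- The index type of the homogeneous basis. -/
abbrev Idx : Type u := Σ i, Module.Basis.ofVectorSpaceIndex K (A.gr i)

instance : Fintype A.Idx :=
  have := Module.Finite.finite_basis A.basis
  Fintype.ofFinite _

instance : DecidableEq A.Idx := Classical.decEq _

lemma basis_mem (s : A.Idx) : A.basis s ∈ A.gr s.1 :=
  (DirectSum.Decomposition.isInternal A.gr).collectedBasis_mem _ s

/-- The duality pairing `(x, y) ↦ ε (x y)`. -/
def pair : LinearMap.BilinForm K A.A := (LinearMap.mul K A.A).compr₂ A.ε

lemma pair_apply (x y : A.A) : A.pair x y = A.ε (x * y) := rfl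

lemma ε_mul_of_ne {i j : ℤ} {x y : A.A} (hx : x ∈ A.gr i) (hy : y ∈ A.gr j) (h : i + j ≠ n) :
    A.ε (x * y) = 0 := A.ε_of_ne _ h _ (SetLike.GradedMul.mul_mem hx hy)

lemma ε_decompose_mul (x : A.A) {j : ℤ} {y : A.A} (hy : y ∈ A.gr j) :
    A.ε (DirectSum.decompose A.gr x (n - j) * y) = A.ε (x * y) := by
  induction x using DirectSum.Decomposition.inductionOn A.gr with
  | zero => simp
  | add x z hx hz =>
    rw [DirectSum.decompose_add, DirectSum.add_apply, Submodule.coe_add, add_mul, add_mul,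
      map_add, map_add, hx, hz]
  | @homogeneous i x =>
    by_cases h : i = n - j
    · subst h
      rw [DirectSum.decompose_coe, DirectSum.of_eq_same]
    · rw [DirectSum.decompose_coe, DirectSum.of_eq_of_ne _ _ _ (Ne.symm h), ZeroMemClass.coe_zero,
        zero_mul, map_zero, A.ε_mul_of_ne x.2 hy (by omega)]

lemma ε_mul_decompose (x : A.A) {j : ℤ} {y : A.A} (hy : y ∈ A.gr j) :
    A.ε (y * DirectSum.decompose A.gr x (n - j)) = A.ε (y * x) := by
  induction x using DirectSum.Decomposition.inductionOn A.gr with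
  | zero => simp
  | add x z hx hz =>
    rw [DirectSum.decompose_add, DirectSum.add_apply, Submodule.coe_add, mul_add, mul_add,
      map_add, map_add, hx, hz]
  | @homogeneous i x =>
    by_cases h : i = n - j
    · subst h
      rw [DirectSum.decompose_coe, DirectSum.of_eq_same]
    · rw [DirectSum.decompose_coe, DirectSum.of_eq_of_ne _ _ _ (Ne.symm h), ZeroMemClass.coe_zero,
        mul_zero, map_zero, A.ε_mul_of_ne hy x.2 (by omega)]

lemma eq_zero_of_ε {x : A.A} (h : ∀ y, A.ε (x * y) = 0) : x = 0 := by
  have h1 : ∀ i, (DirectSum.decompose A.gr x i : A.A) = 0 := by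
    intro i
    refine A.nondeg i _ (SetLike.coe_mem _) fun y hy => ?_
    rw [← h y, ← A.ε_decompose_mul x hy, sub_sub_cancel]
  refine (DirectSum.decompose A.gr).injective ?_
  rw [DirectSum.decompose_zero]
  apply DFinsupp.ext
  intro i
  exact Subtype.ext (h1 i)

lemma pair_nondegenerate : A.pair.Nondegenerate :=
  LinearMap.BilinForm.Nondegenerate.ofSeparatingLeft fun _ hx => A.eq_zero_of_ε hx

/-- The dual basis `a ↦ a^∨`, with `ε (a_i a_j^∨) = δ_ij`. -/
def dbasis : Module.Basis A.Idx K A.A :=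
  LinearMap.BilinForm.dualBasis A.pair.flip A.pair_nondegenerate.flip A.basis

lemma ε_basis_dbasis (s t : A.Idx) : A.ε (A.basis s * A.dbasis t) = if s = t then 1 else 0 :=
  LinearMap.BilinForm.apply_dualBasis_left (B := A.pair.flip) A.pair_nondegenerate.flip A.basis t s

lemma repr_eq (x : A.A) (s : A.Idx) : A.basis.repr x s = A.ε (x * A.dbasis s) := by
  conv_rhs => rw [← A.basis.sum_repr x]
  rw [Finset.sum_mul, map_sum, Finset.sum_eq_single s]
  · rw [smul_mul_assoc, map_smul, A.ε_basis_dbasis, if_pos rfl, smul_eq_mul, mul_one]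
  · intro t _ ht
    rw [smul_mul_assoc, map_smul, A.ε_basis_dbasis, if_neg ht, smul_zero]
  · intro h
    exact absurd (Finset.mem_univ _) h

lemma drepr_eq (x : A.A) (s : A.Idx) : A.dbasis.repr x s = A.ε (A.basis s * x) :=
  LinearMap.BilinForm.dualBasis_repr_apply (B := A.pair.flip) A.pair_nondegenerate.flip A.basis x s

lemma expand (x : A.A) : x = ∑ s, A.ε (x * A.dbasis s) • A.basis s := by
  conv_lhs => rw [← A.basis.sum_repr x]
  exact Finset.sum_congr rfl fun s _ => by rw [repr_eq]

lemma dexpand (x : A.A) : x = ∑ s, A.ε (A.basis s * x) • A.dbasis s := by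
  conv_lhs => rw [← A.dbasis.sum_repr x]
  exact Finset.sum_congr rfl fun s _ => by rw [drepr_eq]

lemma dbasis_mem (s : A.Idx) : A.dbasis s ∈ A.gr (n - s.1) := by
  suffices h : A.dbasis s = DirectSum.decompose A.gr (A.dbasis s) (n - s.1) by
    rw [h]; exact SetLike.coe_mem _
  refine A.dbasis.repr.injective (Finsupp.ext fun t => ?_)
  rw [drepr_eq, drepr_eq]
  have ht := A.basis_mem t
  by_cases hst : (t.1 : ℤ) = s.1
  · rw [← hst, A.ε_mul_decompose _ ht]
  · rw [A.ε_mul_of_ne ht (SetLike.coe_mem _) (by omega), ε_basis_dbasis, if_neg]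
    rintro rfl
    exact hst rfl

section Diag

variable {R : Type u} [Ring R] [Algebra K R] (f g : A.A →ₗ[K] R)

/-- The image `∑ (-1)^|a_i| f (a_i) g (a_i^∨)` of the diagonal class
`Δ = ∑ (-1)^|a_i| a_i ⊗ a_i^∨`. -/
def diag : R := ∑ s : A.Idx, sg K s.1 • (f (A.basis s) * g (A.dbasis s))

/-- Graded commutation of the images of two maps. -/
def GComm : Prop := ∀ {i j : ℤ} {a b : A.A}, a ∈ A.gr i → b ∈ A.gr j →
  g b * f a = sg K (i * j) • (f a * g b)

variable {f g}

lemma diag_symm (h : A.GComm f g) : A.diag g f = sg K n • A.diag f g := by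
  have h1 : A.diag g f = ∑ s : A.Idx, ∑ t : A.Idx,
      (sg K s.1 * A.ε (A.dbasis s * A.dbasis t)) • (g (A.basis s) * f (A.basis t)) := by
    refine Finset.sum_congr rfl fun s _ => ?_
    conv_lhs => rw [A.expand (A.dbasis s)]
    simp only [map_sum, map_smul, Finset.mul_sum, Finset.smul_sum, mul_smul_comm, smul_smul]
  have h2 : ∀ t : A.Idx, (∑ s : A.Idx,
      (sg K s.1 * A.ε (A.dbasis s * A.dbasis t)) • (g (A.basis s) * f (A.basis t))) =
      sg K n • (sg K t.1 • (f (A.basis t) * g (A.dbasis t))) := by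
    intro t
    have h3 : ∀ s : A.Idx, sg K s.1 * A.ε (A.dbasis s * A.dbasis t) =
        sg K (n - t.1 + t.1 * (n - t.1)) * A.ε (A.dbasis t * A.dbasis s) := by
      intro s
      by_cases hst : ((n : ℤ) - s.1) + (n - t.1) = n
      · rw [A.mul_comm (A.dbasis_mem s) (A.dbasis_mem t), map_smul, smul_eq_mul, ← mul_assoc,
          ← sg_add]
        congr 2
        have : (s.1 : ℤ) = n - t.1 := by omega
        rw [this]; ring
      · rw [A.ε_mul_of_ne (A.dbasis_mem s) (A.dbasis_mem t) hst,
          A.ε_mul_of_ne (A.dbasis_mem t) (A.dbasis_mem s) (by omega), mul_zero, mul_zero]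
    simp only [h3]
    rw [show (∑ s : A.Idx, (sg K (n - t.1 + t.1 * (n - t.1)) * A.ε (A.dbasis t * A.dbasis s)) •
        (g (A.basis s) * f (A.basis t))) = sg K (n - t.1 + t.1 * (n - t.1)) •
        (g (∑ s : A.Idx, A.ε (A.dbasis t * A.dbasis s) • A.basis s) * f (A.basis t)) by
      simp only [map_sum, map_smul, Finset.sum_mul, Finset.smul_sum, smul_mul_assoc, smul_smul]]
    rw [← A.expand, h (A.basis_mem t) (A.dbasis_mem t), smul_smul, smul_smul, ← sg_add, ← sg_add]
    congr 1
    by_cases hn : Even (n : ℤ) <;> by_cases ht : Even t.1 <;>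
    simp [sg, -Int.not_even_iff_odd, ← Int.not_even_iff_odd, Int.even_add, Int.even_sub,
      Int.even_mul, hn, ht, -Int.even_coe_nat]
  rw [h1, Finset.sum_comm, Finset.sum_congr rfl fun t _ => h2 t, diag, Finset.smul_sum]

lemma diag_slide (hf : ∀ x y, f (x * y) = f x * f y) (hg : ∀ x y, g (x * y) = g x * g y)
    (h : A.GComm f g) (x : A.A) : f x * A.diag f g = g x * A.diag f g := by
  induction x using DirectSum.Decomposition.inductionOn A.gr with
  | zero => simp
  | add x y hx hy => rw [map_add, map_add, add_mul, add_mul, hx, hy]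
  | @homogeneous q x =>
    obtain ⟨x, hx⟩ := x
    dsimp only
    have h1 : f x * A.diag f g = ∑ s : A.Idx, ∑ t : A.Idx,
        (sg K s.1 * A.ε (x * A.basis s * A.dbasis t)) • (f (A.basis t) * g (A.dbasis s)) := by
      rw [diag, Finset.mul_sum]
      refine Finset.sum_congr rfl fun s _ => ?_
      rw [mul_smul_comm, ← mul_assoc, ← hf]
      conv_lhs => rw [A.expand (x * A.basis s)]
      simp only [map_sum, map_smul, Finset.sum_mul, Finset.smul_sum, smul_mul_assoc, smul_smul]
    have h2 : g x * A.diag f g = ∑ t : A.Idx, ∑ s : A.Idx,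
        (sg K (t.1 + t.1 * q) * A.ε (A.basis s * (x * A.dbasis t))) •
          (f (A.basis t) * g (A.dbasis s)) := by
      rw [diag, Finset.mul_sum]
      refine Finset.sum_congr rfl fun t _ => ?_
      rw [mul_smul_comm, ← mul_assoc, h (A.basis_mem t) hx, smul_mul_assoc, mul_assoc, ← hg,
        smul_smul, ← sg_add]
      conv_lhs => rw [A.dexpand (x * A.dbasis t)]
      simp only [map_sum, map_smul, Finset.mul_sum, Finset.smul_sum, mul_smul_comm, smul_smul]
    rw [h1, h2, Finset.sum_comm]
    refine Finset.sum_congr rfl fun t _ => Finset.sum_congr rfl fun s _ => ?_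
    congr 1
    have hs := A.basis_mem s
    have ht := A.dbasis_mem t
    rw [← mul_assoc, A.mul_comm hs hx, smul_mul_assoc, map_smul, smul_eq_mul, ← mul_assoc,
      ← sg_add]
    by_cases e : q + s.1 + (n - t.1) = n
    · congr 1
      have : (t.1 : ℤ) = q + s.1 := by omega
      rw [this]
      by_cases hq : Even q <;> by_cases hs : Even s.1 <;>
      simp [sg, -Int.not_even_iff_odd, ← Int.not_even_iff_odd, Int.even_add, Int.even_sub,
        Int.even_mul, hq, hs]
    · rw [A.ε_mul_of_ne (SetLike.GradedMul.mul_mem hx hs) ht e, mul_zero, mul_zero]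

lemma diag_d (f g : A.A →ₗ[K] R) : ∑ s : A.Idx, sg K s.1 • (f (A.d (A.basis s)) *
    g (A.dbasis s)) + ∑ s : A.Idx, f (A.basis s) * g (A.d (A.dbasis s)) = 0 := by
  have h1 : (∑ s : A.Idx, sg K s.1 • (f (A.d (A.basis s)) * g (A.dbasis s))) =
      ∑ s : A.Idx, ∑ t : A.Idx, (sg K s.1 * A.ε (A.d (A.basis s) * A.dbasis t)) •
        (f (A.basis t) * g (A.dbasis s)) := by
    refine Finset.sum_congr rfl fun s _ => ?_
    conv_lhs => rw [A.expand (A.d (A.basis s))]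
    simp only [map_sum, map_smul, Finset.sum_mul, Finset.smul_sum, smul_mul_assoc, smul_smul]
  have h2 : ∀ s t : A.Idx, sg K s.1 * A.ε (A.d (A.basis s) * A.dbasis t) =
      - A.ε (A.basis s * A.d (A.dbasis t)) := by
    intro s t
    have := A.ε_d (A.basis s * A.dbasis t)
    rw [A.d_mul (A.basis_mem s) (A.dbasis_mem t), map_add, map_smul, smul_eq_mul] at this
    have h3 := sg_mul_self (K := K) s.1
    linear_combination (sg K s.1) * this - A.ε (A.basis s * A.d (A.dbasis t)) * h3
  rw [h1, Finset.sum_comm, ← Finset.sum_add_distrib]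
  refine Finset.sum_eq_zero fun t _ => ?_
  conv_lhs => rw [A.dexpand (A.d (A.dbasis t))]
  simp only [h2, neg_smul, map_sum, map_smul, Finset.mul_sum, mul_smul_comm,
    Finset.sum_neg_distrib]
  exact neg_add_cancel _

end Diag

end PDCDGA

section LS

variable {K : Type u} [Field K] {n : ℕ} (A : PDCDGA K n) (U : Type)

/-- The generators of the Lambrechts-Stanley algebra: `pt v i a` stands for `ι_v(a)`, with `a` in
degree `i`, and `om v w` for `ω_vw`. -/
inductive LSGen : Type u
  | pt (v : U) (i : ℤ) (a : A.gr i) : LSGen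
  | om (v w : U) : LSGen

/-- The degrees of the generators. -/
def LSGen.deg {A : PDCDGA K n} {U : Type} : LSGen A U → ℤ
  | pt _ i _ => i
  | om _ _ => n - 1

open LSGen FreeAlgebra in
/-- The relations of the Lambrechts-Stanley algebra: graded commutativity, the relations which say
that the `ι_v` are morphisms of algebras, the relations between the `ω_vw` (where, by convention,
`ω_vv = 0`), and `ι_v(a) ω_vw = ι_w(a) ω_vw`. -/
inductive LSRel : FreeAlgebra K (LSGen A U) → FreeAlgebra K (LSGen A U) → Prop
  | comm (x y : LSGen A U) : LSRel (ι K x * ι K y) (sg K (x.deg * y.deg) • (ι K y * ι K x))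
  | add (v : U) (i : ℤ) (a b : A.gr i) : LSRel (ι K (pt v i (a + b)))
      (ι K (pt v i a) + ι K (pt v i b))
  | smul (v : U) (i : ℤ) (c : K) (a : A.gr i) : LSRel (ι K (pt v i (c • a))) (c • ι K (pt v i a))
  | one (v : U) : LSRel (ι K (pt v 0 ⟨1, SetLike.GradedOne.one_mem⟩)) 1
  | mul (v : U) (i j : ℤ) (a : A.gr i) (b : A.gr j) :
      LSRel (ι K (pt v (i + j) ⟨a.1 * b.1, SetLike.GradedMul.mul_mem a.2 b.2⟩))
        (ι K (pt v i a) * ι K (pt v j b))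
  | diag (v : U) : LSRel (ι K (om v v)) 0
  | symm (v w : U) : LSRel (ι K (om w v)) (sg K n • ι K (om v w))
  | sq (v w : U) : LSRel (ι K (om v w) * ι K (om v w)) 0
  | arnold (v w x : U) (h1 : v ≠ w) (h2 : w ≠ x) (h3 : x ≠ v) :
      LSRel (ι K (om v w) * ι K (om w x) + ι K (om w x) * ι K (om x v) +
        ι K (om x v) * ι K (om v w)) 0
  | slide (v w : U) (i : ℤ) (a : A.gr i) :
      LSRel (ι K (pt v i a) * ι K (om v w)) (ι K (pt w i a) * ι K (om v w))

/-- The presentation of the Lambrechts-Stanley algebra. -/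
abbrev lsPres : GPres K where
  X := LSGen A U
  deg := LSGen.deg
  rel := LSRel A U
  homog := by
    have h0 : ∀ i, (0 : FreeAlgebra K (LSGen A U)) ∈ Submodule.span K {w | ∃ l : List (LSGen A U),
        (l.map LSGen.deg).sum = i ∧ w = (l.map (FreeAlgebra.ι K)).prod} := fun _ => zero_mem _
    have h1 : ∀ x : LSGen A U, FreeAlgebra.ι K x ∈ Submodule.span K {w | ∃ l : List (LSGen A U),
        (l.map LSGen.deg).sum = x.deg ∧ w = (l.map (FreeAlgebra.ι K)).prod} := fun x =>
      Submodule.subset_span ⟨[x], by simp, by simp⟩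
    have h2 : ∀ x y : LSGen A U, ∀ i, x.deg + y.deg = i → FreeAlgebra.ι K x * FreeAlgebra.ι K y ∈
        Submodule.span K {w | ∃ l : List (LSGen A U),
        (l.map LSGen.deg).sum = i ∧ w = (l.map (FreeAlgebra.ι K)).prod} := fun x y i h =>
      Submodule.subset_span ⟨[x, y], by simp [h], by simp⟩
    intro a b hab
    cases hab with
    | comm x y => exact ⟨_, h2 x y _ rfl, Submodule.smul_mem _ _ (h2 y x _ (add_comm _ _))⟩
    | add v i a b => exact ⟨i, h1 (.pt v i (a + b)), add_mem (h1 (.pt v i a)) (h1 (.pt v i b))⟩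
    | smul v i c a => exact ⟨i, h1 (.pt v i (c • a)), Submodule.smul_mem _ _ (h1 (.pt v i a))⟩
    | one v => exact ⟨0, h1 (.pt v 0 _), Submodule.subset_span ⟨[], by simp, by simp⟩⟩
    | mul v i j a b => exact ⟨i + j, h1 (.pt v (i + j) _), h2 (.pt v i a) (.pt v j b) _ rfl⟩
    | diag v => exact ⟨_, h1 (.om v v), h0 _⟩
    | symm v w => exact ⟨n - 1, h1 (.om w v), Submodule.smul_mem _ _ (h1 (.om v w))⟩
    | sq v w => exact ⟨_, h2 (.om v w) (.om v w) _ rfl, h0 _⟩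
    | arnold v w x =>
      exact ⟨(n - 1) + (n - 1), add_mem (add_mem (h2 (.om v w) (.om w x) _ rfl)
        (h2 (.om w x) (.om x v) _ rfl)) (h2 (.om x v) (.om v w) _ rfl), h0 _⟩
    | slide v w i a =>
      exact ⟨i + (n - 1), h2 (.pt v i a) (.om v w) _ rfl, h2 (.pt w i a) (.om v w) _ rfl⟩

/-- The Lambrechts-Stanley algebra `G_A(U)`. -/
abbrev LS : Type u := (lsPres A U).Alg

/-- The grading of the Lambrechts-Stanley algebra. -/
abbrev lgr : ℤ → Submodule K (LS A U) := (lsPres A U).gr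

variable {U}

/-- The maps `ι_v : A → G_A(U)`. -/
def io (v : U) : A.A →ₗ[K] LS A U :=
  glift A.gr fun i =>
    { toFun := fun a => (lsPres A U).gen (.pt v i a)
      map_add' := fun x y => by
        have := (lsPres A U).proj_rel (LSRel.add v i x y)
        rw [map_add] at this
        exact this
      map_smul' := fun c x => by
        have := (lsPres A U).proj_rel (LSRel.smul v i c x)
        rw [map_smul] at this
        exact this }

/-- The elements `ω_vw`. -/
def om (v w : U) : LS A U := (lsPres A U).gen (.om v w)

lemma io_of_mem (v : U) {i : ℤ} {a : A.A} (ha : a ∈ A.gr i) :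
    io A v a = (lsPres A U).gen (.pt v i ⟨a, ha⟩) := glift_of_mem _ _ ha

lemma gen_pt (v : U) (i : ℤ) (a : A.gr i) : (lsPres A U).gen (.pt v i a) = io A v a := by
  rw [io_of_mem A v a.2]

lemma gen_om (v w : U) : (lsPres A U).gen (.om v w) = om A v w := rfl

lemma io_mem (v : U) {i : ℤ} {a : A.A} (ha : a ∈ A.gr i) : io A v a ∈ lgr A U i := by
  rw [io_of_mem A v ha]
  exact (lsPres A U).gen_mem (.pt v i ⟨a, ha⟩)

lemma om_mem (v w : U) : om A v w ∈ lgr A U (n - 1) := (lsPres A U).gen_mem (.om v w)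

lemma tw_om (N : ℤ) (v w : U) : tw (lgr A U) N (om A v w) = sg K (N * (n - 1)) • om A v w :=
  tw_of_mem (lgr A U) N (om_mem A v w)

lemma tw_io (N : ℤ) (v : U) {i : ℤ} {a : A.A} (ha : a ∈ A.gr i) :
    tw (lgr A U) N (io A v a) = sg K (N * i) • io A v a :=
  tw_of_mem (lgr A U) N (io_mem A v ha)

lemma ls_comm {i j : ℤ} {x y : LS A U} (hx : x ∈ lgr A U i) (hy : y ∈ lgr A U j) :
    x * y = sg K (i * j) • (y * x) := by
  refine (lsPres A U).comm_of_gen ?_ hx hy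
  intro x y
  have := (lsPres A U).proj_rel (LSRel.comm x y)
  rw [map_smul, map_mul, map_mul] at this
  exact this

lemma io_one (v : U) : io A v 1 = 1 := by
  rw [io_of_mem A v SetLike.GradedOne.one_mem]
  have := (lsPres A U).proj_rel (LSRel.one v)
  rw [map_one] at this
  exact this

lemma io_mul (v : U) (x y : A.A) : io A v (x * y) = io A v x * io A v y := by
  have h : (LinearMap.mul K A.A).compr₂ (io A v) =
      (LinearMap.mul K (LS A U)).compl₁₂ (io A v) (io A v) := by
    refine ghom_ext (gr := A.gr) fun i x hx => ghom_ext (gr := A.gr) fun j y hy => ?_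
    simp only [LinearMap.compr₂_apply, LinearMap.compl₁₂_apply, LinearMap.mul_apply']
    rw [io_of_mem A v hx, io_of_mem A v hy, io_of_mem A v (SetLike.GradedMul.mul_mem hx hy)]
    have := (lsPres A U).proj_rel (LSRel.mul v i j ⟨x, hx⟩ ⟨y, hy⟩)
    rw [map_mul] at this
    exact this
  exact LinearMap.congr_fun (LinearMap.congr_fun h x) y

lemma om_diag (v : U) : om A v v = 0 := by
  have := (lsPres A U).proj_rel (LSRel.diag v)
  rw [map_zero] at this
  exact this

lemma om_symm (v w : U) : om A w v = sg K n • om A v w := by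
  have := (lsPres A U).proj_rel (LSRel.symm v w)
  rw [map_smul] at this
  exact this

lemma om_sq (v w : U) : om A v w * om A v w = 0 := by
  have := (lsPres A U).proj_rel (LSRel.sq v w)
  rw [map_zero, map_mul] at this
  exact this

lemma om_sq' (v w : U) : om A v w * om A w v = 0 := by
  rw [om_symm A v w, mul_smul_comm, om_sq, smul_zero]

lemma om_arnold (v w x : U) :
    om A v w * om A w x + om A w x * om A x v + om A x v * om A v w = 0 := by
  by_cases h1 : v = w
  · subst h1
    rw [om_diag, om_sq']; simp
  by_cases h2 : w = x
  · subst h2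
    rw [om_diag, om_sq']; simp
  by_cases h3 : x = v
  · subst h3
    rw [om_diag, om_sq']; simp
  have := (lsPres A U).proj_rel (LSRel.arnold v w x h1 h2 h3)
  rw [map_zero, map_add, map_add, map_mul, map_mul, map_mul] at this
  exact this

lemma io_om (v w : U) (a : A.A) : io A v a * om A v w = io A w a * om A v w := by
  induction a using DirectSum.Decomposition.inductionOn A.gr with
  | zero => simp
  | add x y hx hy => rw [map_add, map_add, add_mul, add_mul, hx, hy]
  | @homogeneous i a =>
    have := (lsPres A U).proj_rel (LSRel.slide v w i a)
    rw [map_mul, map_mul] at this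
    rw [io_of_mem A v a.2, io_of_mem A w a.2]
    exact this

lemma io_om' (v w : U) (a : A.A) : om A v w * io A v a = om A v w * io A w a := by
  induction a using DirectSum.Decomposition.inductionOn A.gr with
  | zero => simp
  | add x y hx hy => rw [map_add, map_add, mul_add, mul_add, hx, hy]
  | @homogeneous i a =>
    rw [ls_comm A (om_mem A v w) (io_mem A v a.2), io_om, ls_comm A (om_mem A v w) (io_mem A w a.2)]

lemma io_gcomm (v w : U) : A.GComm (io A v) (io A w) := by
  intro i j a b ha hb
  rw [ls_comm A (io_mem A w hb) (io_mem A v ha), mul_comm]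

/-- The data and the identities which define a map out of a Lambrechts-Stanley algebra. -/
structure LSMap (U : Type) (R : Type u) [Ring R] [Algebra K R] where
  p : U → A.A →ₗ[K] R
  w : U → U → R
  one : ∀ v, p v 1 = 1
  mul : ∀ v {i j a b}, a ∈ A.gr i → b ∈ A.gr j → p v (a * b) = p v a * p v b
  comm : ∀ v v' {i j a b}, a ∈ A.gr i → b ∈ A.gr j → p v a * p v' b = sg K (i * j) • (p v' b * p v a)
  comm' : ∀ v x y {i a}, a ∈ A.gr i → p v a * w x y = sg K (i * (n - 1)) • (w x y * p v a)
  comm'' : ∀ v v' x y, w v v' * w x y = sg K ((n - 1) * (n - 1)) • (w x y * w v v')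
  diag : ∀ v, w v v = 0
  symm : ∀ v x, w x v = sg K n • w v x
  sq : ∀ v x, w v x * w v x = 0
  arnold : ∀ v x y, v ≠ x → x ≠ y → y ≠ v → w v x * w x y + w x y * w y v + w y v * w v x = 0
  slide : ∀ v x {i a}, a ∈ A.gr i → p v a * w v x = p x a * w v x

namespace LSMap

variable {A} {R : Type u} [Ring R] [Algebra K R] (F : LSMap A U R)

/-- The values on generators. -/
def val : LSGen A U → R
  | .pt v _ a => F.p v a
  | .om v w => F.w v w

lemma rel {a b : FreeAlgebra K (LSGen A U)} (h : LSRel A U a b) :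
    FreeAlgebra.lift K F.val a = FreeAlgebra.lift K F.val b := by
  cases h with
  | comm x y =>
    simp only [map_smul, map_mul, FreeAlgebra.lift_ι_apply]
    cases x with
    | pt v i a =>
      cases y with
      | pt w j b => exact F.comm _ _ a.2 b.2
      | om x y => exact F.comm' _ _ _ a.2
    | om v w =>
      cases y with
      | pt x j b =>
        change F.w v w * F.p x b = sg K ((n - 1) * j) • (F.p x b * F.w v w)
        rw [F.comm' x v w b.2, smul_smul, mul_comm _ j, sg_mul_self, one_smul]
      | om x y => exact F.comm'' _ _ _ _
  | add v i a b => simp [val]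
  | smul v i c a => simp [val]
  | one v => simp [val, F.one]
  | mul v i j a b => simp [val, F.mul v a.2 b.2]
  | diag v => simp [val, F.diag]
  | symm v w => simp [val, F.symm v w]
  | sq v w => simp [val, F.sq]
  | arnold v w x h1 h2 h3 => simp [val, F.arnold v w x h1 h2 h3]
  | slide v w i a => simp [val, F.slide v w a.2]

/-- The map out of the Lambrechts-Stanley algebra. -/
def map : LS A U →ₐ[K] R := (lsPres A U).lift F.val fun _ _ h => F.rel h

end LSMap

/-- The map `G_A(U) → G_A(V)` induced by a map of finite sets which is injective. -/
def LS.push {U V : Type} (e : U → V) (he : Function.Injective e) : LS A U →ₐ[K] LS A V :=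
  LSMap.map
  { p := fun v => io A (e v)
    w := fun v w => om A (e v) (e w)
    one := fun v => io_one A _
    mul := fun v _ _ a b _ _ => io_mul A _ a b
    comm := fun v v' _ _ _ _ ha hb => ls_comm A (io_mem A _ ha) (io_mem A _ hb)
    comm' := fun v x y _ _ ha => ls_comm A (io_mem A _ ha) (om_mem A _ _)
    comm'' := fun _ _ _ _ => ls_comm A (om_mem A _ _) (om_mem A _ _)
    diag := fun _ => om_diag A _
    symm := fun _ _ => om_symm A _ _
    sq := fun _ _ => om_sq A _ _
    arnold := fun _ _ _ _ _ _ => om_arnold A _ _ _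
    slide := fun _ _ _ a _ => io_om A _ _ a }

section Cocomp

/-- The pair of an element `x` of degree `i` and an element `y` of degree `i - N`, which encodes
`x + y θ` for a formal element `θ` of degree `N` of square zero. -/
def eMat (N : ℤ) (x y : LS A U) : Matrix (Fin 2) (Fin 2) (LS A U) :=
  !![x, y; 0, tw (lgr A U) N x]

lemma eMat_mul (N : ℤ) (x y x' y' : LS A U) : eMat A N x y * eMat A N x' y' =
    eMat A N (x * x') (x * y' + y * tw (lgr A U) N x') := by
  simp [eMat, Matrix.mul_fin_two, tw_mul]

lemma eMat_add (N : ℤ) (x y x' y' : LS A U) : eMat A N x y + eMat A N x' y' =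
    eMat A N (x + x') (y + y') := by
  ext i j; fin_cases i <;> fin_cases j <;> simp [eMat]

lemma eMat_smul (N : ℤ) (c : K) (x y : LS A U) : c • eMat A N x y =
    eMat A N (c • x) (c • y) := by
  ext i j; fin_cases i <;> fin_cases j <;> simp [eMat]

lemma eMat_one (N : ℤ) : eMat A N (1 : LS A U) 0 = 1 := by
  ext i j; fin_cases i <;> fin_cases j <;> simp [eMat, tw_one]

lemma eMat_zero (N : ℤ) : eMat A N (0 : LS A U) 0 = 0 := by
  ext i j; fin_cases i <;> fin_cases j <;> simp [eMat]

/-- The collapse of the elements `0` and `1`. -/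
def collapse (k : ℕ) : Fin (k + 2) → Fin (k + 1) := Fin.cases 0 id

/-- The coefficient of `θ` in the image of `ω_vw`: `1` for `ω_01`, and `(-1)^n` for `ω_10`. -/
def thetaCoeff (K : Type u) [Field K] (n k : ℕ) (v w : Fin (k + 2)) : K :=
  if v = 0 ∧ w = 1 then 1 else if v = 1 ∧ w = 0 then sg K n else 0

lemma thetaCoeff_or (k : ℕ) (v w : Fin (k + 2)) :
    thetaCoeff K n k v w = 0 ∨ collapse k v = collapse k w := by
  unfold thetaCoeff
  split_ifs with h1 h2
  · right; rw [h1.1, h1.2]; rfl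
  · right; rw [h2.1, h2.2]; rfl
  · exact Or.inl rfl

lemma thetaCoeff_symm (k : ℕ) (v w : Fin (k + 2)) :
    thetaCoeff K n k w v = sg K n * thetaCoeff K n k v w := by
  have h := sg_mul_self (K := K) n
  have h01 : (0 : Fin (k + 2)) ≠ 1 := by simp
  unfold thetaCoeff
  split_ifs with h1 h2 h3 h4 h5 <;> grind

lemma thetaCoeff_diag (k : ℕ) (v : Fin (k + 2)) : thetaCoeff K n k v v = 0 := by
  unfold thetaCoeff
  split_ifs with h1 h2
  · have := h1.1.symm.trans h1.2; simp at this
  · have := h2.1.symm.trans h2.2; simp at this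
  · rfl

/-- The cocomposition `G_A(U) → G_A(U/W) ⊗ e_n^∨(W)`, where `U = {0, …, k + 1}` and `W = {0, 1}`;
here `e_n^∨(W)` has basis `1`, `θ = ω_01`, and the element `x + y θ` of the target is encoded by
the matrix `eMat (n - 1) x y`. -/
def cocomp (k : ℕ) : LS A (Fin (k + 2)) →ₐ[K] Matrix (Fin 2) (Fin 2) (LS A (Fin (k + 1))) :=
  LSMap.map
  { p := fun v =>
      { toFun := fun a => eMat A (n - 1) (io A (collapse k v) a) 0
        map_add' := fun a b => by rw [map_add, eMat_add, add_zero]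
        map_smul' := fun c a => by rw [map_smul, RingHom.id_apply, eMat_smul, smul_zero] }
    w := fun v w => eMat A (n - 1) (om A (collapse k v) (collapse k w))
      (algebraMap K _ (thetaCoeff K n k v w))
    one := fun v => by
      change eMat A (n - 1) (io A (collapse k v) 1) 0 = 1
      rw [io_one, eMat_one]
    mul := fun v i j a b _ _ => by
      change eMat A (n - 1) (io A (collapse k v) (a * b)) 0 =
        eMat A (n - 1) (io A (collapse k v) a) 0 * eMat A (n - 1) (io A (collapse k v) b) 0
      rw [eMat_mul, io_mul]; simp
    comm := fun v v' i j a b ha hb => by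
      change eMat A (n - 1) (io A (collapse k v) a) 0 * eMat A (n - 1) (io A (collapse k v') b) 0 =
        sg K (i * j) • (eMat A (n - 1) (io A (collapse k v') b) 0 *
          eMat A (n - 1) (io A (collapse k v) a) 0)
      rw [eMat_mul, eMat_mul, eMat_smul, ls_comm A (io_mem A _ ha) (io_mem A _ hb)]; simp
    comm' := fun v x y i a ha => by
      change eMat A (n - 1) (io A (collapse k v) a) 0 * eMat A (n - 1) _ _ =
        sg K (i * (n - 1)) • (eMat A (n - 1) _ _ * eMat A (n - 1) (io A (collapse k v) a) 0)
      rw [eMat_mul, eMat_mul, eMat_smul, ls_comm A (io_mem A _ ha) (om_mem A _ _),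
        tw_io A _ _ ha, mul_comm i]
      simp [smul_smul, sg_mul_self, Algebra.commutes]
    comm'' := fun v v' x y => by
      rw [eMat_mul, eMat_mul, eMat_smul, ls_comm A (om_mem A _ _) (om_mem A _ _),
        tw_om, tw_om]
      congr 1
      simp only [Algebra.algebraMap_eq_smul_one, smul_mul_assoc, mul_smul_comm, mul_one, one_mul,
        smul_add, smul_smul]
      rw [← mul_assoc (sg K _) (sg K _), sg_mul_self, one_mul]
      exact add_comm _ _
    diag := fun v => by
      rw [om_diag, thetaCoeff_diag, map_zero, eMat_zero]
    symm := fun v x => by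
      rw [om_symm A (collapse k v), thetaCoeff_symm, eMat_smul, map_mul, Algebra.smul_def (sg K n)
        (algebraMap K _ _)]
    sq := fun v x => by
      rw [eMat_mul, om_sq, tw_om]
      rcases thetaCoeff_or (K := K) (n := n) k v x with h | h
      · rw [h]; simp [eMat_zero]
      · rw [h, om_diag]; simp [eMat_zero]
    arnold := fun v x y _ _ _ => by
      have key : ∀ v x y : Fin (k + 2), om A (collapse k y) (collapse k v) *
          algebraMap K _ (thetaCoeff K n k v x) + algebraMap K _ (thetaCoeff K n k v x) *
          (sg K ((n - 1) * (n - 1)) • om A (collapse k x) (collapse k y)) = 0 := by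
        intro v x y
        rcases thetaCoeff_or (K := K) (n := n) k v x with h | h
        · rw [h]; simp
        · rw [h, om_symm A (collapse k x) (collapse k y), ← Algebra.commutes, ← mul_add, ← add_smul]
          have : sg K n + sg K ((n - 1) * (n - 1)) = 0 := by
            by_cases hn : Even (n : ℤ) <;> simp [sg, -Int.not_even_iff_odd,
              ← Int.not_even_iff_odd, Int.even_sub, Int.even_mul, hn, -Int.even_coe_nat]
          rw [this, zero_smul, mul_zero]
      rw [eMat_mul, eMat_mul, eMat_mul, eMat_add, eMat_add, om_arnold]
      simp only [tw_om]
      have h1 := key v x y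
      have h2 := key x y v
      have h3 := key y v x
      rw [← eMat_zero]
      congr 1
      refine Eq.trans ?_ ((congrArg₂ (· + ·) (congrArg₂ (· + ·) h1 h2) h3).trans (by simp))
      abel
    slide := fun v x i a ha => by
      change eMat A (n - 1) (io A (collapse k v) a) 0 * eMat A (n - 1) _ _ =
        eMat A (n - 1) (io A (collapse k x) a) 0 * eMat A (n - 1) _ _
      rw [eMat_mul, eMat_mul, io_om]
      rcases thetaCoeff_or (K := K) (n := n) k v x with h | h
      · rw [h]; simp
      · rw [h] }

end Cocomp

section Differential

variable [DecidableEq U]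

/-- The class `Δ_vw = ι_vw(Δ)`, for `v ≠ w`; by convention, `0` for `v = w`. -/
def Del (v w : U) : LS A U := if v = w then 0 else A.diag (io A v) (io A w)

lemma Del_mem (v w : U) : Del A v w ∈ lgr A U n := by
  unfold Del
  split_ifs
  · exact zero_mem _
  · refine Submodule.sum_mem _ fun s _ => Submodule.smul_mem _ _ ?_
    have := SetLike.GradedMul.mul_mem (io_mem A v (A.basis_mem s)) (io_mem A w (A.dbasis_mem s))
    rwa [add_sub_cancel] at this

lemma Del_symm (v w : U) : Del A w v = sg K n • Del A v w := by
  by_cases h : v = w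
  · subst h; simp [Del]
  · rw [Del, Del, if_neg h, if_neg (Ne.symm h), A.diag_symm (io_gcomm A v w)]

lemma io_Del (v w : U) (a : A.A) : io A v a * Del A v w = io A w a * Del A v w := by
  by_cases h : v = w
  · subst h; rfl
  · rw [Del, if_neg h]
    exact A.diag_slide (io_mul A v) (io_mul A w) (io_gcomm A v w) a

lemma om_diag_eq (v w x y : U) (h : ∀ a, om A v w * io A x a = om A v w * io A y a) (z : U) :
    om A v w * A.diag (io A x) (io A z) = om A v w * A.diag (io A y) (io A z) := by
  simp only [PDCDGA.diag, Finset.mul_sum, mul_smul_comm, ← mul_assoc, h]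

lemma om_Del_even (v w x y : U) : om A v w * Del A x y = Del A x y * om A v w := by
  have : Even (((n : ℤ) - 1) * n) := by
    rw [mul_comm]
    exact Int.even_mul_pred_self _
  rw [ls_comm A (om_mem A v w) (Del_mem A x y), sg_even this, one_smul]

lemma om_Del_swap (v w x : U) (h1 : w ≠ x) (h2 : v ≠ x) :
    om A v w * Del A w x = om A v w * Del A v x := by
  rw [Del, Del, if_neg h1, if_neg h2]
  exact om_diag_eq A v w w v (fun a => (io_om' A v w a).symm) x

lemma om_Del_self (v w : U) : om A v w * Del A w v = om A v w * Del A v w := by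
  by_cases h : v = w
  · subst h; rfl
  rw [Del, Del, if_neg h, if_neg (Ne.symm h),
    om_diag_eq A v w w v (fun a => (io_om' A v w a).symm) v]
  simp only [PDCDGA.diag, Finset.mul_sum, mul_smul_comm]
  refine Finset.sum_congr rfl fun s _ => ?_
  congr 1
  have hs := A.basis_mem s
  have ht := A.dbasis_mem s
  rw [ls_comm A (io_mem A v hs) (io_mem A v ht), ls_comm A (io_mem A v hs) (io_mem A w ht),
    mul_smul_comm, mul_smul_comm, ← mul_assoc, io_om', mul_assoc]

/-- The matrix which encodes the value `x` and the derivative `y` of a generator. -/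
def dMat (x y : LS A U) : Matrix (Fin 2) (Fin 2) (LS A U) := !![tw (lgr A U) 1 x, y; 0, x]

lemma dMat_mul (x y x' y' : LS A U) : dMat A x y * dMat A x' y' =
    dMat A (x * x') (tw (lgr A U) 1 x * y' + y * x') := by
  simp [dMat, Matrix.mul_fin_two, tw_mul]

lemma dMat_add (x y x' y' : LS A U) : dMat A x y + dMat A x' y' = dMat A (x + x') (y + y') := by
  ext i j; fin_cases i <;> fin_cases j <;> simp [dMat]

lemma dMat_smul (c : K) (x y : LS A U) : c • dMat A x y = dMat A (c • x) (c • y) := by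
  ext i j; fin_cases i <;> fin_cases j <;> simp [dMat]

lemma dMat_one : dMat A (1 : LS A U) 0 = 1 := by
  ext i j; fin_cases i <;> fin_cases j <;> simp [dMat, tw_one]

lemma dMat_zero : dMat A (0 : LS A U) 0 = 0 := by
  ext i j; fin_cases i <;> fin_cases j <;> simp [dMat]

lemma dMat_comm {i j : ℤ} {x y x' y' : LS A U} (hx : x ∈ lgr A U i) (hy : y ∈ lgr A U (i + 1))
    (hx' : x' ∈ lgr A U j) (hy' : y' ∈ lgr A U (j + 1)) :
    dMat A x y * dMat A x' y' = sg K (i * j) • (dMat A x' y' * dMat A x y) := by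
  rw [dMat_mul, dMat_mul, dMat_smul, ls_comm A hx hx', tw_of_mem (lgr A U) 1 hx,
    tw_of_mem (lgr A U) 1 hx']
  congr 1
  rw [smul_mul_assoc, smul_mul_assoc, ls_comm A hx hy', ls_comm A hy hx']
  simp only [smul_add, smul_smul, ← sg_add]
  have e1 : sg K (1 * i + i * (j + 1)) = sg K (i * j) := by
    rw [show 1 * i + i * (j + 1) = (i + i) + i * j by ring, sg_add, sg_even ⟨i, rfl⟩, one_mul]
  have e2 : sg K ((i + 1) * j) = sg K (i * j + 1 * j) := by
    rw [add_mul]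
  rw [e1, e2, add_comm]

lemma d_one' : A.d 1 = 0 := by
  have h1 : (1 : A.A) ∈ A.gr 0 := SetLike.GradedOne.one_mem
  have := A.d_mul h1 h1
  rwa [mul_one, mul_one, one_mul, sg_zero, one_smul, left_eq_add] at this

variable (U) in
/-- The data which define the differential of the Lambrechts-Stanley algebra. -/
def lsD : LSMap A U (Matrix (Fin 2) (Fin 2) (LS A U)) where
  p v :=
    { toFun := fun a => dMat A (io A v a) (io A v (A.d a))
      map_add' := fun a b => by rw [map_add, map_add, map_add, dMat_add]
      map_smul' := fun c a => by rw [map_smul, map_smul, map_smul, RingHom.id_apply, dMat_smul] }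
  w v w := dMat A (om A v w) (Del A v w)
  one v := by
    change dMat A (io A v 1) (io A v (A.d 1)) = 1
    rw [io_one, d_one', map_zero, dMat_one]
  mul v i j a b ha hb := by
    change dMat A (io A v (a * b)) (io A v (A.d (a * b))) =
      dMat A (io A v a) (io A v (A.d a)) * dMat A (io A v b) (io A v (A.d b))
    rw [dMat_mul, A.d_mul ha hb, map_add, map_smul, io_mul, io_mul, io_mul, tw_io A _ _ ha,
      one_mul, smul_mul_assoc, add_comm]
  comm v v' i j a b ha hb :=
    dMat_comm A (io_mem A v ha) (io_mem A v (A.d_mem ha)) (io_mem A v' hb)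
      (io_mem A v' (A.d_mem hb))
  comm' v x y i a ha :=
    dMat_comm A (io_mem A v ha) (io_mem A v (A.d_mem ha)) (om_mem A x y)
      (by rw [sub_add_cancel]; exact Del_mem A x y)
  comm'' v v' x y :=
    dMat_comm A (om_mem A v v') (by rw [sub_add_cancel]; exact Del_mem A v v') (om_mem A x y)
      (by rw [sub_add_cancel]; exact Del_mem A x y)
  diag v := by rw [om_diag, Del, if_pos rfl, dMat_zero]
  symm v x := by rw [om_symm A v x, Del_symm A v x, dMat_smul]
  sq v x := by
    rw [dMat_mul, om_sq, tw_om, smul_mul_assoc, ← om_Del_even, one_mul]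
    have h := om_Del_self A v x
    rw [Del_symm A v x, mul_smul_comm] at h
    rw [← dMat_zero]
    congr 1
    by_cases hn : Even (n : ℤ)
    · rw [sg_odd (hn.sub_odd odd_one)]; module
    · have hn' := Int.not_even_iff_odd.mp hn
      rw [sg_even (hn'.sub_odd odd_one), one_smul]
      rw [sg_odd hn', neg_one_smul] at h
      nth_rewrite 1 [← h]
      exact neg_add_cancel _
  arnold v x y h1 h2 h3 := by
    have key : ∀ v x y : U, v ≠ x → x ≠ y → y ≠ v →
        tw (lgr A U) 1 (om A v x) * Del A x y + Del A y v * om A v x = 0 := by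
      intro v x y h1 h2 h3
      rw [tw_om, smul_mul_assoc, ← om_Del_even, om_Del_swap A v x y h2 h3.symm, Del_symm A v y,
        mul_smul_comm, ← add_smul]
      have : sg K (1 * (n - 1)) + sg K n = 0 := by
        by_cases hn : Even (n : ℤ) <;> simp [sg, -Int.not_even_iff_odd,
          ← Int.not_even_iff_odd, Int.even_sub, Int.even_mul, hn, -Int.even_coe_nat]
      rw [this, zero_smul]
    rw [dMat_mul, dMat_mul, dMat_mul, dMat_add, dMat_add, om_arnold, ← dMat_zero]
    congr 1
    refine Eq.trans ?_ ((congrArg₂ (· + ·) (congrArg₂ (· + ·) (key v x y h1 h2 h3)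
      (key x y v h2 h3 h1)) (key y v x h3 h1 h2)).trans (by simp))
    abel
  slide v x i a ha := by
    change dMat A (io A v a) (io A v (A.d a)) * dMat A _ _ =
      dMat A (io A x a) (io A x (A.d a)) * dMat A _ _
    rw [dMat_mul, dMat_mul, io_om, io_om, tw_io A _ _ ha, tw_io A _ _ ha, smul_mul_assoc,
      smul_mul_assoc, io_Del]

variable (U) in
/-- The differential on generators. -/
def dgen : LSGen A U → LS A U
  | .pt v _ a => io A v (A.d a)
  | .om v w => Del A v w

lemma lsD_val : (lsD A U).val = (lsPres A U).derMat 1 (dgen A U) := by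
  funext x
  cases x with
  | pt v i a =>
    change dMat A (io A v a) (io A v (A.d a)) = _
    rw [GPres.derMat, gen_pt]; rfl
  | om v w => rfl

variable (U) in
/-- The differential of the Lambrechts-Stanley algebra: the derivation of degree `1` with
`d ι_v(a) = ι_v(d a)` and `d ω_vw = ι_vw(Δ)`. -/
def lsd : LS A U →ₗ[K] LS A U :=
  (lsPres A U).der 1 (dgen A U) fun _ _ h => by
    rw [← lsD_val]; exact (lsD A U).rel h

lemma lsd_io (v : U) (a : A.A) : lsd A U (io A v a) = io A v (A.d a) := by
  have h : lsd A U ∘ₗ io A v = io A v ∘ₗ A.d := by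
    refine ghom_ext (gr := A.gr) fun i a ha => ?_
    rw [LinearMap.comp_apply, io_of_mem A v ha, lsd, GPres.der_gen]; rfl
  exact LinearMap.congr_fun h a

lemma lsd_om (v w : U) : lsd A U (om A v w) = Del A v w := (lsPres A U).der_gen _ _ _ _

lemma lsd_mem {i : ℤ} {x : LS A U} (hx : x ∈ lgr A U i) : lsd A U x ∈ lgr A U (i + 1) := by
  refine (lsPres A U).der_mem 1 _ _ ?_ hx
  intro x
  cases x with
  | pt v i a => exact io_mem A v (A.d_mem a.2)
  | om v w =>
    change Del A v w ∈ lgr A U (n - 1 + 1)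
    rw [sub_add_cancel]; exact Del_mem A v w

lemma lsd_mul (x y : LS A U) :
    lsd A U (x * y) = lsd A U x * y + tw (lgr A U) 1 x * lsd A U y := (lsPres A U).der_mul _ _ _ _ _

lemma lsd_tw (x : LS A U) : lsd A U (tw (lgr A U) 1 x) = -tw (lgr A U) 1 (lsd A U x) := by
  have h : lsd A U ∘ₗ tw (lgr A U) 1 = -(tw (lgr A U) 1 ∘ₗ lsd A U) := by
    refine ghom_ext (gr := lgr A U) fun i a ha => ?_
    simp only [LinearMap.comp_apply, LinearMap.neg_apply]
    rw [tw_of_mem (lgr A U) 1 ha, tw_of_mem (lgr A U) 1 (lsd_mem A ha), map_smul, mul_add,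
      sg_add, sg_odd (K := K) (i := 1 * 1) (by decide)]
    module
  exact LinearMap.congr_fun h x

lemma tw_tw {V : Type u} [AddCommGroup V] [Module K V] (gr : ℤ → Submodule K V)
    [DirectSum.Decomposition gr] (p : ℤ) (x : V) : tw gr p (tw gr p x) = x := by
  have h : tw gr p ∘ₗ tw gr p = LinearMap.id := by
    refine ghom_ext (gr := gr) fun i a ha => ?_
    rw [LinearMap.comp_apply, tw_of_mem gr p ha, map_smul, tw_of_mem gr p ha, smul_smul,
      sg_mul_self, one_smul, LinearMap.id_apply]
  exact LinearMap.congr_fun h x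

lemma lsd_lsd (x : LS A U) : lsd A U (lsd A U x) = 0 := by
  induction x using (lsPres A U).induction with
  | h1 => rw [lsd, GPres.der_one, map_zero]
  | hadd x y hx hy => rw [map_add, map_add, hx, hy, add_zero]
  | hsmul c x hx => rw [map_smul, map_smul, hx, smul_zero]
  | hmul g y hy =>
    have hg : lsd A U (lsd A U ((lsPres A U).gen g)) = 0 := by
      cases g with
      | pt v i a => rw [gen_pt, lsd_io, lsd_io, A.d_d, map_zero]
      | om v w =>
        rw [gen_om, lsd_om, Del]
        split_ifs with h
        · rw [map_zero]
        · rw [PDCDGA.diag, map_sum, ← A.diag_d (io A v) (io A w), ← Finset.sum_add_distrib]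
          refine Finset.sum_congr rfl fun s _ => ?_
          rw [map_smul, lsd_mul, lsd_io, lsd_io, tw_io A _ _ (A.basis_mem s), one_mul, smul_add,
            smul_mul_assoc, smul_smul, sg_mul_self, one_smul]
    rw [lsd_mul, map_add, lsd_mul, lsd_mul, hg, hy, lsd_tw]
    simp

end Differential

end LS

namespace PoisAlg

variable {K : Type u} [Field K] {N : ℤ}

/-- Morphisms of Poisson algebras. -/
structure Hom (B C : PoisAlg K N) where
  f : B.B →ₐ[K] C.B
  mem : ∀ {i x}, x ∈ B.gr i → f x ∈ C.gr i
  d : ∀ x, f (B.d x) = C.d (f x)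
  br : ∀ x y, f (B.br x y) = C.br (f x) (f y)

/-- The underlying chain complex of a Poisson algebra. -/
def toCpx (B : PoisAlg K N) : Cpx K where
  V := B.B
  gr := B.gr
  d := B.d
  d_mem := B.d_mem
  d_d := B.d_d

/-- The chain map underlying a morphism of Poisson algebras. -/
def Hom.toCpx {B C : PoisAlg K N} (φ : Hom B C) : Cpx.Hom B.toCpx C.toCpx where
  f := φ.f.toLinearMap
  mem := φ.mem
  comm := φ.d

/-- Weak equivalences of Poisson algebras: the quasi-isomorphisms. -/
def Hom.IsQuasiIso {B C : PoisAlg K N} (φ : Hom B C) : Prop := φ.toCpx.IsQuasiIso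

/-- The cofibrant objects: those which have the left lifting property with respect to the
surjective quasi-isomorphisms. -/
def Cofibrant (Q : PoisAlg K N) : Prop :=
  ∀ (X Y : PoisAlg K N) (p : Hom X Y), Function.Surjective p.f → p.IsQuasiIso →
    ∀ ψ : Hom Q Y, ∃ χ : Hom Q X, ∀ q, p.f (χ.f q) = ψ.f q

lemma Hom.map_tw {B C : PoisAlg K N} (φ : Hom B C) (p : ℤ) (x : B.B) :
    φ.f (tw B.gr p x) = tw C.gr p (φ.f x) := by
  have h : φ.f.toLinearMap ∘ₗ tw B.gr p = tw C.gr p ∘ₗ φ.f.toLinearMap := by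
    refine ghom_ext (gr := B.gr) fun i a ha => ?_
    simp only [LinearMap.comp_apply, AlgHom.toLinearMap_apply]
    rw [tw_of_mem B.gr p ha, tw_of_mem C.gr p (φ.mem ha), map_smul]
  exact LinearMap.congr_fun h x

end PoisAlg

section TensorPower

variable {K : Type u} [Field K] {N : ℤ} (B : PoisAlg K N)

lemma d_tw (x : B.B) : B.d (tw B.gr 1 x) = -tw B.gr 1 (B.d x) := by
  have h : B.d ∘ₗ tw B.gr 1 = -(tw B.gr 1 ∘ₗ B.d) := by
    refine ghom_ext (gr := B.gr) fun i a ha => ?_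
    simp only [LinearMap.comp_apply, LinearMap.neg_apply]
    rw [tw_of_mem B.gr 1 ha, tw_of_mem B.gr 1 (B.d_mem ha), map_smul, mul_sub, sub_eq_add_neg,
      sg_add, sg_odd (K := K) (i := -(1 * 1)) (by decide)]
    module
  exact LinearMap.congr_fun h x

/-- The `k`-th tensor power of the underlying space. -/
abbrev TPow (k : ℕ) : Type u := ⨂[K] _ : Fin k, B.B

/-- The `i`-th term `σ ⊗ ⋯ ⊗ σ ⊗ d ⊗ 1 ⊗ ⋯ ⊗ 1` of the differential of the tensor power, where
`σ` is multiplication by `(-1)^|x|`. -/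
def tpTerm (k : ℕ) (i : Fin k) : TPow B k →ₗ[K] TPow B k :=
  PiTensorProduct.map fun j => if j < i then tw B.gr 1 else if j = i then B.d else LinearMap.id

/-- The differential of the tensor power. -/
def tpD (k : ℕ) : TPow B k →ₗ[K] TPow B k := ∑ i, tpTerm B k i

/-- Multiplication by `(-1)^|x|` on the tensor power. -/
def tpS (k : ℕ) : TPow B k →ₗ[K] TPow B k := PiTensorProduct.map fun _ => tw B.gr 1

lemma tpTerm_tprod (k : ℕ) (i : Fin k) (b : Fin k → B.B) :
    tpTerm B k i (PiTensorProduct.tprod K b) = PiTensorProduct.tprod K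
      fun j => if j < i then tw B.gr 1 (b j) else if j = i then B.d (b j) else b j := by
  rw [tpTerm, PiTensorProduct.map_tprod]
  congr 1
  funext j
  split_ifs <;> rfl

lemma tpTerm_self (k : ℕ) (i : Fin k) (t : TPow B k) : tpTerm B k i (tpTerm B k i t) = 0 := by
  have h : tpTerm B k i ∘ₗ tpTerm B k i = 0 := by
    apply PiTensorProduct.ext
    apply MultilinearMap.ext
    intro b
    simp only [LinearMap.compMultilinearMap_apply, LinearMap.comp_apply, LinearMap.zero_apply,
      tpTerm_tprod]
    apply MultilinearMap.map_coord_zero _ i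
    simp [B.d_d]
  exact LinearMap.congr_fun h t

lemma tpTerm_comm (k : ℕ) {i i' : Fin k} (hii : i < i') (t : TPow B k) :
    tpTerm B k i (tpTerm B k i' t) + tpTerm B k i' (tpTerm B k i t) = 0 := by
  have h : tpTerm B k i ∘ₗ tpTerm B k i' + tpTerm B k i' ∘ₗ tpTerm B k i = 0 := by
    apply PiTensorProduct.ext
    apply MultilinearMap.ext
    intro b
    simp only [LinearMap.compMultilinearMap_apply, LinearMap.comp_apply, LinearMap.zero_apply,
      LinearMap.add_apply, tpTerm_tprod]
    set c : Fin k → B.B := fun j => if j < i' then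
      tw B.gr 1 (if j < i then tw B.gr 1 (b j) else if j = i then B.d (b j) else b j)
      else if j = i' then B.d (if j < i then tw B.gr 1 (b j) else if j = i then B.d (b j) else b j)
      else if j < i then tw B.gr 1 (b j) else if j = i then B.d (b j) else b j with hc
    have e : (fun j => if j < i then
      tw B.gr 1 (if j < i' then tw B.gr 1 (b j) else if j = i' then B.d (b j) else b j)
      else if j = i then B.d (if j < i' then tw B.gr 1 (b j) else if j = i' then B.d (b j) else b j)
      else if j < i' then tw B.gr 1 (b j) else if j = i' then B.d (b j) else b j) =
        Function.update c i ((-1 : K) • c i) := by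
      funext j
      by_cases h1 : j = i
      · subst h1
        simp [hc, hii, d_tw]
      · rw [Function.update_of_ne h1]
        simp only [hc]
        rcases lt_or_gt_of_ne h1 with h2 | h2
        · simp [h2, h2.trans hii]
        · simp [h1, h2.le.not_gt]
    rw [e, MultilinearMap.map_update_smul, Function.update_eq_self]
    rw [neg_one_smul]
    exact neg_add_cancel _
  exact LinearMap.congr_fun h t

lemma tpD_tpD (k : ℕ) (t : TPow B k) : tpD B k (tpD B k t) = 0 := by
  have key : ∀ s : Finset (Fin k), (∑ i ∈ s, tpTerm B k i) ((∑ i ∈ s, tpTerm B k i) t) = 0 := by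
    intro s
    induction s using Finset.induction_on with
    | empty => simp
    | insert a s ha ih =>
      have h2 : tpTerm B k a ((∑ i ∈ s, tpTerm B k i) t) +
          (∑ i ∈ s, tpTerm B k i) (tpTerm B k a t) = 0 := by
        rw [LinearMap.sum_apply, LinearMap.sum_apply, map_sum, ← Finset.sum_add_distrib]
        refine Finset.sum_eq_zero fun i hi => ?_
        rcases lt_or_gt_of_ne (fun h : i = a => ha (h ▸ hi)) with h | h
        · rw [add_comm]; exact tpTerm_comm B k h t
        · exact tpTerm_comm B k h t
      rw [Finset.sum_insert ha, LinearMap.add_apply, LinearMap.add_apply, map_add, map_add,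
        tpTerm_self, ih, zero_add, add_zero, h2]
  exact key Finset.univ

lemma tpS_tpD (k : ℕ) (t : TPow B k) : tpD B k (tpS B k t) = -tpS B k (tpD B k t) := by
  have h : ∀ i, tpTerm B k i ∘ₗ tpS B k = -(tpS B k ∘ₗ tpTerm B k i) := by
    intro i
    apply PiTensorProduct.ext
    apply MultilinearMap.ext
    intro b
    simp only [LinearMap.compMultilinearMap_apply, LinearMap.comp_apply, LinearMap.neg_apply,
      tpTerm_tprod, tpS, PiTensorProduct.map_tprod]
    set c : Fin k → B.B := fun j => tw B.gr 1
      (if j < i then tw B.gr 1 (b j) else if j = i then B.d (b j) else b j) with hc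
    have e : (fun j => if j < i then tw B.gr 1 (tw B.gr 1 (b j)) else
        if j = i then B.d (tw B.gr 1 (b j)) else tw B.gr 1 (b j)) =
        Function.update c i ((-1 : K) • c i) := by
      funext j
      by_cases h1 : j = i
      · subst h1
        simp [hc, d_tw]
      · rw [Function.update_of_ne h1]
        simp only [hc, h1, if_false]
        split_ifs <;> rfl
    rw [e, MultilinearMap.map_update_smul, Function.update_eq_self, neg_one_smul]
  rw [tpD, LinearMap.sum_apply, LinearMap.sum_apply, map_sum, ← Finset.sum_neg_distrib]
  exact Finset.sum_congr rfl fun i _ => LinearMap.congr_fun (h i) t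

lemma tpS_tpS (k : ℕ) (t : TPow B k) : tpS B k (tpS B k t) = t := by
  have h : tpS B k ∘ₗ tpS B k = LinearMap.id := by
    apply PiTensorProduct.ext
    apply MultilinearMap.ext
    intro b
    simp [tpS, tw_tw]
  exact LinearMap.congr_fun h t

variable {B} in
/-- The action of a morphism on tensor powers. -/
def tpMap {C : PoisAlg K N} (φ : PoisAlg.Hom B C) (k : ℕ) : TPow B k →ₗ[K] TPow C k :=
  PiTensorProduct.map fun _ => φ.f.toLinearMap

variable {B} in
lemma tpMap_tpD {C : PoisAlg K N} (φ : PoisAlg.Hom B C) (k : ℕ) (t : TPow B k) :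
    tpMap φ k (tpD B k t) = tpD C k (tpMap φ k t) := by
  have h : ∀ i, tpMap φ k ∘ₗ tpTerm B k i = tpTerm C k i ∘ₗ tpMap φ k := by
    intro i
    apply PiTensorProduct.ext
    apply MultilinearMap.ext
    intro b
    simp only [LinearMap.compMultilinearMap_apply, LinearMap.comp_apply,
      tpTerm_tprod, tpMap, PiTensorProduct.map_tprod]
    congr 1
    funext j
    split_ifs <;> simp [φ.map_tw, φ.d]
  rw [tpD, tpD, LinearMap.sum_apply, LinearMap.sum_apply, map_sum]
  exact Finset.sum_congr rfl fun i _ => LinearMap.congr_fun (h i) t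

end TensorPower

section Circ

variable {K : Type u} [Field K] {n : ℕ} (A : PDCDGA K n)

/-- The dual `G_A^∨(k)` of the Lambrechts-Stanley algebra. -/
abbrev LSDual (k : ℕ) : Type u := Module.Dual K (LS A (Fin k))

/-- The elements of (homological) degree `i` of the dual are the forms which vanish outside of
degree `i`. -/
def dgr (k : ℕ) (i : ℤ) : Submodule K (LSDual A k) where
  carrier := {f | ∀ j, j ≠ i → ∀ x ∈ lgr A (Fin k) j, f x = 0}
  add_mem' hf hg j hj x hx := by rw [LinearMap.add_apply, hf j hj x hx, hg j hj x hx, add_zero]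
  zero_mem' _ _ _ _ := rfl
  smul_mem' c f hf j hj x hx := by rw [LinearMap.smul_apply, hf j hj x hx, smul_zero]

/-- Multiplication by `(-1)^|f|` on the dual. -/
def dualS (k : ℕ) : LSDual A k →ₗ[K] LSDual A k := (tw (lgr A (Fin k)) 1).dualMap

/-- The differential of the dual: `(d f)(x) = -(-1)^|f| f (d x)`. -/
def dualD (k : ℕ) : LSDual A k →ₗ[K] LSDual A k :=
  -(tw (lgr A (Fin k)) 1 ∘ₗ lsd A (Fin k)).dualMap

lemma dualD_apply (k : ℕ) (f : LSDual A k) (x : LS A (Fin k)) :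
    dualD A k f x = -f (tw (lgr A (Fin k)) 1 (lsd A (Fin k) x)) := rfl

lemma dualS_apply (k : ℕ) (f : LSDual A k) (x : LS A (Fin k)) :
    dualS A k f x = f (tw (lgr A (Fin k)) 1 x) := rfl

lemma dualS_dualS (k : ℕ) (f : LSDual A k) : dualS A k (dualS A k f) = f :=
  LinearMap.ext fun x => by rw [dualS_apply, dualS_apply, tw_tw]

lemma dualD_dualD (k : ℕ) (f : LSDual A k) : dualD A k (dualD A k f) = 0 :=
  LinearMap.ext fun x => by
    rw [dualD_apply, dualD_apply, lsd_tw, lsd_lsd]; simp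

lemma dualD_dualS (k : ℕ) (f : LSDual A k) : dualD A k (dualS A k f) = -dualS A k (dualD A k f) :=
  LinearMap.ext fun x => by
    rw [dualD_apply, dualS_apply, LinearMap.neg_apply, dualS_apply, dualD_apply, lsd_tw]; simp

lemma dualD_mem (k : ℕ) {i : ℤ} {f : LSDual A k} (hf : f ∈ dgr A k i) :
    dualD A k f ∈ dgr A k (i - 1) := by
  intro j hj x hx
  have h := lsd_mem A hx
  rw [dualD_apply, tw_of_mem (lgr A (Fin k)) 1 h, map_smul, hf (j + 1) (by omega) _ h, smul_zero,
    neg_zero]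

lemma dualS_of_mem (k : ℕ) {i : ℤ} {f : LSDual A k} (hf : f ∈ dgr A k i) :
    dualS A k f = sg K i • f := by
  refine ghom_ext (gr := lgr A (Fin k)) fun j x hx => ?_
  rw [dualS_apply, tw_of_mem (lgr A (Fin k)) 1 hx, map_smul, LinearMap.smul_apply]
  by_cases h : j = i
  · subst h; rw [one_mul]
  · rw [hf j h x hx, smul_zero, smul_zero]

/-- The right action of the transposition of `i` and `i + 1` on the dual. -/
def actSwap (k : ℕ) (i : Fin k) : LSDual A (k + 1) →ₗ[K] LSDual A (k + 1) :=
  (LS.push A (Equiv.swap i.castSucc i.succ)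
    (Equiv.swap i.castSucc i.succ).injective).toLinearMap.dualMap

/-- The right action `f ↦ f ∘_0 1` of the generator of `e_n(0)`. -/
def actUnit (k : ℕ) : LSDual A (k + 1) →ₗ[K] LSDual A k :=
  (LS.push A Fin.succ (Fin.succ_injective k)).toLinearMap.dualMap

/-- The right action `f ↦ f ∘_0 μ` of the product `μ` in `e_n(2)`. It is dual to the coefficient
of `1` in the cocomposition. -/
def actMul (k : ℕ) : LSDual A (k + 1) →ₗ[K] LSDual A (k + 2) :=
  ((LinearMap.proj (0 : Fin 2) ∘ₗ LinearMap.proj (0 : Fin 2)) ∘ₗ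
    (cocomp A k).toLinearMap).dualMap

/-- The right action `f ↦ f ∘_0 λ` of the bracket `λ` in `e_n(2)`. It is dual to the coefficient
of `ω_01` in the cocomposition, with the Koszul sign of the exchange of `λ` with the argument of
`f`. -/
def actBr (k : ℕ) : LSDual A (k + 1) →ₗ[K] LSDual A (k + 2) :=
  (tw (lgr A (Fin (k + 1))) (n - 1) ∘ₗ
    (LinearMap.proj (1 : Fin 2) ∘ₗ LinearMap.proj (0 : Fin 2)) ∘ₗ
      (cocomp A k).toLinearMap).dualMap

variable (B : PoisAlg K (n - 1))

/-- The direct sum of the spaces `G_A^∨(k) ⊗ B^{⊗ k}`. -/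
abbrev CircV : Type u := ⨁ k : ℕ, LSDual A k ⊗[K] TPow B k

instance circGrp : AddCommGroup (CircV A B) := Module.addCommMonoidToAddCommGroup K

/-- The inclusion of the summands. -/
abbrev cin (k : ℕ) : LSDual A k ⊗[K] TPow B k →ₗ[K] CircV A B :=
  DirectSum.lof K ℕ (fun k => LSDual A k ⊗[K] TPow B k) k

/-- The element `f ⊗ b_0 ⊗ ⋯ ⊗ b_{k-1}`. -/
def circTmul (k : ℕ) (f : LSDual A k) (b : Fin k → B.B) : CircV A B :=
  cin A B k (f ⊗ₜ[K] PiTensorProduct.tprod K b)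

/-- The differential of `G_A^∨(k) ⊗ B^{⊗ k}`. -/
def circDk (k : ℕ) : LSDual A k ⊗[K] TPow B k →ₗ[K] LSDual A k ⊗[K] TPow B k :=
  TensorProduct.map (dualD A k) LinearMap.id + TensorProduct.map (dualS A k) (tpD B k)

lemma circDk_tmul (k : ℕ) (f : LSDual A k) (t : TPow B k) :
    circDk A B k (f ⊗ₜ t) = dualD A k f ⊗ₜ t + dualS A k f ⊗ₜ tpD B k t := rfl

lemma circDk_circDk (k : ℕ) (t : LSDual A k ⊗[K] TPow B k) :
    circDk A B k (circDk A B k t) = 0 := by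
  have h : circDk A B k ∘ₗ circDk A B k = 0 := by
    apply TensorProduct.ext'
    intro f t
    rw [LinearMap.comp_apply, circDk_tmul, map_add, circDk_tmul, circDk_tmul, dualD_dualD,
      dualS_dualS, tpD_tpD, dualD_dualS, TensorProduct.zero_tmul, TensorProduct.tmul_zero,
      TensorProduct.neg_tmul, LinearMap.zero_apply]
    abel
  exact LinearMap.congr_fun h t

/-- The differential of the direct sum. -/
def circDV : CircV A B →ₗ[K] CircV A B := DirectSum.lmap (circDk A B)

lemma circDV_cin (k : ℕ) (t : LSDual A k ⊗[K] TPow B k) :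
    circDV A B (cin A B k t) = cin A B k (circDk A B k t) := DirectSum.lmap_lof _ _ _

lemma circDV_circDV (t : CircV A B) : circDV A B (circDV A B t) = 0 := by
  have h : circDV A B ∘ₗ circDV A B = 0 := by
    apply DirectSum.linearMap_ext
    intro k
    apply LinearMap.ext
    intro t
    change circDV A B (circDV A B (cin A B k t)) = 0
    rw [circDV_cin, circDV_cin, circDk_circDk, map_zero]
  exact LinearMap.congr_fun h t

/-- The grading of the direct sum. -/
def circGr (m : ℤ) : Submodule K (CircV A B) :=
  Submodule.span K {t | ∃ (k : ℕ) (i : ℤ) (p : Fin k → ℤ), i + ∑ j, p j = m ∧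
    ∃ f ∈ dgr A k i, ∃ b : Fin k → B.B, (∀ j, b j ∈ B.gr (p j)) ∧ t = circTmul A B k f b}

/-- The relations of the relative composition product `G_A^∨ ∘_{e_n} B`, for the generators of the
operad `e_n` and for the symmetric groups: `(f · σ) ⊗ b = f ⊗ (σ · b)` for the transpositions `σ`
of consecutive elements, `(f ∘_0 1) ⊗ b = f ⊗ (1, b)`, `(f ∘_0 μ) ⊗ (x, y, b) = f ⊗ (x y, b)`, and
`(f ∘_0 λ) ⊗ (x, y, b) = f ⊗ ({x, y}, b)`. -/
inductive CircRel : CircV A B → Prop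
  | swap (k : ℕ) (i : Fin k) (f : LSDual A (k + 1)) (b : Fin (k + 1) → B.B) (p : Fin (k + 1) → ℤ)
      (hb : ∀ j, b j ∈ B.gr (p j)) :
      CircRel (circTmul A B (k + 1) (actSwap A k i f) b - sg K (p i.castSucc * p i.succ) •
        circTmul A B (k + 1) f (b ∘ Equiv.swap i.castSucc i.succ))
  | unit (k : ℕ) (f : LSDual A (k + 1)) (b : Fin k → B.B) :
      CircRel (circTmul A B k (actUnit A k f) b -
        circTmul A B (k + 1) f (Fin.cons (1 : B.B) b))
  | mul (k : ℕ) (f : LSDual A (k + 1)) (x y : B.B) (b : Fin k → B.B) :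
      CircRel (circTmul A B (k + 2) (actMul A k f)
          (Fin.cons x (Fin.cons y b : Fin (k + 1) → B.B) : Fin (k + 2) → B.B) -
        circTmul A B (k + 1) f (Fin.cons (x * y) b))
  | br (k : ℕ) (f : LSDual A (k + 1)) (x y : B.B) (b : Fin k → B.B) :
      CircRel (circTmul A B (k + 2) (actBr A k f)
          (Fin.cons x (Fin.cons y b : Fin (k + 1) → B.B) : Fin (k + 2) → B.B) -
        circTmul A B (k + 1) f (Fin.cons (B.br x y) b))

/-- The subcomplex generated by the relations. -/
def circSub : Submodule K (CircV A B) :=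
  Submodule.span K {t | CircRel A B t} ⊔ (Submodule.span K {t | CircRel A B t}).map (circDV A B)

lemma circSub_le : circSub A B ≤ (circSub A B).comap (circDV A B) := by
  refine sup_le (fun t ht => ?_) ?_
  · exact Submodule.mem_sup_right (Submodule.mem_map_of_mem ht)
  · rintro _ ⟨t, -, rfl⟩
    rw [Submodule.mem_comap, circDV_circDV]
    exact zero_mem _

lemma circDV_mem_gr {m : ℤ} {t : CircV A B} (ht : t ∈ circGr A B m) :
    circDV A B t ∈ circGr A B (m - 1) := by
  induction ht using Submodule.span_induction with
  | zero => rw [map_zero]; exact zero_mem _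
  | add x y _ _ h1 h2 => rw [map_add]; exact add_mem h1 h2
  | smul c x _ h => rw [map_smul]; exact Submodule.smul_mem _ _ h
  | mem x hx =>
    obtain ⟨k, i, p, hm, f, hf, b, hb, rfl⟩ := hx
    rw [circTmul, circDV_cin, circDk_tmul, map_add]
    refine add_mem (Submodule.subset_span ⟨k, i - 1, p, by omega, _, dualD_mem A k hf, b, hb, rfl⟩)
      ?_
    rw [dualS_of_mem A k hf, ← TensorProduct.smul_tmul', map_smul, tpD, LinearMap.sum_apply,
      TensorProduct.tmul_sum, map_sum]
    refine Submodule.smul_mem _ _ (Submodule.sum_mem _ fun j _ => ?_)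
    rw [tpTerm_tprod]
    refine Submodule.subset_span ⟨k, i, fun l => if l = j then p l - 1 else p l, ?_, f, hf, _, ?_,
      rfl⟩
    · have : (∑ l, if l = j then p l - 1 else p l) = (∑ l, p l) - 1 := by
        rw [← Finset.add_sum_erase _ _ (Finset.mem_univ j),
          ← Finset.add_sum_erase _ p (Finset.mem_univ j), if_pos rfl]
        rw [Finset.sum_congr rfl fun l hl => if_neg (Finset.ne_of_mem_erase hl)]
        ring
      rw [this]; omega
    · intro l
      rcases lt_trichotomy l j with h | h | h
      · simp only [h, h.ne, if_true, if_false]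
        rw [tw_of_mem B.gr 1 (hb l)]
        exact Submodule.smul_mem _ _ (hb l)
      · subst h
        simp only [lt_irrefl, if_true, if_false]
        exact B.d_mem (hb l)
      · simp only [h.not_gt, h.ne', if_false]
        exact hb l

/-- The relative composition product `G_A^∨ ∘_{e_n} B`: the quotient of the direct sum of the
complexes `G_A^∨(k) ⊗ B^{⊗ k}` by the relations. -/
def circ : Cpx K where
  V := CircV A B ⧸ circSub A B
  gr m := (circGr A B m).map (circSub A B).mkQ
  d := (circSub A B).mapQ (circSub A B) (circDV A B) (circSub_le A B)
  d_mem := by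
    rintro i _ ⟨t, ht, rfl⟩
    exact ⟨circDV A B t, circDV_mem_gr A B ht, rfl⟩
  d_d x := by
    obtain ⟨t, rfl⟩ := (circSub A B).mkQ_surjective x
    rw [Submodule.mkQ_apply, Submodule.mapQ_apply, Submodule.mapQ_apply, circDV_circDV,
      Submodule.Quotient.mk_zero]

variable {B} {C : PoisAlg K (n - 1)} (φ : PoisAlg.Hom B C)

/-- The map induced by a morphism on the direct sums. -/
def circMapV : CircV A B →ₗ[K] CircV A C :=
  DirectSum.lmap fun k => TensorProduct.map LinearMap.id (tpMap φ k)

lemma circMapV_cin (k : ℕ) (f : LSDual A k) (t : TPow B k) :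
    circMapV A φ (cin A B k (f ⊗ₜ t)) = cin A C k (f ⊗ₜ tpMap φ k t) := DirectSum.lmap_lof _ _ _

lemma circMapV_circTmul (k : ℕ) (f : LSDual A k) (b : Fin k → B.B) :
    circMapV A φ (circTmul A B k f b) = circTmul A C k f fun j => φ.f (b j) := by
  rw [circTmul, circMapV_cin, tpMap, PiTensorProduct.map_tprod]; rfl

lemma circMapV_d (t : CircV A B) : circMapV A φ (circDV A B t) = circDV A C (circMapV A φ t) := by
  have h : circMapV A φ ∘ₗ circDV A B = circDV A C ∘ₗ circMapV A φ := by
    apply DirectSum.linearMap_ext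
    intro k
    apply TensorProduct.ext'
    intro f t
    change circMapV A φ (circDV A B (cin A B k (f ⊗ₜ t))) =
      circDV A C (circMapV A φ (cin A B k (f ⊗ₜ t)))
    rw [circDV_cin, circDk_tmul, map_add, map_add, circMapV_cin, circMapV_cin, circMapV_cin,
      circDV_cin, circDk_tmul, map_add, tpMap_tpD]
  exact LinearMap.congr_fun h t

lemma circMapV_rel {t : CircV A B} (h : CircRel A B t) : CircRel A C (circMapV A φ t) := by
  have hc : ∀ (k : ℕ) (x : B.B) (b : Fin k → B.B),
      (fun j => φ.f ((Fin.cons x b : Fin (k + 1) → B.B) j)) =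
        (Fin.cons (φ.f x) (fun j => φ.f (b j)) : Fin (k + 1) → C.B) := by
    intro k x b
    funext j
    refine Fin.cases ?_ (fun j => ?_) j <;> simp
  cases h with
  | swap k i f b p hb =>
    rw [map_sub, map_smul, circMapV_circTmul, circMapV_circTmul]
    exact CircRel.swap k i f _ p fun j => φ.mem (hb j)
  | unit k f b =>
    rw [map_sub, circMapV_circTmul, circMapV_circTmul, hc, map_one]
    exact CircRel.unit k f _
  | mul k f x y b =>
    rw [map_sub, circMapV_circTmul, circMapV_circTmul, hc, hc, hc, map_mul]
    exact CircRel.mul k f _ _ _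
  | br k f x y b =>
    rw [map_sub, circMapV_circTmul, circMapV_circTmul, hc, hc, hc, φ.br]
    exact CircRel.br k f _ _ _

lemma circMapV_sub : circSub A B ≤ (circSub A C).comap (circMapV A φ) := by
  have h : Submodule.span K {t | CircRel A B t} ≤
      (Submodule.span K {t | CircRel A C t}).comap (circMapV A φ) :=
    Submodule.span_le.mpr fun t ht => Submodule.subset_span (circMapV_rel A φ ht)
  refine sup_le (fun t ht => Submodule.mem_sup_left (h ht)) ?_
  rintro _ ⟨t, ht, rfl⟩
  rw [Submodule.mem_comap, circMapV_d]
  exact Submodule.mem_sup_right (Submodule.mem_map_of_mem (h ht))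

/-- The map `G_A^∨ ∘_{e_n} B → G_A^∨ ∘_{e_n} C` induced by a morphism `B → C`. -/
def circMap : Cpx.Hom (circ A B) (circ A C) where
  f := (circSub A B).mapQ (circSub A C) (circMapV A φ) (circMapV_sub A φ)
  mem := by
    rintro i _ ⟨t, ht, rfl⟩
    refine ⟨circMapV A φ t, ?_, rfl⟩
    induction ht using Submodule.span_induction with
    | zero => rw [map_zero]; exact zero_mem _
    | add x y _ _ h1 h2 => rw [map_add]; exact add_mem h1 h2
    | smul c x _ h => rw [map_smul]; exact Submodule.smul_mem _ _ h
    | mem x hx =>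
      obtain ⟨k, i, p, hm, f, hf, b, hb, rfl⟩ := hx
      rw [circMapV_circTmul]
      exact Submodule.subset_span ⟨k, i, p, hm, f, hf, _, fun j => φ.mem (hb j), rfl⟩
  comm x := by
    obtain ⟨t, rfl⟩ := (circSub A B).mkQ_surjective x
    change (circSub A C).mkQ (circMapV A φ (circDV A B t)) =
      (circSub A C).mkQ (circDV A C (circMapV A φ t))
    rw [circMapV_d]

end Circ

end GradedLS

end

noncomputable section

namespace GradedLS

set_option linter.all false

open Submodule (smul_mem subset_span span_induction span mem_comap mem_bot mem_iSup_of_mem mem_sup_left)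
open LinearMap (comp_apply lTensor mulRight compl₁₂_apply mk₂ id_apply compr₂_apply ker lTensor_tmul applyₗ mulLeft_apply codRestrict range flip_apply mem_ker)
open TensorProduct (ext' induction_on tmul_add tmul_smul smul_tmul' add_tmul map_tmul tmul_zero rid zero_tmul)
open DirectSum.Decomposition (inductionOn)
open Finset (sum_congr smul_sum sum_add_distrib sum_comm mem_univ sum_neg_distrib sum_sub_distrib sum_eq_zero)
open AlgHom (toLinearMap_apply ofLinearMap)
open DirectSum (Decomposition linearMap_ext decompose decompose_of_mem_same decompose_add decompose_of_mem_ne decompose_zero)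
open Function (Injective Surjective)
open Algebra.TensorProduct (tmul_mul_tmul)
open PiTensorProduct (map_tprod)
open TensorProduct renaming map → tmap
open Fin renaming succ_injective → fsucc_inj, succ_zero_eq_one → fsucc_zero
open Equiv renaming swap → eswap, swap_apply_of_ne_of_ne → eswap_ne, swap_apply_left → eswap_left, swap_apply_right → eswap_right
open Int renaming not_even_iff_odd → int_not_even
open SetLike.GradedMul renaming mul_mem → gmul_mem
open SetLike.GradedOne renaming one_mem → gone_mem
open Submodule.Quotient renaming mk_eq_zero → quot_mk_eq_zero
open Module.End renaming mul_apply → end_mul_apply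
open Finsupp renaming linearCombination → fcomb
open LinearMap renaming smul_apply → lsmul_apply, add_apply → ladd_apply, zero_apply → lzero_apply, sum_apply → lmsum_apply, neg_apply → lneg_apply, id → lid, mulLeft → lmulLeft, congr_fun → lcongr_fun, congr_fun₂ → lcongr_fun₂, ext → lext
open PiTensorProduct renaming tprod → ptprod

section Signs

variable {K : Type u} [Field K]

lemma sg_congr {i j : ℤ} (h : Even (i + j)) : sg K i = sg K j := by
  unfold sg
  rw [Int.even_add] at h
  simp only [h]

lemma sg_of_zmod {i j : ℤ} (h : (i : ZMod 2) = j) : sg K i = sg K j := by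
  refine sg_congr ?_
  rw [← ZMod.intCast_eq_zero_iff_even]
  push_cast
  rw [h]
  exact CharTwo.add_self_eq_zero _

end Signs

section Span

variable {K : Type u} [Field K] {V W : Type u} [AddCommGroup V] [Module K V] [AddCommGroup W]
  [Module K W] {S : Set V} {x : V}

lemma map_mem_of_mem_span {f : V →ₗ[K] W} {T : Submodule K W} (h : ∀ x ∈ S, f x ∈ T)
    (hx : x ∈ span K S) : f x ∈ T :=
  (Submodule.span_le (p := T.comap f)).mpr h hx

lemma mul_mem_of_mem_span {R : Type u} [Ring R] [Algebra K R] {a x : R} {S : Set R} {T : Submodule K R} (h : ∀ x ∈ S, a * x ∈ T)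
    (hx : x ∈ span K S) : a * x ∈ T :=
  map_mem_of_mem_span (f := lmulLeft K a) h hx

end Span

section TensorCons

variable {K : Type u} [Field K] {V W M : Type u} [AddCommGroup V] [Module K V] [AddCommGroup W]
  [Module K W] [AddCommGroup M] [Module K M]

/-- The map `(b, b_0 ⊗ ⋯ ⊗ b_{k-1}) ↦ b ⊗ b_0 ⊗ ⋯ ⊗ b_{k-1}`. -/
def tcons (k : ℕ) : V →ₗ[K] (⨂[K] _ : Fin k, V) →ₗ[K] (⨂[K] _ : Fin (k + 1), V) :=
  (PiTensorProduct.lift (R := K) (s := fun _ : Fin k => V)).toLinearMap ∘ₗ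
    MultilinearMap.curryLeft (ptprod K : MultilinearMap K (fun _ : Fin (k + 1) => V) _)

lemma tcons_tprod {k : ℕ} (b : V) (c : Fin k → V) :
    tcons (K := K) k b (ptprod K c) =
      ptprod K (Fin.cons b c : Fin (k + 1) → V) := by
  simp [tcons]

lemma tprod_eq_tcons {k : ℕ} (b : Fin (k + 1) → V) : ptprod K b =
    tcons (K := K) k (b 0) (ptprod K (Fin.tail b)) := by
  rw [tcons_tprod, Fin.cons_self_tail]

/-- The map out of a tensor power with given values on the elements `b ⊗ t`. -/
def tlift {k : ℕ} (f : V →ₗ[K] (⨂[K] _ : Fin k, V) →ₗ[K] M) :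
    (⨂[K] _ : Fin (k + 1), V) →ₗ[K] M :=
  PiTensorProduct.lift (LinearMap.uncurryLeft
    ((PiTensorProduct.lift (R := K) (s := fun _ : Fin k => V)).symm.toLinearMap ∘ₗ f))

lemma tpow_induction {k : ℕ} {p : (⨂[K] _ : Fin k, V) → Prop}
    (h : ∀ b : Fin k → V, p (ptprod K b)) (hadd : ∀ x y, p x → p y → p (x + y))
    (hsmul : ∀ (c : K) x, p x → p (c • x)) (t : ⨂[K] _ : Fin k, V) : p t := by
  induction t using PiTensorProduct.induction_on with
  | smul_tprod c b => exact hsmul _ _ (h b)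
  | add x y hx hy => exact hadd _ _ hx hy

lemma tlift_tcons {k : ℕ} (f : V →ₗ[K] (⨂[K] _ : Fin k, V) →ₗ[K] M) (b : V)
    (t : ⨂[K] _ : Fin k, V) : tlift f (tcons k b t) = f b t := by
  induction t using tpow_induction with
  | h c => simp [tlift, tcons_tprod]
  | hadd x y hx hy => rw [map_add, map_add, map_add, hx, hy]
  | hsmul c x hx => rw [map_smul, map_smul, map_smul, hx]

lemma tcons_induction {k : ℕ} {p : (⨂[K] _ : Fin (k + 1), V) → Prop}
    (h : ∀ (b : V) (t : ⨂[K] _ : Fin k, V), p (tcons k b t)) (hadd : ∀ x y, p x → p y → p (x + y))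
    (t : ⨂[K] _ : Fin (k + 1), V) : p t := by
  induction t using PiTensorProduct.induction_on with
  | smul_tprod c b =>
    rw [tprod_eq_tcons, ← map_smul]
    exact h _ _
  | add x y hx hy => exact hadd _ _ hx hy

lemma tpow_ext {k : ℕ} {f f' : (⨂[K] _ : Fin (k + 1), V) →ₗ[K] M}
    (h : ∀ b t, f (tcons k b t) = f' (tcons k b t)) : f = f' := by
  apply lext
  intro t
  induction t using tcons_induction with
  | h b t => exact h b t
  | hadd x y hx hy => rw [map_add, map_add, hx, hy]

lemma tpow_zero (t : ⨂[K] _ : Fin 0, V) :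
    ∃ c : K, t = c • ptprod K (Fin.elim0 : Fin 0 → V) := by
  induction t using PiTensorProduct.induction_on with
  | smul_tprod c b => exact ⟨c, by rw [Subsingleton.elim b]⟩
  | add x y hx hy =>
    obtain ⟨c, rfl⟩ := hx
    obtain ⟨c', rfl⟩ := hy
    exact ⟨c + c', (add_smul _ _ _).symm⟩

/-- The operator `τ ⊗ ⋯ ⊗ τ ⊗ θ ⊗ 1 ⊗ ⋯ ⊗ 1`, with `θ` in position `j`. -/
def slotOp (k : ℕ) (τ θ : V →ₗ[K] V) (j : Fin k) :
    (⨂[K] _ : Fin k, V) →ₗ[K] (⨂[K] _ : Fin k, V) :=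
  PiTensorProduct.map fun l => if l < j then τ else if l = j then θ else lid

lemma map_tcons (k : ℕ) (f : Fin (k + 1) → V →ₗ[K] W) (b : V) (t : ⨂[K] _ : Fin k, V) :
    PiTensorProduct.map f (tcons k b t) =
      tcons k (f 0 b) (PiTensorProduct.map (fun j => f j.succ) t) := by
  induction t using tpow_induction with
  | h c =>
    rw [tcons_tprod, map_tprod, map_tprod, tcons_tprod]
    congr 1
    funext j
    refine Fin.cases ?_ (fun j => ?_) j <;> simp
  | hadd x y hx hy => simp only [map_add, hx, hy]
  | hsmul c x hx => simp only [map_smul, hx]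

lemma slotOp_zero (k : ℕ) (τ θ : V →ₗ[K] V) (b : V) (t : ⨂[K] _ : Fin k, V) :
    slotOp (k + 1) τ θ 0 (tcons k b t) = tcons k (θ b) t := by
  rw [slotOp, map_tcons]
  congr 2
  simp [Fin.succ_ne_zero, PiTensorProduct.map_id]

lemma slotOp_succ (k : ℕ) (τ θ : V →ₗ[K] V) (j : Fin k) (b : V) (t : ⨂[K] _ : Fin k, V) :
    slotOp (k + 1) τ θ j.succ (tcons k b t) = tcons k (τ b) (slotOp k τ θ j t) := by
  rw [slotOp, map_tcons, slotOp]
  simp only [Fin.succ_lt_succ_iff, Fin.succ_inj, Fin.succ_pos, if_true]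

lemma slotOp_add (k : ℕ) (τ θ θ' : V →ₗ[K] V) (j : Fin k) (t : ⨂[K] _ : Fin k, V) :
    slotOp k τ (θ + θ') j t = slotOp k τ θ j t + slotOp k τ θ' j t := by
  induction k with
  | zero => exact j.elim0
  | succ k ih =>
    induction t using tcons_induction with
    | hadd x y hx hy => simp only [map_add, hx, hy]; abel
    | h b t =>
      refine Fin.cases ?_ (fun j => ?_) j
      · simp only [slotOp_zero, ladd_apply, map_add]
      · simp only [slotOp_succ, ih, map_add]

lemma slotOp_smul (k : ℕ) (τ θ : V →ₗ[K] V) (c : K) (j : Fin k) (t : ⨂[K] _ : Fin k, V) :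
    slotOp k τ (c • θ) j t = c • slotOp k τ θ j t := by
  induction k with
  | zero => exact j.elim0
  | succ k ih =>
    induction t using tcons_induction with
    | hadd x y hx hy => simp only [map_add, hx, hy, smul_add]
    | h b t =>
      refine Fin.cases ?_ (fun j => ?_) j
      · simp only [slotOp_zero, lsmul_apply, map_smul]
      · simp only [slotOp_succ, ih, map_smul]

/-- Operators which commute up to a scalar with `τ` and `θ` commute up to this scalar with the
operators on the tensor powers. -/
lemma map_slotOp (k : ℕ) {τ θ σ : V →ₗ[K] V} {c : K} (h1 : ∀ b, σ (τ b) = τ (σ b))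
    (h2 : ∀ b, σ (θ b) = c • θ (σ b)) (j : Fin k) (t : ⨂[K] _ : Fin k, V) :
    PiTensorProduct.map (fun _ => σ) (slotOp k τ θ j t) =
      c • slotOp k τ θ j (PiTensorProduct.map (fun _ => σ) t) := by
  induction k with
  | zero => exact j.elim0
  | succ k ih =>
    induction t using tcons_induction with
    | hadd x y hx hy => simp only [map_add, hx, hy, smul_add]
    | h b t =>
      refine Fin.cases ?_ (fun j => ?_) j
      · simp only [slotOp_zero, map_tcons, h2, map_smul, lsmul_apply]
      · simp only [slotOp_succ, map_tcons, ih, h1, map_smul]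

lemma slotOp_comm (k : ℕ) {τ θ τ' θ' : V →ₗ[K] V} {c : K} (h1 : ∀ b, τ (τ' b) = τ' (τ b))
    (h2 : ∀ b, τ (θ' b) = c • θ' (τ b)) (h3 : ∀ b, τ' (θ b) = c • θ (τ' b)) (hc : c * c = 1)
    {i j : Fin k} (hij : i ≠ j) (t : ⨂[K] _ : Fin k, V) :
    slotOp k τ θ i (slotOp k τ' θ' j t) = c • slotOp k τ' θ' j (slotOp k τ θ i t) := by
  induction k with
  | zero => exact i.elim0
  | succ k ih =>
    induction t using tcons_induction with
    | hadd x y hx hy => simp only [map_add, hx, hy, smul_add]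
    | h b t =>
      revert hij
      refine Fin.cases ?_ (fun i => ?_) i <;> refine Fin.cases ?_ (fun j => ?_) j <;> intro hij
      · exact absurd rfl hij
      · simp only [slotOp_zero, slotOp_succ, h3, map_smul, lsmul_apply, smul_smul, hc,
          one_smul]
      · simp only [slotOp_zero, slotOp_succ, h2, map_smul, lsmul_apply, smul_smul, hc,
          one_smul]
      · have hij' : i ≠ j := fun h => hij (by rw [h])
        simp only [slotOp_succ, ih hij', h1, map_smul]

lemma slotOp_commutator (k : ℕ) {τ θ τ' θ' τ'' θ'' : V →ₗ[K] V} {c : K}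
    (h1 : ∀ b, τ (τ' b) = τ'' b) (h1' : ∀ b, τ' (τ b) = τ'' b)
    (h2 : ∀ b, θ (θ' b) = θ'' b + c • θ' (θ b))
    (j : Fin k) (t : ⨂[K] _ : Fin k, V) :
    slotOp k τ θ j (slotOp k τ' θ' j t) = slotOp k τ'' θ'' j t +
      c • slotOp k τ' θ' j (slotOp k τ θ j t) := by
  induction k with
  | zero => exact j.elim0
  | succ k ih =>
    induction t using tcons_induction with
    | hadd x y hx hy => simp only [map_add, hx, hy, smul_add]; abel
    | h b t =>
      refine Fin.cases ?_ (fun j => ?_) j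
      · simp only [slotOp_zero, h2, map_add, ladd_apply, map_smul, lsmul_apply]
      · simp only [slotOp_succ, ih, h1, h1', map_add, map_smul]

end TensorCons

section TensorCons

variable {K : Type u} [Field K] {V M : Type u} [AddCommGroup V] [Module K V] [AddCommGroup M]
  [Module K M]

/-- The linear version of `tlift`. -/
def tliftL (k : ℕ) : (V →ₗ[K] (⨂[K] _ : Fin k, V) →ₗ[K] M) →ₗ[K]
    (⨂[K] _ : Fin (k + 1), V) →ₗ[K] M where
  toFun := tlift
  map_add' f f' := tpow_ext fun b t => by simp [tlift_tcons]
  map_smul' c f := tpow_ext fun b t => by simp [tlift_tcons]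

end TensorCons

section Swap

variable {K : Type u} [Field K] {N : ℤ} (B : PoisAlg K N)

/-- The map `(a, b, t) ↦ (-1)^(|a| |b|) b ⊗ a ⊗ t`. -/
def braid (k : ℕ) : B.B →ₗ[K] B.B →ₗ[K] TPow B k →ₗ[K] TPow B (k + 2) :=
  glift B.gr fun i => (mk₂ K (fun a b => tcons (k + 1) (tw B.gr i b) ∘ₗ tcons k a)
    (fun a a' b => by ext t; simp) (fun c a b => by ext t; simp) (fun a b b' => by ext t; simp)
    (fun c a b => by ext t; simp)) ∘ₗ (B.gr i).subtype

variable {B} in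
lemma braid_apply (k : ℕ) {i j : ℤ} {a b : B.B} (ha : a ∈ B.gr i) (hb : b ∈ B.gr j)
    (t : TPow B k) : braid B k a b t = sg K (i * j) • tcons (k + 1) b (tcons k a t) := by
  rw [braid, glift_of_mem _ _ ha]
  simp [tw_of_mem B.gr i hb]

/-- The action of the transposition of `i` and `i + 1` on the tensor power, with Koszul signs. -/
def tswap : (k : ℕ) → Fin k → (TPow B (k + 1) →ₗ[K] TPow B (k + 1))
  | _ + 1, ⟨0, _⟩ => tlift ((tliftL _) ∘ₗ braid B _)
  | k + 1, ⟨i + 1, h⟩ => tlift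
      ((LinearMap.llcomp K _ _ _).flip (tswap k ⟨i, Nat.lt_of_succ_lt_succ h⟩) ∘ₗ tcons (k + 1))

lemma tswap_zero (k : ℕ) (a b : B.B) (t : TPow B k) :
    tswap B (k + 1) 0 (tcons (k + 1) a (tcons k b t)) = braid B k a b t := by
  change tlift ((tliftL _) ∘ₗ braid B _) _ = _
  rw [tlift_tcons]
  exact tlift_tcons _ _ _

lemma tswap_succ (k : ℕ) (i : Fin k) (a : B.B) (t : TPow B (k + 1)) :
    tswap B (k + 1) i.succ (tcons (k + 1) a t) = tcons (k + 1) a (tswap B k i t) := by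
  change tlift _ _ = _
  rw [tlift_tcons]
  rfl

lemma tpow_hom_induction {k : ℕ} {p : TPow B k → Prop}
    (h : ∀ (q : Fin k → ℤ) (b : Fin k → B.B), (∀ j, b j ∈ B.gr (q j)) →
      p (ptprod K b)) (hadd : ∀ x y, p x → p y → p (x + y))
    (hsmul : ∀ (c : K) x, p x → p (c • x)) (t : TPow B k) : p t := by
  have key : ∀ (k : ℕ) (t : TPow B k), t ∈ span K {t : TPow B k |
      ∃ (q : Fin k → ℤ) (b : Fin k → B.B), (∀ j, b j ∈ B.gr (q j)) ∧
        t = ptprod K b} := by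
    intro k
    induction k with
    | zero =>
      intro t
      obtain ⟨c, rfl⟩ := tpow_zero t
      exact smul_mem _ _ (subset_span ⟨Fin.elim0, _, fun j => j.elim0, rfl⟩)
    | succ k ih =>
      intro t
      induction t using tcons_induction with
      | hadd x y hx hy => exact add_mem hx hy
      | h b t =>
        induction b using inductionOn B.gr with
        | zero => rw [map_zero]; exact zero_mem _
        | add x y hx hy => rw [map_add]; exact add_mem hx hy
        | @homogeneous i x =>
          refine span_induction ?_ ?_ ?_ ?_ (ih t)
          · rintro _ ⟨q, b, hb, rfl⟩
            rw [tcons_tprod]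
            refine subset_span ⟨Fin.cons i q, _, fun j => ?_, rfl⟩
            refine Fin.cases ?_ (fun j => ?_) j
            · exact x.2
            · exact hb j
          · rw [map_zero]; exact zero_mem _
          · intro x y _ _ hx hy
            rw [map_add]; exact add_mem hx hy
          · intro c x _ hx
            rw [map_smul]; exact smul_mem _ _ hx
  refine span_induction ?_ ?_ ?_ ?_ (key k t)
  · rintro _ ⟨q, b, hb, rfl⟩
    exact h q b hb
  · have := hsmul 0 _ (h 0 0 fun j => zero_mem _)
    rwa [zero_smul] at this
  · exact fun x y _ _ hx hy => hadd _ _ hx hy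
  · exact fun c x _ hx => hsmul c x hx

lemma swap_succ_succ {k : ℕ} (a b j : Fin k) :
    eswap a.succ b.succ j.succ = (eswap a b j).succ :=
  (fsucc_inj _).swap_apply _ _ _

lemma tswap_tprod (k : ℕ) (i : Fin k) (b : Fin (k + 1) → B.B) (p : Fin (k + 1) → ℤ)
    (hb : ∀ j, b j ∈ B.gr (p j)) : tswap B k i (ptprod K b) =
      sg K (p i.castSucc * p i.succ) •
        ptprod K (b ∘ eswap i.castSucc i.succ) := by
  induction k with
  | zero => exact i.elim0
  | succ k ih =>
    refine Fin.cases ?_ (fun i => ?_) i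
    · have h1 : Fin.tail b 0 ∈ B.gr (p 1) := hb 1
      rw [tprod_eq_tcons b, tprod_eq_tcons (Fin.tail b), tswap_zero, braid_apply k (hb 0) h1,
        tcons_tprod, tcons_tprod]
      congr 2
      funext j
      refine Fin.cases ?_ (fun j => Fin.cases ?_ (fun j => ?_) j) j
      · simp
        rfl
      · simp [Fin.tail]
      · have h1 : j.succ.succ ≠ (1 : Fin (k + 2)) := by
          rw [← fsucc_zero, Ne, Fin.succ_inj]; exact Fin.succ_ne_zero _
        simp [Fin.tail, eswap_ne, h1]
    · rw [tprod_eq_tcons b, tswap_succ, ih i (Fin.tail b) (fun j => p j.succ) (fun j => hb j.succ), map_smul,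
        tcons_tprod]
      congr 2
      funext j
      refine Fin.cases ?_ (fun j => ?_) j
      · rw [Fin.cons_zero, Function.comp_apply, eswap_ne] <;>
          simp [Fin.ext_iff]
      · simp only [Fin.cons_succ, Function.comp_apply, Fin.tail, Fin.castSucc_succ]
        rw [swap_succ_succ]

variable {B}

/-- An operator on the second factor commutes with the transposition. -/
lemma tswap_slotOp (k : ℕ) (i : Fin k) {p : ℤ} {θ : B.B →ₗ[K] B.B}
    (hθ : ∀ {q x}, x ∈ B.gr q → θ x ∈ B.gr (q + p)) (j : Fin (k + 1)) (t : TPow B (k + 1)) :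
    tswap B k i (slotOp (k + 1) (tw B.gr p) θ j t) =
      slotOp (k + 1) (tw B.gr p) θ (eswap i.castSucc i.succ j) (tswap B k i t) := by
  induction k with
  | zero => exact i.elim0
  | succ k ih =>
    induction t using tcons_induction with
    | hadd x y hx hy => simp only [map_add, hx, hy]
    | h a t =>
      refine Fin.cases ?_ (fun i => ?_) i
      · induction t using tcons_induction with
        | hadd x y hx hy => simp only [map_add, hx, hy]
        | h b t =>
          induction a using inductionOn B.gr with
          | zero => simp
          | add x y hx hy => simp only [map_add, ladd_apply, hx, hy]
          | @homogeneous u a =>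
          induction b using inductionOn B.gr with
          | zero => simp
          | add x y hx hy => simp only [map_add, ladd_apply, hx, hy]
          | @homogeneous v b =>
          refine Fin.cases ?_ (fun j => Fin.cases ?_ (fun j => ?_) j) j
          · rw [slotOp_zero, tswap_zero, tswap_zero, braid_apply k (hθ a.2) b.2,
              braid_apply k a.2 b.2, Fin.castSucc_zero, eswap_left, map_smul,
              slotOp_succ, slotOp_zero, tw_of_mem _ _ b.2, map_smul, lsmul_apply,
              smul_smul, add_mul, sg_add]
          · rw [slotOp_succ, slotOp_zero, tswap_zero, tswap_zero, tw_of_mem _ _ a.2, map_smul,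
              lsmul_apply, lsmul_apply, braid_apply k a.2 (hθ b.2),
              braid_apply k a.2 b.2, Fin.castSucc_zero, eswap_right, map_smul,
              slotOp_zero, smul_smul, ← sg_add]
            congr 1
            refine sg_congr ⟨u * v + p * u, by ring⟩
          · have h1 : eswap (Fin.castSucc (0 : Fin (k + 1))) (Fin.succ 0) j.succ.succ =
                j.succ.succ := by
              refine eswap_ne ?_ ?_
              · exact Fin.succ_ne_zero _
              · rw [Ne, Fin.succ_inj]; exact Fin.succ_ne_zero _
            rw [h1, slotOp_succ, slotOp_succ, tswap_zero, tswap_zero, tw_of_mem _ _ a.2,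
              tw_of_mem _ _ b.2]
            simp only [map_smul, lsmul_apply]
            rw [braid_apply k a.2 b.2, braid_apply k a.2 b.2, map_smul, slotOp_succ, slotOp_succ,
              tw_of_mem _ _ a.2, tw_of_mem _ _ b.2]
            simp only [map_smul, lsmul_apply, smul_smul]
            congr 1
            ring
      · refine Fin.cases ?_ (fun j => ?_) j
        · rw [slotOp_zero, tswap_succ, tswap_succ, eswap_ne, slotOp_zero] <;>
            simp [Fin.ext_iff]
        · rw [slotOp_succ, tswap_succ, tswap_succ, ih]
          rw [← Fin.succ_castSucc, swap_succ_succ, slotOp_succ]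

end Swap

section LSMaps

variable {K : Type u} [Field K] {n : ℕ} {A : PDCDGA K n} {U V W : Type}

lemma LSMap.map_io {R : Type u} [Ring R] [Algebra K R] (F : LSMap A U R) (v : U) (a : A.A) :
    F.map (io A v a) = F.p v a := by
  have h : F.map.toLinearMap ∘ₗ io A v = F.p v := by
    refine ghom_ext (gr := A.gr) fun i a ha => ?_
    rw [comp_apply, io_of_mem A v ha]
    exact (lsPres A U).lift_gen _ _ _
  exact lcongr_fun h a

lemma LSMap.map_om {R : Type u} [Ring R] [Algebra K R] (F : LSMap A U R) (v w : U) :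
    F.map (om A v w) = F.w v w := (lsPres A U).lift_gen _ _ _

lemma ls_hom_ext {R : Type u} [Ring R] [Algebra K R] {F G : LS A U →ₐ[K] R}
    (h : ∀ v a, F (io A v a) = G (io A v a)) (h' : ∀ v w, F (om A v w) = G (om A v w)) : F = G := by
  refine (lsPres A U).hom_ext fun x => ?_
  cases x with
  | pt v i a => rw [gen_pt]; exact h v a
  | om v w => exact h' v w

lemma push_io (e : U → V) (he : Injective e) (v : U) (a : A.A) :
    LS.push A e he (io A v a) = io A (e v) a := LSMap.map_io _ v a

lemma push_om (e : U → V) (he : Injective e) (v w : U) :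
    LS.push A e he (om A v w) = om A (e v) (e w) := LSMap.map_om _ v w

lemma push_push (e : U → V) (he : Injective e) (e' : V → W) (he' : Injective e')
    (z : LS A U) : LS.push A e' he' (LS.push A e he z) = LS.push A (e' ∘ e) (he'.comp he) z := by
  have : (LS.push A e' he').comp (LS.push A e he) = LS.push A (e' ∘ e) (he'.comp he) := by
    apply ls_hom_ext <;> intros <;> simp [push_io, push_om]
  exact DFunLike.congr_fun this z

lemma hom_mem_of_gen {F : LS A U →ₐ[K] LS A V}
    (h : ∀ v i a, a ∈ A.gr i → F (io A v a) ∈ lgr A V i)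
    (h' : ∀ v w, F (om A v w) ∈ lgr A V (n - 1)) {i : ℤ} {z : LS A U} (hz : z ∈ lgr A U i) :
    F z ∈ lgr A V i := by
  refine map_mem_of_mem_span (f := F.toLinearMap) (fun x hx => ?_) hz
  obtain ⟨l, rfl, rfl⟩ := hx
  clear hz
  rw [toLinearMap_apply]
  induction l with
  | nil => simpa using gone_mem
  | cons a l ih =>
    simp only [List.map_cons, List.prod_cons, List.sum_cons, map_mul]
    refine gmul_mem ?_ ih
    cases a with
    | pt v i a => rw [gen_pt]; exact h v i a a.2
    | om v w => exact h' v w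

lemma hom_tw {F : LS A U →ₐ[K] LS A V} (h : ∀ i z, z ∈ lgr A U i → F z ∈ lgr A V i) (p : ℤ)
    (z : LS A U) : F (tw (lgr A U) p z) = tw (lgr A V) p (F z) := by
  have h : F.toLinearMap ∘ₗ tw (lgr A U) p = tw (lgr A V) p ∘ₗ F.toLinearMap := by
    refine ghom_ext (gr := lgr A U) fun i a ha => ?_
    simp only [comp_apply, toLinearMap_apply]
    rw [tw_of_mem (lgr A U) p ha, tw_of_mem (lgr A V) p (h i a ha), map_smul]
  exact lcongr_fun h z

lemma push_mem (e : U → V) (he : Injective e) (i : ℤ) (z : LS A U) (hz : z ∈ lgr A U i) :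
    LS.push A e he z ∈ lgr A V i := by
  refine hom_mem_of_gen (fun v i a ha => ?_) (fun v w => ?_) hz
  · rw [push_io]; exact io_mem A _ ha
  · rw [push_om]; exact om_mem A _ _

end LSMaps

section Mixed

variable {K : Type u} [Field K] {n : ℕ} (A : PDCDGA K n) (g : DGLie K) (U : Type)

/-- The graded symmetric algebra which underlies the Chevalley-Eilenberg complex of `A ⊗ g`. -/
abbrev CEAlg : Type u := (A.tensor g).Sym (-1)

/-- The grading of the Chevalley-Eilenberg complex. -/
abbrev cgr : ℤ → Submodule K (CEAlg A g) := (A.tensor g).sgr (-1)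

/-- The tensor product of the Lambrechts-Stanley algebra with the Chevalley-Eilenberg complex. -/
abbrev Mix : Type u := LS A U ⊗[K] CEAlg A g

variable {U}

/-- The twist. -/
def mtw (p : ℤ) : Mix A g U →ₗ[K] Mix A g U :=
  tmap (tw (lgr A U) p) (tw (cgr A g) p)

/-- Left multiplication by `z ⊗ c`, where `c` has degree `p`. -/
def mulOp (p : ℤ) : LS A U →ₗ[K] CEAlg A g →ₗ[K] Module.End K (Mix A g U) :=
  mk₂ K (fun z c => tmap (lmulLeft K z ∘ₗ tw (lgr A U) p)
      (lmulLeft K c))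
    (fun z z' c => by apply ext'; intro y e; simp [add_mul, add_tmul])
    (fun r z c => by apply ext'; intro y e; simp [smul_tmul'])
    (fun z c c' => by apply ext'; intro y e; simp [add_mul, tmul_add])
    (fun r z c => by apply ext'; intro y e; simp)

variable {A g}

lemma mulOp_tmul (p : ℤ) (z : LS A U) (c : CEAlg A g) (y : LS A U) (e : CEAlg A g) :
    mulOp A g p z c (y ⊗ₜ e) = (z * tw (lgr A U) p y) ⊗ₜ (c * e) := rfl

lemma tw_comm_tw {V : Type u} [AddCommGroup V] [Module K V] (gr : ℤ → Submodule K V)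
    [Decomposition gr] (p q : ℤ) (x : V) : tw gr p (tw gr q x) = tw gr q (tw gr p x) := by
  have h : tw gr p ∘ₗ tw gr q = tw gr q ∘ₗ tw gr p := by
    refine ghom_ext (gr := gr) fun i a ha => ?_
    simp only [comp_apply]
    rw [tw_of_mem gr p ha, map_smul, tw_of_mem gr q ha, map_smul, tw_of_mem gr p ha, smul_comm]
  exact lcongr_fun h x

lemma mtw_comm (p q : ℤ) (m : Mix A g U) : mtw A g p (mtw A g q m) = mtw A g q (mtw A g p m) := by
  induction m using induction_on with
  | zero => simp
  | add x y hx hy => simp only [map_add, hx, hy]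
  | tmul y e => simp only [mtw, map_tmul, tw_comm_tw _ p q]

lemma mtw_mulOp (r : ℤ) {i p : ℤ} {z : LS A U} {c : CEAlg A g} (hz : z ∈ lgr A U i)
    (hc : c ∈ cgr A g p) (q : ℤ) (m : Mix A g U) : mtw A g r (mulOp A g q z c m) =
      sg K (r * (i + p)) • mulOp A g q z c (mtw A g r m) := by
  induction m using induction_on with
  | zero => simp
  | add x y hx hy => simp only [map_add, hx, hy, smul_add]
  | tmul y e =>
    simp only [mtw, map_tmul, mulOp_tmul]
    rw [tw_mul, tw_mul, tw_of_mem _ _ hz, tw_of_mem _ _ hc, smul_mul_assoc, smul_mul_assoc,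
      TensorProduct.smul_tmul_smul, tw_comm_tw _ r q, mul_add, sg_add]

lemma mulOp_mulOp {j p q : ℤ} {z z' : LS A U} {c c' : CEAlg A g}
    (hz' : z' ∈ lgr A U j) (m : Mix A g U) :
    mulOp A g p z c (mulOp A g q z' c' m) = sg K (p * j) • mulOp A g (p + q) (z * z') (c * c') m := by
  induction m using induction_on with
  | zero => simp
  | add x y hx hy => simp only [map_add, hx, hy, smul_add]
  | tmul y e =>
    have h : tw (lgr A U) p (tw (lgr A U) q y) = tw (lgr A U) (p + q) y := by
      have h : tw (lgr A U) p ∘ₗ tw (lgr A U) q = tw (lgr A U) (p + q) := by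
        refine ghom_ext (gr := lgr A U) fun i a ha => ?_
        rw [comp_apply, tw_of_mem _ q ha, map_smul, tw_of_mem _ p ha,
          tw_of_mem _ (p + q) ha, smul_smul, add_mul, sg_add, mul_comm]
      exact lcongr_fun h y
    simp only [mulOp_tmul]
    rw [tw_mul, tw_of_mem _ _ hz', h, smul_mul_assoc, mul_smul_comm, mul_assoc, mul_assoc,
      smul_tmul']

lemma mulOp_comm {i j p q : ℤ} {z z' : LS A U} {c c' : CEAlg A g} (hz : z ∈ lgr A U i)
    (hz' : z' ∈ lgr A U j) (hc : c ∈ cgr A g p) (hc' : c' ∈ cgr A g q) (m : Mix A g U) :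
    mulOp A g p z c (mulOp A g q z' c' m) =
      sg K ((i + p) * (j + q)) • mulOp A g q z' c' (mulOp A g p z c m) := by
  rw [mulOp_mulOp hz', mulOp_mulOp hz, ls_comm A hz hz', (A.tensor g).sym_comm (-1) hc hc',
    add_comm q p]
  simp only [map_smul, lsmul_apply, smul_smul, ← sg_add]
  congr 1
  apply sg_congr
  exact ⟨p * j + p * q + i * j + i * q, by ring⟩

variable (A g) in
/-- Left multiplication by an element of the Lambrechts-Stanley algebra. -/
def lmul : LS A U →ₗ[K] Module.End K (Mix A g U) := (mulOp A g 0).flip 1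

lemma lmul_eq (z : LS A U) : lmul A g z = mulOp A g 0 z 1 := rfl

lemma one_mem_cgr : (1 : CEAlg A g) ∈ cgr A g 0 := gone_mem

lemma lmul_lmul (z z' : LS A U) (m : Mix A g U) :
    lmul A g z (lmul A g z' m) = lmul A g (z * z') m := by
  induction m using induction_on with
  | zero => simp
  | add x y hx hy => simp only [map_add, hx, hy]
  | tmul y e =>
    have h : ∀ x : LS A U, tw (lgr A U) 0 x = x := by
      intro x
      have : tw (lgr A U) 0 = lid := by
        refine ghom_ext (gr := lgr A U) fun i a ha => ?_
        rw [tw_of_mem _ _ ha, zero_mul, sg_zero, one_smul, id_apply]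
      exact lcongr_fun this x
    simp only [lmul_eq, mulOp_tmul, h, one_mul, mul_assoc]

variable (A g) in
/-- The generator `s (a ⊗ x)` of the Chevalley-Eilenberg complex. -/
def stm : A.A →ₗ[K] g.V →ₗ[K] CEAlg A g :=
  mk₂ K (fun a x => (A.tensor g).s (-1) (show (A.tensor g).V from a ⊗ₜ[K] x))
    (fun a b x => by
      rw [← map_add]; congr 1; exact add_tmul a b x)
    (fun c a x => by
      rw [← map_smul]; rfl)
    (fun a x y => by
      rw [← map_add]; congr 1; exact tmul_add a x y)
    (fun c a x => by
      rw [← map_smul]; congr 1; exact tmul_smul c a x)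

variable (A g) in
/-- Left multiplication by `-∑ ι_v(a_s) ⊗ s(a_s^∨ ⊗ x)`, where `x` has degree `i`. -/
def delta (v : U) (i : ℤ) : g.V →ₗ[K] Module.End K (Mix A g U) :=
  -∑ s : A.Idx, mulOp A g (i - (n - s.1) + 1) (io A v (A.basis s)) ∘ₗ
    stm A g (A.dbasis s)

lemma delta_apply (v : U) (i : ℤ) (x : g.V) (m : Mix A g U) : delta A g v i x m =
    -∑ s : A.Idx, mulOp A g (i - (n - s.1) + 1) (io A v (A.basis s))
      (stm A g (A.dbasis s) x) m := by
  simp [delta]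

lemma st_mem {i j : ℤ} {a : A.A} {x : g.V} (ha : a ∈ A.gr i) (hx : x ∈ g.gr j) :
    stm A g a x ∈ cgr A g (j - i + 1) :=
  (A.tensor g).s_mem (-1) (A.tmul_mem g ha hx)

lemma mtw_delta (r : ℤ) (v : U) {i : ℤ} {x : g.V} (hx : x ∈ g.gr i) (m : Mix A g U) :
    mtw A g r (delta A g v i x m) = sg K (r * (i - (n - 1))) • delta A g v i x (mtw A g r m) := by
  simp only [delta_apply, map_neg, map_sum, smul_neg, smul_sum]
  congr 1
  refine sum_congr rfl fun s _ => ?_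
  rw [mtw_mulOp r (io_mem A v (A.basis_mem s)) (st_mem (A.dbasis_mem s) hx)]
  congr 1
  apply sg_congr
  exact ⟨r * (i - n + s.1 + 1), by ring⟩

lemma mtw_om (r : ℤ) (v w : U) (m : Mix A g U) : mtw A g r (lmul A g (om A v w) m) =
    sg K (r * (n - 1)) • lmul A g (om A v w) (mtw A g r m) := by
  rw [lmul_eq, mtw_mulOp r (om_mem A v w) one_mem_cgr, add_zero]

lemma delta_lmul (v : U) {i j : ℤ} {x : g.V} (hx : x ∈ g.gr i) {z : LS A U} (hz : z ∈ lgr A U j)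
    (m : Mix A g U) : delta A g v i x (lmul A g z m) =
      sg K ((i - (n - 1)) * j) • lmul A g z (delta A g v i x m) := by
  simp only [delta_apply, map_neg, map_sum, smul_neg, smul_sum]
  congr 1
  refine sum_congr rfl fun s _ => ?_
  rw [lmul_eq, mulOp_comm (io_mem A v (A.basis_mem s)) hz (st_mem (A.dbasis_mem s) hx) one_mem_cgr]
  congr 1
  apply sg_congr
  exact ⟨(i - n + s.1 + 1) * j, by ring⟩

lemma delta_delta (v w : U) {i j : ℤ} {x y : g.V} (hx : x ∈ g.gr i) (hy : y ∈ g.gr j)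
    (m : Mix A g U) : delta A g v i x (delta A g w j y m) =
      sg K ((i - (n - 1)) * (j - (n - 1))) • delta A g w j y (delta A g v i x m) := by
  simp only [delta_apply, map_neg, map_sum, smul_sum, sum_neg_distrib, smul_neg,
    neg_neg]
  rw [sum_comm]
  refine sum_congr rfl fun t _ => sum_congr rfl fun s _ => ?_
  rw [mulOp_comm (io_mem A v (A.basis_mem t)) (io_mem A w (A.basis_mem s))
    (st_mem (A.dbasis_mem t) hx) (st_mem (A.dbasis_mem s) hy)]
  congr 1
  apply sg_congr
  exact ⟨(i - n + 1) * (j - n + 1) + (i - n + 1) * s.1 + t.1 * (j - n + 1) + 2 * t.1 * s.1,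
    by ring⟩

lemma om_om (v w v' w' : U) (m : Mix A g U) : lmul A g (om A v w) (lmul A g (om A v' w') m) =
    sg K ((n - 1) * (n - 1)) • lmul A g (om A v' w') (lmul A g (om A v w) m) := by
  rw [lmul_lmul, lmul_lmul, ls_comm A (om_mem A v w) (om_mem A v' w'), map_smul,
    lsmul_apply]

end Mixed

section Slots

variable {K : Type u} [Field K] (g : DGLie K) (N : ℤ)

/-- The tensor powers of the symmetric algebra. -/
abbrev SPow (k : ℕ) : Type u := ⨂[K] _ : Fin k, g.Sym N

/-- The action of `{s x, -}` on the factor `j` of the tensor power, for `x` in degree `i`. -/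
def adSlot (k : ℕ) (i : ℤ) (j : Fin k) : g.V →ₗ[K] Module.End K (SPow g N k) where
  toFun x := slotOp k (tw (g.sgr N) i) (g.ad N x) j
  map_add' x y := by ext t; simp [slotOp_add]
  map_smul' c x := by ext t; simp [slotOp_smul]

/-- The twist of the tensor power. -/
abbrev stw (k : ℕ) (p : ℤ) : Module.End K (SPow g N k) :=
  PiTensorProduct.map fun _ => tw (g.sgr N) p

variable {g N}

lemma adSlot_zero (k : ℕ) (i : ℤ) (x : g.V) (b : g.Sym N) (t : SPow g N k) :
    adSlot g N (k + 1) i 0 x (tcons k b t) = tcons k (g.ad N x b) t := slotOp_zero _ _ _ _ _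

lemma adSlot_succ (k : ℕ) (i : ℤ) (j : Fin k) (x : g.V) (b : g.Sym N) (t : SPow g N k) :
    adSlot g N (k + 1) i j.succ x (tcons k b t) =
      tcons k (tw (g.sgr N) i b) (adSlot g N k i j x t) := slotOp_succ _ _ _ _ _ _

lemma tw_isDer {p r : ℤ} {D : g.Sym N →ₗ[K] g.Sym N} (hD : IsDer (g.sgr N) p D) (b : g.Sym N) :
    tw (g.sgr N) r (D b) = sg K (r * p) • D (tw (g.sgr N) r b) := by
  have h : tw (g.sgr N) r ∘ₗ D = sg K (r * p) • (D ∘ₗ tw (g.sgr N) r) := by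
    refine ghom_ext (gr := g.sgr N) fun i a ha => ?_
    simp only [comp_apply, lsmul_apply]
    rw [tw_of_mem _ r ha, tw_of_mem _ r (hD.mem ha), map_smul, smul_smul, mul_add, sg_add, mul_comm]
  exact lcongr_fun h b

lemma tw_ad {i : ℤ} (r : ℤ) {x : g.V} (hx : x ∈ g.gr i) (b : g.Sym N) :
    tw (g.sgr N) r (g.ad N x b) = sg K (r * i) • g.ad N x (tw (g.sgr N) r b) :=
  tw_isDer (g.isDer_ad N hx) b

lemma stw_adSlot (k : ℕ) (r : ℤ) {i : ℤ} {x : g.V} (hx : x ∈ g.gr i) (j : Fin k)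
    (t : SPow g N k) : stw g N k r (adSlot g N k i j x t) =
      sg K (r * i) • adSlot g N k i j x (stw g N k r t) :=
  map_slotOp k (tw_comm_tw _ r i) (tw_ad r hx) j t

lemma adSlot_stw (k : ℕ) (r : ℤ) {i : ℤ} {x : g.V} (hx : x ∈ g.gr i) (j : Fin k)
    (t : SPow g N k) : adSlot g N k i j x (stw g N k r t) =
      sg K (r * i) • stw g N k r (adSlot g N k i j x t) := by
  rw [stw_adSlot k r hx, smul_smul, sg_mul_self, one_smul]

lemma stw_comm (k : ℕ) (p q : ℤ) (t : SPow g N k) :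
    stw g N k p (stw g N k q t) = stw g N k q (stw g N k p t) := by
  induction t using tpow_induction with
  | h b => simp only [map_tprod, tw_comm_tw _ p q]
  | hadd x y hx hy => simp only [map_add, hx, hy]
  | hsmul c x hx => simp only [map_smul, hx]

lemma adSlot_comm (k : ℕ) {i l : ℤ} {x y : g.V} (hx : x ∈ g.gr i) (hy : y ∈ g.gr l) {j m : Fin k}
    (hjm : j ≠ m) (t : SPow g N k) : adSlot g N k i j x (adSlot g N k l m y t) =
      sg K (i * l) • adSlot g N k l m y (adSlot g N k i j x t) := by
  refine slotOp_comm k (tw_comm_tw _ i l) (tw_ad i hy) ?_ (sg_mul_self _) hjm t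
  intro b
  rw [mul_comm]
  exact tw_ad l hx b

lemma ad_ad {i l : ℤ} {x y : g.V} (hx : x ∈ g.gr i) (hy : y ∈ g.gr l) (b : g.Sym N) :
    g.ad N x (g.ad N y b) = g.ad N (g.br x y) b + sg K (i * l) • g.ad N y (g.ad N x b) := by
  have h := g.symBr_ad N hx (g.s_mem N hy) b
  rw [g.symBr_s N hy, g.ad_s N hx hy, map_smul, lsmul_apply,
    g.symBr_s N (g.br_mem hx hy), smul_smul, ← sg_add, sg_even ⟨i * N, by ring⟩, one_smul] at h
  rw [h, sub_add_cancel]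

lemma tw_tw_add {V : Type u} [AddCommGroup V] [Module K V] (gr : ℤ → Submodule K V)
    [Decomposition gr] (p q : ℤ) (x : V) : tw gr p (tw gr q x) = tw gr (p + q) x := by
  have h : tw gr p ∘ₗ tw gr q = tw gr (p + q) := by
    refine ghom_ext (gr := gr) fun i a ha => ?_
    rw [comp_apply, tw_of_mem _ q ha, map_smul, tw_of_mem _ p ha,
      tw_of_mem _ (p + q) ha, smul_smul, add_mul, sg_add, mul_comm]
  exact lcongr_fun h x

lemma adSlot_commutator (k : ℕ) {i l : ℤ} {x y : g.V} (hx : x ∈ g.gr i) (hy : y ∈ g.gr l)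
    (j : Fin k) (t : SPow g N k) : adSlot g N k i j x (adSlot g N k l j y t) =
      adSlot g N k (i + l) j (g.br x y) t +
        sg K (i * l) • adSlot g N k l j y (adSlot g N k i j x t) :=
  slotOp_commutator k (tw_tw_add _ i l) (fun b => by rw [tw_tw_add, add_comm]) (ad_ad hx hy) j t

end Slots

section Wick

variable {K : Type u} [Field K] {n : ℕ} (A : PDCDGA K n) (g : DGLie K)

/-- The operator which describes the multiplication of the first factor by the generator `s x`. -/
def wickOp (k : ℕ) (i : ℤ) : g.V →ₗ[K]
    Module.End K (SPow g (n - 1) k →ₗ[K] Mix A g (Fin (k + 1))) :=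
  mk₂ K (fun x Ψ => delta A g 0 i x ∘ₗ Ψ + ∑ j : Fin k,
      lmul A g (om A 0 j.succ) ∘ₗ mtw A g i ∘ₗ Ψ ∘ₗ stw g (n - 1) k i ∘ₗ adSlot g (n - 1) k i j x)
    (fun x y Ψ => by
      refine lext fun t => ?_; simp only [map_add, ladd_apply, comp_apply, lmsum_apply,
        sum_add_distrib]
      abel)
    (fun c x Ψ => by
      refine lext fun t => ?_; simp only [map_smul, ladd_apply, comp_apply, lmsum_apply,
        lsmul_apply, smul_sum, smul_add])
    (fun x Ψ Ψ' => by
      refine lext fun t => ?_; simp only [map_add, ladd_apply, comp_apply, lmsum_apply,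
        sum_add_distrib]
      abel)
    (fun c x Ψ => by
      refine lext fun t => ?_; simp only [map_smul, ladd_apply, comp_apply, lmsum_apply,
        lsmul_apply, smul_sum, smul_add])

variable {A g}

lemma wickOp_apply (k : ℕ) (i : ℤ) (x : g.V) (Ψ : SPow g (n - 1) k →ₗ[K] Mix A g (Fin (k + 1)))
    (t : SPow g (n - 1) k) : wickOp A g k i x Ψ t = delta A g 0 i x (Ψ t) + ∑ j : Fin k,
      lmul A g (om A 0 j.succ) (mtw A g i (Ψ (stw g (n - 1) k i (adSlot g (n - 1) k i j x t)))) := by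
  simp [wickOp]

lemma wickOp_comm (k : ℕ) {i l : ℤ} {x y : g.V} (hx : x ∈ g.gr i) (hy : y ∈ g.gr l)
    (Ψ : SPow g (n - 1) k →ₗ[K] Mix A g (Fin (k + 1))) :
    wickOp A g k i x (wickOp A g k l y Ψ) =
      sg K ((i - (n - 1)) * (l - (n - 1))) • wickOp A g k l y (wickOp A g k i x Ψ) := by
  have key : ∀ {i l : ℤ} {x y : g.V} (hx : x ∈ g.gr i) (hy : y ∈ g.gr l) (t : SPow g (n - 1) k),
      wickOp A g k i x (wickOp A g k l y Ψ) t = delta A g 0 i x (delta A g 0 l y (Ψ t)) +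
      (∑ j : Fin k, delta A g 0 i x (lmul A g (om A 0 j.succ)
        (mtw A g l (Ψ (stw g (n - 1) k l (adSlot g (n - 1) k l j y t)))))) +
      (sg K ((i - (n - 1)) * (l - (n - 1))) • ∑ j : Fin k, delta A g 0 l y (lmul A g (om A 0 j.succ)
        (mtw A g i (Ψ (stw g (n - 1) k i (adSlot g (n - 1) k i j x t)))))) +
      ∑ j : Fin k, ∑ m : Fin k, sg K (i * (n - 1) + l * i) • lmul A g (om A 0 j.succ)
        (lmul A g (om A 0 m.succ) (mtw A g i (mtw A g l (Ψ (stw g (n - 1) k l (stw g (n - 1) k i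
          (adSlot g (n - 1) k l m y (adSlot g (n - 1) k i j x t)))))))) := by
    intro i l x y hx hy t
    rw [wickOp_apply, wickOp_apply]
    simp only [wickOp_apply, map_add, map_sum, sum_add_distrib, smul_sum]
    rw [← add_assoc]
    congr 1
    · congr 1
      refine sum_congr rfl fun j _ => ?_
      rw [mtw_delta i 0 hy, map_smul, delta_lmul 0 hy (om_mem A _ _), smul_smul, ← sg_add]
      congr 2
      ring
    · refine sum_congr rfl fun j _ => sum_congr rfl fun m _ => ?_
      rw [mtw_om, map_smul, adSlot_stw k i hy]
      simp only [map_smul, smul_smul, sg_add, mul_comm l i]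
  refine lext fun t => ?_
  rw [lsmul_apply, key hx hy, key hy hx, delta_delta 0 0 hx hy, sum_comm,
    mul_comm (l - _) (i - _)]
  simp only [smul_add, smul_smul, sg_mul_self, one_smul]
  have hd : ∀ j m : Fin k, sg K (i * (n - 1) + l * i) • lmul A g (om A 0 j.succ)
        (lmul A g (om A 0 m.succ) (mtw A g i (mtw A g l (Ψ (stw g (n - 1) k l (stw g (n - 1) k i
          (adSlot g (n - 1) k l m y (adSlot g (n - 1) k i j x t)))))))) =
      sg K ((i - (n - 1)) * (l - (n - 1))) • sg K (l * (n - 1) + i * l) •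
        lmul A g (om A 0 m.succ) (lmul A g (om A 0 j.succ) (mtw A g l (mtw A g i (Ψ (stw g (n - 1) k i
          (stw g (n - 1) k l (adSlot g (n - 1) k i j x (adSlot g (n - 1) k l m y t)))))))) := by
    intro j m
    by_cases hjm : j = m
    · subst hjm
      rw [lmul_lmul, lmul_lmul, om_sq]
      simp
    · rw [om_om, adSlot_comm k hx hy hjm, mtw_comm l i, stw_comm k l i]
      simp only [map_smul, smul_smul, ← sg_add]
      congr 1
      refine sg_congr ⟨2 * i * l + (n - 1) * (n - 1), by ring⟩
  simp only [hd, smul_sum]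
  abel

end Wick

section Phi

variable {K : Type u} [Field K] {n : ℕ} {A : PDCDGA K n} {g : DGLie K} {U V : Type}

variable (g) in
/-- The map induced by a morphism of algebras on the first factor. -/
def mmap (F : LS A U →ₐ[K] LS A V) : Mix A g U →ₗ[K] Mix A g V :=
  tmap F.toLinearMap lid

lemma mmap_tmul (F : LS A U →ₐ[K] LS A V) (z : LS A U) (c : CEAlg A g) :
    mmap g F (z ⊗ₜ c) = F z ⊗ₜ c := rfl

lemma tw_zero {V : Type u} [AddCommGroup V] [Module K V] (gr : ℤ → Submodule K V)
    [Decomposition gr] (x : V) : tw gr 0 x = x := by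
  have : tw gr 0 = lid := by
    refine ghom_ext (gr := gr) fun i a ha => ?_
    rw [tw_of_mem _ _ ha, zero_mul, sg_zero, one_smul, id_apply]
  exact lcongr_fun this x

lemma lmul_tmul (z y : LS A U) (c : CEAlg A g) : lmul A g z (y ⊗ₜ c) = (z * y) ⊗ₜ c := by
  rw [lmul_eq, mulOp_tmul, tw_zero, one_mul]

lemma mmap_lmul (F : LS A U →ₐ[K] LS A V) (z : LS A U) (m : Mix A g U) :
    mmap g F (lmul A g z m) = lmul A g (F z) (mmap g F m) := by
  induction m using induction_on with
  | zero => simp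
  | add x y hx hy => simp only [map_add, hx, hy]
  | tmul y e => rw [lmul_tmul, mmap_tmul, mmap_tmul, lmul_tmul, map_mul]

lemma mmap_mulOp {F : LS A U →ₐ[K] LS A V} (hF : ∀ i z, z ∈ lgr A U i → F z ∈ lgr A V i) (p : ℤ)
    (z : LS A U) (c : CEAlg A g) (m : Mix A g U) :
    mmap g F (mulOp A g p z c m) = mulOp A g p (F z) c (mmap g F m) := by
  induction m using induction_on with
  | zero => simp
  | add x y hx hy => simp only [map_add, hx, hy]
  | tmul y e => rw [mulOp_tmul, mmap_tmul, mmap_tmul, mulOp_tmul, map_mul, hom_tw hF]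

lemma mmap_mtw {F : LS A U →ₐ[K] LS A V} (hF : ∀ i z, z ∈ lgr A U i → F z ∈ lgr A V i) (p : ℤ)
    (m : Mix A g U) : mmap g F (mtw A g p m) = mtw A g p (mmap g F m) := by
  induction m using induction_on with
  | zero => simp
  | add x y hx hy => simp only [map_add, hx, hy]
  | tmul y e => simp only [mtw, map_tmul, mmap_tmul, hom_tw hF]

lemma mmap_delta {F : LS A U →ₐ[K] LS A V} (hF : ∀ i z, z ∈ lgr A U i → F z ∈ lgr A V i) {v : U}
    {w : V} (h : ∀ a, F (io A v a) = io A w a) (i : ℤ) (x : g.V) (m : Mix A g U) :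
    mmap g F (delta A g v i x m) = delta A g w i x (mmap g F m) := by
  simp only [delta_apply, map_neg, map_sum]
  congr 1
  refine sum_congr rfl fun s _ => ?_
  rw [mmap_mulOp hF, h]

lemma tw_even {V : Type u} [AddCommGroup V] [Module K V] (gr : ℤ → Submodule K V)
    [Decomposition gr] {p : ℤ} (hp : Even p) (x : V) : tw gr p x = x := by
  have : tw gr p = lid := by
    refine ghom_ext (gr := gr) fun i a ha => ?_
    rw [tw_of_mem _ _ ha, sg_even (hp.mul_right i), one_smul, id_apply]
  exact lcongr_fun this x

lemma wick_aux (k : ℕ) (a b : FreeAlgebra K (Σ i, g.gr i)) (hab : g.SymRel (n - 1) a b) :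
    FreeAlgebra.lift K (fun x : Σ i, g.gr i => wickOp A g k x.1 x.2) a =
      FreeAlgebra.lift K (fun x : Σ i, g.gr i => wickOp A g k x.1 x.2) b := by
  cases hab with
  | add i x y => simp
  | smul i c x => simp
  | comm i j x y =>
    simp only [map_smul, map_mul, FreeAlgebra.lift_ι_apply]
    refine lext fun Ψ => ?_
    exact wickOp_comm k x.2 y.2 Ψ

variable (A g) in
/-- The action of the symmetric algebra by `wickOp`. -/
def wick (k : ℕ) : g.Sym (n - 1) →ₐ[K]
    Module.End K (SPow g (n - 1) k →ₗ[K] Mix A g (Fin (k + 1))) :=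
  (g.symPres (n - 1)).lift (fun x => wickOp A g k x.1 x.2) (wick_aux k)

variable (A g) in
/-- The map `S(g[n-1])^{⊗ k} → G_A(k) ⊗ C(A ⊗ g)`, which is dual to `Φ`. -/
def phi : (k : ℕ) → SPow g (n - 1) k →ₗ[K] Mix A g (Fin k)
  | 0 => PiTensorProduct.lift (MultilinearMap.constOfIsEmpty K _ (1 ⊗ₜ 1))
  | k + 1 => tlift (applyₗ
      (mmap g (LS.push A Fin.succ (fsucc_inj k)) ∘ₗ phi k) ∘ₗ (wick A g k).toLinearMap)

lemma phi_zero (b : Fin 0 → g.Sym (n - 1)) :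
    phi A g 0 (ptprod K b) = 1 ⊗ₜ 1 := by
  rw [phi, PiTensorProduct.lift.tprod]; rfl

lemma phi_tcons (k : ℕ) (X : g.Sym (n - 1)) (t : SPow g (n - 1) k) : phi A g (k + 1) (tcons k X t) =
    wick A g k X (mmap g (LS.push A Fin.succ (fsucc_inj k)) ∘ₗ phi A g k) t := by
  rw [phi, tlift_tcons]; rfl

lemma phi_one (k : ℕ) (t : SPow g (n - 1) k) : phi A g (k + 1) (tcons k 1 t) =
    mmap g (LS.push A Fin.succ (fsucc_inj k)) (phi A g k t) := by
  rw [phi_tcons, map_one]; rfl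

lemma stw_tcons (k : ℕ) (p : ℤ) (X : g.Sym (n - 1)) (t : SPow g (n - 1) k) :
    stw g (n - 1) (k + 1) p (tcons k X t) = tcons k (tw (g.sgr (n - 1)) p X) (stw g (n - 1) k p t) :=
  map_tcons _ _ _ _

lemma tw_s_mul (N p : ℤ) {i : ℤ} {x : g.V} (hx : x ∈ g.gr i) (X : g.Sym N) :
    tw (g.sgr N) p (g.s N x * X) = sg K (p * (i - N)) • (g.s N x * tw (g.sgr N) p X) := by
  rw [tw_mul, tw_of_mem _ p (g.s_mem N hx), smul_mul_assoc]

lemma stw_self (N : ℤ) (k : ℕ) (p : ℤ) (t : SPow g N k) : stw g N k p (stw g N k p t) = t := by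
  induction t using tpow_induction with
  | h b => simp only [map_tprod, tw_tw]
  | hadd x y hx hy => simp only [map_add, hx, hy]
  | hsmul c x hx => simp only [map_smul, hx]

/-- The form of the recursion before the compatibility with twists is known. -/
lemma phi_mul' (k : ℕ) {i : ℤ} {x : g.V} (hx : x ∈ g.gr i) (X : g.Sym (n - 1))
    (t : SPow g (n - 1) k) : phi A g (k + 1) (tcons k (g.s (n - 1) x * X) t) =
      delta A g 0 i x (phi A g (k + 1) (tcons k X t)) + ∑ j : Fin k,
        lmul A g (om A 0 j.succ) (mtw A g i (phi A g (k + 1)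
          (tcons k X (stw g (n - 1) k i (adSlot g (n - 1) k i j x t))))) := by
  rw [phi_tcons, map_mul, g.s_of_mem _ hx, wick, GPres.lift_gen, ← wick, end_mul_apply,
    wickOp_apply]
  simp only [phi_tcons]

lemma phi_stw (k : ℕ) (p : ℤ) (t : SPow g (n - 1) k) :
    phi A g k (stw g (n - 1) k p t) = mtw A g p (phi A g k t) := by
  induction k with
  | zero =>
    obtain ⟨c, rfl⟩ := tpow_zero t
    rw [map_smul, map_smul, map_smul, map_smul, map_tprod, phi_zero, phi_zero]
    simp [mtw, tw_one]
  | succ k ih =>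
    induction t using tcons_induction with
    | hadd x y hx hy => simp only [map_add, hx, hy]
    | h X t =>
      induction X using g.sym_induction (n - 1) generalizing t with
      | h1 =>
        rw [stw_tcons, tw_one, phi_one, phi_one, ih, mmap_mtw (push_mem _ _)]
      | hadd x y hx hy => simp only [map_add, ladd_apply, hx, hy]
      | hsmul c x hx => simp only [map_smul, lsmul_apply, hx]
      | hmul i x hx j y hy ihX =>
        have key : ∀ t', phi A g (k + 1) (tcons k (tw (g.sgr (n - 1)) p y) (stw g (n - 1) k p t')) =
            mtw A g p (phi A g (k + 1) (tcons k y t')) := by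
          intro t'
          rw [← ihX t', stw_tcons]
        rw [stw_tcons, tw_s_mul _ _ hx, map_smul, lsmul_apply, map_smul, phi_mul' k hx,
          phi_mul' k hx, key, map_add, map_sum, mtw_delta p 0 hx, smul_add, smul_sum]
        congr 1
        refine sum_congr rfl fun j _ => ?_
        rw [mtw_om, mtw_comm p i, ← key, stw_comm k p i, stw_adSlot k p hx]
        simp only [map_smul, smul_smul, ← sg_add]
        congr 1
        exact sg_congr ⟨p * i, by ring⟩

lemma phi_mul (k : ℕ) {i : ℤ} {x : g.V} (hx : x ∈ g.gr i) (X : g.Sym (n - 1))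
    (t : SPow g (n - 1) k) : phi A g (k + 1) (tcons k (g.s (n - 1) x * X) t) =
      delta A g 0 i x (phi A g (k + 1) (tcons k X t)) + ∑ j : Fin k,
        lmul A g (om A 0 j.succ) (phi A g (k + 1)
          (tcons k (tw (g.sgr (n - 1)) i X) (adSlot g (n - 1) k i j x t))) := by
  rw [phi_mul' k hx]
  congr 1
  refine sum_congr rfl fun j _ => ?_
  rw [← phi_stw, stw_tcons, stw_self]

end Phi

section Duality

variable {K : Type u} [Field K] {n : ℕ} (A : PDCDGA K n)

lemma sum_basis_slide {M : Type u} [AddCommGroup M] [Module K M] (f : A.A →ₗ[K] A.A →ₗ[K] M)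
    {q : ℤ} {a : A.A} (ha : a ∈ A.gr q) : ∑ s : A.Idx, f (a * A.basis s) (A.dbasis s) =
      ∑ s : A.Idx, sg K (q + q * s.1) • f (A.basis s) (a * A.dbasis s) := by
  have h1 : ∀ s : A.Idx, f (a * A.basis s) (A.dbasis s) = ∑ t : A.Idx,
      A.ε (a * A.basis s * A.dbasis t) • f (A.basis t) (A.dbasis s) := by
    intro s
    conv_lhs => rw [A.expand (a * A.basis s)]
    simp
  have h2 : ∀ t : A.Idx, sg K (q + q * t.1) • f (A.basis t) (a * A.dbasis t) = ∑ s : A.Idx,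
      (sg K (q + q * t.1) * A.ε (A.basis s * (a * A.dbasis t))) • f (A.basis t) (A.dbasis s) := by
    intro t
    conv_lhs => rw [A.dexpand (a * A.dbasis t)]
    simp [smul_sum, smul_smul]
  simp only [h1, h2]
  rw [sum_comm]
  refine sum_congr rfl fun t _ => sum_congr rfl fun s _ => ?_
  congr 1
  have hs := A.basis_mem s
  have ht := A.dbasis_mem t
  rw [← mul_assoc (A.basis s), A.mul_comm hs ha, smul_mul_assoc, map_smul, smul_eq_mul,
    ← mul_assoc, ← sg_add]
  by_cases e : q + s.1 + (n - t.1) = n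
  · have : (t.1 : ℤ) = q + s.1 := by omega
    rw [this, sg_even, one_mul]
    obtain ⟨r, hr⟩ := Int.even_mul_succ_self q
    exact ⟨r + q * s.1, by linear_combination hr⟩
  · rw [A.ε_mul_of_ne (gmul_mem ha hs) ht e, mul_zero]

lemma sum_basis_d {M : Type u} [AddCommGroup M] [Module K M] (f : A.A →ₗ[K] A.A →ₗ[K] M) :
    ∑ s : A.Idx, sg K s.1 • f (A.d (A.basis s)) (A.dbasis s) +
      ∑ s : A.Idx, f (A.basis s) (A.d (A.dbasis s)) = 0 := by
  have h := congrArg (TensorProduct.lift f) (A.diag_d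
    (Algebra.TensorProduct.includeLeft (R := K) (S := K) (A := A.A) (B := A.A)).toLinearMap
    (Algebra.TensorProduct.includeRight (R := K) (A := A.A) (B := A.A)).toLinearMap)
  simpa using h

lemma gr_eq_bot_of_lt {i : ℤ} (hi : (n : ℤ) < i) : A.gr i = ⊥ := by
  rw [eq_bot_iff]
  intro x hx
  refine A.nondeg i x hx fun y hy => ?_
  rw [A.gr_neg _ (by omega)] at hy
  rw [(mem_bot K).mp hy, mul_zero, map_zero]

lemma idx_mem (s : A.Idx) : 0 ≤ s.1 ∧ s.1 ≤ n := by
  have h := A.basis_mem s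
  have h0 := A.basis.ne_zero s
  constructor
  · by_contra hs
    rw [A.gr_neg _ (not_le.mp hs)] at h
    exact h0 ((mem_bot K).mp h)
  · by_contra hs
    rw [gr_eq_bot_of_lt A (not_le.mp hs)] at h
    exact h0 ((mem_bot K).mp h)

lemma sum_sg_idx : ∑ s : A.Idx, sg K s.1 = (A.euler : K) := by
  have hsg : ∀ i : ℕ, sg K (i : ℤ) = (-1) ^ i := by
    intro i
    rcases Nat.even_or_odd i with h | h
    · rw [sg_even (by exact_mod_cast h), h.neg_one_pow]
    · rw [sg_odd (by exact_mod_cast h), h.neg_one_pow]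
  have hmap : ∀ s ∈ (Finset.univ : Finset A.Idx), s.1.toNat ∈ Finset.range (n + 1) := by
    intro s _
    have := idx_mem A s
    rw [Finset.mem_range]
    omega
  rw [← Finset.sum_fiberwise_of_maps_to hmap, PDCDGA.euler]
  push_cast
  refine sum_congr rfl fun i _ => ?_
  have h1 : ∀ s ∈ Finset.univ.filter (fun s : A.Idx => s.1.toNat = i), sg K s.1 = (-1) ^ i := by
    intro s hs
    have := idx_mem A s
    rw [← hsg, ← (Finset.mem_filter.mp hs).2, Int.toNat_of_nonneg this.1]
  rw [sum_congr rfl h1, Finset.sum_const, nsmul_eq_mul, mul_comm]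
  congr 2
  rw [Module.finrank_eq_nat_card_basis (Module.Basis.ofVectorSpace K (A.gr i)),
    ← Fintype.card_subtype, ← Nat.card_eq_fintype_card]
  refine Nat.card_congr ?_
  refine (Equiv.subtypeEquivRight fun s => ?_).trans (Equiv.sigmaSubtype (i : ℤ))
  have := idx_mem A s
  omega

lemma sum_basis_mul_dbasis (hA : A.euler = 0) :
    ∑ s : A.Idx, sg K s.1 • (A.basis s * A.dbasis s) = 0 := by
  refine A.nondeg n _ (Submodule.sum_mem _ fun s _ => smul_mem _ _ ?_) fun y hy => ?_
  · have := gmul_mem (A.basis_mem s) (A.dbasis_mem s)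
    rwa [add_sub_cancel] at this
  · rw [sub_self] at hy
    obtain ⟨c, rfl⟩ := A.gr_zero y hy
    rw [← Algebra.commutes, ← Algebra.smul_def, map_smul, map_sum]
    simp only [map_smul, A.ε_basis_dbasis, if_true, smul_eq_mul, mul_one]
    rw [sum_sg_idx, hA, Int.cast_zero, mul_zero]

end Duality

section Action

variable {K : Type u} [Field K] {n : ℕ} (A : PDCDGA K n) (g : DGLie K) {U V : Type}

/-- The element `a ⊗ x` of `A ⊗ g`. -/
def ten : A.A →ₗ[K] g.V →ₗ[K] (A.tensor g).V := TensorProduct.mk K A.A g.V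

lemma stm_eq (a : A.A) (x : g.V) : stm A g a x = (A.tensor g).s (-1) (ten A g a x) := rfl

variable {A g}

lemma ten_mem {q i : ℤ} {a : A.A} {x : g.V} (ha : a ∈ A.gr q) (hx : x ∈ g.gr i) :
    ten A g a x ∈ (A.tensor g).gr (i - q) := A.tmul_mem g ha hx

lemma br_ten {i p : ℤ} {x : g.V} {b : A.A} (hx : x ∈ g.gr i) (hb : b ∈ A.gr p) (a : A.A) (y : g.V) :
    (A.tensor g).br (ten A g a x) (ten A g b y) = sg K (i * p) • ten A g (a * b) (g.br x y) :=
  A.tbr_tmul g hx hb a y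

lemma d_ten {q : ℤ} {a : A.A} (ha : a ∈ A.gr q) (x : g.V) :
    (A.tensor g).d (ten A g a x) = ten A g (A.d a) x + sg K q • ten A g a (g.d x) :=
  A.td_tmul g ha x

/-- The operation of `w ∈ A ⊗ g`, of degree `r`, on the second factor. -/
def adM (r : ℤ) (w : (A.tensor g).V) : Mix A g U →ₗ[K] Mix A g U :=
  tmap (tw (lgr A U) r) ((A.tensor g).ad (-1) w)

lemma adM_tmul (r : ℤ) (w : (A.tensor g).V) (z : LS A U) (c : CEAlg A g) :
    adM r w (z ⊗ₜ c) = tw (lgr A U) r z ⊗ₜ (A.tensor g).ad (-1) w c := rfl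

/-- Left multiplication by `z ⊗ c`. -/
def mulG : LS A U →ₗ[K] CEAlg A g →ₗ[K] Module.End K (Mix A g U) :=
  (glift (cgr A g) fun p => (mulOp A g p).flip ∘ₗ (cgr A g p).subtype).flip

lemma mulG_of_mem {p : ℤ} {c : CEAlg A g} (hc : c ∈ cgr A g p) (z : LS A U) :
    mulG z c = mulOp A g p z c := by
  rw [mulG, flip_apply, glift_of_mem _ _ hc]; rfl

lemma delta_eq (v : U) {i : ℤ} {x : g.V} (hx : x ∈ g.gr i) (m : Mix A g U) :
    delta A g v i x m = -∑ s : A.Idx, mulG (io A v (A.basis s)) (stm A g (A.dbasis s) x) m := by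
  rw [delta_apply]
  congr 1
  refine sum_congr rfl fun s _ => ?_
  rw [mulG_of_mem (st_mem (A.dbasis_mem s) hx)]

lemma mmap_adM {F : LS A U →ₐ[K] LS A V} (hF : ∀ i z, z ∈ lgr A U i → F z ∈ lgr A V i) (r : ℤ)
    (w : (A.tensor g).V) (m : Mix A g U) : mmap g F (adM r w m) = adM r w (mmap g F m) := by
  induction m using induction_on with
  | zero => simp
  | add x y hx hy => simp only [map_add, hx, hy]
  | tmul y e => rw [adM_tmul, mmap_tmul, mmap_tmul, adM_tmul, hom_tw hF]

lemma adM_lmul (r : ℤ) (w : (A.tensor g).V) {u : ℤ} {z : LS A U} (hz : z ∈ lgr A U u)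
    (m : Mix A g U) : adM r w (lmul A g z m) = sg K (r * u) • lmul A g z (adM r w m) := by
  induction m using induction_on with
  | zero => simp
  | add x y hx hy => simp only [map_add, hx, hy, smul_add]
  | tmul y e =>
    rw [lmul_tmul, adM_tmul, adM_tmul, lmul_tmul, tw_mul, tw_of_mem _ _ hz, smul_mul_assoc,
      smul_tmul']

lemma IsDer.mul' {R : Type u} [Ring R] [Algebra K R] {𝒜 : ℤ → Submodule K R} [GradedAlgebra 𝒜]
    {p i : ℤ} {D : R →ₗ[K] R} (hD : IsDer 𝒜 p D) {x : R} (hx : x ∈ 𝒜 i) (y : R) :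
    D (x * y) = D x * y + sg K (p * i) • (x * D y) := by
  induction y using inductionOn 𝒜 with
  | zero => simp
  | homogeneous y => exact hD.mul hx y.2
  | add a b ha hb => simp only [mul_add, map_add, ha, hb, smul_add]; abel

lemma adM_mulOp {r p u : ℤ} {w : (A.tensor g).V} (hw : w ∈ (A.tensor g).gr r) {z : LS A U}
    (hz : z ∈ lgr A U u) {c : CEAlg A g} (hc : c ∈ cgr A g p) (m : Mix A g U) :
    adM r w (mulOp A g p z c m) =
      sg K (r * u) • mulOp A g (p + r) z ((A.tensor g).ad (-1) w c) m +
        sg K (r * (u + p)) • mulOp A g p z c (adM r w m) := by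
  induction m using induction_on with
  | zero => simp
  | add x y hx hy => simp only [map_add, hx, hy, smul_add]; abel
  | tmul y e =>
    rw [mulOp_tmul, mulOp_tmul, adM_tmul, adM_tmul, mulOp_tmul, tw_mul, tw_of_mem _ _ hz,
      smul_mul_assoc, tw_tw_add, IsDer.mul' ((A.tensor g).isDer_ad (-1) hw) hc, add_comm r p,
      tmul_add, tw_tw_add, mul_add, sg_add]
    simp only [tmul_smul, ← smul_tmul', smul_add, smul_smul,
      mul_comm (sg K (r * p))]

lemma ad_stm {i q j p : ℤ} {a b : A.A} {x y : g.V} (ha : a ∈ A.gr q) (hx : x ∈ g.gr i)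
    (hb : b ∈ A.gr p) (hy : y ∈ g.gr j) :
    (A.tensor g).ad (-1) (ten A g a x) (stm A g b y) =
      sg K (i - q + i * p) • stm A g (a * b) (g.br x y) := by
  rw [stm_eq, (A.tensor g).ad_s (-1) (ten_mem ha hx) (ten_mem hb hy), br_ten hx hb, map_smul,
    smul_smul, ← sg_add, stm_eq]
  congr 1
  exact sg_congr ⟨i * p, by ring⟩

lemma adM_delta {i q j : ℤ} {a : A.A} {x y : g.V} (ha : a ∈ A.gr q) (hx : x ∈ g.gr i)
    (hy : y ∈ g.gr j) (v : U) (m : Mix A g U) :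
    adM (i - q) (ten A g a x) (delta A g v j y m) =
      sg K (i * (n - 1)) • lmul A g (io A v a) (delta A g v (i + j) (g.br x y) m) +
      sg K ((i - q) * (j - (n - 1))) • delta A g v j y (adM (i - q) (ten A g a x) m) := by
  have hbr := g.br_mem hx hy
  have h := sum_basis_slide A (((mulG (g := g)).compl₁₂ (io A v)
    ((stm A g).flip (g.br x y))).compr₂ (applyₗ m)) ha
  simp only [compr₂_apply, compl₁₂_apply, flip_apply,
    LinearMap.applyₗ_apply_apply] at h
  have h1 : lmul A g (io A v a) (delta A g v (i + j) (g.br x y) m) =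
      -∑ s : A.Idx, mulG (io A v (a * A.basis s)) (stm A g (A.dbasis s) (g.br x y)) m := by
    rw [delta_eq v hbr, map_neg, map_sum]
    congr 1
    refine sum_congr rfl fun s _ => ?_
    rw [mulG_of_mem (st_mem (A.dbasis_mem s) hbr), mulG_of_mem (st_mem (A.dbasis_mem s) hbr),
      lmul_eq, mulOp_mulOp (io_mem A v (A.basis_mem s)), zero_mul, sg_zero, one_smul, zero_add,
      one_mul, io_mul]
  rw [h1, h, delta_apply, delta_apply, map_neg, map_sum]
  simp only [smul_neg, smul_sum, ← sum_neg_distrib, ← sum_add_distrib]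
  refine sum_congr rfl fun s _ => ?_
  have hs := A.basis_mem s
  have hd := A.dbasis_mem s
  rw [adM_mulOp (ten_mem ha hx) (io_mem A v hs) (st_mem hd hy), ad_stm ha hx hd hy,
    mulG_of_mem (st_mem (gmul_mem ha hd) hbr)]
  simp only [map_smul, lsmul_apply, smul_smul, ← sg_add, neg_add]
  congr 1
  · congr 1
    rw [show i + j - (q + (n - s.1)) + 1 = j - (n - s.1) + 1 + (i - q) by ring]
    congr 1
    exact sg_congr ⟨i * n, by ring⟩
  · congr 2
    exact sg_congr ⟨(i - q) * (s.1 + j - n + 1), by ring⟩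

end Action

section Equivariance

variable {K : Type u} [Field K] {n : ℕ} {A : PDCDGA K n} {g : DGLie K} {U V : Type}

lemma ad_one {N : ℤ} {i : ℤ} {x : g.V} (hx : x ∈ g.gr i) : g.ad N x 1 = 0 :=
  DGLie.IsDer.map_one g N (g.isDer_ad N hx)

lemma ad_s_mul {N i l : ℤ} {x y : g.V} (hx : x ∈ g.gr i) (hy : y ∈ g.gr l) (X : g.Sym N) :
    g.ad N x (g.s N y * X) = sg K (N * i) • (g.s N (g.br x y) * X) +
      sg K (i * (l - N)) • (g.s N y * g.ad N x X) := by
  rw [IsDer.mul' (g.isDer_ad N hx) (g.s_mem N hy), g.ad_s N hx hy, smul_mul_assoc]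

lemma lmul_mem_comm {i j : ℤ} {z z' : LS A U} (hz : z ∈ lgr A U i) (hz' : z' ∈ lgr A U j)
    (m : Mix A g U) : lmul A g z (lmul A g z' m) = sg K (i * j) • lmul A g z' (lmul A g z m) := by
  rw [lmul_lmul, lmul_lmul, ls_comm A hz hz', map_smul, lsmul_apply]

lemma phi_ad (k : ℕ) {i q : ℤ} {a : A.A} {x : g.V} (ha : a ∈ A.gr q) (hx : x ∈ g.gr i)
    (t : SPow g (n - 1) k) : adM (i - q) (ten A g a x) (phi A g k t) =
      ∑ j, lmul A g (io A j a) (phi A g k (adSlot g (n - 1) k i j x t)) := by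
  induction k with
  | zero =>
    obtain ⟨c, rfl⟩ := tpow_zero t
    rw [map_smul, map_smul, phi_zero, adM_tmul, ad_one (ten_mem ha hx)]
    simp
  | succ k ih =>
    induction t using tcons_induction with
    | hadd x y hx hy => simp only [map_add, hx, hy, sum_add_distrib]
    | h X t =>
      induction X using g.sym_induction (n - 1) generalizing t with
      | h1 =>
        rw [phi_one, ← mmap_adM (push_mem _ _), ih, Fin.sum_univ_succ, adSlot_zero, ad_one hx]
        simp only [map_zero, lzero_apply, zero_add, map_sum, mmap_lmul, adSlot_succ,
          tw_one, phi_one, push_io]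
      | hadd x y hx hy =>
        simp only [map_add, ladd_apply, hx, hy, sum_add_distrib]
      | hsmul c x hx => simp only [map_smul, lsmul_apply, hx, smul_sum]
      | hmul l y hy r X hX ih' =>
        have hbr := g.br_mem hx hy
        have ih0 : ∀ t, adM (i - q) (ten A g a x) (phi A g (k + 1) (tcons k X t)) =
            lmul A g (io A 0 a) (phi A g (k + 1) (tcons k (g.ad (n - 1) x X) t)) +
            ∑ m : Fin k, lmul A g (io A m.succ a) (phi A g (k + 1)
              (tcons k (tw (g.sgr (n - 1)) i X) (adSlot g (n - 1) k i m x t))) := by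
          intro t
          rw [ih' t, Fin.sum_univ_succ]
          simp only [adSlot_zero, adSlot_succ]
        have hX' := hX
        have ih1 : ∀ t, adM (i - q) (ten A g a x) (phi A g (k + 1)
              (tcons k (tw (g.sgr (n - 1)) l X) t)) =
            sg K (i * l) • lmul A g (io A 0 a) (phi A g (k + 1) (tcons k
              (tw (g.sgr (n - 1)) l (g.ad (n - 1) x X)) t)) +
            ∑ m : Fin k, lmul A g (io A m.succ a) (phi A g (k + 1)
              (tcons k (tw (g.sgr (n - 1)) l (tw (g.sgr (n - 1)) i X))
                (adSlot g (n - 1) k i m x t))) := by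
          intro t
          rw [tw_ad l hx, tw_comm_tw _ l i]
          rw [tw_of_mem _ l hX]
          simp only [map_smul, lsmul_apply, smul_smul, ← smul_sum, ih0, smul_add]
          congr 2
          rw [mul_comm l i, ← mul_assoc, sg_mul_self, one_mul]
        have hδ : ∀ (v : Fin (k + 1)) (m : Mix A g (Fin (k + 1))),
            delta A g 0 l y (lmul A g (io A v a) m) = sg K ((l - (n - 1)) * q) •
              lmul A g (io A v a) (delta A g 0 l y m) := fun v m => delta_lmul 0 hy (io_mem A v ha) m
        rw [phi_mul k hy, map_add, map_sum, adM_delta ha hx hy, ih0, Fin.sum_univ_succ, adSlot_zero,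
          ad_s_mul hx hy]
        simp only [adSlot_succ, tw_s_mul _ i hy]
        simp only [map_add, map_smul, lsmul_apply, ladd_apply, map_sum,
          phi_mul k hy, phi_mul k hbr, adM_lmul _ _ (om_mem A _ _), ih1, smul_add, smul_sum,
          sum_add_distrib, hδ, smul_smul,
          lmul_mem_comm (om_mem A _ _) (io_mem A _ ha), ← sg_add]
        have hc : ∀ (Y : g.Sym (n - 1)) (m j : Fin k), lmul A g (io A m.succ a)
            (lmul A g (om A 0 j.succ) (phi A g (k + 1) (tcons k Y
              (adSlot g (n - 1) k i m x (adSlot g (n - 1) k l j y t))))) =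
            (if m = j then lmul A g (io A 0 a) (lmul A g (om A 0 j.succ) (phi A g (k + 1)
              (tcons k Y (adSlot g (n - 1) k (i + l) j (g.br x y) t)))) else 0) +
            sg K (i * l) • lmul A g (io A m.succ a) (lmul A g (om A 0 j.succ) (phi A g (k + 1)
              (tcons k Y (adSlot g (n - 1) k l j y (adSlot g (n - 1) k i m x t))))) := by
          intro Y m j
          split_ifs with h
          · subst h
            rw [adSlot_commutator k hx hy, lmul_lmul (io A 0 a), io_om, ← lmul_lmul]
            simp only [map_add, map_smul]
          · rw [zero_add, adSlot_comm k hx hy h]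
            simp only [map_smul]
        simp only [hc, smul_add, sum_add_distrib, smul_ite, smul_zero, Finset.sum_ite_eq',
          mem_univ, if_true, smul_smul, ← sg_add, tw_tw_add]
        rw [sum_comm (f := fun x_1 x_2 => sg K (_ + _) • _), sg_congr (i := (i - q) * (l - (n - 1)) + (l - (n - 1)) * q) (j := i * (l - (n - 1)))
            ⟨i * (l - (n - 1)), by ring⟩,
          sg_congr (i := (i - q) * (n - 1) + (i * l + (n - 1) * q)) (j := i * (l - (n - 1)))
            ⟨i * l, by ring⟩,
          sg_congr (i := (i - q) * (n - 1) + (n - 1) * q + i * l) (j := i * (l - (n - 1)))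
            ⟨i * l, by ring⟩,
          sg_congr (i := (i - q) * (n - 1) + (n - 1) * q) (j := (n - 1) * i)
            ⟨i * (n - 1), by ring⟩, mul_comm i (n - 1 : ℤ), add_comm l i]
        abel

end Equivariance

section ChainMap

variable {K : Type u} [Field K] {n : ℕ} {A : PDCDGA K n} {g : DGLie K} {U V : Type}
  [DecidableEq U] [DecidableEq V]

lemma lsd_one : lsd A U 1 = 0 := by
  rw [← map_one (algebraMap K (LS A U)), Algebra.algebraMap_eq_smul_one, map_smul, lsd,
    GPres.der_one, smul_zero]

lemma lsd_push (e : U → V) (he : Injective e) (z : LS A U) :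
    lsd A V (LS.push A e he z) = LS.push A e he (lsd A U z) := by
  induction z using (lsPres A U).induction with
  | h1 => rw [map_one, lsd_one, lsd_one, map_zero]
  | hadd x y hx hy => simp only [map_add, hx, hy]
  | hsmul c x hx => simp only [map_smul, hx]
  | hmul x y hy =>
    have hx : lsd A V (LS.push A e he ((lsPres A U).gen x)) =
        LS.push A e he (lsd A U ((lsPres A U).gen x)) := by
      cases x with
      | pt v i a => rw [gen_pt, lsd_io, push_io, push_io, lsd_io]
      | om v w =>
        rw [gen_om, lsd_om, push_om, lsd_om, Del, Del]
        by_cases h : v = w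
        · rw [if_pos h, if_pos (by rw [h]), map_zero]
        · rw [if_neg h, if_neg (fun h' => h (he h'))]
          simp only [PDCDGA.diag, map_sum, map_smul, map_mul, push_io]
    rw [map_mul, lsd_mul, lsd_mul, map_add, map_mul, map_mul, hx, hy, hom_tw (push_mem e he)]

variable (A g U) in
/-- The differential of the tensor product. -/
def dM : Mix A g U →ₗ[K] Mix A g U :=
  tmap (lsd A U) lid +
    tmap (tw (lgr A U) 1) (A.tensor g).ceD

lemma dM_tmul (z : LS A U) (c : CEAlg A g) :
    dM A g U (z ⊗ₜ c) = lsd A U z ⊗ₜ c + tw (lgr A U) 1 z ⊗ₜ (A.tensor g).ceD c := rfl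

lemma dM_push (e : U → V) (he : Injective e) (m : Mix A g U) :
    dM A g V (mmap g (LS.push A e he) m) = mmap g (LS.push A e he) (dM A g U m) := by
  induction m using induction_on with
  | zero => simp
  | add x y hx hy => simp only [map_add, hx, hy]
  | tmul y e' => rw [mmap_tmul, dM_tmul, dM_tmul, map_add, mmap_tmul, mmap_tmul, lsd_push,
      hom_tw (push_mem e he)]

lemma lsd_tw' (p : ℤ) (z : LS A U) :
    lsd A U (tw (lgr A U) p z) = sg K p • tw (lgr A U) p (lsd A U z) := by
  have h : lsd A U ∘ₗ tw (lgr A U) p = sg K p • (tw (lgr A U) p ∘ₗ lsd A U) := by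
    refine ghom_ext (gr := lgr A U) fun i a ha => ?_
    simp only [comp_apply, lsmul_apply]
    rw [tw_of_mem (lgr A U) p ha, tw_of_mem (lgr A U) p (lsd_mem A ha), map_smul, smul_smul,
      ← sg_add]
    congr 1
    exact sg_congr ⟨p * i + p, by ring⟩
  exact lcongr_fun h z

lemma dM_lmul {u : ℤ} {z : LS A U} (hz : z ∈ lgr A U u) (m : Mix A g U) :
    dM A g U (lmul A g z m) = lmul A g (lsd A U z) m + sg K u • lmul A g z (dM A g U m) := by
  induction m using induction_on with
  | zero => simp
  | add x y hx hy => simp only [map_add, hx, hy, smul_add]; abel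
  | tmul y e =>
    rw [lmul_tmul, dM_tmul, dM_tmul, lmul_tmul, map_add, lmul_tmul, lmul_tmul, lsd_mul, tw_mul,
      tw_of_mem _ 1 hz, one_mul, smul_mul_assoc, smul_mul_assoc, add_tmul,
      ← smul_tmul', ← smul_tmul', smul_add, add_assoc]

lemma dM_mulOp {p u : ℤ} {z : LS A U} (hz : z ∈ lgr A U u) {w : (A.tensor g).V}
    (hw : w ∈ (A.tensor g).gr p) (m : Mix A g U) :
    dM A g U (mulOp A g (p + 1) z ((A.tensor g).s (-1) w) m) =
      mulOp A g (p + 1) (lsd A U z) ((A.tensor g).s (-1) w) m -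
      sg K u • mulOp A g p z ((A.tensor g).s (-1) ((A.tensor g).d w)) m +
      sg K (u + p + 1) • mulOp A g (p + 1) z ((A.tensor g).s (-1) w) (dM A g U m) +
      sg K u • lmul A g z (adM p w m) := by
  induction m using induction_on with
  | zero => simp
  | add x y hx hy => simp only [map_add, hx, hy, smul_add]; abel
  | tmul y e =>
    have h2 : tw (lgr A U) (p + 1 + 1) y = tw (lgr A U) p y := by
      rw [add_assoc, ← tw_tw_add, tw_even (p := 1 + 1) _ (by decide)]
    rw [mulOp_tmul, dM_tmul, dM_tmul, map_add, mulOp_tmul, mulOp_tmul, mulOp_tmul, mulOp_tmul,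
      adM_tmul, lmul_tmul, lsd_mul, tw_mul, tw_of_mem _ 1 hz, one_mul, lsd_tw', tw_tw_add,
      tw_tw_add, (A.tensor g).ceD_mul hw, (A.tensor g).symD_s (-1) hw, sg_odd (i := -1) (by decide),
      neg_one_smul, add_comm 1 (p + 1), h2]
    simp only [tmul_add, add_tmul, tmul_smul,
      ← smul_tmul', smul_add, smul_smul, neg_mul, TensorProduct.tmul_neg,
      smul_mul_assoc, mul_smul_comm, sg_add, smul_neg]
    module

lemma dM_delta {i : ℤ} {x : g.V} (hx : x ∈ g.gr i) (v : U) (m : Mix A g U) :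
    dM A g U (delta A g v i x m) = sg K (n - 1) • delta A g v (i - 1) (g.d x) m +
      sg K (i - (n - 1)) • delta A g v i x (dM A g U m) -
      ∑ s : A.Idx, sg K s.1 • lmul A g (io A v (A.basis s))
        (adM (i - (n - s.1)) (ten A g (A.dbasis s) x) m) := by
  have hdx := g.d_mem hx
  have h := sum_basis_d A (((mulG (g := g)).compl₁₂ (io A v ∘ₗ tw A.gr 1)
    ((stm A g).flip x)).compr₂ (applyₗ m))
  simp only [compr₂_apply, compl₁₂_apply, flip_apply,
    LinearMap.applyₗ_apply_apply, comp_apply] at h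
  have e1 : ∀ s : A.Idx, sg K s.1 • mulG (io A v (tw A.gr 1 (A.d (A.basis s))))
      (stm A g (A.dbasis s) x) m = 
      -mulOp A g (i - (n - s.1) + 1) (lsd A U (io A v (A.basis s))) (stm A g (A.dbasis s) x) m := by
    intro s
    rw [tw_of_mem _ 1 (A.d_mem (A.basis_mem s)), lsd_io,
      mulG_of_mem (st_mem (A.dbasis_mem s) hx)]
    simp only [map_smul, lsmul_apply, smul_smul, ← sg_add]
    rw [sg_odd ⟨s.1, by ring⟩, neg_one_smul]
  have e2 : ∀ s : A.Idx, mulG (io A v (tw A.gr 1 (A.basis s)))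
      (stm A g (A.d (A.dbasis s)) x) m = sg K s.1 • mulOp A g (i - (n - s.1)) (io A v (A.basis s)) 
        (stm A g (A.d (A.dbasis s)) x) m := by
    intro s
    rw [tw_of_mem _ 1 (A.basis_mem s), mulG_of_mem (st_mem (A.d_mem (A.dbasis_mem s)) hx), one_mul]
    simp only [map_smul, lsmul_apply]
    rw [show i - (n - s.1 + 1) + 1 = i - (n - s.1) by ring]
  simp only [e1, e2, sum_neg_distrib] at h
  rw [delta_apply, delta_apply, delta_apply, map_neg, map_sum]
  have e3 : ∀ s : A.Idx, dM A g U (mulOp A g (i - (n - s.1) + 1) (io A v (A.basis s))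
      (stm A g (A.dbasis s) x) m) = 
      mulOp A g (i - (n - s.1) + 1) (lsd A U (io A v (A.basis s))) (stm A g (A.dbasis s) x) m -
      sg K s.1 • mulOp A g (i - (n - s.1)) (io A v (A.basis s)) 
        (stm A g (A.d (A.dbasis s)) x) m + 
      (sg K (n - 1) • mulOp A g (i - 1 - (n - s.1) + 1) (io A v (A.basis s)) 
        (stm A g (A.dbasis s) (g.d x)) m +
      sg K (i - (n - 1)) • mulOp A g (i - (n - s.1) + 1) (io A v (A.basis s))
        (stm A g (A.dbasis s) x) (dM A g U m) +
      sg K s.1 • lmul A g (io A v (A.basis s))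
        (adM (i - (n - s.1)) (ten A g (A.dbasis s) x) m)) := by
    intro s
    rw [stm_eq, dM_mulOp (io_mem A v (A.basis_mem s)) (ten_mem (A.dbasis_mem s) hx),
      d_ten (A.dbasis_mem s), map_add, map_smul, ← stm_eq, ← stm_eq, ← stm_eq, map_add, map_smul,
      ladd_apply, lsmul_apply, smul_add, smul_smul, ← sg_add,
      sg_congr (i := s.1 + (n - s.1)) (j := n - 1 + 1) ⟨n, by ring⟩, sg_add (n - 1 : ℤ) 1,
      sg_odd (i := 1) (by decide), 
      sg_congr (i := s.1 + (i - (n - s.1)) + 1) (j := i - (n - 1)) ⟨i + s.1 - n + 1, by ring⟩,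
      show i - 1 - (n - s.1) + 1 = i - (n - s.1) by ring, mul_neg_one, neg_smul]
    abel
  simp only [e3, sum_add_distrib, sum_sub_distrib, smul_neg, smul_sum]
  rw [neg_add_eq_zero] at h
  rw [h]
  abel

lemma phi_tprod_zero (t : SPow g (n - 1) 0) : dM A g (Fin 0) (phi A g 0 t) = 0 := by
  obtain ⟨c, rfl⟩ := tpow_zero t
  rw [map_smul, map_smul, phi_zero, dM_tmul, lsd_one, DGLie.ceD_one]
  simp

variable (g) in
/-- The differential of the tensor power of the symmetric algebra. -/
def spD (N : ℤ) (k : ℕ) : Module.End K (SPow g N k) :=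
  ∑ l, slotOp k (tw (g.sgr N) 1) (g.symD N) l

lemma spD_tcons {N : ℤ} (k : ℕ) (b : g.Sym N) (t : SPow g N k) :
    spD g N (k + 1) (tcons k b t) =
      tcons k (g.symD N b) t + tcons k (tw (g.sgr N) 1 b) (spD g N k t) := by
  simp only [spD, lmsum_apply]
  rw [Fin.sum_univ_succ, slotOp_zero, map_sum]
  simp only [slotOp_succ]

lemma spD_adSlot (k : ℕ) {i : ℤ} {x : g.V} (hx : x ∈ g.gr i) {N : ℤ} (j : Fin k) (t : SPow g N k) :
    spD g N k (adSlot g N k i j x t) = adSlot g N k (i - 1) j (g.d x) t +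
      sg K i • adSlot g N k i j x (spD g N k t) := by
  have hD := g.isDer_symD N
  have h0 : ∀ b, g.symD N (g.ad N x b) = g.ad N (g.d x) b + sg K i • g.ad N x (g.symD N b) := by
    intro b
    induction b using inductionOn (g.sgr N) with
    | zero => simp
    | add a b ha hb => simp only [map_add, ha, hb, smul_add]; abel
    | @homogeneous l b =>
    have h : g.symD N (g.symBr N (g.s N x) b) = sg K N • (g.symBr N (g.symD N (g.s N x)) b +
      sg K (i - N) • g.symBr N (g.s N x) (g.symD N b)) := (g.symPois N).d_br (g.s_mem N hx) b.2
    rw [g.symD_s N hx, map_smul, lsmul_apply, g.symBr_s N hx,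
      g.symBr_s N (g.d_mem hx), smul_add, smul_smul, smul_smul, sg_mul_self, one_smul, ← sg_add,
      add_sub_cancel] at h
    exact h
  have h : ∀ l, slotOp k (tw (g.sgr N) 1) (g.symD N) l (adSlot g N k i j x t) =
      (if l = j then adSlot g N k (i - 1) j (g.d x) t else 0) +
        sg K i • adSlot g N k i j x (slotOp k (tw (g.sgr N) 1) (g.symD N) l t) := by
    intro l
    change slotOp k (tw (g.sgr N) 1) (g.symD N) l (slotOp k (tw (g.sgr N) i) (g.ad N x) j t) = _ + 
      sg K i • slotOp k (tw (g.sgr N) i) (g.ad N x) j (slotOp k (tw (g.sgr N) 1) (g.symD N) l t)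
    split_ifs with hl
    · subst hl
      have e : ∀ b, tw (g.sgr N) (i - 1) b = tw (g.sgr N) (1 + i) b := by
        intro b
        rw [show 1 + i = i - 1 + 2 by ring, ← tw_tw_add, tw_even (p := 2) _ (by decide)]
      exact slotOp_commutator k (fun b => by rw [e, tw_tw_add])
        (fun b => by rw [e, tw_tw_add, add_comm]) h0 l t
    · rw [zero_add]
      refine slotOp_comm k (tw_comm_tw _ 1 i) (fun b => by rw [tw_ad 1 hx, one_mul]) (fun b => ?_)
        (sg_mul_self _) hl t
      rw [tw_isDer hD]
      congr 1
      exact sg_congr ⟨0, by ring⟩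
  simp only [spD, lmsum_apply, h]
  rw [sum_add_distrib, Finset.sum_ite_eq', if_pos (mem_univ _), map_sum,
    smul_sum]

end ChainMap

section ChainMap

variable {K : Type u} [Field K] {n : ℕ} {A : PDCDGA K n} {g : DGLie K}

lemma sum_lmul_io_io {U : Type} (v : U) (hA : A.euler = 0) (m : Mix A g U) :
    ∑ s : A.Idx, sg K s.1 • lmul A g (io A v (A.basis s)) (lmul A g (io A v (A.dbasis s)) m) = 0 := by
  have h := congrArg (fun a => lmul A g (io A v a) m) (sum_basis_mul_dbasis A hA)
  simp only [map_sum, map_smul, lmsum_apply, lsmul_apply, map_zero,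
    lzero_apply, io_mul, ← lmul_lmul] at h
  exact h

lemma phi_d (hA : A.euler = 0) (k : ℕ) (t : SPow g (n - 1) k) :
    phi A g k (spD g (n - 1) k t) = dM A g (Fin k) (phi A g k t) := by
  induction k with
  | zero =>
    rw [phi_tprod_zero]
    simp [spD]
  | succ k ih =>
    induction t using tcons_induction with
    | hadd x y hx hy => simp only [map_add, hx, hy]
    | h X t =>
      induction X using g.sym_induction (n - 1) generalizing t with
      | h1 =>
        rw [phi_one, dM_push, ← ih, spD_tcons, DGLie.IsDer.map_one _ _ (g.isDer_symD _), tw_one,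
          map_zero, lzero_apply, zero_add, phi_one]
      | hadd x y hx hy => simp only [map_add, ladd_apply, hx, hy]
      | hsmul c x hx => simp only [map_smul, lsmul_apply, hx]
      | hmul i x hx r X hX ih' =>
        have hdx := g.d_mem hx
        have ih0 : ∀ t, dM A g (Fin (k + 1)) (phi A g (k + 1) (tcons k X t)) =
            phi A g (k + 1) (tcons k (g.symD (n - 1) X) t) +
            phi A g (k + 1) (tcons k (tw (g.sgr (n - 1)) 1 X) (spD g (n - 1) k t)) := by
          intro t
          rw [← ih' t, spD_tcons, map_add]
        have ih1 : ∀ t, dM A g (Fin (k + 1)) (phi A g (k + 1) (tcons k (tw (g.sgr (n - 1)) i X) t)) =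
            sg K i • phi A g (k + 1) (tcons k (tw (g.sgr (n - 1)) i (g.symD (n - 1) X)) t) +
            phi A g (k + 1) (tcons k (tw (g.sgr (n - 1)) (i - 1) X) (spD g (n - 1) k t)) := by
          intro t
          have e : tw (g.sgr (n - 1)) (i - 1) X = tw (g.sgr (n - 1)) i (tw (g.sgr (n - 1)) 1 X) := by
            rw [tw_tw_add, show i + 1 = i - 1 + 2 by ring, ← tw_tw_add _ (i - 1) 2, tw_even (p := 2) _ (by decide)]
          rw [e, tw_isDer (g.isDer_symD _), tw_comm_tw _ i 1]
          rw [tw_of_mem _ i hX]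
          simp only [map_smul, lsmul_apply, smul_smul, ← sg_add, ih0, smul_add]
          congr 2
          exact sg_congr ⟨i * r, by ring⟩
        have hD : g.symD (n - 1) (g.s (n - 1) x * X) = sg K (n - 1) • (g.s (n - 1) (g.d x) * X) +
            sg K (i - (n - 1)) • (g.s (n - 1) x * g.symD (n - 1) X) := by
          rw [IsDer.mul' (g.isDer_symD _) (g.s_mem _ hx), g.symD_s _ hx, smul_mul_assoc]
          congr 2
          exact sg_congr ⟨0, by ring⟩
        have hE : ∑ s : A.Idx, sg K s.1 • lmul A g (io A (0 : Fin (k + 1)) (A.basis s))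
            (adM (i - (n - s.1)) (ten A g (A.dbasis s) x) (phi A g (k + 1) (tcons k X t))) =
            ∑ j : Fin k, lmul A g (Del A 0 j.succ) (phi A g (k + 1) (tcons k (tw (g.sgr (n - 1)) i X)
              (adSlot g (n - 1) k i j x t))) := by
          have h1 : ∀ s : A.Idx, adM (i - (n - s.1)) (ten A g (A.dbasis s) x)
              (phi A g (k + 1) (tcons k X t)) = _ :=
            fun s => phi_ad (k + 1) (A.dbasis_mem s) hx (tcons k X t)
          simp only [h1, Fin.sum_univ_succ, map_add, smul_add, sum_add_distrib, adSlot_zero,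
            adSlot_succ, map_sum, smul_sum]
          rw [sum_comm, sum_lmul_io_io _ hA, zero_add]
          refine sum_congr rfl fun j _ => ?_
          rw [Del, if_neg (Fin.succ_ne_zero j).symm, PDCDGA.diag, map_sum, lmsum_apply]
          refine sum_congr rfl fun s _ => ?_
          rw [map_smul, lsmul_apply, lmul_lmul]
        rw [spD_tcons, hD, tw_s_mul _ 1 hx, phi_mul k hx, map_add (dM A g _), dM_delta hx, hE, ih0,
          map_sum]
        simp only [dM_lmul (om_mem A _ _), lsd_om, ih1, map_add, map_smul, ladd_apply,
          lsmul_apply, phi_mul k hx, phi_mul k hdx, spD_adSlot k hx, sum_add_distrib,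
          smul_add, smul_sum, smul_smul, ← sg_add, one_mul, g.symD_symD]
        have e : tw (g.sgr (n - 1)) i (tw (g.sgr (n - 1)) 1 X) = tw (g.sgr (n - 1)) (i - 1) X := by
          rw [tw_tw_add, show i + 1 = i - 1 + 2 by ring, ← tw_tw_add _ (i - 1) 2, tw_even (p := 2) _ (by decide)]
        rw [e, sg_congr (i := n - 1 + i) (j := i - (n - 1)) ⟨i, by ring⟩]
        abel

end ChainMap

section Slot

variable {K : Type u} [Field K] {n : ℕ} {A : PDCDGA K n} {g : DGLie K}

lemma phi_mul₂ (k : ℕ) {i : ℤ} {x : g.V} (hx : x ∈ g.gr i) (X Y : g.Sym (n - 1))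
    (t : SPow g (n - 1) k) :
    phi A g (k + 2) (tcons (k + 1) (g.s (n - 1) x * X) (tcons k Y t)) =
      delta A g 0 i x (phi A g (k + 2) (tcons (k + 1) X (tcons k Y t))) +
      (lmul A g (om A 0 1) (phi A g (k + 2) (tcons (k + 1) (tw (g.sgr (n - 1)) i X)
        (tcons k (g.ad (n - 1) x Y) t))) + ∑ j : Fin k, lmul A g (om A 0 j.succ.succ)
          (phi A g (k + 2) (tcons (k + 1) (tw (g.sgr (n - 1)) i X)
            (tcons k (tw (g.sgr (n - 1)) i Y) (adSlot g (n - 1) k i j x t))))) := by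
  rw [phi_mul (k + 1) hx, Fin.sum_univ_succ, adSlot_zero, fsucc_zero]
  simp only [adSlot_succ]

lemma lmul_om_delta {U : Type} (v w : U) {i : ℤ} {x : g.V} (hx : x ∈ g.gr i) (m : Mix A g U) :
    lmul A g (om A v w) (delta A g v i x m) = lmul A g (om A v w) (delta A g w i x m) := by
  rw [delta_apply, delta_apply, map_neg, map_neg, map_sum, map_sum]
  congr 1
  refine sum_congr rfl fun s _ => ?_
  rw [lmul_eq, mulOp_mulOp (io_mem A v (A.basis_mem s)), mulOp_mulOp (io_mem A w (A.basis_mem s)),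
    io_om']

lemma om_arnold' {U : Type} (u v w : U) : om A v u * om A u w =
    sg K (n - 1) • (om A u w * om A v w - om A u v * om A v w) := by
  have h := om_arnold A u v w
  have hs : sg K n = -sg K (n - 1) := by
    rw [show (n : ℤ) = n - 1 + 1 by ring, sg_add, sg_odd (i := 1) (by decide), mul_neg_one,
      show (n : ℤ) - 1 + 1 - 1 = n - 1 by ring]
  have hN : sg K ((n - 1) * (n - 1)) = sg K (n - 1) := by
    obtain ⟨r, hr⟩ := Int.even_mul_succ_self ((n : ℤ) - 1)
    exact sg_congr ⟨r, by linear_combination hr⟩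
  have e1 : om A w u = -sg K (n - 1) • om A u w := by rw [om_symm A u w, hs]
  have e2 : om A v u = -sg K (n - 1) • om A u v := by rw [om_symm A u v, hs]
  have e3 := ls_comm A (om_mem A v w) (om_mem A u w)
  have e4 := ls_comm A (om_mem A u w) (om_mem A u v)
  rw [hN] at e3 e4
  rw [e1, mul_smul_comm, smul_mul_assoc, e3, e4, smul_smul, smul_smul, neg_mul, sg_mul_self] at h
  rw [e2, smul_mul_assoc]
  have h' : om A u v * om A u w = om A u v * om A v w - om A u w * om A v w := by
    rw [← sub_eq_zero, ← neg_eq_zero, ← h]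
    module
  rw [h']
  module

set_option maxHeartbeats 1600000 in
lemma phi_slot (k : ℕ) {i : ℤ} {x : g.V} (hx : x ∈ g.gr i) (X Y : g.Sym (n - 1))
    (t : SPow g (n - 1) k) :
    phi A g (k + 2) (tcons (k + 1) (tw (g.sgr (n - 1)) (i - (n - 1)) X)
      (tcons k (g.s (n - 1) x * Y) t)) =
      delta A g 1 i x (phi A g (k + 2) (tcons (k + 1) X (tcons k Y t))) +
      (lmul A g (om A 1 0) (phi A g (k + 2) (tcons (k + 1) (g.ad (n - 1) x X)
        (tcons k Y t))) + ∑ j : Fin k, lmul A g (om A 1 j.succ.succ)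
          (phi A g (k + 2) (tcons (k + 1) (tw (g.sgr (n - 1)) i X)
            (tcons k (tw (g.sgr (n - 1)) i Y) (adSlot g (n - 1) k i j x t))))) := by
  induction X using g.sym_induction (n - 1) generalizing i x Y t with
  | h1 =>
    rw [tw_one, phi_one, phi_one, ad_one hx, phi_mul k hx, map_add,
      mmap_delta (push_mem _ _) (fun a => push_io _ _ _ _)]
    simp only [map_zero, lzero_apply, zero_add, map_sum, mmap_lmul, push_om, tw_one,
      phi_one, fsucc_zero]
  | hadd X X' h h' =>
    simp only [map_add, ladd_apply, h hx, h' hx, sum_add_distrib]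
    abel
  | hsmul c X h =>
    simp only [map_smul, lsmul_apply, h hx, smul_add, smul_sum]
  | hmul l y hy r X hX ih =>
    have hxy := g.br_mem hx hy
    have hyx := g.br_mem hy hx
    have hbr : g.br y x = -(sg K (i * l) • g.br x y) := by rw [g.br_symm hy hx, mul_comm]
    have e2 : tw (g.sgr (n - 1)) l (tw (g.sgr (n - 1)) (i - (n - 1)) X) =
        tw (g.sgr (n - 1)) (i - (n - 1)) (tw (g.sgr (n - 1)) l X) := tw_comm_tw _ _ _ _
    have e3 : ∀ Z : g.Sym (n - 1), tw (g.sgr (n - 1)) i (tw (g.sgr (n - 1)) l Z) =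
        tw (g.sgr (n - 1)) (l + i) Z := fun Z => by rw [tw_tw_add, add_comm]
    have e4 : ∀ Z : g.Sym (n - 1), tw (g.sgr (n - 1)) l (tw (g.sgr (n - 1)) i Z) =
        tw (g.sgr (n - 1)) (l + i) Z := fun Z => by rw [tw_tw_add]
    have hz : ∀ m : Mix A g (Fin (k + 2)), lmul A g (om A 0 1) (lmul A g (om A 1 0) m) = 0 := by
      intro m
      rw [lmul_lmul, om_sq', map_zero, lzero_apply]
    have hz' : ∀ m : Mix A g (Fin (k + 2)), lmul A g (om A 1 0) (lmul A g (om A 0 1) m) = 0 := by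
      intro m
      rw [lmul_lmul, om_sq', map_zero, lzero_apply]
    have T2 : phi A g (k + 2) (tcons (k + 1) (tw (g.sgr (n - 1)) l
          (tw (g.sgr (n - 1)) (i - (n - 1)) X)) (tcons k (g.ad (n - 1) y (g.s (n - 1) x * Y)) t)) =
        sg K ((n - 1) * l) • phi A g (k + 2) (tcons (k + 1) (tw (g.sgr (n - 1)) (l + i - (n - 1)) X)
          (tcons k (g.s (n - 1) (g.br y x) * Y) t)) +
        sg K (l * (i - (n - 1))) • phi A g (k + 2) (tcons (k + 1) (tw (g.sgr (n - 1)) (i - (n - 1))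
          (tw (g.sgr (n - 1)) l X)) (tcons k (g.s (n - 1) x * g.ad (n - 1) y Y) t)) := by
      rw [ad_s_mul hy hx, ← e2, tw_tw_add, add_sub_assoc]
      simp only [map_add, map_smul, ladd_apply, lsmul_apply]
    have T3 : ∀ u, phi A g (k + 2) (tcons (k + 1) (tw (g.sgr (n - 1)) l
          (tw (g.sgr (n - 1)) (i - (n - 1)) X)) (tcons k (tw (g.sgr (n - 1)) l
            (g.s (n - 1) x * Y)) u)) =
        sg K (l * (i - (n - 1))) • phi A g (k + 2) (tcons (k + 1) (tw (g.sgr (n - 1)) (i - (n - 1))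
          (tw (g.sgr (n - 1)) l X)) (tcons k (g.s (n - 1) x * tw (g.sgr (n - 1)) l Y) u)) := by
      intro u
      rw [tw_s_mul _ _ hx, e2]
      simp only [map_smul, lsmul_apply]
    have R2 : phi A g (k + 2) (tcons (k + 1) (g.ad (n - 1) x (g.s (n - 1) y * X)) (tcons k Y t)) =
        sg K ((n - 1) * i) • phi A g (k + 2) (tcons (k + 1) (g.s (n - 1) (g.br x y) * X)
          (tcons k Y t)) +
        sg K (i * (l - (n - 1))) • phi A g (k + 2) (tcons (k + 1) (g.s (n - 1) y * g.ad (n - 1) x X)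
          (tcons k Y t)) := by
      rw [ad_s_mul hx hy]
      simp only [map_add, map_smul, ladd_apply, lsmul_apply]
    have R3 : ∀ u, phi A g (k + 2) (tcons (k + 1) (tw (g.sgr (n - 1)) i (g.s (n - 1) y * X))
          (tcons k (tw (g.sgr (n - 1)) i Y) u)) =
        sg K (i * (l - (n - 1))) • phi A g (k + 2) (tcons (k + 1)
          (g.s (n - 1) y * tw (g.sgr (n - 1)) i X) (tcons k (tw (g.sgr (n - 1)) i Y) u)) := by
      intro u
      rw [tw_s_mul _ _ hy]
      simp only [map_smul, lsmul_apply]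
    have hc : ∀ (Z W : g.Sym (n - 1)) (j m : Fin k), lmul A g (om A 0 j.succ.succ)
        (lmul A g (om A 1 m.succ.succ) (phi A g (k + 2) (tcons (k + 1) Z (tcons k W
          (adSlot g (n - 1) k i m x (adSlot g (n - 1) k l j y t)))))) =
        (if j = m then lmul A g (om A 0 j.succ.succ) (lmul A g (om A 1 j.succ.succ)
          (phi A g (k + 2) (tcons (k + 1) Z (tcons k W
            (adSlot g (n - 1) k (i + l) j (g.br x y) t))))) else 0) +
        sg K (i * l + (n - 1) * (n - 1)) • lmul A g (om A 1 m.succ.succ) (lmul A g (om A 0 j.succ.succ)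
          (phi A g (k + 2) (tcons (k + 1) Z (tcons k W
            (adSlot g (n - 1) k l j y (adSlot g (n - 1) k i m x t)))))) := by
      intro Z W j m
      split_ifs with h
      · subst h
        rw [adSlot_commutator k hx hy]
        simp only [map_add, map_smul, sg_add, mul_smul]
        rw [om_om 0 _ 1 _ (phi A g _ (tcons _ _ (tcons _ _ (adSlot g _ k l _ y _))))]
      · rw [zero_add, adSlot_comm k hx hy (Ne.symm h)]
        simp only [map_smul, sg_add, mul_smul]
        rw [om_om 0]
    have har : ∀ (j : Fin k) (m : Mix A g (Fin (k + 2))),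
        lmul A g (om A 1 0) (lmul A g (om A 0 j.succ.succ) m) = sg K (n - 1) •
          (lmul A g (om A 0 j.succ.succ) (lmul A g (om A 1 j.succ.succ) m) -
            lmul A g (om A 0 1) (lmul A g (om A 1 j.succ.succ) m)) := by
      intro j m
      simp only [lmul_lmul]
      rw [om_arnold', map_smul, map_sub, lsmul_apply, LinearMap.sub_apply]
    have ihl : ∀ (Y : g.Sym (n - 1)) (t : SPow g (n - 1) k),
        phi A g (k + 2) (tcons (k + 1) (tw (g.sgr (n - 1)) (i - (n - 1)) (tw (g.sgr (n - 1)) l X))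
          (tcons k (g.s (n - 1) x * Y) t)) =
        delta A g 1 i x (phi A g (k + 2) (tcons (k + 1) (tw (g.sgr (n - 1)) l X) (tcons k Y t))) +
        (lmul A g (om A 1 0) (phi A g (k + 2) (tcons (k + 1) (g.ad (n - 1) x
          (tw (g.sgr (n - 1)) l X)) (tcons k Y t))) + ∑ j : Fin k, lmul A g (om A 1 j.succ.succ)
          (phi A g (k + 2) (tcons (k + 1) (tw (g.sgr (n - 1)) i (tw (g.sgr (n - 1)) l X))
            (tcons k (tw (g.sgr (n - 1)) i Y) (adSlot g (n - 1) k i j x t))))) := by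
      intro Y t
      rw [tw_of_mem _ l hX]
      simp only [map_smul, lsmul_apply, ih hx, smul_add, smul_sum]
    have hs : sg K n = -sg K (n - 1) := by
      rw [show (n : ℤ) = n - 1 + 1 by ring, sg_add, sg_odd (i := 1) (by decide), mul_neg_one,
        show (n : ℤ) - 1 + 1 - 1 = n - 1 by ring]
    have h10 : ∀ m : Mix A g (Fin (k + 2)), lmul A g (om A 1 0) m =
        -(sg K (n - 1) • lmul A g (om A 0 1) m) := by
      intro m
      rw [om_symm A 0 1, hs, neg_smul, map_neg, map_smul]; rfl
    have h01 : ∀ (j : Fin k) (m : Mix A g (Fin (k + 2))),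
        lmul A g (om A 1 j.succ.succ) (lmul A g (om A 0 1) m) =
        sg K ((n - 1) * (n - 1)) • lmul A g (om A 0 1) (lmul A g (om A 1 j.succ.succ) m) :=
      fun j m => om_om _ _ _ _ _
    rw [tw_s_mul _ _ hy, map_smul, lsmul_apply, map_smul, phi_mul₂ k hy, ih hx, T2, ih hyx,
      ihl, phi_mul₂ k hy, R2, phi_mul₂ k hxy, phi_mul₂ k hy]
    simp only [T3, ihl, R3, phi_mul₂ k hy]
    rw [hbr]
    have d1 := fun m => delta_delta (A := A) (U := Fin (k + 2)) 1 0 hx hy m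
    have d2 := fun w w' m => delta_lmul (A := A) (U := Fin (k + 2)) 1 hx (om_mem A w w') m
    have d3 := fun w w' m => delta_lmul (A := A) (U := Fin (k + 2)) 0 hy (om_mem A w w') m
    have d4 := fun m => (lmul_om_delta (A := A) (U := Fin (k + 2)) 0 1 hx m).symm
    have d5 := fun m => (lmul_om_delta (A := A) (U := Fin (k + 2)) 0 1 hxy m).symm
    simp only [map_add, map_sum, map_smul, map_neg, lneg_apply, lsmul_apply,
      smul_add, smul_neg, smul_sum, smul_smul, hz, hz', smul_zero, sum_add_distrib]
    simp only [hc, e3, e4]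
    clear ih ihl hc T2 T3 R2 R3 e2 e3 e4
    simp only [d1, d2, d3, smul_add, sum_add_distrib, smul_smul]
    simp only [har, h10, h01, d4, d5, smul_add, smul_neg, smul_sub, map_neg, map_smul, neg_neg, smul_smul, neg_zero, Finset.sum_const_zero, add_zero, zero_add]
    simp only [smul_ite, smul_zero, Finset.sum_ite_eq, mem_univ, if_true, sum_add_distrib, sum_sub_distrib, sum_neg_distrib]
    have ax : g.ad (n - 1) x (tw (g.sgr (n - 1)) l X) =
        sg K (i * l) • tw (g.sgr (n - 1)) l (g.ad (n - 1) x X) := by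
      rw [tw_ad _ hx, smul_smul, mul_comm l i, sg_mul_self, one_smul]
    have ay : g.ad (n - 1) y (tw (g.sgr (n - 1)) i Y) =
        sg K (i * l) • tw (g.sgr (n - 1)) i (g.ad (n - 1) y Y) := by
      rw [tw_ad _ hy, smul_smul, sg_mul_self, one_smul]
    have har' : ∀ (j : Fin k) (m : Mix A g (Fin (k + 2))),
        lmul A g (om A 0 j.succ.succ) (lmul A g (om A 0 1) m) = -(sg K ((n - 1) * (n - 1)) •
          (lmul A g (om A 0 j.succ.succ) (lmul A g (om A 1 j.succ.succ) m) -
            lmul A g (om A 0 1) (lmul A g (om A 1 j.succ.succ) m))) := by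
      intro j m
      have h := har j m
      rw [h10] at h
      rw [om_om, ← smul_neg]
      congr 1
      have h2 := congrArg (fun z => sg K (n - 1) • z) h
      simp only [smul_neg, smul_smul, sg_mul_self, one_smul] at h2
      rw [← h2, neg_neg]
    have f1 : sg K ((i - (n - 1)) * (l - (n - 1))) =
        sg K (i * l) * sg K (i * (n - 1)) * sg K (l * (n - 1)) * sg K ((n - 1) * (n - 1)) := by
      simp only [← sg_add]
      exact sg_congr ⟨i * l + (n - 1) * (n - 1), by ring⟩
    have f2 : sg K ((i - (n - 1)) * (n - 1)) = sg K (i * (n - 1)) * sg K ((n - 1) * (n - 1)) := by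
      rw [← sg_add]; exact sg_congr ⟨i * (n - 1), by ring⟩
    have f3 : sg K ((l - (n - 1)) * (n - 1)) = sg K (l * (n - 1)) * sg K ((n - 1) * (n - 1)) := by
      rw [← sg_add]; exact sg_congr ⟨l * (n - 1), by ring⟩
    have f4 : sg K (i * (l - (n - 1))) = sg K (i * l) * sg K (i * (n - 1)) := by
      rw [← sg_add]; exact sg_congr ⟨i * l, by ring⟩
    have f5 : sg K (l * (i - (n - 1))) = sg K (i * l) * sg K (l * (n - 1)) := by
      rw [← sg_add]; exact sg_congr ⟨i * l, by ring⟩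
    have f6 : sg K ((n - 1) * (n - 1)) = sg K (n - 1) := by
      obtain ⟨r, hr⟩ := Int.even_mul_succ_self ((n : ℤ) - 1)
      exact sg_congr ⟨r, by linear_combination hr⟩
    rw [mul_comm ((n : ℤ) - 1) i, mul_comm ((n : ℤ) - 1) l, add_comm l i]
    simp only [d5, ax, ay, map_smul, lsmul_apply, har', f1, f2, f3, f4, f5, sg_add, f6,
      smul_add, smul_neg, smul_sub, sum_neg_distrib, sum_sub_distrib, smul_smul]
    have q1 := sg_mul_self (K := K) (i * l)
    have q2 := sg_mul_self (K := K) (i * (n - 1))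
    have q3 := sg_mul_self (K := K) (l * (n - 1))
    have q4 := sg_mul_self (K := K) (n - 1)
    generalize sg K (i * l) = c1 at *
    generalize sg K (i * (n - 1)) = c2 at *
    generalize sg K (l * (n - 1)) = c3 at *
    generalize sg K (n - 1) = c4 at *
    have w : ∀ {a : K}, a * a = 1 → ∀ b, a * (a * b) = b := fun h b => by rw [← mul_assoc, h, one_mul]
    simp only [mul_assoc, mul_comm, mul_left_comm, q1, q2, q3, q4, w q1, w q2, w q3, w q4, one_smul, mul_one]
    rw [sum_comm]
    abel

end Slot

section Swap

variable {K : Type u} [Field K] {n : ℕ} {A : PDCDGA K n} {g : DGLie K}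

variable (g) in
/-- The braiding on tensor powers of the symmetric algebra. -/
def spBraid (N : ℤ) (k : ℕ) : g.Sym N →ₗ[K] g.Sym N →ₗ[K] SPow g N k →ₗ[K] SPow g N (k + 2) :=
  braid (g.symPois N) k

lemma spBraid_apply (N : ℤ) (k : ℕ) {i j : ℤ} {X Y : g.Sym N} (hX : X ∈ g.sgr N i)
    (hY : Y ∈ g.sgr N j) (t : SPow g N k) :
    spBraid g N k X Y t = sg K (i * j) • tcons (k + 1) Y (tcons k X t) :=
  braid_apply (B := g.symPois N) k hX hY t

variable (g) in
/-- The transpositions on tensor powers of the symmetric algebra. -/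
def spSwap (N : ℤ) (k : ℕ) (i : Fin k) : SPow g N (k + 1) →ₗ[K] SPow g N (k + 1) :=
  tswap (g.symPois N) k i

lemma spSwap_zero (N : ℤ) (k : ℕ) (X Y : g.Sym N) (t : SPow g N k) :
    spSwap g N (k + 1) 0 (tcons (k + 1) X (tcons k Y t)) = spBraid g N k X Y t :=
  tswap_zero (g.symPois N) k X Y t

lemma spSwap_succ (N : ℤ) (k : ℕ) (i : Fin k) (X : g.Sym N) (t : SPow g N (k + 1)) :
    spSwap g N (k + 1) i.succ (tcons (k + 1) X t) = tcons (k + 1) X (spSwap g N k i t) :=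
  tswap_succ (g.symPois N) k i X t

lemma spSwap_adSlot (N : ℤ) (k : ℕ) (i : Fin k) {p : ℤ} {x : g.V} (hx : x ∈ g.gr p)
    (j : Fin (k + 1)) (t : SPow g N (k + 1)) :
    spSwap g N k i (adSlot g N (k + 1) p j x t) =
      adSlot g N (k + 1) p (eswap i.castSucc i.succ j) x (spSwap g N k i t) :=
  tswap_slotOp (B := g.symPois N) k i (fun h => by
    have := (g.isDer_ad N hx).mem h
    rwa [add_comm] at this ⊢) j t

/-- The injection which misses `1`. -/
def missOne (k : ℕ) : Fin (k + 1) → Fin (k + 2) := Fin.cons 0 fun j => j.succ.succ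

lemma missOne_inj (k : ℕ) : Injective (missOne k) := by
  intro a b
  refine Fin.cases (Fin.cases (fun _ => rfl) (fun b h => ?_) b) (fun a => Fin.cases (fun h => ?_)
    (fun b h => ?_) b) a
  · exact absurd (show b.succ.succ = 0 from h.symm) (Fin.succ_ne_zero _)
  · exact absurd (show a.succ.succ = 0 from h) (Fin.succ_ne_zero _)
  · rw [Fin.succ_inj.mp (Fin.succ_inj.mp h)]

lemma mmap_push_push {U V W : Type} (e : U → V) (he : e.Injective) (e' : V → W) (he' : e'.Injective)
    (m : Mix A g U) : mmap g (LS.push A e' he') (mmap g (LS.push A e he) m) =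
      mmap g (LS.push A (e' ∘ e) (he'.comp he)) m := by
  induction m using induction_on with
  | zero => simp
  | add x y hx hy => simp only [map_add, hx, hy]
  | tmul y e => simp only [mmap_tmul, push_push]

lemma mmap_push_congr {U V : Type} {e e' : U → V} (he : e.Injective) (he' : e'.Injective)
    (h : ∀ u, e u = e' u) (m : Mix A g U) :
    mmap g (LS.push A e he) m = mmap g (LS.push A e' he') m := by
  obtain rfl : e = e' := funext h
  rfl

lemma phi_one₂ (k : ℕ) (X : g.Sym (n - 1)) (t : SPow g (n - 1) k) :
    phi A g (k + 2) (tcons (k + 1) X (tcons k 1 t)) =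
      mmap g (LS.push A (missOne k) (missOne_inj k)) (phi A g (k + 1) (tcons k X t)) := by
  induction X using g.sym_induction (n - 1) generalizing t with
  | h1 =>
    rw [phi_one, phi_one, mmap_push_push, mmap_push_push]
    exact mmap_push_congr _ _ (fun j => rfl) _
  | hadd x y hx hy => simp only [map_add, ladd_apply, hx, hy]
  | hsmul c x hx => simp only [map_smul, lsmul_apply, hx]
  | hmul i x hx j y hy ih =>
    have ih' : ∀ t, phi A g (k + 2) (tcons (k + 1) (tw (g.sgr (n - 1)) i y) (tcons k 1 t)) =
      mmap g (LS.push A (missOne k) (missOne_inj k)) (phi A g (k + 1)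
        (tcons k (tw (g.sgr (n - 1)) i y) t)) := by
      intro t
      rw [tw_of_mem _ i hy]
      simp only [map_smul, lsmul_apply, ih]
    rw [phi_mul₂ k hx, ad_one hx, phi_mul k hx, map_add,
      mmap_delta (push_mem _ _) (fun a => push_io _ _ _ _)]
    simp only [map_zero, lzero_apply, zero_add, map_sum, mmap_lmul, push_om, tw_one, ih',
      ih]
    rfl

lemma phi_braid (k : ℕ) (X Y : g.Sym (n - 1)) (t : SPow g (n - 1) k) :
    phi A g (k + 2) (spBraid g (n - 1) k X Y t) =
      mmap g (LS.push A (eswap 0 1) (eswap 0 1).injective)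
        (phi A g (k + 2) (tcons (k + 1) X (tcons k Y t))) := by
  have h01 : (1 : Fin (k + 2)) = (0 : Fin (k + 1)).succ := rfl
  induction X using g.sym_induction (n - 1) generalizing Y t with
  | h1 =>
    have h : spBraid g (n - 1) k 1 Y t = tcons (k + 1) Y (tcons k 1 t) := by
      induction Y using inductionOn (g.sgr (n - 1)) with
      | zero => simp
      | add x y hx hy => simp only [map_add, ladd_apply, hx, hy]
      | @homogeneous j Y =>
        rw [spBraid_apply (n - 1) k (gone_mem (A := g.sgr (n - 1))) Y.2, zero_mul,
          sg_zero, one_smul]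
    rw [h, phi_one₂, phi_one, mmap_push_push]
    refine mmap_push_congr _ _ (fun j => ?_) _
    refine Fin.cases ?_ (fun j => ?_) j
    · exact (eswap_right 0 1).symm
    · change j.succ.succ = eswap 0 1 j.succ.succ
      refine (eswap_ne (Fin.succ_ne_zero _) ?_).symm
      rw [h01, Ne, Fin.succ_inj]
      exact Fin.succ_ne_zero _
  | hadd x y hx hy => simp only [map_add, ladd_apply, hx, hy]
  | hsmul c x hx => simp only [map_smul, lsmul_apply, hx]
  | hmul i x hx r X hX ih =>
    induction Y using inductionOn (g.sgr (n - 1)) with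
    | zero => simp
    | add x y hx hy => simp only [map_add, ladd_apply, hx, hy]
    | @homogeneous q Y =>
    obtain ⟨Y, hY⟩ := Y
    have hsX : g.s (n - 1) x * X ∈ g.sgr (n - 1) (i - (n - 1) + r) :=
      gmul_mem (g.s_mem (n - 1) hx) hX
    have hxY : g.ad (n - 1) x Y ∈ g.sgr (n - 1) (i + q) := by
      rw [add_comm]; exact (g.isDer_ad (n - 1) hx).mem hY
    have hs := phi_slot (A := A) k hx Y X t
    rw [tw_of_mem _ _ hY] at hs
    have hj : ∀ j : Fin k, eswap (0 : Fin (k + 2)) 1 j.succ.succ = j.succ.succ := by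
      intro j
      refine eswap_ne (Fin.succ_ne_zero _) ?_
      rw [h01, Ne, Fin.succ_inj]
      exact Fin.succ_ne_zero _
    have hs' := congrArg (fun m => sg K ((i - (n - 1)) * q) • m) hs
    simp only [map_smul, lsmul_apply, smul_smul, sg_mul_self, one_smul] at hs'
    rw [spBraid_apply (n - 1) k hsX hY, map_smul, hs', phi_mul₂ k hx, map_add,
      mmap_delta (push_mem _ _) (fun a => push_io _ _ _ _), ← ih]
    simp only [map_add, map_sum, mmap_lmul, push_om, tw_of_mem _ i hX, tw_of_mem _ i hY, map_smul,
      lsmul_apply, ← ih, eswap_left, eswap_right, hj]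
    rw [spBraid_apply (n - 1) k hX hY, spBraid_apply (n - 1) k hX hxY]
    simp only [spBraid_apply (n - 1) k hX hY, map_smul, smul_add, smul_smul, ← sg_add,
      smul_sum]
    congr 1
    · congr 1
      exact sg_congr ⟨(i - (n - 1)) * q + r * q, by ring⟩
    · congr 1
      · congr 1
        exact sg_congr ⟨(i - (n - 1)) * q + r * q + i * r, by ring⟩
      · refine sum_congr rfl fun j _ => ?_
        congr 1
        exact sg_congr ⟨(i - (n - 1)) * q + r * q + i * r + i * q, by ring⟩

lemma phi_swap (k : ℕ) (i : Fin k) (t : SPow g (n - 1) (k + 1)) :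
    phi A g (k + 1) (spSwap g (n - 1) k i t) =
      mmap g (LS.push A (eswap i.castSucc i.succ) (eswap i.castSucc i.succ).injective)
        (phi A g (k + 1) t) := by
  induction k with
  | zero => exact i.elim0
  | succ k ih =>
    induction t using tcons_induction with
    | hadd x y hx hy => simp only [map_add, hx, hy]
    | h X t =>
    refine Fin.cases ?_ (fun i => ?_) i
    · induction t using tcons_induction with
      | hadd x y hx hy => simp only [map_add, hx, hy]
      | h Y t =>
        rw [spSwap_zero, phi_braid]
        rfl
    · rw [spSwap_succ]
      have h0 : eswap i.succ.castSucc i.succ.succ 0 = 0 := by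
        refine eswap_ne ?_ ?_ <;> simp [Fin.ext_iff]
      have hj : ∀ j : Fin (k + 1), eswap i.succ.castSucc i.succ.succ j.succ =
          (eswap i.castSucc i.succ j).succ := fun j => by
        rw [← Fin.succ_castSucc, swap_succ_succ]
      induction X using g.sym_induction (n - 1) generalizing t with
      | h1 =>
        rw [phi_one, ih, phi_one, mmap_push_push, mmap_push_push]
        exact mmap_push_congr _ _ (fun j => (hj j).symm) _
      | hadd x y hx hy => simp only [map_add, ladd_apply, hx, hy]
      | hsmul c x hx => simp only [map_smul, lsmul_apply, hx]
      | hmul l x hx r X hX ih2 =>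
        have ih' : ∀ t, phi A g (k + 2) (tcons (k + 1) (tw (g.sgr (n - 1)) l X)
            (spSwap g (n - 1) k i t)) =
            mmap g (LS.push A (eswap i.succ.castSucc i.succ.succ)
              (eswap i.succ.castSucc i.succ.succ).injective) (phi A g (k + 2)
              (tcons (k + 1) (tw (g.sgr (n - 1)) l X) t)) := by
          intro t
          rw [tw_of_mem _ l hX]
          simp only [map_smul, lsmul_apply, ih2]
        rw [phi_mul (k + 1) hx, phi_mul (k + 1) hx, ih2, map_add,
          mmap_delta (push_mem _ _) (fun a => (push_io _ _ _ _).trans (by rw [h0])), map_sum]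
        congr 1
        rw [← Equiv.sum_comp (eswap i.castSucc i.succ)]
        refine sum_congr rfl fun j _ => ?_
        rw [mmap_lmul, push_om, h0, hj, ← ih', spSwap_adSlot (n - 1) k i hx]

end Swap

section Collapse

variable {K : Type u} [Field K] {n : ℕ} (A : PDCDGA K n) {g : DGLie K} {U V : Type}

/-- The morphism of algebras induced by any map of finite sets, which sends `ω_vw` to `0` if `v`
and `w` have the same image. -/
def lsMap (e : U → V) : LS A U →ₐ[K] LS A V :=
  LSMap.map
  { p := fun v => io A (e v)
    w := fun v w => om A (e v) (e w)
    one := fun v => io_one A _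
    mul := fun v _ _ a b _ _ => io_mul A _ a b
    comm := fun v v' _ _ _ _ ha hb => ls_comm A (io_mem A _ ha) (io_mem A _ hb)
    comm' := fun v x y _ _ ha => ls_comm A (io_mem A _ ha) (om_mem A _ _)
    comm'' := fun _ _ _ _ => ls_comm A (om_mem A _ _) (om_mem A _ _)
    diag := fun _ => om_diag A _
    symm := fun _ _ => om_symm A _ _
    sq := fun _ _ => om_sq A _ _
    arnold := fun _ _ _ _ _ _ => om_arnold A _ _ _
    slide := fun _ _ _ a _ => io_om A _ _ a }

lemma lsMap_io (e : U → V) (v : U) (a : A.A) : lsMap A e (io A v a) = io A (e v) a :=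
  LSMap.map_io _ v a

lemma lsMap_om (e : U → V) (v w : U) : lsMap A e (om A v w) = om A (e v) (e w) :=
  LSMap.map_om _ v w

lemma lsMap_mem (e : U → V) (i : ℤ) (z : LS A U) (hz : z ∈ lgr A U i) : lsMap A e z ∈ lgr A V i := by
  refine hom_mem_of_gen (fun v i a ha => ?_) (fun v w => ?_) hz
  · rw [lsMap_io]; exact io_mem A _ ha
  · rw [lsMap_om]; exact om_mem A _ _

/-- The coefficient of `1` in the cocomposition. -/
def c0 (k : ℕ) : LS A (Fin (k + 2)) →ₐ[K] LS A (Fin (k + 1)) := lsMap A (collapse k)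

/-- The coefficient of `ω_01` in the cocomposition. -/
def c1 (k : ℕ) : LS A (Fin (k + 2)) →ₗ[K] LS A (Fin (k + 1)) :=
  (LinearMap.proj (1 : Fin 2) ∘ₗ LinearMap.proj (0 : Fin 2)) ∘ₗ (cocomp A k).toLinearMap

lemma cocomp_io (k : ℕ) (v : Fin (k + 2)) (a : A.A) :
    cocomp A k (io A v a) = eMat A (n - 1) (io A (collapse k v) a) 0 := LSMap.map_io _ v a

lemma cocomp_om (k : ℕ) (v w : Fin (k + 2)) :
    cocomp A k (om A v w) = eMat A (n - 1) (om A (collapse k v) (collapse k w))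
      (algebraMap K _ (thetaCoeff K n k v w)) := LSMap.map_om _ v w

lemma eMat_inj {N : ℤ} {x y x' y' : LS A U} (h : eMat A N x y = eMat A N x' y') :
    x = x' ∧ y = y' :=
  ⟨congrFun (congrFun h 0) 0, congrFun (congrFun h 0) 1⟩

lemma cocomp_eq (k : ℕ) (z : LS A (Fin (k + 2))) :
    cocomp A k z = eMat A (n - 1) (c0 A k z) (c1 A k z) := by
  have h : ∀ {z x y}, cocomp A k z = eMat A (n - 1) x y → c0 A k z = x →
      cocomp A k z = eMat A (n - 1) (c0 A k z) (c1 A k z) := by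
    intro z x y h h'
    have : c1 A k z = y := congrFun (congrFun h 0) 1
    rw [h, this, h']
  induction z using (lsPres A (Fin (k + 2))).induction with
  | h1 => exact h ((map_one _).trans (eMat_one A (n - 1)).symm) (map_one _)
  | hadd x y hx hy =>
    exact h (by rw [map_add, hx, hy, eMat_add]) (map_add _ _ _)
  | hsmul c x hx => exact h (by rw [map_smul, hx, eMat_smul]) (map_smul _ _ _)
  | hmul s y hy =>
    cases s with
    | pt v i a =>
      rw [gen_pt]
      exact h (by rw [map_mul, hy, cocomp_io, eMat_mul]) (by rw [map_mul, c0, lsMap_io])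
    | om v w =>
      rw [gen_om]
      exact h (by rw [map_mul, hy, cocomp_om, eMat_mul]) (by rw [map_mul, c0, lsMap_om])

lemma c1_one (k : ℕ) : c1 A k 1 = 0 := by
  have := (cocomp_eq A k 1).symm.trans ((map_one (cocomp A k)).trans (eMat_one A (n - 1)).symm)
  exact (eMat_inj A this).2

lemma c1_mul (k : ℕ) (z z' : LS A (Fin (k + 2))) : c1 A k (z * z') =
    c0 A k z * c1 A k z' + c1 A k z * tw (lgr A (Fin (k + 1))) (n - 1) (c0 A k z') := by
  have h := cocomp_eq A k (z * z')
  rw [map_mul, cocomp_eq, cocomp_eq A k z', eMat_mul] at h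
  exact (eMat_inj A h).2.symm

lemma c1_io (k : ℕ) (v : Fin (k + 2)) (a : A.A) : c1 A k (io A v a) = 0 := by
  have h := cocomp_eq A k (io A v a)
  rw [cocomp_io] at h
  exact (eMat_inj A h).2.symm

lemma c1_om (k : ℕ) (v w : Fin (k + 2)) :
    c1 A k (om A v w) = algebraMap K _ (thetaCoeff K n k v w) := by
  have h := cocomp_eq A k (om A v w)
  rw [cocomp_om] at h
  exact (eMat_inj A h).2.symm

lemma c1_mem (k : ℕ) {i : ℤ} {z : LS A (Fin (k + 2))} (hz : z ∈ lgr A (Fin (k + 2)) i) :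
    c1 A k z ∈ lgr A (Fin (k + 1)) (i - (n - 1)) := by
  refine map_mem_of_mem_span (fun x hx => ?_) hz
  obtain ⟨l, rfl, rfl⟩ := hx
  clear hz
  induction l with
  | nil => simp [c1_one]
  | cons a l ih =>
    simp only [List.map_cons, List.prod_cons, List.sum_cons]
    rw [c1_mul]
    refine add_mem ?_ ?_
    · rw [add_sub_assoc]
      exact gmul_mem (lsMap_mem A _ _ _ ((lsPres A _).gen_mem a)) ih
    · have hw := lsMap_mem A (collapse k) _ _ ((lsPres A (Fin (k + 2))).word_mem l)
      cases a with
      | pt v i a => rw [gen_pt, c1_io, zero_mul]; exact zero_mem _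
      | om v w =>
        rw [gen_om, c1_om, c0, tw_of_mem (lgr A (Fin (k + 1))) _ hw, ← Algebra.smul_def]
        refine smul_mem _ _ (smul_mem _ _ ?_)
        have : (lsPres A (Fin (k + 2))).deg (.om v w) = (n : ℤ) - 1 := rfl
        have e : ∀ a : ℤ, (lsPres A (Fin (k + 2))).deg (.om v w) + a - (n - 1) = a := fun a => by
          rw [this, add_sub_cancel_left]
        erw [e]
        exact hw

lemma c1_tw (k : ℕ) (p : ℤ) (z : LS A (Fin (k + 2))) : c1 A k (tw (lgr A (Fin (k + 2))) p z) =
    sg K (p * (n - 1)) • tw (lgr A (Fin (k + 1))) p (c1 A k z) := by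
  have h : c1 A k ∘ₗ tw (lgr A (Fin (k + 2))) p =
      sg K (p * (n - 1)) • (tw (lgr A (Fin (k + 1))) p ∘ₗ c1 A k) := by
    refine ghom_ext (gr := lgr A (Fin (k + 2))) fun i a ha => ?_
    simp only [comp_apply, lsmul_apply]
    rw [tw_of_mem (lgr A (Fin (k + 2))) p ha, tw_of_mem (lgr A (Fin (k + 1))) p (c1_mem A k ha),
      map_smul, smul_smul, ← sg_add]
    congr 1
    exact sg_congr ⟨p * i, by ring⟩
  exact lcongr_fun h z

lemma c0_push (k : ℕ) (z : LS A (Fin (k + 1))) :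
    c0 A k (LS.push A Fin.succ (fsucc_inj _) z) = z := by
  have : (c0 A k).comp (LS.push A Fin.succ (fsucc_inj _)) = AlgHom.id K _ := by
    apply ls_hom_ext
    · intro v a
      rw [AlgHom.comp_apply, push_io, c0, lsMap_io]; rfl
    · intro v w
      rw [AlgHom.comp_apply, push_om, c0, lsMap_om]; rfl
  exact DFunLike.congr_fun this z

lemma c1_push (k : ℕ) (z : LS A (Fin (k + 1))) :
    c1 A k (LS.push A Fin.succ (fsucc_inj _) z) = 0 := by
  induction z using (lsPres A (Fin (k + 1))).induction with
  | h1 => rw [map_one, c1_one]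
  | hadd x y hx hy => rw [map_add, map_add, hx, hy, add_zero]
  | hsmul c x hx => rw [map_smul, map_smul, hx, smul_zero]
  | hmul s y hy =>
    rw [map_mul, c1_mul, hy, mul_zero, zero_add]
    cases s with
    | pt v i a => rw [gen_pt, push_io, c1_io, zero_mul]
    | om v w =>
      have : thetaCoeff K n k v.succ w.succ = 0 := by
        simp [thetaCoeff]
      rw [gen_om, push_om, c1_om, this, map_zero, zero_mul]

lemma mmap_c0_delta (k : ℕ) (i : ℤ) (x : g.V) (m : Mix A g (Fin (k + 2))) :
    mmap g (c0 A k) (delta A g 0 i x m) = delta A g 0 i x (mmap g (c0 A k) m) :=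
  mmap_delta (lsMap_mem A (collapse k)) (lsMap_io A (collapse k) 0) i x m

lemma phi_c0 (k : ℕ) (X Y : g.Sym (n - 1)) (t : SPow g (n - 1) k) :
    mmap g (c0 A k) (phi A g (k + 2) (tcons (k + 1) X (tcons k Y t))) =
      phi A g (k + 1) (tcons k (X * Y) t) := by
  have h0 : c0 A k (om A 0 1) = 0 := by
    rw [c0, lsMap_om]; exact om_diag A _
  have hj : ∀ j : Fin k, c0 A k (om A 0 j.succ.succ) = om A 0 j.succ := fun j => by
    rw [c0, lsMap_om]; rfl
  induction X using g.sym_induction (n - 1) generalizing Y t with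
  | h1 =>
    rw [phi_one, one_mul]
    induction phi A g (k + 1) (tcons k Y t) using induction_on with
    | zero => simp
    | add x y hx hy => rw [map_add, map_add, hx, hy]
    | tmul z c => rw [mmap_tmul, mmap_tmul, c0_push]
  | hadd x y hx hy => simp only [map_add, ladd_apply, add_mul, hx, hy]
  | hsmul c x hx => simp only [map_smul, lsmul_apply, smul_mul_assoc, hx]
  | hmul i x hx j y hy ih =>
    have ih' : ∀ Y t, mmap g (c0 A k) (phi A g (k + 2) (tcons (k + 1) (tw (g.sgr (n - 1)) i y)
        (tcons k Y t))) = phi A g (k + 1) (tcons k (tw (g.sgr (n - 1)) i y * Y) t) := by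
      intro Y t
      rw [tw_of_mem _ i hy]
      simp only [map_smul, lsmul_apply, smul_mul_assoc, ih]
    rw [phi_mul₂ k hx, mul_assoc, phi_mul k hx, map_add,
      mmap_c0_delta]
    simp only [map_add, map_sum, mmap_lmul, h0, hj, map_zero, lzero_apply, zero_add, ih,
      ih', tw_mul]

variable (g) in
/-- The action of the coefficient of `ω_01` in the cocomposition, with the sign which appears in
the definition of the right module. -/
def cbr (k : ℕ) : Mix A g (Fin (k + 2)) →ₗ[K] Mix A g (Fin (k + 1)) :=
  tmap (tw (lgr A (Fin (k + 1))) (n - 1) ∘ₗ c1 A k) lid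

lemma cbr_tmul (k : ℕ) (z : LS A (Fin (k + 2))) (c : CEAlg A g) : cbr A g k (z ⊗ₜ c) =
    tw (lgr A (Fin (k + 1))) (n - 1) (c1 A k z) ⊗ₜ c := rfl

lemma cbr_lmul (k : ℕ) {z : LS A (Fin (k + 2))} (hz : c1 A k z = 0) (m : Mix A g (Fin (k + 2))) :
    cbr A g k (lmul A g z m) =
      lmul A g (tw (lgr A (Fin (k + 1))) (n - 1) (c0 A k z)) (cbr A g k m) := by
  induction m using induction_on with
  | zero => simp
  | add x y hx hy => simp only [map_add, hx, hy]
  | tmul y c => rw [lmul_tmul, cbr_tmul, cbr_tmul, c1_mul, hz, zero_mul, add_zero, lmul_tmul, tw_mul]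

lemma cbr_om (k : ℕ) (m : Mix A g (Fin (k + 2))) :
    cbr A g k (lmul A g (om A 0 1) m) = mmap g (c0 A k) m := by
  induction m using induction_on with
  | zero => simp
  | add x y hx hy => simp only [map_add, hx, hy]
  | tmul y c =>
    have h1 : c1 A k (om A 0 1) = 1 := by
      rw [c1_om, thetaCoeff, if_pos ⟨rfl, rfl⟩, map_one]
    have h0 : c0 A k (om A 0 1) = 0 := by
      rw [c0, lsMap_om]; exact om_diag A _
    rw [lmul_tmul, cbr_tmul, c1_mul, h1, h0, zero_mul, zero_add, one_mul, tw_tw, mmap_tmul]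

lemma cbr_delta (k : ℕ) (v : Fin (k + 2)) {i : ℤ} {x : g.V} (hx : x ∈ g.gr i)
    (m : Mix A g (Fin (k + 2))) : cbr A g k (delta A g v i x m) =
      sg K ((n - 1) * (i - (n - 1))) • delta A g (collapse k v) i x (cbr A g k m) := by
  simp only [delta_apply, map_neg, map_sum, smul_neg, smul_sum]
  congr 1
  refine sum_congr rfl fun s _ => ?_
  induction m using induction_on with
  | zero => simp
  | add x y hx hy => simp only [map_add, smul_add, hx, hy]
  | tmul y c =>
    rw [mulOp_tmul, cbr_tmul, cbr_tmul, mulOp_tmul, c1_mul, c1_io, zero_mul, add_zero, c1_tw, c0,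
      lsMap_io, tw_mul, map_smul, tw_io A _ _ (A.basis_mem s), tw_comm_tw, smul_mul_assoc,
      mul_smul_comm, smul_smul, ← sg_add, smul_tmul']
    congr 2
    exact sg_congr ⟨(n - 1) * i - (n - 1) * (n - 1) + (n - 1) * s.1, by ring⟩

lemma tw_symBr (N p : ℤ) (X Y : g.Sym N) : tw (g.sgr N) p (g.symBr N X Y) =
    sg K (p * N) • g.symBr N (tw (g.sgr N) p X) (tw (g.sgr N) p Y) := by
  induction X using inductionOn (g.sgr N) with
  | zero => simp
  | add x y hx hy => simp only [map_add, ladd_apply, hx, hy, smul_add]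
  | @homogeneous j X =>
    rw [tw_isDer (g.isDer_symBr N X.2), tw_of_mem _ p X.2, map_smul, lsmul_apply, smul_smul,
      mul_add, sg_add, mul_comm]

lemma symBr_one_left (N : ℤ) (Y : g.Sym N) : g.symBr N 1 Y = 0 := by
  have h := g.symBr_mul_left N (gone_mem (A := g.sgr N))
    (gone_mem (A := g.sgr N)) Y
  simpa [sg_zero] using h

lemma phi_cbr (k : ℕ) (X Y : g.Sym (n - 1)) (t : SPow g (n - 1) k) :
    cbr A g k (phi A g (k + 2) (tcons (k + 1) X (tcons k Y t))) =
      phi A g (k + 1) (tcons k (g.symBr (n - 1) X Y) t) := by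
  have hj : ∀ j : Fin k, c1 A k (om A 0 j.succ.succ) = 0 := fun j => by
    have h1 : thetaCoeff K n k 0 j.succ.succ = 0 := by
      have : j.succ.succ ≠ (1 : Fin (k + 2)) := by
        rw [← fsucc_zero, Ne, Fin.succ_inj]; exact Fin.succ_ne_zero _
      simp [thetaCoeff, this]
    rw [c1_om, h1, map_zero]
  have hj' : ∀ j : Fin k, c0 A k (om A 0 j.succ.succ) = om A 0 j.succ := fun j => by
    rw [c0, lsMap_om]; rfl
  induction X using g.sym_induction (n - 1) generalizing Y t with
  | h1 =>
    rw [phi_one, symBr_one_left, map_zero, lzero_apply, map_zero]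
    induction phi A g (k + 1) (tcons k Y t) using induction_on with
    | zero => simp
    | add x y hx hy => rw [map_add, map_add, hx, hy, add_zero]
    | tmul z c => rw [mmap_tmul, cbr_tmul, c1_push, map_zero, zero_tmul]
  | hadd x y hx hy => simp only [map_add, ladd_apply, hx, hy]
  | hsmul c x hx => simp only [map_smul, lsmul_apply, hx]
  | hmul i x hx r y hy ih =>
    have ih' : ∀ Y t, cbr A g k (phi A g (k + 2) (tcons (k + 1) (tw (g.sgr (n - 1)) i y)
        (tcons k Y t))) = phi A g (k + 1) (tcons k (g.symBr (n - 1) (tw (g.sgr (n - 1)) i y) Y) t) := by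
      intro Y t
      rw [tw_of_mem _ i hy]
      simp only [map_smul, lsmul_apply, ih]
    have hb : g.symBr (n - 1) (g.s (n - 1) x * y) Y =
        sg K ((n - 1) * (i - (n - 1))) • (g.s (n - 1) x * g.symBr (n - 1) y Y) +
          tw (g.sgr (n - 1)) i y * g.ad (n - 1) x Y := by
      rw [g.symBr_mul_left (n - 1) (g.s_mem (n - 1) hx) hy, g.symBr_s (n - 1) hx, tw_of_mem _ i hy,
        smul_mul_assoc]
      congr 2
      exact sg_congr ⟨i * r, by ring⟩
    rw [phi_mul₂ k hx, hb]
    simp only [map_add, map_smul, ladd_apply, lsmul_apply]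
    rw [phi_mul k hx, cbr_delta A k 0 hx, cbr_om, phi_c0, map_sum, ih, tw_symBr, smul_add]
    simp only [cbr_lmul A k (hj _), hj', ih', tw_om, map_smul, lsmul_apply,
      smul_sum, smul_smul, ← sg_add]
    rw [add_assoc, add_comm (phi A g (k + 1) _)]
    congr 2
    refine sum_congr rfl fun j _ => ?_
    congr 1
    exact sg_congr ⟨(n - 1) * i, by ring⟩

end Collapse

section Grading

variable {K : Type u} [Field K] {n : ℕ} {A : PDCDGA K n} {g : DGLie K} {U V : Type}

variable (g) in
/-- The grading of the tensor powers of the symmetric algebra. -/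
def spGr (N : ℤ) (k : ℕ) (m : ℤ) : Submodule K (SPow g N k) :=
  span K {t | ∃ (p : Fin k → ℤ) (b : Fin k → g.Sym N), (∀ j, b j ∈ g.sgr N (p j)) ∧
    ∑ j, p j = m ∧ t = ptprod K b}

lemma spGr_tcons (N : ℤ) (k : ℕ) {i m : ℤ} {X : g.Sym N} {t : SPow g N k} (hX : X ∈ g.sgr N i)
    (ht : t ∈ spGr g N k m) : tcons k X t ∈ spGr g N (k + 1) (i + m) := by
  refine map_mem_of_mem_span (fun x hx => ?_) ht
  obtain ⟨p, b, hb, rfl, rfl⟩ := hx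
  rw [tcons_tprod]
  refine subset_span ⟨Fin.cons i p, _, fun j => ?_, by simp [Fin.sum_univ_succ], rfl⟩
  exact Fin.cases (by simpa using hX) (fun j => by simpa using hb j) j

lemma spGr_le (N : ℤ) (k : ℕ) {m : ℤ} (P : Submodule K (SPow g N (k + 1)))
    (h : ∀ i X l t, X ∈ g.sgr N i → t ∈ spGr g N k l → i + l = m → tcons k X t ∈ P) :
    spGr g N (k + 1) m ≤ P := by
  refine Submodule.span_le.mpr ?_
  rintro _ ⟨p, b, hb, rfl, rfl⟩
  rw [tprod_eq_tcons]
  exact h (p 0) _ (∑ j : Fin k, p j.succ) _ (hb 0)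
    (subset_span ⟨_, _, fun j => hb j.succ, rfl, rfl⟩) (Fin.sum_univ_succ p).symm

lemma adSlot_mem (N : ℤ) (k : ℕ) {i m : ℤ} {x : g.V} (hx : x ∈ g.gr i) (j : Fin k) {t : SPow g N k}
    (ht : t ∈ spGr g N k m) : adSlot g N k i j x t ∈ spGr g N k (i + m) := by
  induction k generalizing m with
  | zero => exact j.elim0
  | succ k ih =>
    refine spGr_le N k ((spGr g N (k + 1) (i + m)).comap (adSlot g N (k + 1) i j x))
      (fun p X l u hX hu hm => ?_) ht
    subst hm
    rw [mem_comap]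
    refine Fin.cases ?_ (fun j => ?_) j
    · rw [adSlot_zero, ← add_assoc, add_comm i]
      exact spGr_tcons N k ((g.isDer_ad N hx).mem hX) hu
    · rw [adSlot_succ, add_left_comm, tw_of_mem _ _ hX, map_smul]
      exact smul_mem _ _ (spGr_tcons N k hX (ih j hu))

variable (A g U) in
/-- The grading of `G_A(U) ⊗ C(A ⊗ g)`. -/
def mixGr (m : ℤ) : Submodule K (Mix A g U) :=
  span K {t | ∃ (a b : ℤ), b - a = m ∧ ∃ z ∈ lgr A U a, ∃ c ∈ cgr A g b, t = z ⊗ₜ c}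

lemma mulOp_mem {a b m : ℤ} (q : ℤ) {z : LS A U} {c : CEAlg A g} (hz : z ∈ lgr A U a) (hc : c ∈ cgr A g b)
    {w : Mix A g U} (hw : w ∈ mixGr A g U m) : mulOp A g q z c w ∈ mixGr A g U (b - a + m) := by
  refine map_mem_of_mem_span (fun x hx => ?_) hw
  obtain ⟨a', b', rfl, z', hz', c', hc', rfl⟩ := hx
  rw [mulOp_tmul, tw_of_mem (lgr A U) _ hz']
  exact subset_span ⟨a + a', b + b', by ring, _, gmul_mem hz
    (smul_mem _ _ hz'), _, gmul_mem hc hc', rfl⟩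

lemma lmul_om_mem (v w : U) {m : ℤ} {t : Mix A g U} (ht : t ∈ mixGr A g U m) :
    lmul A g (om A v w) t ∈ mixGr A g U (m - (n - 1)) := by
  have h := mulOp_mem 0 (om_mem A v w) one_mem_cgr ht
  rwa [zero_sub, neg_add_eq_sub] at h

lemma delta_mem (v : U) {i : ℤ} {x : g.V} (hx : x ∈ g.gr i) {m : ℤ} {t : Mix A g U}
    (ht : t ∈ mixGr A g U m) : delta A g v i x t ∈ mixGr A g U (i - (n - 1) + m) := by
  rw [delta_apply]
  refine neg_mem (Submodule.sum_mem _ fun s _ => ?_)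
  have h := mulOp_mem (i - (n - s.1) + 1) (io_mem A v (A.basis_mem s)) (st_mem (A.dbasis_mem s) hx) ht
  rwa [show i - (n - s.1) + 1 - s.1 + m = i - (n - 1) + m by ring] at h

lemma mmap_mem {F : LS A U →ₐ[K] LS A V} (hF : ∀ i z, z ∈ lgr A U i → F z ∈ lgr A V i) {m : ℤ}
    {t : Mix A g U} (ht : t ∈ mixGr A g U m) : mmap g F t ∈ mixGr A g V m := by
  refine map_mem_of_mem_span (fun x hx => ?_) ht
  obtain ⟨a', b', rfl, z', hz', c', hc', rfl⟩ := hx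
  exact subset_span ⟨a', b', rfl, _, hF _ _ hz', _, hc', rfl⟩

lemma sgr_induction (N : ℤ) {q : (i : ℤ) → g.Sym N → Prop} (h1 : q 0 1)
    (hmul : ∀ i x j y, x ∈ g.gr i → y ∈ g.sgr N j → q j y → q (i - N + j) (g.s N x * y))
    (h0 : ∀ i, q i 0) (hadd : ∀ i x y, q i x → q i y → q i (x + y))
    (hsmul : ∀ i (c : K) x, q i x → q i (c • x)) {i : ℤ} {X : g.Sym N} (hX : X ∈ g.sgr N i) :
    q i X := by
  induction hX using span_induction with
  | zero => exact h0 i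
  | add x y _ _ h1 h2 => exact hadd _ _ _ h1 h2
  | smul c x _ h => exact hsmul _ _ _ h
  | mem x hx =>
    obtain ⟨l, rfl, rfl⟩ := hx
    induction l with
    | nil => exact h1
    | cons a l ih =>
      simp only [List.map_cons, List.prod_cons, List.sum_cons]
      have := hmul a.1 a.2 _ _ a.2.2 ((g.symPres N).word_mem l) ih
      rwa [g.s_of_mem N a.2.2] at this

lemma phi_mem (k : ℕ) {m : ℤ} {t : SPow g (n - 1) k} (ht : t ∈ spGr g (n - 1) k m) :
    phi A g k t ∈ mixGr A g (Fin k) m := by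
  induction k generalizing m with
  | zero =>
    refine map_mem_of_mem_span (fun x hx => ?_) ht
    obtain ⟨p, b, hb, rfl, rfl⟩ := hx
    rw [phi_zero]
    exact subset_span ⟨0, 0, by simp, 1, gone_mem, 1, one_mem_cgr, rfl⟩
  | succ k ih =>
    have key : ∀ i X, X ∈ g.sgr (n - 1) i → ∀ l t, t ∈ spGr g (n - 1) k l →
        phi A g (k + 1) (tcons k X t) ∈ mixGr A g (Fin (k + 1)) (i + l) := by
      intro i X hX
      refine sgr_induction (n - 1) (q := fun i X => ∀ l t, t ∈ spGr g (n - 1) k l →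
        phi A g (k + 1) (tcons k X t) ∈ mixGr A g (Fin (k + 1)) (i + l)) ?_ ?_ ?_ ?_ ?_ hX
      · intro l t ht
        rw [phi_one, zero_add]
        exact mmap_mem (push_mem _ _) (ih ht)
      · intro i x j y hx hy h l t ht
        rw [phi_mul k hx]
        refine add_mem ?_ (Submodule.sum_mem _ fun s _ => ?_)
        · rw [add_assoc]
          exact delta_mem 0 hx (h l t ht)
        · have h2 := lmul_om_mem (A := A) (0 : Fin (k + 1)) s.succ
            (h _ _ (adSlot_mem (n - 1) k hx s ht))
          rw [tw_of_mem _ _ hy]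
          simp only [map_smul, lsmul_apply]
          refine smul_mem _ _ ?_
          rwa [show j + (i + l) - ((n : ℤ) - 1) = i - (n - 1) + j + l by ring] at h2
      · intro i l t ht
        simp
      · intro i x y h1 h2 l t ht
        rw [map_add, ladd_apply, map_add]
        exact add_mem (h1 l t ht) (h2 l t ht)
      · intro i c x h l t ht
        rw [map_smul, lsmul_apply, map_smul]
        exact smul_mem _ _ (h l t ht)
    refine spGr_le (n - 1) k ((mixGr A g (Fin (k + 1)) m).comap (phi A g (k + 1)))
      (fun p X l u hX hu hm => ?_) ht
    subst hm
    exact key _ _ hX _ _ hu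

end Grading

section CircPhi

variable {K : Type u} [Field K] {n : ℕ} (A : PDCDGA K n) (g : DGLie K) {U V : Type}

/-- The evaluation of a form on the first factor. -/
def evM : Module.Dual K (LS A U) →ₗ[K] Mix A g U →ₗ[K] CEAlg A g where
  toFun f := (TensorProduct.lid K _).toLinearMap ∘ₗ tmap f lid
  map_add' f f' := by
    apply ext'
    intro z c
    simp [add_smul]
  map_smul' r f := by
    apply ext'
    intro z c
    simp [mul_smul]

variable {A g}

lemma evM_tmul (f : Module.Dual K (LS A U)) (z : LS A U) (c : CEAlg A g) :
    evM A g f (z ⊗ₜ c) = f z • c := by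
  simp [evM]

lemma evM_mmap (F : LS A U →ₐ[K] LS A V) (f : Module.Dual K (LS A V)) (m : Mix A g U) :
    evM A g f (mmap g F m) = evM A g (F.toLinearMap.dualMap f) m := by
  induction m using induction_on with
  | zero => simp
  | add x y hx hy => simp only [map_add, hx, hy]
  | tmul z c => rw [mmap_tmul, evM_tmul, evM_tmul]; rfl

lemma evM_cbr (k : ℕ) (f : LSDual A (k + 1)) (m : Mix A g (Fin (k + 2))) :
    evM A g f (cbr A g k m) = evM A g (actBr A k f) m := by
  induction m using induction_on with
  | zero => simp
  | add x y hx hy => simp only [map_add, hx, hy]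
  | tmul z c => rw [cbr_tmul, evM_tmul, evM_tmul]; rfl

lemma actMul_apply (k : ℕ) (f : LSDual A (k + 1)) (z : LS A (Fin (k + 2))) :
    actMul A k f z = f (c0 A k z) := by
  change f (cocomp A k z 0 0) = _
  rw [cocomp_eq]; rfl

lemma evM_c0 (k : ℕ) (f : LSDual A (k + 1)) (m : Mix A g (Fin (k + 2))) :
    evM A g f (mmap g (c0 A k) m) = evM A g (actMul A k f) m := by
  induction m using induction_on with
  | zero => simp
  | add x y hx hy => simp only [map_add, hx, hy]
  | tmul z c => rw [mmap_tmul, evM_tmul, evM_tmul, actMul_apply]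

lemma evM_mem {k : ℕ} {i m : ℤ} {f : LSDual A k} (hf : f ∈ dgr A k i) {t : Mix A g (Fin k)}
    (ht : t ∈ mixGr A g (Fin k) m) : evM A g f t ∈ cgr A g (i + m) := by
  refine map_mem_of_mem_span (fun x hx => ?_) ht
  obtain ⟨a, b, rfl, z, hz, c, hc, rfl⟩ := hx
  rw [evM_tmul]
  by_cases h : a = i
  · subst h
    rw [add_sub_cancel]
    exact smul_mem _ _ hc
  · rw [hf a h z hz, zero_smul]; exact zero_mem _

variable (A g) in
/-- The map `Φ` on the direct sum. -/
def phiV : CircV A (g.symPois (n - 1)) →ₗ[K] CEAlg A g :=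
  DirectSum.toModule K ℕ _ fun k => TensorProduct.lift ((LinearMap.lcomp K _ (phi A g k)) ∘ₗ evM A g)

lemma phiV_cin (k : ℕ) (f : LSDual A k) (t : SPow g (n - 1) k) :
    phiV A g (cin A (g.symPois (n - 1)) k (f ⊗ₜ t)) = evM A g f (phi A g k t) := by
  rw [phiV, DirectSum.toModule_lof]
  rfl

lemma phiV_circTmul (k : ℕ) (f : LSDual A k) (b : Fin k → g.Sym (n - 1)) :
    phiV A g (circTmul A (g.symPois (n - 1)) k f b) =
      evM A g f (phi A g k (ptprod K b)) := phiV_cin k f _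

lemma evM_dM (hA : A.euler = 0) (k : ℕ) (f : LSDual A k) (t : SPow g (n - 1) k) :
    evM A g (dualD A k f) (phi A g k t) + evM A g (dualS A k f) (phi A g k (spD g (n - 1) k t)) =
      (A.tensor g).ceD (evM A g f (phi A g k t)) := by
  rw [phi_d hA]
  induction phi A g k t using induction_on with
  | zero => simp
  | add x y hx hy =>
    simp only [map_add, ← hx, ← hy]
    abel
  | tmul z c =>
    rw [dM_tmul, map_add, evM_tmul, evM_tmul, evM_tmul, evM_tmul, dualD_apply, dualS_apply,
      dualS_apply, tw_tw, neg_smul, neg_add_cancel_left, map_smul]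

lemma phi_swap_tprod (k : ℕ) (i : Fin k) (b : Fin (k + 1) → g.Sym (n - 1)) (p : Fin (k + 1) → ℤ)
    (hb : ∀ j, b j ∈ g.sgr (n - 1) (p j)) :
    sg K (p i.castSucc * p i.succ) • phi A g (k + 1)
        (ptprod K (b ∘ eswap i.castSucc i.succ)) =
      mmap g (LS.push A (eswap i.castSucc i.succ) (eswap i.castSucc i.succ).injective)
        (phi A g (k + 1) (ptprod K b)) := by
  have h2 : spSwap g (n - 1) k i (ptprod K b) = sg K (p i.castSucc * p i.succ) •
      ptprod K (b ∘ eswap i.castSucc i.succ) :=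
    tswap_tprod (g.symPois (n - 1)) k i b p hb
  rw [← phi_swap, h2, map_smul]

lemma phi_unit_tprod (k : ℕ) (b : Fin k → g.Sym (n - 1)) :
    phi A g (k + 1) (ptprod K (Fin.cons 1 b : Fin (k + 1) → g.Sym (n - 1))) =
      mmap g (LS.push A Fin.succ (fsucc_inj k)) (phi A g k (ptprod K b)) := by
  rw [← tcons_tprod, phi_one]

lemma phi_mul_tprod (k : ℕ) (X Y : g.Sym (n - 1)) (b : Fin k → g.Sym (n - 1)) :
    mmap g (c0 A k) (phi A g (k + 2) (ptprod K (Fin.cons X (Fin.cons Y b :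
      Fin (k + 1) → g.Sym (n - 1)) : Fin (k + 2) → g.Sym (n - 1)))) =
      phi A g (k + 1) (ptprod K (Fin.cons (X * Y) b : Fin (k + 1) → g.Sym (n - 1))) := by
  rw [← tcons_tprod, ← tcons_tprod, ← tcons_tprod, phi_c0]

lemma phi_br_tprod (k : ℕ) (X Y : g.Sym (n - 1)) (b : Fin k → g.Sym (n - 1)) :
    cbr A g k (phi A g (k + 2) (ptprod K (Fin.cons X (Fin.cons Y b :
      Fin (k + 1) → g.Sym (n - 1)) : Fin (k + 2) → g.Sym (n - 1)))) =
      phi A g (k + 1) (ptprod K (Fin.cons (g.symBr (n - 1) X Y) b :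
        Fin (k + 1) → g.Sym (n - 1))) := by
  rw [← tcons_tprod, ← tcons_tprod, ← tcons_tprod, phi_cbr]

lemma phiV_d (hA : A.euler = 0) (t : CircV A (g.symPois (n - 1))) :
    phiV A g (circDV A _ t) = (A.tensor g).ceD (phiV A g t) := by
  have h : phiV A g ∘ₗ circDV A _ = (A.tensor g).ceD ∘ₗ phiV A g := by
    apply linearMap_ext
    intro k
    apply ext'
    intro f t
    change phiV A g (circDV A _ (cin A _ k (f ⊗ₜ t))) = (A.tensor g).ceD (phiV A g (cin A _ k (f ⊗ₜ t)))
    rw [circDV_cin, circDk_tmul, map_add, map_add]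
    refine (congrArg₂ _ (phiV_cin k _ _) (phiV_cin k _ (spD g (n - 1) k t))).trans ?_
    exact (evM_dM hA k f t).trans (congrArg _ (phiV_cin k f t)).symm
  exact lcongr_fun h t

lemma phiV_rel {t : CircV A (g.symPois (n - 1))} (h : CircRel A _ t) : phiV A g t = 0 := by
  cases h with
  | swap k i f b p hb =>
    rw [map_sub, map_smul, sub_eq_zero]
    refine (phiV_circTmul _ _ _).trans (Eq.trans ?_ (congrArg _ (phiV_circTmul _ _ _).symm))
    refine Eq.trans ?_ (map_smul (evM A g f) _ _)
    refine Eq.trans ?_ (congrArg (evM A g f) (phi_swap_tprod k i b p hb).symm)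
    rw [evM_mmap]
    rfl
  | unit k f b =>
    rw [map_sub, sub_eq_zero]
    refine (phiV_circTmul _ _ _).trans (Eq.trans ?_ (phiV_circTmul _ _ _).symm)
    refine Eq.trans ?_ (congrArg (evM A g f) (phi_unit_tprod k b).symm)
    rw [evM_mmap]
    rfl
  | mul k f x y b =>
    rw [map_sub, sub_eq_zero]
    refine (phiV_circTmul _ _ _).trans (Eq.trans ?_ (phiV_circTmul _ _ _).symm)
    exact (evM_c0 k f _).symm.trans (congrArg (evM A g f) (phi_mul_tprod k x y b))
  | br k f x y b =>
    rw [map_sub, sub_eq_zero]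
    refine (phiV_circTmul _ _ _).trans (Eq.trans ?_ (phiV_circTmul _ _ _).symm)
    exact (evM_cbr k f _).symm.trans (congrArg (evM A g f) (phi_br_tprod k x y b))

lemma phiV_mem {m : ℤ} {t : CircV A (g.symPois (n - 1))} (ht : t ∈ circGr A _ m) :
    phiV A g t ∈ cgr A g m := by
  refine map_mem_of_mem_span (fun x hx => ?_) ht
  obtain ⟨k, i, p, rfl, f, hf, b, hb, rfl⟩ := hx
  have := phiV_circTmul (A := A) k f b
  erw [this]
  exact evM_mem hf (phi_mem k (subset_span ⟨p, b, hb, rfl, rfl⟩))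

lemma phiV_sub (hA : A.euler = 0) :
    circSub A (g.symPois (n - 1)) ≤ ker (phiV A g) := by
  have h : span K {t | CircRel A (g.symPois (n - 1)) t} ≤ ker (phiV A g) :=
    Submodule.span_le.mpr fun t ht => phiV_rel ht
  refine sup_le h ?_
  rintro _ ⟨t, ht, rfl⟩
  rw [mem_ker, phiV_d hA, LinearMap.mem_ker.mp (h ht), map_zero]

variable (A g) in
/-- The chain map `Φ`. -/
def circPhi (hA : A.euler = 0) : Cpx.Hom (circ A (g.symPois (n - 1))) (A.tensor g).CE where
  f := (circSub A (g.symPois (n - 1))).liftQ (phiV A g) (phiV_sub hA)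
  mem := by
    rintro i _ ⟨t, ht, rfl⟩
    exact phiV_mem ht
  comm x := by
    obtain ⟨t, rfl⟩ := (circSub A (g.symPois (n - 1))).mkQ_surjective x
    exact phiV_d hA t

end CircPhi

section Slant

variable {K : Type u} [Field K] {n : ℕ} (A : PDCDGA K n)

/-- Push-forward along the successor map. -/
abbrev psucc (k : ℕ) : LS A (Fin k) →ₐ[K] LS A (Fin (k + 1)) :=
  LS.push A Fin.succ (fsucc_inj k)

lemma gen_comm_left {U : Type} {i : ℤ} {g x : LS A U} (hg : g ∈ lgr A U i) (S : Submodule K (LS A U))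
    {j : ℤ} (hx : x ∈ lgr A U j) {y : LS A U} (h : x * (g * y) ∈ S) : g * (x * y) ∈ S := by
  rw [← mul_assoc, ls_comm A hg hx, smul_mul_assoc, mul_assoc]
  exact smul_mem _ _ h

/-- Decomposition of `G_A(k + 1)` with respect to the element `0`. -/
lemma ls_succ_span (k : ℕ) : span K ({z | ∃ a y, z = io A 0 a * psucc A k y} ∪
    {z | ∃ (j : Fin k) (y : _), z = om A 0 j.succ * psucc A k y}) = ⊤ := by
  set S := span K ({z | ∃ a y, z = io A 0 a * psucc A k y} ∪
    {z | ∃ (j : Fin k) (y : _), z = om A 0 j.succ * psucc A k y}) with hS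
  have m1 : ∀ a y, io A 0 a * psucc A k y ∈ S := fun a y =>
    subset_span (Or.inl ⟨a, y, rfl⟩)
  have m2 : ∀ (j : Fin k) y, om A 0 j.succ * psucc A k y ∈ S := fun j y =>
    subset_span (Or.inr ⟨j, y, rfl⟩)
  have hio : ∀ i, ∀ b ∈ A.gr i, ∀ v, ∀ x ∈ S, io A v b * x ∈ S := by
    intro i b hb v x hx
    refine mul_mem_of_mem_span (fun x hx => ?_) hx
    refine Fin.cases ?_ (fun v => ?_) v
    · rcases hx with ⟨a, y, rfl⟩ | ⟨j, y, rfl⟩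
      · rw [← mul_assoc, ← io_mul]; exact m1 _ _
      · rw [← mul_assoc, io_om, mul_assoc]
        refine gen_comm_left A (io_mem A _ hb) S (om_mem A _ _) ?_
        rw [← push_io Fin.succ (fsucc_inj k), ← map_mul]
        exact m2 _ _
    · rcases hx with ⟨a, y, rfl⟩ | ⟨j, y, rfl⟩
      · induction a using inductionOn A.gr with
        | zero => rw [map_zero, zero_mul, mul_zero]; exact zero_mem _
        | add a a' h1 h2 => rw [map_add, add_mul, mul_add]; exact add_mem h1 h2
        | @homogeneous l a =>
          refine gen_comm_left A (io_mem A _ hb) S (io_mem A _ a.2) ?_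
          rw [← push_io Fin.succ (fsucc_inj k), ← map_mul]
          exact m1 _ _
      · refine gen_comm_left A (io_mem A _ hb) S (om_mem A _ _) ?_
        rw [← push_io Fin.succ (fsucc_inj k), ← map_mul]
        exact m2 _ _
  have hom0 : ∀ (l : Fin k), ∀ x ∈ S, om A 0 l.succ * x ∈ S := by
    intro l x hx
    refine mul_mem_of_mem_span (fun x hx => ?_) hx
    rcases hx with ⟨a, y, rfl⟩ | ⟨j, y, rfl⟩
    · rw [← mul_assoc, io_om', mul_assoc, ← push_io Fin.succ (fsucc_inj k), ← map_mul]
      exact m2 _ _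
    · rw [om_symm A l.succ 0, smul_mul_assoc, ← mul_assoc, om_arnold', smul_mul_assoc, sub_mul,
        mul_assoc, mul_assoc, ← push_om Fin.succ (fsucc_inj k), ← map_mul]
      exact smul_mem _ _ (smul_mem _ _ (sub_mem (m2 _ _) (m2 _ _)))
  have hom : ∀ v w, ∀ x ∈ S, om A v w * x ∈ S := by
    intro v w
    refine Fin.cases (Fin.cases ?_ (fun w => ?_) w) (fun v => Fin.cases ?_ (fun w => ?_) w) v
    · intro x _
      rw [om_diag, zero_mul]; exact zero_mem _
    · exact hom0 w
    · intro x hx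
      rw [om_symm A 0 v.succ, smul_mul_assoc]
      exact smul_mem _ _ (hom0 v x hx)
    · intro x hx
      refine mul_mem_of_mem_span (fun x hx => ?_) hx
      rcases hx with ⟨a, y, rfl⟩ | ⟨j, y, rfl⟩
      · induction a using inductionOn A.gr with
        | zero => rw [map_zero, zero_mul, mul_zero]; exact zero_mem _
        | add a a' h1 h2 => rw [map_add, add_mul, mul_add]; exact add_mem h1 h2
        | @homogeneous l a =>
          refine gen_comm_left A (om_mem A _ _) S (io_mem A _ a.2) ?_
          rw [← push_om Fin.succ (fsucc_inj k), ← map_mul]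
          exact m1 _ _
      · refine gen_comm_left A (om_mem A _ _) S (om_mem A _ _) ?_
        rw [← push_om Fin.succ (fsucc_inj k), ← map_mul]
        exact m2 _ _
  refine eq_top_iff.mpr fun z _ => ?_
  induction z using (lsPres A (Fin (k + 1))).induction with
  | h1 => simpa [io_one] using m1 1 1
  | hadd x y hx hy => exact add_mem (hx trivial) (hy trivial)
  | hsmul c x hx => exact smul_mem _ _ (hx trivial)
  | hmul s y hy =>
    cases s with
    | pt v i a => rw [gen_pt]; exact hio i a a.2 v _ (hy trivial)
    | om v w => exact hom v w _ (hy trivial)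

variable {A} in
lemma ls_succ_ext {k : ℕ} {M : Type u} [AddCommGroup M] [Module K M]
    {f g : LS A (Fin (k + 1)) →ₗ[K] M}
    (h1 : ∀ i, ∀ a ∈ A.gr i, ∀ y, f (io A 0 a * psucc A k y) = g (io A 0 a * psucc A k y))
    (h2 : ∀ (j : Fin k) y, f (om A 0 j.succ * psucc A k y) = g (om A 0 j.succ * psucc A k y)) :
    f = g := by
  refine LinearMap.ext_on (ls_succ_span A k) ?_
  rintro _ (⟨a, y, rfl⟩ | ⟨j, y, rfl⟩)
  · induction a using inductionOn A.gr with
    | zero => simp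
    | add a a' h1 h2 => simp only [map_add, add_mul, h1, h2]
    | homogeneous a => exact h1 _ _ a.2 y
  · exact h2 j y

/-- Left multiplication by an element of degree `i` on `G_A(k) ⊗ A`. -/
def slOp (k : ℕ) (i : ℤ) : LS A (Fin k) →ₗ[K] Module.End K (LS A (Fin k) ⊗[K] A.A) where
  toFun z := tmap (lmulLeft K z) (tw A.gr i)
  map_add' z z' := by apply ext'; intro y c; simp [add_mul, add_tmul]
  map_smul' r z := by apply ext'; intro y c; simp [smul_tmul']

/-- Left multiplication by an element of `A` on `G_A(k) ⊗ A`. -/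
def srOp (k : ℕ) : A.A →ₗ[K] Module.End K (LS A (Fin k) ⊗[K] A.A) where
  toFun b := tmap lid (lmulLeft K b)
  map_add' z z' := by apply ext'; intro y c; simp [add_mul, tmul_add]
  map_smul' r z := by apply ext'; intro y c; simp

variable {A}

lemma slOp_tmul (k : ℕ) (i : ℤ) (z y : LS A (Fin k)) (c : A.A) :
    slOp A k i z (y ⊗ₜ c) = (z * y) ⊗ₜ tw A.gr i c := rfl

lemma srOp_tmul (k : ℕ) (b : A.A) (y : LS A (Fin k)) (c : A.A) :
    srOp A k b (y ⊗ₜ c) = y ⊗ₜ (b * c) := rfl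

lemma slOp_mul (k : ℕ) (i j : ℤ) (z w : LS A (Fin k)) :
    slOp A k i z * slOp A k j w = slOp A k (i + j) (z * w) := by
  apply ext'
  intro y c
  rw [end_mul_apply, slOp_tmul, slOp_tmul, slOp_tmul, tw_tw_add, mul_assoc]

lemma slOp_comm (k : ℕ) {i j : ℤ} {z w : LS A (Fin k)} (hz : z ∈ lgr A (Fin k) i)
    (hw : w ∈ lgr A (Fin k) j) :
    slOp A k i z * slOp A k j w = sg K (i * j) • (slOp A k j w * slOp A k i z) := by
  rw [slOp_mul, slOp_mul, ls_comm A hz hw, map_smul, add_comm]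

lemma srOp_slOp (k : ℕ) {i : ℤ} (j : ℤ) {a : A.A} (ha : a ∈ A.gr i) (z : LS A (Fin k)) :
    srOp A k a * slOp A k j z = sg K (i * j) • (slOp A k j z * srOp A k a) := by
  apply ext'
  intro y c
  rw [lsmul_apply, end_mul_apply, end_mul_apply, slOp_tmul, srOp_tmul,
    srOp_tmul, slOp_tmul, tw_mul, tw_of_mem A.gr j ha, smul_mul_assoc, tmul_smul,
    smul_smul, mul_comm i, sg_mul_self, one_smul]

lemma srOp_mul (k : ℕ) (a b : A.A) : srOp A k (a * b) = srOp A k a * srOp A k b := by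
  apply ext'
  intro y c
  rw [end_mul_apply, srOp_tmul, srOp_tmul, srOp_tmul, mul_assoc]

variable (A) in
/-- The action of `ι_v(a)` on `G_A(k) ⊗ A`. -/
def slIo (k : ℕ) (v : Fin (k + 1)) : A.A →ₗ[K] Module.End K (LS A (Fin k) ⊗[K] A.A) :=
  Fin.cases (srOp A k) (fun j => glift A.gr fun i => slOp A k i ∘ₗ io A j ∘ₗ (A.gr i).subtype) v

variable (A) in
/-- The action of `ω_vw` on `G_A(k) ⊗ A`. -/
def slOm (k : ℕ) (v w : Fin (k + 1)) : Module.End K (LS A (Fin k) ⊗[K] A.A) :=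
  Fin.cases 0 (fun j => Fin.cases 0 (fun l => slOp A k (n - 1) (om A j l)) w) v

lemma slIo_zero (k : ℕ) : slIo A k 0 = srOp A k := rfl

lemma slIo_succ (k : ℕ) (j : Fin k) {i : ℤ} {a : A.A} (ha : a ∈ A.gr i) :
    slIo A k j.succ a = slOp A k i (io A j a) := by
  change glift A.gr _ a = _
  rw [glift_of_mem _ _ ha]; rfl

lemma slOm_zero (k : ℕ) (w : Fin (k + 1)) : slOm A k 0 w = 0 := rfl

lemma slOm_succ_zero (k : ℕ) (w : Fin (k + 1)) : slOm A k w 0 = 0 := by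
  refine Fin.cases rfl (fun j => rfl) w

lemma slOm_succ (k : ℕ) (v w : Fin k) : slOm A k v.succ w.succ = slOp A k (n - 1) (om A v w) := rfl

variable (A) in
/-- The action of `G_A(k + 1)` on `G_A(k) ⊗ A`, where `ω_{0j}` acts by zero. -/
def slMap (k : ℕ) : LSMap A (Fin (k + 1)) (Module.End K (LS A (Fin k) ⊗[K] A.A)) where
  p := slIo A k
  w := slOm A k
  one v := by
    refine Fin.cases ?_ (fun v => ?_) v
    · apply ext'
      intro y c
      rw [slIo_zero, srOp_tmul, one_mul]; rfl
    · apply ext'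
      intro y c
      rw [slIo_succ k v (gone_mem (A := A.gr)), slOp_tmul, io_one, one_mul, tw_zero]
      rfl
  mul v i j a b ha hb := by
    refine Fin.cases ?_ (fun v => ?_) v
    · exact srOp_mul k a b
    · rw [slIo_succ k v (gmul_mem ha hb), slIo_succ k v ha, slIo_succ k v hb,
        slOp_mul, io_mul]
  comm v v' i j a b ha hb := by
    refine Fin.cases (Fin.cases ?_ (fun w => ?_) v') (fun v => Fin.cases ?_ (fun w => ?_) v') v
    · rw [slIo_zero, ← srOp_mul, ← srOp_mul, A.mul_comm ha hb, map_smul]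
    · rw [slIo_succ k w hb, slIo_zero, srOp_slOp k j ha]
    · rw [slIo_succ k v ha, slIo_zero, srOp_slOp k i hb, smul_smul, mul_comm j, sg_mul_self, one_smul]
    · rw [slIo_succ k v ha, slIo_succ k w hb, slOp_comm k (io_mem A v ha) (io_mem A w hb)]
  comm' v x y i a ha := by
    refine Fin.cases ?_ (fun x => Fin.cases ?_ (fun y => ?_) y) x
    · rw [slOm_zero, mul_zero, zero_mul, smul_zero]
    · rw [slOm_succ_zero, mul_zero, zero_mul, smul_zero]
    · rw [slOm_succ]
      refine Fin.cases ?_ (fun v => ?_) v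
      · exact srOp_slOp k _ ha _
      · rw [slIo_succ k v ha]
        exact slOp_comm k (io_mem A v ha) (om_mem A x y)
  comm'' v v' x y := by
    refine Fin.cases ?_ (fun x => Fin.cases ?_ (fun y => ?_) y) x
    · rw [slOm_zero, mul_zero, zero_mul, smul_zero]
    · rw [slOm_succ_zero, mul_zero, zero_mul, smul_zero]
    · refine Fin.cases ?_ (fun v => Fin.cases ?_ (fun v' => ?_) v') v
      · rw [slOm_zero, mul_zero, zero_mul, smul_zero]
      · rw [slOm_succ_zero, mul_zero, zero_mul, smul_zero]
      · exact slOp_comm k (om_mem A v v') (om_mem A x y)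
  diag v := by
    refine Fin.cases rfl (fun v => ?_) v
    rw [slOm_succ, om_diag, map_zero]
  symm v x := by
    refine Fin.cases ?_ (fun v => Fin.cases ?_ (fun x => ?_) x) v
    · rw [slOm_zero, slOm_succ_zero, smul_zero]
    · rw [slOm_zero, slOm_succ_zero, smul_zero]
    · rw [slOm_succ, slOm_succ, om_symm A v x, map_smul]
  sq v x := by
    refine Fin.cases ?_ (fun v => Fin.cases ?_ (fun x => ?_) x) v
    · rw [slOm_zero, mul_zero]
    · rw [slOm_succ_zero, mul_zero]
    · rw [slOm_succ, slOp_mul, om_sq, map_zero]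
  arnold v x y _ _ _ := by
    refine Fin.cases ?_ (fun v => Fin.cases ?_ (fun x => Fin.cases ?_ (fun y => ?_) y) x) v
    · simp [slOm_zero, slOm_succ_zero]
    · simp [slOm_zero, slOm_succ_zero]
    · simp [slOm_zero, slOm_succ_zero]
    · rw [slOm_succ, slOm_succ, slOm_succ, slOp_mul, slOp_mul, slOp_mul, ← map_add, ← map_add,
        om_arnold, map_zero]
  slide v x i a ha := by
    refine Fin.cases ?_ (fun v => Fin.cases ?_ (fun x => ?_) x) v
    · rw [slOm_zero, mul_zero, mul_zero]
    · rw [slOm_succ_zero, mul_zero, mul_zero]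
    · rw [slOm_succ, slIo_succ k v ha, slIo_succ k x ha, slOp_mul, slOp_mul, io_om]

variable (A) in
/-- The slant product: `ι_0(b) y ↦ ε(b a) y`, for `y` which does not involve `0`, and
`ω_{0j} z ↦ 0`. -/
def slant (k : ℕ) : A.A →ₗ[K] LS A (Fin (k + 1)) →ₗ[K] LS A (Fin k) where
  toFun a := (rid K _).toLinearMap ∘ₗ
    tmap lid (A.ε ∘ₗ mulRight K a) ∘ₗ
      applyₗ ((1 : LS A (Fin k)) ⊗ₜ[K] (1 : A.A)) ∘ₗ (slMap A k).map.toLinearMap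
  map_add' a b := by
    have : A.ε ∘ₗ mulRight K (a + b) =
        A.ε ∘ₗ mulRight K a + A.ε ∘ₗ mulRight K b := by
      ext; simp [mul_add]
    rw [this, TensorProduct.map_add_right, LinearMap.add_comp, LinearMap.comp_add]
  map_smul' r a := by
    have : A.ε ∘ₗ mulRight K (r • a) = r • (A.ε ∘ₗ mulRight K a) := by
      ext; simp
    rw [this, TensorProduct.map_smul_right, LinearMap.smul_comp, LinearMap.comp_smul]
    rfl

lemma slMap_psucc (k : ℕ) (y : LS A (Fin k)) :
    (slMap A k).map (psucc A k y) (1 ⊗ₜ 1) = y ⊗ₜ 1 := by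
  induction y using (lsPres A (Fin k)).induction with
  | h1 => rw [map_one, map_one]; rfl
  | hadd x y hx hy => rw [map_add, map_add, ladd_apply, hx, hy, add_tmul]
  | hsmul c x hx => rw [map_smul, map_smul, lsmul_apply, hx, smul_tmul']
  | hmul s y hy =>
    rw [map_mul, map_mul, end_mul_apply, hy]
    cases s with
    | pt v i a =>
      rw [gen_pt, push_io, LSMap.map_io]
      change slIo A k v.succ a (y ⊗ₜ 1) = _
      rw [slIo_succ k v a.2, slOp_tmul, tw_one]
    | om v w =>
      rw [gen_om, push_om, LSMap.map_om]
      change slOm A k v.succ w.succ (y ⊗ₜ 1) = _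
      rw [slOm_succ, slOp_tmul, tw_one]

lemma slant_io (k : ℕ) (a b : A.A) (y : LS A (Fin k)) :
    slant A k a (io A 0 b * psucc A k y) = A.ε (b * a) • y := by
  change (rid K _) (tmap lid (A.ε ∘ₗ mulRight K a)
    ((slMap A k).map (io A 0 b * psucc A k y) (1 ⊗ₜ 1))) = _
  rw [map_mul, end_mul_apply, slMap_psucc, LSMap.map_io]
  change (rid K _) (tmap lid (A.ε ∘ₗ mulRight K a)
    (srOp A k b (y ⊗ₜ 1))) = _
  rw [srOp_tmul, map_tmul, mul_one]
  simp

lemma slant_om (k : ℕ) (a : A.A) (j : Fin k) (z : LS A (Fin (k + 1))) :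
    slant A k a (om A 0 j.succ * z) = 0 := by
  change (rid K _) (tmap lid (A.ε ∘ₗ mulRight K a)
    ((slMap A k).map (om A 0 j.succ * z) (1 ⊗ₜ 1))) = _
  rw [map_mul, LSMap.map_om]
  change (rid K _) (tmap lid (A.ε ∘ₗ mulRight K a)
    (((0 : Module.End K _) * _) (1 ⊗ₜ 1))) = _
  rw [zero_mul, lzero_apply, map_zero, map_zero]

end Slant

section SlantProps

variable {K : Type u} [Field K] {n : ℕ} {A : PDCDGA K n}

lemma proj_of_mem {V : Type u} [AddCommGroup V] [Module K V] (gr : ℤ → Submodule K V)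
    [Decomposition gr] (m : ℤ) {i : ℤ} {x : V} (hx : x ∈ gr i) :
    ((decompose gr x) m : V) = if i = m then x else 0 := by
  split_ifs with h
  · subst h
    exact decompose_of_mem_same gr hx
  · exact decompose_of_mem_ne gr hx h

lemma ls_succ_mem {k : ℕ} {m : ℤ} {z : LS A (Fin (k + 1))} (hz : z ∈ lgr A (Fin (k + 1)) m)
    (P : Submodule K (LS A (Fin (k + 1))))
    (h1 : ∀ i j a y, a ∈ A.gr i → y ∈ lgr A (Fin k) j → i + j = m → io A 0 a * psucc A k y ∈ P)
    (h2 : ∀ (j : Fin k) y, y ∈ lgr A (Fin k) (m - (n - 1)) → om A 0 j.succ * psucc A k y ∈ P) :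
    z ∈ P := by
  have key : ∀ z : LS A (Fin (k + 1)),
      ((decompose (lgr A (Fin (k + 1))) z) m : LS A (Fin (k + 1))) ∈ P := by
    intro z
    have hz : z ∈ span K ({z | ∃ a y, z = io A 0 a * psucc A k y} ∪
        {z | ∃ (j : Fin k) (y : _), z = om A 0 j.succ * psucc A k y}) := by
      rw [ls_succ_span]; trivial
    induction hz using span_induction with
    | zero => rw [decompose_zero]; exact zero_mem _
    | add x y _ _ h1 h2 => rw [decompose_add]; exact add_mem h1 h2
    | smul c x _ h => rw [DirectSum.decompose_smul]; exact smul_mem _ _ h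
    | mem x hx =>
      rcases hx with ⟨a, y, rfl⟩ | ⟨j, y, rfl⟩
      · induction a using inductionOn A.gr with
        | zero => rw [map_zero, zero_mul, decompose_zero]; exact zero_mem _
        | add a a' h1 h2 => rw [map_add, add_mul, decompose_add]; exact add_mem h1 h2
        | @homogeneous i a =>
          induction y using inductionOn (lgr A (Fin k)) with
          | zero => rw [map_zero, mul_zero, decompose_zero]; exact zero_mem _
          | add a a' h1 h2 => rw [map_add, mul_add, decompose_add]; exact add_mem h1 h2
          | @homogeneous j y =>
            rw [proj_of_mem (lgr A (Fin (k + 1))) m (gmul_mem (io_mem A 0 a.2) (push_mem Fin.succ (fsucc_inj k) _ _ y.2))]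
            split_ifs with h
            · exact h1 _ _ _ _ a.2 y.2 h
            · exact zero_mem _
      · induction y using inductionOn (lgr A (Fin k)) with
        | zero => rw [map_zero, mul_zero, decompose_zero]; exact zero_mem _
        | add a a' h1 h2 => rw [map_add, mul_add, decompose_add]; exact add_mem h1 h2
        | @homogeneous l y =>
          rw [proj_of_mem (lgr A (Fin (k + 1))) m (gmul_mem (om_mem A 0 j.succ) (push_mem Fin.succ (fsucc_inj k) _ _ y.2))]
          split_ifs with h
          · refine h2 _ _ ?_
            rw [← h, add_sub_cancel_left]
            exact y.2
          · exact zero_mem _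
  have := key z
  rwa [decompose_of_mem_same _ hz] at this

lemma slant_mem (k : ℕ) {α m : ℤ} {a : A.A} (ha : a ∈ A.gr α) {z : LS A (Fin (k + 1))}
    (hz : z ∈ lgr A (Fin (k + 1)) m) : slant A k a z ∈ lgr A (Fin k) (m - (n - α)) := by
  refine ls_succ_mem hz ((lgr A (Fin k) (m - (n - α))).comap (slant A k a)) ?_ ?_
  · intro i j b y hb hy h
    rw [mem_comap, slant_io]
    by_cases hi : i + α = n
    · refine smul_mem _ _ ?_
      rwa [show m - (n - α) = j by omega]
    · rw [A.ε_mul_of_ne hb ha hi, zero_smul]; exact zero_mem _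
  · intro j y hy
    rw [mem_comap, slant_om]; exact zero_mem _

lemma slant_tw (k : ℕ) (p : ℤ) {α : ℤ} {a : A.A} (ha : a ∈ A.gr α) (z : LS A (Fin (k + 1))) :
    slant A k a (tw (lgr A (Fin (k + 1))) p z) =
      sg K (p * (n - α)) • tw (lgr A (Fin k)) p (slant A k a z) := by
  have h : slant A k a ∘ₗ tw (lgr A (Fin (k + 1))) p =
      sg K (p * (n - α)) • (tw (lgr A (Fin k)) p ∘ₗ slant A k a) := by
    refine ghom_ext (gr := lgr A (Fin (k + 1))) fun i z hz => ?_
    simp only [comp_apply, lsmul_apply]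
    rw [tw_of_mem (lgr A (Fin (k + 1))) p hz, tw_of_mem (lgr A (Fin k)) p (slant_mem k ha hz),
      map_smul, smul_smul, ← sg_add]
    congr 1
    exact sg_congr ⟨p * i, by ring⟩
  exact lcongr_fun h z

lemma push_congr {U V : Type} {e e' : U → V} (he : e.Injective) (he' : e'.Injective)
    (h : ∀ u, e u = e' u) (z : LS A U) : LS.push A e he z = LS.push A e' he' z := by
  obtain rfl : e = e' := funext h
  rfl

lemma slant_push (k : ℕ) (a : A.A) (e : Fin (k + 1) → Fin (k + 1)) (he : e.Injective)
    (σ : Fin k → Fin k) (hσ : σ.Injective) (h0 : e 0 = 0) (h : ∀ j, e j.succ = (σ j).succ)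
    (z : LS A (Fin (k + 1))) :
    slant A k a (LS.push A e he z) = LS.push A σ hσ (slant A k a z) := by
  have hp : ∀ y, LS.push A e he (psucc A k y) = psucc A k (LS.push A σ hσ y) := by
    intro y
    rw [psucc, push_push, push_push]
    exact push_congr _ _ h _
  have : slant A k a ∘ₗ (LS.push A e he).toLinearMap =
      (LS.push A σ hσ).toLinearMap ∘ₗ slant A k a := by
    refine ls_succ_ext (fun i b _ y => ?_) (fun j y => ?_) <;>
      simp only [comp_apply, toLinearMap_apply]
    · rw [map_mul, push_io, h0, hp, slant_io, slant_io, map_smul]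
    · rw [map_mul, push_om, h0, h, slant_om, slant_om, map_zero]
  exact lcongr_fun this z

lemma swap_push_psucc (k : ℕ) (y : LS A (Fin k)) :
    LS.push A (eswap (0 : Fin (k + 2)) 1) (eswap 0 1).injective
      (psucc A (k + 1) (psucc A k y)) = psucc A (k + 1) (psucc A k y) := by
  simp only [psucc, push_push]
  refine push_congr _ _ (fun j => ?_) _
  refine eswap_ne (Fin.succ_ne_zero _) ?_
  rw [← fsucc_zero, Ne, Function.comp_apply, Fin.succ_inj]
  exact Fin.succ_ne_zero _

lemma swap_zero_one_succ_succ (k : ℕ) (j : Fin k) :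
    eswap (0 : Fin (k + 2)) 1 j.succ.succ = j.succ.succ := by
  refine eswap_ne (Fin.succ_ne_zero _) ?_
  rw [← fsucc_zero, Ne, Fin.succ_inj]
  exact Fin.succ_ne_zero _

lemma slant_slant (k : ℕ) {α β : ℤ} {a b : A.A} (ha : a ∈ A.gr α) (hb : b ∈ A.gr β)
    (z : LS A (Fin (k + 2))) :
    slant A k a (slant A (k + 1) b (LS.push A (eswap 0 1) (eswap 0 1).injective z)) =
      sg K ((n - α) * (n - β)) • slant A k b (slant A (k + 1) a z) := by
  set S := LS.push A (eswap (0 : Fin (k + 2)) 1) (eswap 0 1).injective with hS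
  have Sm : ∀ x y, S (x * y) = S x * S y := map_mul S
  have Sio : ∀ v c, S (io A v c) = io A (eswap 0 1 v) c := fun v c => push_io _ _ _ _
  have Som : ∀ v w, S (om A v w) = om A (eswap 0 1 v) (eswap 0 1 w) :=
    fun v w => push_om _ _ _ _
  have pm : ∀ x y, psucc A (k + 1) (x * y) = psucc A (k + 1) x * psucc A (k + 1) y :=
    map_mul (psucc A (k + 1))
  have Sp : ∀ y, S (psucc A (k + 1) (psucc A k y)) = psucc A (k + 1) (psucc A k y) :=
    swap_push_psucc k
  have hz : ∀ (j : Fin (k + 1)) (m : ℤ) (x : LS A (Fin (k + 2))), x ∈ lgr A (Fin (k + 2)) m → ∀ y,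
      slant A (k + 1) b (x * (om A 0 j.succ * y)) = 0 := by
    intro j m x hx y
    rw [← mul_assoc, ls_comm A hx (om_mem A _ _), smul_mul_assoc, map_smul, mul_assoc, slant_om,
      smul_zero]
  have : slant A k a ∘ₗ slant A (k + 1) b ∘ₗ S.toLinearMap =
      sg K ((n - α) * (n - β)) • (slant A k b ∘ₗ slant A (k + 1) a) := by
    refine ls_succ_ext (fun i c hc w => ?_) (fun j w => ?_) <;>
      simp only [comp_apply, lsmul_apply, toLinearMap_apply]
    · have : (slant A k a ∘ₗ slant A (k + 1) b ∘ₗ S.toLinearMap) ∘ₗ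
          lmulLeft K (io A 0 c) ∘ₗ (psucc A (k + 1)).toLinearMap =
          (sg K ((n - α) * (n - β)) • (slant A k b ∘ₗ slant A (k + 1) a)) ∘ₗ
          lmulLeft K (io A 0 c) ∘ₗ (psucc A (k + 1)).toLinearMap := by
        refine ls_succ_ext (fun l e he y => ?_) (fun j y => ?_) <;>
          simp only [comp_apply, lsmul_apply, toLinearMap_apply,
            mulLeft_apply]
        · rw [slant_io, map_smul, slant_io, Sm, Sio, eswap_left, pm, Sm, push_io, Sio,
            fsucc_zero, eswap_right, Sp,
            ← mul_assoc, ls_comm A (io_mem A _ hc) (io_mem A _ he), smul_mul_assoc, mul_assoc,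
            map_smul]
          have : io A 1 c * psucc A (k + 1) (psucc A k y) =
              psucc A (k + 1) (io A 0 c * psucc A k y) := by
            rw [map_mul, push_io]; rfl
          rw [this, slant_io, map_smul, map_smul, slant_io]
          by_cases h1 : i + α = n
          · by_cases h2 : l + β = n
            · rw [show (n : ℤ) - α = i by omega, show (n : ℤ) - β = l by omega]
              congr 1
              rw [smul_smul, smul_smul, mul_comm]
            · rw [A.ε_mul_of_ne he hb h2]; simp
          · rw [A.ε_mul_of_ne hc ha h1]; simp
        · rw [slant_io, map_smul, slant_om, smul_zero, smul_zero, Sm, Sio, pm, Sm, push_om, Som,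
            fsucc_zero, eswap_right, swap_zero_one_succ_succ,
            hz _ _ _ (io_mem A _ hc), map_zero]
      exact lcongr_fun this w
    · rw [slant_om, map_zero, smul_zero]
      refine Fin.cases ?_ (fun j => ?_) j
      · rw [Sm, Som, fsucc_zero, eswap_right,
          eswap_left, om_symm A 0 1, smul_mul_assoc, map_smul, ← fsucc_zero,
          slant_om, smul_zero, map_zero]
      · have : (slant A k a ∘ₗ slant A (k + 1) b ∘ₗ S.toLinearMap) ∘ₗ
            lmulLeft K (om A 0 j.succ.succ) ∘ₗ (psucc A (k + 1)).toLinearMap = 0 := by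
          refine ls_succ_ext (fun l e he y => ?_) (fun l y => ?_) <;>
          simp only [comp_apply, lzero_apply, toLinearMap_apply,
            mulLeft_apply]
          · rw [Sm, Som, eswap_left, swap_zero_one_succ_succ, pm, Sm, push_io, Sio,
              fsucc_zero, eswap_right, Sp, ← mul_assoc, ls_comm A (om_mem A _ _) (io_mem A _ he), smul_mul_assoc,
              mul_assoc, map_smul]
            have : om A 1 j.succ.succ * psucc A (k + 1) (psucc A k y) =
                psucc A (k + 1) (om A 0 j.succ * psucc A k y) := by
              rw [map_mul, push_om]; rfl
            rw [this, slant_io, map_smul, map_smul, slant_om, smul_zero, smul_zero]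
          · rw [Sm, Som, pm, Sm, push_om, Som,
              fsucc_zero, eswap_right, swap_zero_one_succ_succ,
              swap_zero_one_succ_succ, hz _ _ _ (om_mem A _ _), map_zero]
        exact lcongr_fun this w
  exact lcongr_fun this z

lemma push_tw {U V : Type} (e : U → V) (he : e.Injective) (p : ℤ) (z : LS A U) :
    LS.push A e he (tw (lgr A U) p z) = tw (lgr A V) p (LS.push A e he z) := by
  have : (LS.push A e he).toLinearMap ∘ₗ tw (lgr A U) p =
      tw (lgr A V) p ∘ₗ (LS.push A e he).toLinearMap := by
    refine ghom_ext (gr := lgr A U) fun i x hx => ?_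
    simp only [comp_apply, toLinearMap_apply]
    rw [tw_of_mem (lgr A U) p hx, map_smul, tw_of_mem (lgr A V) p (push_mem e he _ _ hx)]
  exact lcongr_fun this z

lemma push_id {U : Type} (z : LS A U) : LS.push A id Function.injective_id z = z := by
  have : LS.push A (id : U → U) Function.injective_id = AlgHom.id K _ := by
    apply ls_hom_ext
    · intro v a; rw [push_io]; rfl
    · intro v w; rw [push_om]; rfl
  exact AlgHom.congr_fun this z

/-- The injection which misses `2`. -/
def missTwo (k : ℕ) : Fin (k + 2) → Fin (k + 3) := Fin.cons 0 fun j => (missOne k j).succ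

lemma missTwo_inj (k : ℕ) : Injective (missTwo k) := by
  intro a b
  refine Fin.cases (Fin.cases (fun _ => rfl) (fun b h => ?_) b) (fun a => Fin.cases (fun h => ?_)
    (fun b h => ?_) b) a
  · exact absurd (show (missOne k b).succ = 0 from h.symm) (Fin.succ_ne_zero _)
  · exact absurd (show (missOne k a).succ = 0 from h) (Fin.succ_ne_zero _)
  · rw [missOne_inj k (Fin.succ_inj.mp h)]

/-- The cyclic permutation `0 ↦ 2 ↦ 1 ↦ 0`. -/
def rot (k : ℕ) : Fin (k + 3) → Fin (k + 3) := Fin.cons 2 (missTwo k)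

lemma rot_eq (k : ℕ) : rot k =
    eswap (1 : Fin (k + 2)).castSucc (1 : Fin (k + 2)).succ ∘
      eswap (0 : Fin (k + 2)).castSucc (0 : Fin (k + 2)).succ := by
  have e1 : (1 : Fin (k + 2)).castSucc = (1 : Fin (k + 3)) := rfl
  have e2 : (1 : Fin (k + 2)).succ = (2 : Fin (k + 3)) := rfl
  have e3 : (0 : Fin (k + 2)).castSucc = (0 : Fin (k + 3)) := rfl
  have e4 : (0 : Fin (k + 2)).succ = (1 : Fin (k + 3)) := rfl
  have n01 : (0 : Fin (k + 3)) ≠ 1 := by simp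
  have n02 : (0 : Fin (k + 3)) ≠ 2 := by rw [← e2]; exact (Fin.succ_ne_zero _).symm
  rw [e1, e2, e3, e4]
  funext v
  refine Fin.cases ?_ (fun v => Fin.cases ?_ (fun v => Fin.cases ?_ (fun v => ?_) v) v) v
  · rw [Function.comp_apply, eswap_left, eswap_left]; rfl
  · rw [Function.comp_apply, e4, eswap_right, eswap_ne n01 n02]; rfl
  · rw [Function.comp_apply]
    change (1 : Fin (k + 3)) = eswap 1 2 (eswap 0 1 2)
    have n12 : (1 : Fin (k + 3)) ≠ 2 := by
      rw [← e4, ← e2, Ne, Fin.succ_inj]; simp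
    rw [eswap_ne n02.symm n12.symm, eswap_right]
  · rw [Function.comp_apply]
    have m1 : v.succ.succ.succ ≠ (1 : Fin (k + 3)) := by
      rw [← e4, Ne, Fin.succ_inj]; exact Fin.succ_ne_zero _
    have m2 : v.succ.succ.succ ≠ (2 : Fin (k + 3)) := by
      rw [← e2, Ne, Fin.succ_inj, ← fsucc_zero, Fin.succ_inj]; exact Fin.succ_ne_zero _
    rw [eswap_ne (Fin.succ_ne_zero _) m1, eswap_ne m1 m2]
    rfl

lemma rot_inj (k : ℕ) : Injective (rot k) := by
  rw [rot_eq]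
  exact (Equiv.injective _).comp (Equiv.injective _)

lemma collapse_missTwo (k : ℕ) (v : Fin (k + 2)) :
    collapse (k + 1) (missTwo k v) = missOne k (collapse k v) := by
  refine Fin.cases rfl (fun v => ?_) v
  rfl

lemma c0_push_missTwo (k : ℕ) (z : LS A (Fin (k + 2))) :
    c0 A (k + 1) (LS.push A (missTwo k) (missTwo_inj k) z) =
      LS.push A (missOne k) (missOne_inj k) (c0 A k z) := by
  have : (c0 A (k + 1)).comp (LS.push A (missTwo k) (missTwo_inj k)) =
      (LS.push A (missOne k) (missOne_inj k)).comp (c0 A k) := by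
    apply ls_hom_ext
    · intro v a
      rw [AlgHom.comp_apply, AlgHom.comp_apply, push_io, c0, c0, lsMap_io, lsMap_io, push_io,
        collapse_missTwo]
    · intro v w
      rw [AlgHom.comp_apply, AlgHom.comp_apply, push_om, c0, c0, lsMap_om, lsMap_om, push_om,
        collapse_missTwo, collapse_missTwo]
  exact AlgHom.congr_fun this z

lemma thetaCoeff_missTwo (k : ℕ) (v w : Fin (k + 2)) :
    thetaCoeff K n (k + 1) (missTwo k v) (missTwo k w) = thetaCoeff K n k v w := by
  have h0 : ∀ v, missTwo k v = 0 ↔ v = 0 := fun v =>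
    (show (0 : Fin (k + 3)) = missTwo k 0 from rfl) ▸ (missTwo_inj k).eq_iff
  have h1 : ∀ v, missTwo k v = 1 ↔ v = 1 := fun v =>
    (show (1 : Fin (k + 3)) = missTwo k 1 from rfl) ▸ (missTwo_inj k).eq_iff
  simp only [thetaCoeff, h0, h1]

lemma c1_push_missTwo (k : ℕ) (z : LS A (Fin (k + 2))) :
    c1 A (k + 1) (LS.push A (missTwo k) (missTwo_inj k) z) =
      LS.push A (missOne k) (missOne_inj k) (c1 A k z) := by
  induction z using (lsPres A (Fin (k + 2))).induction with
  | h1 => rw [map_one, c1_one, c1_one, map_zero]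
  | hadd x y hx hy => simp only [map_add, hx, hy]
  | hsmul c x hx => simp only [map_smul, hx]
  | hmul s y hy =>
    rw [map_mul, c1_mul, c1_mul, c0_push_missTwo, c0_push_missTwo, hy, map_add, map_mul, map_mul,
      push_tw]
    congr 2
    cases s with
    | pt v i a => rw [gen_pt, push_io, c1_io, c1_io, map_zero]
    | om v w => rw [gen_om, push_om, c1_om, c1_om, AlgHom.commutes, thetaCoeff_missTwo]

/-- The compatibility of the slant product with the cocomposition. -/
lemma c1_slant (k : ℕ) (a : A.A) (z : LS A (Fin (k + 3))) :
    c1 A k (slant A (k + 2) a z) = slant A (k + 1) a (LS.push A (eswap 0 1)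
      (eswap 0 1).injective (c1 A (k + 1) (LS.push A (rot k) (rot_inj k) z))) := by
  have hr : ∀ w, LS.push A (rot k) (rot_inj k) (psucc A (k + 2) w) =
      LS.push A (missTwo k) (missTwo_inj k) w := by
    intro w
    rw [psucc, push_push]
    exact push_congr _ _ (fun j => rfl) _
  have hs : ∀ w, LS.push A (eswap (0 : Fin (k + 2)) 1) (eswap 0 1).injective
      (LS.push A (missOne k) (missOne_inj k) w) = psucc A (k + 1) w := by
    intro w
    rw [psucc, push_push]
    refine push_congr _ _ (fun j => ?_) _
    refine Fin.cases ?_ (fun j => ?_) j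
    · exact eswap_left _ _
    · exact swap_zero_one_succ_succ k j
  have e2 : (2 : Fin (k + 3)) = (1 : Fin (k + 2)).succ := rfl
  have n01 : ∀ x, thetaCoeff K n (k + 1) 2 x = 0 := by
    intro x
    have h1 : (2 : Fin (k + 3)) ≠ 0 := by rw [e2]; exact Fin.succ_ne_zero _
    have h2 : (2 : Fin (k + 3)) ≠ 1 := by
      rw [e2]
      exact fun h => Fin.succ_ne_zero (0 : Fin (k + 1))
        (fsucc_inj _ (h.trans Fin.succ_zero_eq_one.symm))
    rw [thetaCoeff, if_neg (fun h => h1 h.1), if_neg (fun h => h2 h.1)]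
  have hc : collapse (k + 1) 2 = 1 := rfl
  have : c1 A k ∘ₗ slant A (k + 2) a = slant A (k + 1) a ∘ₗ (LS.push A (eswap 0 1)
      (eswap 0 1).injective).toLinearMap ∘ₗ c1 A (k + 1) ∘ₗ
        (LS.push A (rot k) (rot_inj k)).toLinearMap := by
    have hR := map_mul (LS.push A (rot k) (rot_inj k))
    have hS := map_mul (LS.push A (eswap (0 : Fin (k + 2)) 1) (eswap 0 1).injective)
    refine ls_succ_ext (fun i b hb w => ?_) (fun j w => ?_) <;>
      simp only [comp_apply, toLinearMap_apply]
    · rw [slant_io, map_smul, hR, hr, push_io, c1_mul, c1_io, zero_mul, add_zero,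
        c1_push_missTwo, c0, lsMap_io, show rot k 0 = 2 from rfl, hc, hS, push_io,
        eswap_right, hs, slant_io]
    · rw [slant_om, map_zero, hR, hr, push_om, c1_mul, c1_om, show rot k 0 = 2 from rfl, n01,
        map_zero, zero_mul, add_zero, c1_push_missTwo, c0, lsMap_om, hc, hS, push_om,
        eswap_right, hs, show rot k j.succ = missTwo k j from rfl, collapse_missTwo]
      refine Fin.cases ?_ (fun j => ?_) (collapse k j)
      · rw [show eswap (0 : Fin (k + 2)) 1 (missOne k 0) = (0 : Fin (k + 1)).succ from
          eswap_left _ _, slant_om]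
      · rw [show eswap (0 : Fin (k + 2)) 1 (missOne k j.succ) = j.succ.succ from
          swap_zero_one_succ_succ k j, slant_om]
  exact lcongr_fun this z

variable (A) in
/-- The coefficient of `ω_{0, j + 1}`. -/
def cJ (k : ℕ) (j : Fin (k + 1)) : LS A (Fin (k + 2)) →ₗ[K] LS A (Fin (k + 1)) :=
  tw (lgr A (Fin (k + 1))) (n - 1) ∘ₗ c1 A k ∘ₗ (LS.push A (eswap (Fin.succ 0) j.succ)
    (eswap (Fin.succ 0) j.succ).injective).toLinearMap

lemma push_swap_psucc (k : ℕ) (j : Fin (k + 1)) (y : LS A (Fin (k + 1))) :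
    LS.push A (eswap (Fin.succ 0) j.succ) (eswap (Fin.succ 0) j.succ).injective
      (psucc A (k + 1) y) =
    psucc A (k + 1) (LS.push A (eswap 0 j) (eswap 0 j).injective y) := by
  rw [psucc, push_push, push_push]
  exact push_congr _ _ (fun l => (fsucc_inj _).swap_apply 0 j l) _

lemma cJ_io (k : ℕ) (j : Fin (k + 1)) (b : A.A) (y : LS A (Fin (k + 1))) :
    cJ A k j (io A 0 b * psucc A (k + 1) y) = 0 := by
  simp only [cJ, comp_apply, toLinearMap_apply]
  rw [map_mul, push_swap_psucc, push_io, c1_mul, c1_io, zero_mul, add_zero, psucc, c1_push, mul_zero,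
    map_zero]

lemma cJ_om (k : ℕ) (j l : Fin (k + 1)) (y : LS A (Fin (k + 1))) :
    cJ A k j (om A 0 l.succ * psucc A (k + 1) y) =
      if l = j then LS.push A (eswap 0 j) (eswap 0 j).injective y else 0 := by
  simp only [cJ, comp_apply, toLinearMap_apply]
  have h0 : eswap (Fin.succ 0) j.succ (0 : Fin (k + 2)) = 0 :=
    eswap_ne (Fin.succ_ne_zero _).symm (Fin.succ_ne_zero _).symm
  rw [map_mul, push_swap_psucc, push_om, c1_mul, c1_om, psucc, c1_push, mul_zero, zero_add, c0_push,
    h0, (fsucc_inj _).swap_apply 0 j l, ← Algebra.smul_def, map_smul, tw_tw]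
  by_cases h : l = j
  · subst h
    rw [if_pos rfl, eswap_right, thetaCoeff, if_pos ⟨rfl, rfl⟩, one_smul]
  · rw [if_neg h, thetaCoeff, if_neg, if_neg, zero_smul]
    · rintro ⟨h, -⟩; simp at h
    · rintro ⟨-, h2⟩
      refine h ?_
      have := fsucc_inj _ (h2.trans Fin.succ_zero_eq_one.symm)
      rw [Equiv.swap_apply_eq_iff, eswap_left] at this
      exact this

lemma sum_slant (k : ℕ) (b : A.A) (y : LS A (Fin k)) :
    ∑ s : A.Idx, io A 0 (A.basis s) * psucc A k (slant A k (A.dbasis s) (io A 0 b * psucc A k y)) =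
      io A 0 b * psucc A k y := by
  conv_rhs => rw [A.expand b, map_sum, Finset.sum_mul]
  refine sum_congr rfl fun s _ => ?_
  rw [slant_io, map_smul, map_smul, mul_smul_comm, smul_mul_assoc]

/-- The expansion of an element of `G_A(1)`. -/
lemma ls_one_expand (z : LS A (Fin 1)) :
    z = ∑ s : A.Idx, io A 0 (A.basis s) * psucc A 0 (slant A 0 (A.dbasis s) z) := by
  have : lid = ∑ s : A.Idx, lmulLeft K (io A 0 (A.basis s)) ∘ₗ
      (psucc A 0).toLinearMap ∘ₗ slant A 0 (A.dbasis s) := by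
    refine ls_succ_ext (fun i b hb y => ?_) (fun j => j.elim0)
    simp only [lmsum_apply, comp_apply, toLinearMap_apply,
      mulLeft_apply]
    exact (sum_slant 0 b y).symm
  have := lcongr_fun this z
  simpa only [lmsum_apply, comp_apply, toLinearMap_apply,
      mulLeft_apply, id_apply] using this

/-- The expansion of an element of `G_A(k + 2)`. -/
lemma ls_succ_expand (k : ℕ) (z : LS A (Fin (k + 2))) :
    z = ∑ s : A.Idx, io A 0 (A.basis s) * psucc A (k + 1) (slant A (k + 1) (A.dbasis s) z) +
      ∑ j : Fin (k + 1), om A 0 j.succ * psucc A (k + 1) (LS.push A (eswap 0 j)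
        (eswap 0 j).injective (cJ A k j z)) := by
  have : lid = ∑ s : A.Idx, lmulLeft K (io A 0 (A.basis s)) ∘ₗ
      (psucc A (k + 1)).toLinearMap ∘ₗ slant A (k + 1) (A.dbasis s) +
      ∑ j : Fin (k + 1), lmulLeft K (om A 0 j.succ) ∘ₗ (psucc A (k + 1)).toLinearMap ∘ₗ
        (LS.push A (eswap 0 j) (eswap 0 j).injective).toLinearMap ∘ₗ cJ A k j := by
    refine ls_succ_ext (fun i b hb y => ?_) (fun j y => ?_) <;>
    simp only [ladd_apply, lmsum_apply, comp_apply,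
      toLinearMap_apply, mulLeft_apply, id_apply]
    · rw [sum_slant, sum_eq_zero, add_zero]
      intro j _
      rw [cJ_io, map_zero, map_zero, mul_zero]
    · rw [sum_eq_zero (s := (Finset.univ : Finset A.Idx)), zero_add,
        Finset.sum_eq_single j]
      · rw [cJ_om, if_pos rfl]
        refine congrArg (fun w => om A 0 j.succ * psucc A (k + 1) w) ?_
        rw [push_push]
        refine (push_id y).symm.trans ?_
        exact push_congr _ _ (fun l => (Equiv.swap_apply_self 0 j l).symm) _
      · intro l _ h
        rw [cJ_om, if_neg h.symm, map_zero, map_zero, mul_zero]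
      · intro h; exact absurd (mem_univ _) h
      · intro s _
        rw [slant_om, map_zero, mul_zero]
  have := lcongr_fun this z
  simpa only [ladd_apply, lmsum_apply, comp_apply,
    toLinearMap_apply, mulLeft_apply, id_apply] using this

end SlantProps

section Psi

variable {K : Type u} [Field K] {n : ℕ} {A : PDCDGA K n} {g : DGLie K}

variable (A g) in
/-- The direct sum of the `G_A^∨(k) ⊗ S(g[n-1])^{⊗ k}`. -/
abbrev CV : Type u := CircV A (g.symPois (n - 1))

variable (A g) in
/-- The element `f ⊗ t`. -/
def ci (k : ℕ) : LSDual A k →ₗ[K] SPow g (n - 1) k →ₗ[K] CV A g :=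
  (TensorProduct.mk K (LSDual A k) (TPow (g.symPois (n - 1)) k)).compr₂
    (cin A (g.symPois (n - 1)) k)

lemma cv_ext {M : Type u} [AddCommGroup M] [Module K M] {F G : CV A g →ₗ[K] M}
    (h : ∀ k f t, F (ci A g k f t) = G (ci A g k f t)) : F = G := by
  apply linearMap_ext
  intro k
  apply ext'
  intro f t
  exact h k f t

lemma cv_induction {p : CV A g → Prop} (h0 : p 0) (hadd : ∀ x y, p x → p y → p (x + y))
    (h : ∀ k f t, p (ci A g k f t)) (x : CV A g) : p x := by
  induction x using DirectSum.induction_on with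
  | zero => exact h0
  | add x y hx hy => exact hadd x y hx hy
  | of k t =>
    induction t using induction_on with
    | zero => rw [map_zero]; exact h0
    | add x y hx hy => rw [map_add]; exact hadd _ _ hx hy
    | tmul f t => exact h k f t

lemma phiV_ci (k : ℕ) (f : LSDual A k) (t : SPow g (n - 1) k) :
    phiV A g (ci A g k f t) = evM A g f (phi A g k t) := phiV_cin k f t

variable (A g) in
/-- The span of the relations for the symmetric groups. -/
def swapSub : Submodule K (CV A g) := span K {v | ∃ (k : ℕ) (i : Fin k)
  (f : LSDual A (k + 1)) (t : SPow g (n - 1) (k + 1)),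
  v = ci A g (k + 1) (actSwap A k i f) t - ci A g (k + 1) f (spSwap g (n - 1) k i t)}

lemma swap_mem (k : ℕ) (i : Fin k) (f : LSDual A (k + 1)) (t : SPow g (n - 1) (k + 1)) :
    ci A g (k + 1) (actSwap A k i f) t - ci A g (k + 1) f (spSwap g (n - 1) k i t) ∈ swapSub A g :=
  subset_span ⟨k, i, f, t, rfl⟩

variable (A) in
/-- The transpose of the slant product. -/
def dslant (r : ℤ) (k : ℕ) : A.A →ₗ[K] LSDual A k →ₗ[K] LSDual A (k + 1) :=
  mk₂ K (fun a f => f ∘ₗ tw (lgr A (Fin k)) r ∘ₗ slant A k a)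
    (fun a a' f => by apply lext; intro z; simp)
    (fun c a f => by apply lext; intro z; simp)
    (fun a f f' => by apply lext; intro z; simp)
    (fun c a f => by apply lext; intro z; simp)

lemma dslant_apply (r : ℤ) (k : ℕ) (a : A.A) (f : LSDual A k) (z : LS A (Fin (k + 1))) :
    dslant A r k a f z = f (tw (lgr A (Fin k)) r (slant A k a z)) := rfl

/-- The linear map on the direct sum with given values on the `f ⊗ t`. -/
def cvLift {M : Type u} [AddCommGroup M] [Module K M]
    (b : ∀ k, LSDual A k →ₗ[K] SPow g (n - 1) k →ₗ[K] M) : CV A g →ₗ[K] M :=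
  DirectSum.toModule K ℕ _ fun k => TensorProduct.lift (b k)

lemma cvLift_ci {M : Type u} [AddCommGroup M] [Module K M]
    (b : ∀ k, LSDual A k →ₗ[K] SPow g (n - 1) k →ₗ[K] M) (k : ℕ) (f : LSDual A k)
    (t : SPow g (n - 1) k) : cvLift b (ci A g k f t) = b k f t :=
  (DirectSum.toModule_lof ..).trans rfl

variable (A g) in
/-- The operator of insertion of `a ⊗ x`. -/
def uOp (r : ℤ) : A.A →ₗ[K] g.V →ₗ[K] Module.End K (CV A g) :=
  mk₂ K (fun a x => cvLift fun k =>
      -(ci A g (k + 1)).compl₁₂ (dslant A r k a) (tcons k (g.s (n - 1) x)))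
    (fun a a' x => by
      apply cv_ext
      intro k f t
      simp only [ladd_apply, cvLift_ci, lneg_apply, compl₁₂_apply, map_add,
        neg_add])
    (fun c a x => by
      apply cv_ext
      intro k f t
      simp only [lsmul_apply, cvLift_ci, lneg_apply, compl₁₂_apply,
        map_smul, smul_neg])
    (fun a x x' => by
      apply cv_ext
      intro k f t
      simp only [ladd_apply, cvLift_ci, lneg_apply, compl₁₂_apply, map_add,
        neg_add])
    (fun c a x => by
      apply cv_ext
      intro k f t
      simp only [lsmul_apply, cvLift_ci, lneg_apply, compl₁₂_apply,
        map_smul, smul_neg])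

variable (A g) in
/-- The operator of insertion of an element of `A ⊗ g`. -/
def uT (r : ℤ) : A.A ⊗[K] g.V →ₗ[K] Module.End K (CV A g) := TensorProduct.lift (uOp A g r)

lemma uT_ci (r : ℤ) (a : A.A) (x : g.V) (k : ℕ) (f : LSDual A k) (t : SPow g (n - 1) k) :
    uT A g r (a ⊗ₜ x) (ci A g k f t) =
      -ci A g (k + 1) (dslant A r k a f) (tcons k (g.s (n - 1) x) t) := by
  rw [uT, TensorProduct.lift.tmul]
  exact cvLift_ci _ k f t

lemma dslant_actSwap (r : ℤ) (k : ℕ) (i : Fin k) (a : A.A) (f : LSDual A (k + 1)) :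
    dslant A r (k + 1) a (actSwap A k i f) = actSwap A (k + 1) i.succ (dslant A r (k + 1) a f) := by
  apply lext
  intro z
  rw [dslant_apply]
  change f (LS.push A _ _ _) = f (tw _ r (slant A (k + 1) a (LS.push A _ _ z)))
  rw [push_tw, slant_push (k + 1) a _ (Equiv.injective _) (eswap i.castSucc i.succ)
    (Equiv.injective _)]
  · exact eswap_ne (by simp [Fin.ext_iff]) (Fin.succ_ne_zero _).symm
  · intro j
    exact (fsucc_inj _).swap_apply i.castSucc i.succ j

lemma uT_swapSub (r : ℤ) (v : A.A ⊗[K] g.V) :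
    swapSub A g ≤ (swapSub A g).comap (uT A g r v) := by
  refine Submodule.span_le.mpr ?_
  rintro _ ⟨k, i, f, t, rfl⟩
  change uT A g r v _ ∈ swapSub A g
  induction v using induction_on with
  | zero => rw [map_zero, lzero_apply]; exact zero_mem _
  | add v w hv hw => rw [map_add, ladd_apply]; exact add_mem hv hw
  | tmul a x =>
    rw [map_sub, uT_ci, uT_ci, dslant_actSwap, ← spSwap_succ, ← neg_sub']
    exact neg_mem (swap_mem (k + 1) i.succ _ _)

variable (A g) in
/-- The quotient of the direct sum by the relations for the symmetric groups. -/
abbrev QV : Type u := CV A g ⧸ swapSub A g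

variable (A g) in
/-- The operator induced by the insertion of an element of `A ⊗ g`. -/
def uQ (r : ℤ) (v : A.A ⊗[K] g.V) : Module.End K (QV A g) :=
  (swapSub A g).mapQ (swapSub A g) (uT A g r v) (uT_swapSub r v)

lemma uQ_mk (r : ℤ) (v : A.A ⊗[K] g.V) (y : CV A g) :
    uQ A g r v ((swapSub A g).mkQ y) = (swapSub A g).mkQ (uT A g r v y) := rfl

lemma qv_ext {M : Type u} [AddCommGroup M] [Module K M] {F G : QV A g →ₗ[K] M}
    (h : ∀ k f t, F ((swapSub A g).mkQ (ci A g k f t)) = G ((swapSub A g).mkQ (ci A g k f t))) :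
    F = G := by
  apply Submodule.linearMap_qext
  exact cv_ext h

lemma mkQ_swap (k : ℕ) (i : Fin k) (f : LSDual A (k + 1)) (t : SPow g (n - 1) (k + 1)) :
    (swapSub A g).mkQ (ci A g (k + 1) (actSwap A k i f) t) =
      (swapSub A g).mkQ (ci A g (k + 1) f (spSwap g (n - 1) k i t)) := by
  rw [← sub_eq_zero, ← map_sub]
  exact (quot_mk_eq_zero _).mpr (swap_mem k i f t)

lemma actSwap_actSwap (k : ℕ) (i : Fin k) (f : LSDual A (k + 1)) :
    actSwap A k i (actSwap A k i f) = f := by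
  apply lext
  intro z
  change f (LS.push A _ _ (LS.push A _ _ z)) = f z
  rw [push_push]
  exact congrArg f ((push_congr _ _ (fun j => Equiv.swap_apply_self _ _ j) z).trans (push_id z))

lemma dslant_dslant (r r' : ℤ) (k : ℕ) {α β : ℤ} {a b : A.A} (ha : a ∈ A.gr α) (hb : b ∈ A.gr β)
    (f : LSDual A k) : actSwap A (k + 1) 0 (dslant A r (k + 1) a (dslant A r' k b f)) =
      sg K ((n - α) * (n - β) + r * (n - β) + r' * (n - α)) •
        dslant A r' (k + 1) b (dslant A r k a f) := by
  apply lext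
  intro z
  change f (tw _ r' (slant A k b (tw _ r (slant A (k + 1) a (LS.push A (eswap 0 1)
    (Equiv.injective _) z))))) =
    sg K _ • f (tw _ r (slant A k a (tw _ r' (slant A (k + 1) b z))))
  rw [slant_tw k r hb, slant_slant k hb ha, slant_tw k r' ha, map_smul, map_smul, map_smul, map_smul,
    map_smul, map_smul, map_smul, tw_comm_tw (lgr A (Fin k)) r r']
  simp only [smul_smul, ← sg_add, smul_eq_mul, ← mul_assoc]
  congr 1
  refine sg_congr ⟨(n - β) * (n - α) + r * (n - β) + r' * (n - α), by ring⟩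

lemma uQ_comm {i j : ℤ} {v w : A.A ⊗[K] g.V} (hv : v ∈ A.tgr g i) (hw : w ∈ A.tgr g j) :
    uQ A g (i + 1) v * uQ A g (j + 1) w =
      sg K ((i - -1) * (j - -1)) • (uQ A g (j + 1) w * uQ A g (i + 1) v) := by
  apply qv_ext
  intro k f t
  rw [lsmul_apply, end_mul_apply, end_mul_apply]
  simp only [uQ_mk]
  rw [← map_smul]
  induction hv using PDCDGA.tgr_induction with
  | h0 => simp
  | hadd x y _ _ hx hy =>
    simp only [map_add, ladd_apply, smul_add] at hx hy ⊢
    rw [hx, hy]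
  | ht α p hi a ha x hx =>
    induction hw using PDCDGA.tgr_induction with
    | h0 => simp
    | hadd x y _ _ hx hy =>
      simp only [map_add, ladd_apply, smul_add] at hx hy ⊢
      rw [hx, hy]
    | ht β q hj b hb y hy =>
      rw [uT_ci, map_neg, uT_ci, neg_neg, uT_ci, map_neg, uT_ci, neg_neg,
        ← actSwap_actSwap (k + 1) 0 (dslant A (i + 1) (k + 1) a (dslant A (j + 1) k b f)), mkQ_swap,
        dslant_dslant _ _ _ ha hb, spSwap_zero, spBraid_apply _ _ (g.s_mem _ hx) (g.s_mem _ hy)]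
      simp only [map_smul, lsmul_apply, smul_smul, ← sg_add]
      congr 1
      subst hi hj
      refine sg_congr ⟨((n : ℤ) - α) * (n - β) + (p - α + 1) * (q - β + 1), by ring⟩

lemma uQ_add (r : ℤ) (v w : A.A ⊗[K] g.V) : uQ A g r (v + w) = uQ A g r v + uQ A g r w := by
  apply qv_ext
  intro k f t
  rw [ladd_apply, uQ_mk, uQ_mk, uQ_mk, ← map_add, ← ladd_apply, ← map_add]

lemma uQ_smul (r : ℤ) (c : K) (v : A.A ⊗[K] g.V) : uQ A g r (c • v) = c • uQ A g r v := by
  apply qv_ext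
  intro k f t
  rw [lsmul_apply, uQ_mk, uQ_mk, ← map_smul, ← lsmul_apply, ← map_smul]

lemma psi_aux (a b : FreeAlgebra K (Σ i, (A.tensor g).gr i)) (hab : (A.tensor g).SymRel (-1) a b) :
    FreeAlgebra.lift K (fun x : Σ i, (A.tensor g).gr i => uQ A g (x.1 + 1) x.2.1) a =
      FreeAlgebra.lift K (fun x : Σ i, (A.tensor g).gr i => uQ A g (x.1 + 1) x.2.1) b := by
  cases hab with
  | add i x y =>
    rw [map_add, FreeAlgebra.lift_ι_apply, FreeAlgebra.lift_ι_apply, FreeAlgebra.lift_ι_apply]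
    exact uQ_add (i + 1) x.1 y.1
  | smul i c x =>
    rw [map_smul, FreeAlgebra.lift_ι_apply, FreeAlgebra.lift_ι_apply]
    exact uQ_smul (i + 1) c x.1
  | comm i j x y =>
    rw [map_smul, map_mul, map_mul, FreeAlgebra.lift_ι_apply, FreeAlgebra.lift_ι_apply]
    exact uQ_comm x.2 y.2

variable (A g) in
/-- The action of the Chevalley-Eilenberg algebra on the quotient. -/
def psiL : CEAlg A g →ₐ[K] Module.End K (QV A g) :=
  ((A.tensor g).symPres (-1)).lift (fun x => uQ A g (x.1 + 1) x.2.1) psi_aux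

lemma psiL_s {m : ℤ} {v : A.A ⊗[K] g.V} (hv : v ∈ A.tgr g m) (y : CV A g) :
    psiL A g ((A.tensor g).s (-1) v) ((swapSub A g).mkQ y) =
      (swapSub A g).mkQ (uT A g (m + 1) v y) := by
  have h : v ∈ (A.tensor g).gr m := hv
  rw [(A.tensor g).s_of_mem (-1) h, psiL, GPres.lift_gen]
  rfl

lemma phiV_swapSub : swapSub A g ≤ ker (phiV A g) := by
  refine Submodule.span_le.mpr ?_
  rintro _ ⟨k, i, f, t, rfl⟩
  change phiV A g _ = 0
  rw [map_sub, phiV_ci, phiV_ci, phi_swap, evM_mmap, sub_eq_zero]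
  rfl

variable (A g) in
/-- The map induced by `Φ` on the quotient. -/
def phiQ : QV A g →ₗ[K] CEAlg A g := (swapSub A g).liftQ (phiV A g) phiV_swapSub

lemma phiQ_mk (y : CV A g) : phiQ A g ((swapSub A g).mkQ y) = phiV A g y := rfl

lemma sum_basis_eval {M : Type u} [AddCommGroup M] [Module K M] (a : A.A) (F : A.A →ₗ[K] M) :
    ∑ s : A.Idx, A.ε (A.basis s * a) • F (A.dbasis s) = F a := by
  conv_rhs => rw [← A.dbasis.sum_repr a, map_sum]
  refine sum_congr rfl fun s _ => ?_
  rw [A.drepr_eq, map_smul]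

lemma phiV_uT {m : ℤ} {v : A.A ⊗[K] g.V} (hv : v ∈ A.tgr g m) (y : CV A g) :
    phiV A g (uT A g (m + 1) v y) = (A.tensor g).s (-1) v * phiV A g y := by
  induction y using cv_induction with
  | h0 => simp
  | hadd x y hx hy => rw [map_add, map_add, map_add, hx, hy, mul_add]
  | h k f t =>
    induction hv using PDCDGA.tgr_induction with
    | h0 =>
      have : (A.tensor g).s (-1) (0 : A.A ⊗[K] g.V) = 0 := map_zero _
      rw [map_zero, this, lzero_apply, map_zero, zero_mul]
    | hadd x y _ _ hx hy =>
      have : (A.tensor g).s (-1) (x + y : A.A ⊗[K] g.V) = (A.tensor g).s (-1) x +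
        (A.tensor g).s (-1) y := map_add _ _ _
      rw [map_add, this, ladd_apply, map_add, hx, hy, add_mul]
    | ht α i hi a ha x hx =>
      rw [uT_ci, map_neg, phiV_ci, phiV_ci]
      have h1 := phi_mul k hx 1 t (A := A)
      rw [mul_one] at h1
      rw [h1, map_add, map_sum, sum_eq_zero (s := (Finset.univ : Finset (Fin k))), add_zero,
        phi_one]
      · generalize phi A g k t = w
        induction w using induction_on with
        | zero => simp
        | add x y hx hy => rw [map_add, map_add, map_add, map_add, mul_add, ← hx, ← hy, neg_add]
        | tmul z c =>
          rw [mmap_tmul, delta_apply, map_neg, neg_neg, map_sum, evM_tmul]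
          refine Eq.trans ?_ (sum_basis_eval a ((mulRight K (f z • c)) ∘ₗ
            (stm A g).flip x))
          refine sum_congr rfl fun s _ => ?_
          rw [mulOp_tmul, evM_tmul, dslant_apply]
          by_cases hs : (s.1 : ℤ) + α = n
          · have : tw (lgr A (Fin (k + 1))) (i - (n - s.1) + 1) ((LS.push A Fin.succ
                (fsucc_inj k)) z) = psucc A k (tw (lgr A (Fin k)) (i - (n - s.1) + 1) z) :=
              (push_tw _ _ _ z).symm
            rw [this, slant_io, map_smul, map_smul,
              show i - (n - s.1) + 1 = m + 1 by omega, tw_tw]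
            simp [mul_smul_comm, smul_smul]
          · have : A.ε (A.basis s * a) = 0 := A.ε_mul_of_ne (A.basis_mem s) ha hs
            have h2 : tw (lgr A (Fin (k + 1))) (i - (n - s.1) + 1) ((LS.push A Fin.succ
                (fsucc_inj k)) z) = psucc A k (tw (lgr A (Fin k)) (i - (n - s.1) + 1) z) :=
              (push_tw _ _ _ z).symm
            rw [h2, slant_io, this, zero_smul, zero_smul, map_zero, map_zero, zero_smul]
      · intro j _
        generalize phi A g (k + 1) _ = w
        induction w using induction_on with
        | zero => simp
        | add x y hx hy => rw [map_add, map_add, hx, hy, add_zero]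
        | tmul z c => rw [lmul_tmul, evM_tmul, dslant_apply, slant_om, map_zero, map_zero, zero_smul]

lemma phiQ_psiL (w : CEAlg A g) (q : QV A g) : phiQ A g (psiL A g w q) = w * phiQ A g q := by
  induction w using (A.tensor g).sym_induction (-1) generalizing q with
  | h1 => rw [map_one, one_mul]; rfl
  | hadd x y hx hy => rw [map_add, ladd_apply, map_add, hx, hy, add_mul]
  | hsmul c x hx => rw [map_smul, lsmul_apply, map_smul, hx, smul_mul_assoc]
  | hmul i x hx j y hy ih =>
    rw [map_mul, end_mul_apply, mul_assoc, ← ih]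
    obtain ⟨y, hy⟩ := (swapSub A g).mkQ_surjective (psiL A g y q)
    rw [← hy, psiL_s hx, phiQ_mk, phiV_uT hx, phiQ_mk]

variable (A) in
/-- The augmentation of `G_A(∅)`. -/
def lsEmpty : LS A (Fin 0) →ₐ[K] K :=
  LSMap.map (A := A) (U := Fin 0) (R := K)
  { p := fun v => v.elim0
    w := fun v => v.elim0
    one := fun v => v.elim0
    mul := fun v => v.elim0
    comm := fun v => v.elim0
    comm' := fun v => v.elim0
    comm'' := fun v => v.elim0
    diag := fun v => v.elim0
    symm := fun v => v.elim0
    sq := fun v => v.elim0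
    arnold := fun v => v.elim0
    slide := fun v => v.elim0 }

lemma dual_empty (f : LSDual A 0) : f = f 1 • (lsEmpty A).toLinearMap := by
  apply lext
  intro z
  induction z using (lsPres A (Fin 0)).induction with
  | h1 => simp
  | hadd x y hx hy => rw [map_add, map_add, hx, hy]
  | hsmul c x hx => rw [map_smul, map_smul, hx]
  | hmul s y hy =>
    cases s with
    | pt v i a => exact v.elim0
    | om v w => exact v.elim0

variable (A g) in
/-- The unit of `G_A^∨ ∘ S(g[n-1])`. -/
def civ : CV A g := ci A g 0 (lsEmpty A).toLinearMap (ptprod K fun j => j.elim0)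

variable (A g) in
/-- The inverse of `Φ`. -/
def psiQ : CEAlg A g →ₗ[K] QV A g :=
  applyₗ ((swapSub A g).mkQ (civ A g)) ∘ₗ (psiL A g).toLinearMap

lemma psiQ_apply (w : CEAlg A g) : psiQ A g w = psiL A g w ((swapSub A g).mkQ (civ A g)) := rfl

lemma phiQ_psiQ (w : CEAlg A g) : phiQ A g (psiQ A g w) = w := by
  rw [psiQ_apply, phiQ_psiL, phiQ_mk, civ, phiV_ci, phi_zero, evM_tmul]
  simp

lemma dslant_mem (r : ℤ) (k : ℕ) {α i : ℤ} {a : A.A} (ha : a ∈ A.gr α) {f : LSDual A k}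
    (hf : f ∈ dgr A k i) : dslant A r k a f ∈ dgr A (k + 1) (i + (n - α)) := by
  intro j hj z hz
  rw [dslant_apply, tw_of_mem (lgr A (Fin k)) r (slant_mem k ha hz), map_smul,
    hf _ (by omega) _ (slant_mem k ha hz), smul_zero]

lemma uT_mem (r : ℤ) {m l : ℤ} {v : A.A ⊗[K] g.V} (hv : v ∈ A.tgr g m) {y : CV A g}
    (hy : y ∈ circGr A (g.symPois (n - 1)) l) :
    uT A g r v y ∈ circGr A (g.symPois (n - 1)) (m + 1 + l) := by
  refine map_mem_of_mem_span (fun x hx => ?_) hy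
  obtain ⟨k, i, p, rfl, f, hf, b, hb, rfl⟩ := hx
  induction hv using PDCDGA.tgr_induction with
  | h0 => rw [map_zero, lzero_apply]; exact zero_mem _
  | hadd x y _ _ h1 h2 => rw [map_add, ladd_apply]; exact add_mem h1 h2
  | ht α q hi a ha x hx =>
    have h : uT A g r (a ⊗ₜ x) (circTmul A (g.symPois (n - 1)) k f b) =
        -ci A g (k + 1) (dslant A r k a f) (tcons k (g.s (n - 1) x) (ptprod K b)) :=
      uT_ci r a x k f _
    rw [h]
    refine neg_mem (subset_span ⟨k + 1, i + (n - α), Fin.cons (q - (n - 1)) p, ?_, _,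
      dslant_mem r k ha hf, (Fin.cons (g.s (n - 1) x) b : Fin (k + 1) → g.Sym (n - 1)), ?_, ?_⟩)
    · rw [Fin.sum_univ_succ]
      simp only [Fin.cons_zero, Fin.cons_succ]
      omega
    · intro j
      refine Fin.cases ?_ (fun j => ?_) j
      · exact g.s_mem _ hx
      · exact hb j
    · exact congrArg (ci A g (k + 1) (dslant A r k a f)) (tcons_tprod (V := g.Sym (n - 1)) _ b)

lemma psiQ_mem {m : ℤ} {w : CEAlg A g} (hw : w ∈ cgr A g m) :
    psiQ A g w ∈ (circGr A (g.symPois (n - 1)) m).map (swapSub A g).mkQ := by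
  refine sgr_induction (g := A.tensor g) (-1)
    (q := fun m w => psiQ A g w ∈ (circGr A (g.symPois (n - 1)) m).map (swapSub A g).mkQ)
    ?_ ?_ ?_ ?_ ?_ hw
  · refine ⟨civ A g, subset_span ⟨0, 0, fun j => j.elim0, by simp, _, ?_, _,
      fun j => j.elim0, rfl⟩, ?_⟩
    · intro j hj z hz
      have h : ∀ z : LS A (Fin 0), z ∈ lgr A (Fin 0) 0 := by
        intro z
        induction z using (lsPres A (Fin 0)).induction with
        | h1 => exact gone_mem
        | hadd x y hx hy => exact add_mem hx hy
        | hsmul c x hx => exact smul_mem _ _ hx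
        | hmul s y hy =>
          cases s with
          | pt v i a => exact v.elim0
          | om v w => exact v.elim0
      have h0 := h z
      have : z = 0 := by
        have h1 := decompose_of_mem_same (lgr A (Fin 0)) hz
        rw [decompose_of_mem_ne (lgr A (Fin 0)) h0 hj.symm] at h1
        exact h1.symm
      rw [this, map_zero]
    · rw [psiQ_apply, map_one]; rfl
  · rintro i x j y hx hy ⟨u, hu, e⟩
    refine ⟨uT A g (i + 1) x u, ?_, ?_⟩
    · have := uT_mem (i + 1) (show x ∈ A.tgr g i from hx) hu
      rwa [show i - -1 + j = i + 1 + j by ring]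
    · rw [psiQ_apply, map_mul, end_mul_apply, ← psiQ_apply, ← e, psiL_s hx]
  · intro i; rw [map_zero]; exact zero_mem _
  · intro i x y hx hy; rw [map_add]; exact add_mem hx hy
  · intro i c x hx; rw [map_smul]; exact smul_mem _ _ hx

end Psi

section PsiSurj

variable {K : Type u} [Field K] {n : ℕ} {A : PDCDGA K n} {g : DGLie K}

variable (A g) in
/-- The span of the relations for the bracket of two generators. -/
def brSub : Submodule K (CV A g) := span K {v | ∃ (k : ℕ) (f : LSDual A (k + 1)) (i j : ℤ)
  (x y : g.V) (_ : x ∈ g.gr i) (_ : y ∈ g.gr j) (t : SPow g (n - 1) k),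
  v = ci A g (k + 2) (actBr A k f) (tcons (k + 1) (g.s (n - 1) x) (tcons k (g.s (n - 1) y) t)) -
    ci A g (k + 1) f (tcons k (g.symBr (n - 1) (g.s (n - 1) x) (g.s (n - 1) y)) t)}

lemma dslant_actBr (r : ℤ) (k : ℕ) {α : ℤ} {a : A.A} (ha : a ∈ A.gr α) (f : LSDual A (k + 1)) :
    dslant A r (k + 2) a (actBr A k f) = sg K (r * (n - 1) + (n - 1) * (n - α)) •
      actSwap A (k + 2) 0 (actSwap A (k + 2) 1 (actBr A (k + 1)
        (actSwap A (k + 1) 0 (dslant A r (k + 1) a f)))) := by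
  apply lext
  intro z
  have h1 : dslant A r (k + 2) a (actBr A k f) z =
      f (tw _ (n - 1) (c1 A k (tw _ r (slant A (k + 2) a z)))) := rfl
  have h2 : ∀ F : LSDual A (k + 2), actSwap A (k + 2) 0 (actSwap A (k + 2) 1 (actBr A (k + 1) F)) z =
      F (tw (lgr A (Fin (k + 2))) (n - 1) (c1 A (k + 1) (LS.push A (rot k) (rot_inj k) z))) := by
    intro F
    change F (tw (lgr A (Fin (k + 2))) (n - 1) (c1 A (k + 1) (LS.push A _ _ (LS.push A _ _ z)))) = _
    rw [push_push]
    exact congrArg (fun w => F (tw (lgr A (Fin (k + 2))) (n - 1) (c1 A (k + 1) w)))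
      (push_congr _ _ (fun j => (congrFun (rot_eq k) j).symm) z)
  rw [lsmul_apply, h1, h2]
  change _ = sg K _ • f (tw _ r (slant A (k + 1) a (LS.push A (eswap 0 1) (Equiv.injective _) _)))
  rw [push_tw, slant_tw (k + 1) (n - 1) ha, c1_tw, c1_slant, map_smul, map_smul, map_smul, map_smul,
    tw_comm_tw (lgr A (Fin (k + 1))) r, smul_smul]
  congr 1
  rw [← sg_add]
  refine sg_congr ⟨r * (n - 1) + (n - 1) * (n - α), by ring⟩

lemma map_neg_sub_neg {V W : Type u} [AddCommGroup V] [Module K V] [AddCommGroup W] [Module K W]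
    (f : V →ₗ[K] W) (u v : V) : f (-u - -v) = -f u + f v := by
  rw [map_sub, map_neg, map_neg, sub_neg_eq_add]

lemma map_smul_neg_sub {V W : Type u} [AddCommGroup V] [Module K V] [AddCommGroup W] [Module K W]
    (f : V →ₗ[K] W) (c : K) (u v : V) : f (c • -(u - v)) = -(c • f u) + c • f v := by
  rw [map_smul, map_neg, map_sub, smul_neg, smul_sub, neg_sub, sub_eq_neg_add]

lemma smul_aux {W : Type u} [AddCommGroup W] [Module K W] {P P' Q R : W} {s s' c : K}
    (h : P' = s' • P) (h' : R = c • Q) (hs : s * s' = c) (hc : c * c = 1) :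
    -(c • P) + c • R = -(s • P') + Q := by
  rw [h, h', smul_smul, smul_smul, hs, hc, one_smul]

lemma uT_brSub {m : ℤ} {v : A.A ⊗[K] g.V} (hv : v ∈ A.tgr g m) {b : CV A g} (hb : b ∈ brSub A g) :
    (swapSub A g).mkQ (uT A g (m + 1) v b) ∈ (brSub A g).map (swapSub A g).mkQ := by
  induction hb using span_induction with
  | zero => rw [map_zero, map_zero]; exact zero_mem _
  | add x y _ _ h1 h2 => rw [map_add, map_add]; exact add_mem h1 h2
  | smul c x _ h => rw [map_smul, map_smul]; exact smul_mem _ _ h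
  | mem b hb =>
    obtain ⟨k, f, i, j, x, y, hx, hy, t, rfl⟩ := hb
    induction hv using PDCDGA.tgr_induction with
    | h0 => rw [map_zero, lzero_apply, map_zero]; exact zero_mem _
    | hadd v w _ _ h1 h2 => rw [map_add, ladd_apply, map_add]; exact add_mem h1 h2
    | ht α q hm a ha z hz =>
      have sx := g.s_mem (n - 1) hx
      have sy := g.s_mem (n - 1) hy
      have sz := g.s_mem (n - 1) hz
      have sb := (g.isDer_symBr (n - 1) sx).mem sy
      set X := g.s (n - 1) x
      set Y := g.s (n - 1) y
      set Z := g.s (n - 1) z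
      set F := actSwap A (k + 1) 0 (dslant A (m + 1) (k + 1) a f) with hF
      have e1 : (swapSub A g).mkQ (ci A g (k + 3) (actSwap A (k + 2) 0 (actSwap A (k + 2) 1
          (actBr A (k + 1) F))) (tcons (k + 2) Z (tcons (k + 1) X (tcons k Y t)))) =
          sg K ((q - (n - 1)) * (i - (n - 1)) + (q - (n - 1)) * (j - (n - 1))) •
          (swapSub A g).mkQ (ci A g (k + 3) (actBr A (k + 1) F)
            (tcons (k + 2) X (tcons (k + 1) Y (tcons k Z t)))) := by
        rw [mkQ_swap, spSwap_zero, spBraid_apply _ _ sz sx, map_smul, map_smul, mkQ_swap,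
          ← fsucc_zero, spSwap_succ, spSwap_zero, spBraid_apply _ _ sz sy, map_smul, map_smul,
          map_smul, smul_smul, sg_add]
      have e2 : (swapSub A g).mkQ (ci A g (k + 2) F (tcons (k + 1) (g.symBr (n - 1) X Y) (tcons k Z t))) =
          sg K ((j - (n - 1) + (i - (n - 1) + (n - 1))) * (q - (n - 1))) • (swapSub A g).mkQ (ci A g (k + 2)
          (dslant A (m + 1) (k + 1) a f) (tcons (k + 1) Z (tcons k (g.symBr (n - 1) X Y) t))) := by
        rw [hF, mkQ_swap, spSwap_zero, spBraid_apply _ _ sb sz, map_smul, map_smul]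
      refine ⟨sg K ((j - (n - 1) + (i - (n - 1) + (n - 1))) * (q - (n - 1))) •
        -(ci A g (k + 3) (actBr A (k + 1) F) (tcons (k + 2) X (tcons (k + 1) Y (tcons k Z t))) -
        ci A g (k + 2) F (tcons (k + 1) (g.symBr (n - 1) X Y) (tcons k Z t))), ?_, ?_⟩
      · exact smul_mem _ _ (neg_mem (subset_span
          ⟨k + 1, F, i, j, x, y, hx, hy, tcons k Z t, rfl⟩))
      · have hs : sg K ((m + 1) * (n - 1) + (n - 1) * (n - α)) * sg K ((q - (n - 1)) * (i - (n - 1)) +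
            (q - (n - 1)) * (j - (n - 1))) =
            sg K ((j - (n - 1) + (i - (n - 1) + (n - 1))) * (q - (n - 1))) := by
          rw [← sg_add]
          subst hm
          exact sg_congr ⟨(j - (n - 1) + i) * (q - (n - 1)) + (n - 1) * (n - α), by ring⟩
        rw [map_sub (uT A g (m + 1) (a ⊗ₜ z)), uT_ci, uT_ci, dslant_actBr _ _ ha, ← hF]
        have e3 : ∀ (c : K) (f : LSDual A (k + 3)) (t : SPow g (n - 1) (k + 3)),
          (swapSub A g).mkQ (ci A g (k + 3) (c • f) t) = c • (swapSub A g).mkQ (ci A g (k + 3) f t) :=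
          fun c f t => by rw [map_smul, lsmul_apply, map_smul]
        refine (map_smul_neg_sub (swapSub A g).mkQ _ _ _).trans (Eq.trans ?_
          (map_neg_sub_neg (swapSub A g).mkQ _ _).symm)
        refine Eq.trans (smul_aux e1 e2 hs (sg_mul_self _)) (congrArg (fun w => -w + _) (e3 _ _ _).symm)

variable (A g) in
/-- The elements whose class belongs to the image of `Ψ`, up to the relations for the bracket. -/
def good : Submodule K (CV A g) :=
  (range (psiQ A g) ⊔ (brSub A g).map (swapSub A g).mkQ).comap (swapSub A g).mkQ

lemma brSub_le_good : brSub A g ≤ good A g :=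
  fun v hv => Submodule.mem_sup_right (Submodule.mem_map_of_mem hv)

lemma uT_good {m : ℤ} {v : A.A ⊗[K] g.V} (hv : v ∈ A.tgr g m) {y : CV A g} (hy : y ∈ good A g) :
    uT A g (m + 1) v y ∈ good A g := by
  obtain ⟨_, ⟨w, rfl⟩, _, ⟨b, hb, rfl⟩, e⟩ := Submodule.mem_sup.mp hy
  rw [good, mem_comap, ← psiL_s hv, ← e, map_add]
  refine add_mem (mem_sup_left ⟨(A.tensor g).s (-1) v * w, ?_⟩) (Submodule.mem_sup_right ?_)
  · rw [psiQ_apply, map_mul]; rfl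
  · rw [psiL_s hv]
    exact uT_brSub hv hb

variable (g) in
/-- The tensors of generators. -/
def gens (N : ℤ) : (k : ℕ) → Submodule K (SPow g N k)
  | 0 => ⊤
  | k + 1 => span K {u | ∃ (i : ℤ) (x : g.V) (_ : x ∈ g.gr i) (t : SPow g N k)
      (_ : t ∈ gens N k), u = tcons k (g.s N x) t}

lemma gens_cons (N : ℤ) (k : ℕ) {i : ℤ} {x : g.V} (hx : x ∈ g.gr i) {t : SPow g N k}
    (ht : t ∈ gens g N k) : tcons k (g.s N x) t ∈ gens g N (k + 1) :=
  subset_span ⟨i, x, hx, t, ht, rfl⟩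

lemma gens_le (N : ℤ) (k : ℕ) {P : Submodule K (SPow g N (k + 1))}
    (h : ∀ i, ∀ x ∈ g.gr i, ∀ t ∈ gens g N k, tcons k (g.s N x) t ∈ P) : gens g N (k + 1) ≤ P := by
  refine Submodule.span_le.mpr ?_
  rintro _ ⟨i, x, hx, t, ht, rfl⟩
  exact h i x hx t ht

lemma gens_swap (N : ℤ) (k : ℕ) (i : Fin k) (t : SPow g N (k + 1)) (ht : t ∈ gens g N (k + 1)) :
    spSwap g N k i t ∈ gens g N (k + 1) := by
  induction k with
  | zero => exact i.elim0
  | succ k ih =>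
    revert t
    refine Fin.cases ?_ (fun i => ?_) i
    · intro t ht
      refine gens_le N (k + 1) (P := (gens g N (k + 2)).comap (spSwap g N (k + 1) 0)) ?_ ht
      intro i x hx t ht
      refine gens_le N k (P := (gens g N (k + 2)).comap (spSwap g N (k + 1) 0 ∘ₗ
        tcons (k + 1) (g.s N x))) ?_ ht
      intro j y hy u hu
      rw [mem_comap, comp_apply, spSwap_zero,
        spBraid_apply _ _ (g.s_mem N hx) (g.s_mem N hy)]
      exact smul_mem _ _ (gens_cons N _ hy (gens_cons N _ hx hu))
    · intro t ht
      refine gens_le N (k + 1) (P := (gens g N (k + 2)).comap (spSwap g N (k + 1) i.succ)) ?_ ht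
      intro j x hx t ht
      rw [mem_comap, spSwap_succ]
      exact gens_cons N _ hx (ih i t ht)

lemma gens_perm (k : ℕ) (σ : Equiv.Perm (Fin (k + 1))) : ∀ (f : LSDual A (k + 1)),
    ∀ t ∈ gens g (n - 1) (k + 1), ∃ t' ∈ gens g (n - 1) (k + 1),
      (swapSub A g).mkQ (ci A g (k + 1) ((LS.push A σ σ.injective).toLinearMap.dualMap f) t) =
        (swapSub A g).mkQ (ci A g (k + 1) f t') := by
  have h : σ ∈ Submonoid.closure (Set.range fun i : Fin k => eswap i.castSucc i.succ) := by
    rw [Equiv.Perm.mclosure_swap_castSucc_succ]; trivial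
  induction h using Submonoid.closure_induction with
  | mem σ hσ =>
    obtain ⟨i, rfl⟩ := hσ
    intro f t ht
    exact ⟨_, gens_swap _ k i t ht, mkQ_swap k i f t⟩
  | one =>
    intro f t ht
    refine ⟨t, ht, congrArg (fun f => (swapSub A g).mkQ (ci A g (k + 1) f t)) ?_⟩
    apply lext
    intro z
    exact congrArg f (push_id z)
  | mul σ τ _ _ hσ hτ =>
    intro f t ht
    obtain ⟨t', ht', e'⟩ := hτ ((LS.push A σ σ.injective).toLinearMap.dualMap f) t ht
    obtain ⟨u, hu, e⟩ := hσ f t' ht'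
    refine ⟨u, hu, Eq.trans ?_ (e'.trans e)⟩
    refine congrArg (fun f => (swapSub A g).mkQ (ci A g (k + 1) f t)) ?_
    apply lext
    intro z
    exact congrArg f (push_push _ τ.injective _ σ.injective z).symm

lemma ci_actBr_good (k : ℕ) (h : ∀ f, ∀ t ∈ gens g (n - 1) (k + 1), ci A g (k + 1) f t ∈ good A g)
    (f : LSDual A (k + 1)) {t : SPow g (n - 1) (k + 2)} (ht : t ∈ gens g (n - 1) (k + 2)) :
    ci A g (k + 2) (actBr A k f) t ∈ good A g := by
  refine gens_le _ (k + 1) (P := (good A g).comap (ci A g (k + 2) (actBr A k f))) ?_ ht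
  intro i x hx t ht
  refine gens_le _ k (P := (good A g).comap (ci A g (k + 2) (actBr A k f) ∘ₗ tcons (k + 1)
    (g.s (n - 1) x))) ?_ ht
  intro j y hy u hu
  rw [mem_comap, comp_apply]
  have h1 := brSub_le_good (subset_span ⟨k, f, i, j, x, y, hx, hy, u, rfl⟩ :
    ci A g (k + 2) (actBr A k f) (tcons (k + 1) (g.s (n - 1) x) (tcons k (g.s (n - 1) y) u)) -
    ci A g (k + 1) f (tcons k (g.symBr (n - 1) (g.s (n - 1) x) (g.s (n - 1) y)) u) ∈ brSub A g)
  have h2 := h f (tcons k (g.symBr (n - 1) (g.s (n - 1) x) (g.s (n - 1) y)) u) (by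
    rw [g.symBr_s_s _ hx hy, map_smul, lsmul_apply]
    exact smul_mem _ _ (gens_cons _ _ (g.br_mem hx hy) hu))
  have := add_mem h1 h2
  rwa [sub_add_cancel] at this

lemma ci_slant_good (k : ℕ) (h : ∀ f, ∀ t ∈ gens g (n - 1) k, ci A g k f t ∈ good A g)
    {i : ℤ} {x : g.V} (hx : x ∈ g.gr i) {t : SPow g (n - 1) k} (ht : t ∈ gens g (n - 1) k) {α : ℤ}
    {a : A.A} (ha : a ∈ A.gr α) (f : LSDual A k) :
    ci A g (k + 1) (f ∘ₗ slant A k a) (tcons k (g.s (n - 1) x) t) ∈ good A g := by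
  have h1 := neg_mem (uT_good (A.tmul_mem g ha hx) (h (f ∘ₗ tw (lgr A (Fin k)) (i - α + 1)) t ht))
  rw [uT_ci, neg_neg] at h1
  have h2 : dslant A (i - α + 1) k a (f ∘ₗ tw (lgr A (Fin k)) (i - α + 1)) = f ∘ₗ slant A k a := by
    apply lext
    intro z
    rw [dslant_apply, comp_apply, comp_apply, tw_tw]
  rwa [h2] at h1

lemma gens_good (k : ℕ) (f : LSDual A k) {t : SPow g (n - 1) k} (ht : t ∈ gens g (n - 1) k) :
    ci A g k f t ∈ good A g := by
  induction k with
  | zero =>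
    obtain ⟨c, rfl⟩ := tpow_zero t
    rw [dual_empty f, map_smul (ci A g 0), lsmul_apply, map_smul, smul_comm]
    refine smul_mem _ _ (smul_mem _ _ (mem_sup_left ⟨1, ?_⟩))
    rw [psiQ_apply, map_one, Module.End.one_apply, civ]
  | succ k ih =>
    refine gens_le _ k (P := (good A g).comap (ci A g (k + 1) f)) ?_ ht
    intro i x hx t ht
    rw [mem_comap]
    cases k with
    | zero =>
      have hf : f = ∑ s : A.Idx, (f ∘ₗ lmulLeft K (io A 0 (A.basis s)) ∘ₗ
          (psucc A 0).toLinearMap) ∘ₗ slant A 0 (A.dbasis s) := by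
        apply lext
        intro z
        conv_lhs => rw [ls_one_expand z, map_sum]
        rw [lmsum_apply]
        rfl
      rw [hf, map_sum, lmsum_apply]
      exact Submodule.sum_mem _ fun s _ => ci_slant_good 0 (fun f t ht => ih f ht) hx ht
        (A.dbasis_mem s) _
    | succ k =>
      have hf : f = ∑ s : A.Idx, (f ∘ₗ lmulLeft K (io A 0 (A.basis s)) ∘ₗ
          (psucc A (k + 1)).toLinearMap) ∘ₗ slant A (k + 1) (A.dbasis s) +
          ∑ j : Fin (k + 1), (LS.push A (eswap (Fin.succ 0) j.succ)
            (eswap (Fin.succ 0) j.succ).injective).toLinearMap.dualMap (actBr A k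
            (f ∘ₗ lmulLeft K (om A 0 j.succ) ∘ₗ (psucc A (k + 1)).toLinearMap ∘ₗ
              (LS.push A (eswap 0 j) (eswap 0 j).injective).toLinearMap)) := by
        apply lext
        intro z
        conv_lhs => rw [ls_succ_expand k z, map_add, map_sum, map_sum]
        rw [ladd_apply, lmsum_apply, lmsum_apply]
        rfl
      rw [hf, map_add, ladd_apply, map_sum, map_sum, lmsum_apply,
        lmsum_apply]
      refine add_mem (Submodule.sum_mem _ fun s _ => ci_slant_good (k + 1) (fun f t ht => ih f ht)
        hx ht (A.dbasis_mem s) _) (Submodule.sum_mem _ fun j _ => ?_)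
      obtain ⟨t', ht', e⟩ := gens_perm (A := A) (k + 1) (eswap (Fin.succ 0) j.succ) (actBr A k
        (f ∘ₗ lmulLeft K (om A 0 j.succ) ∘ₗ (psucc A (k + 1)).toLinearMap ∘ₗ
          (LS.push A (eswap 0 j) (eswap 0 j).injective).toLinearMap)) _
        (gens_cons _ _ hx ht)
      rw [good, mem_comap, e]
      exact ci_actBr_good k (fun f t ht => ih f ht) _ ht'

end PsiSurj

section Rel

variable {K : Type u} [Field K] {n : ℕ} {A : PDCDGA K n} {B : PoisAlg K (n - 1)} {W : Type u} [AddCommGroup W] [Module K W]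
  {P : CircV A B →ₗ[K] W} (hP : ∀ t, CircRel A B t → P t = 0)

include hP

lemma rel_swap (k : ℕ) (i : Fin k) (f : LSDual A (k + 1)) (t : TPow B (k + 1)) :
    P (cin A B _ (actSwap A k i f ⊗ₜ t)) = P (cin A B _ (f ⊗ₜ tswap B k i t)) := by
  induction t using tpow_hom_induction with
  | h p b hb =>
    have h := hP _ (CircRel.swap k i f b p hb)
    rw [map_sub, map_smul, sub_eq_zero] at h
    rw [tswap_tprod B k i b p hb, tmul_smul, map_smul, map_smul]
    exact h
  | hadd x y hx hy => simp only [tmul_add, map_add, hx, hy]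
  | hsmul c x hx => simp only [tmul_smul, map_smul, hx]

lemma rel_unit (k : ℕ) (f : LSDual A (k + 1)) (t : TPow B k) :
    P (cin A B _ (actUnit A k f ⊗ₜ t)) = P (cin A B _ (f ⊗ₜ tcons k 1 t)) := by
  induction t using tpow_hom_induction with
  | h p b hb =>
    have h := hP _ (CircRel.unit k f b)
    rw [map_sub, sub_eq_zero] at h
    rw [tcons_tprod]; exact h
  | hadd x y hx hy => simp only [tmul_add, map_add, hx, hy]
  | hsmul c x hx => simp only [tmul_smul, map_smul, hx]

lemma rel_mul (k : ℕ) (f : LSDual A (k + 1)) (x y : B.B) (t : TPow B k) :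
    P (cin A B _ (actMul A k f ⊗ₜ tcons (k + 1) x (tcons k y t))) =
      P (cin A B _ (f ⊗ₜ tcons k (x * y) t)) := by
  induction t using tpow_hom_induction with
  | h p b hb =>
    have h := hP _ (CircRel.mul k f x y b)
    rw [map_sub, sub_eq_zero] at h
    rw [tcons_tprod, tcons_tprod, tcons_tprod]; exact h
  | hadd x y hx hy => simp only [tmul_add, map_add, hx, hy]
  | hsmul c x hx => simp only [tmul_smul, map_smul, hx]

lemma rel_br (k : ℕ) (f : LSDual A (k + 1)) (x y : B.B) (t : TPow B k) :
    P (cin A B _ (actBr A k f ⊗ₜ tcons (k + 1) x (tcons k y t))) =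
      P (cin A B _ (f ⊗ₜ tcons k (B.br x y) t)) := by
  induction t using tpow_hom_induction with
  | h p b hb =>
    have h := hP _ (CircRel.br k f x y b)
    rw [map_sub, sub_eq_zero] at h
    rw [tcons_tprod, tcons_tprod, tcons_tprod]; exact h
  | hadd x y hx hy => simp only [tmul_add, map_add, hx, hy]
  | hsmul c x hx => simp only [tmul_smul, map_smul, hx]

end Rel

section PhiIso

variable {K : Type u} [Field K] {n : ℕ} {A : PDCDGA K n} {g : DGLie K}

variable (A g) in
/-- The projection onto the relative composition product. -/
def mkC : CV A g →ₗ[K] (circ A (g.symPois (n - 1))).V := (circSub A (g.symPois (n - 1))).mkQ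

lemma mkC_rel (t : CircV A (g.symPois (n - 1))) (h : CircRel A _ t) : mkC A g t = 0 :=
  (quot_mk_eq_zero _).mpr (mem_sup_left (subset_span h))

lemma mkC_swap (k : ℕ) (i : Fin k) (f : LSDual A (k + 1)) (t : SPow g (n - 1) (k + 1)) :
    mkC A g (ci A g (k + 1) (actSwap A k i f) t) =
      mkC A g (ci A g (k + 1) f (spSwap g (n - 1) k i t)) := rel_swap (P := mkC A g) mkC_rel k i f t

lemma mkC_unit (k : ℕ) (f : LSDual A (k + 1)) (t : SPow g (n - 1) k) :
    mkC A g (ci A g k (actUnit A k f) t) = mkC A g (ci A g (k + 1) f (tcons k 1 t)) :=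
  rel_unit (P := mkC A g) mkC_rel k f t

lemma mkC_mul (k : ℕ) (f : LSDual A (k + 1)) (X Y : g.Sym (n - 1)) (t : SPow g (n - 1) k) :
    mkC A g (ci A g (k + 2) (actMul A k f) (tcons (k + 1) X (tcons k Y t))) =
      mkC A g (ci A g (k + 1) f (tcons k (X * Y) t)) := rel_mul (P := mkC A g) mkC_rel k f X Y t

lemma mkC_br (k : ℕ) (f : LSDual A (k + 1)) (X Y : g.Sym (n - 1)) (t : SPow g (n - 1) k) :
    mkC A g (ci A g (k + 2) (actBr A k f) (tcons (k + 1) X (tcons k Y t))) =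
      mkC A g (ci A g (k + 1) f (tcons k (g.symBr (n - 1) X Y) t)) :=
  rel_br (P := mkC A g) mkC_rel k f X Y t

lemma swapSub_le : swapSub A g ≤ ker (mkC A g) := by
  refine Submodule.span_le.mpr ?_
  rintro _ ⟨k, i, f, t, rfl⟩
  change mkC A g _ = 0
  rw [map_sub, mkC_swap, sub_self]

lemma brSub_le : brSub A g ≤ ker (mkC A g) := by
  refine Submodule.span_le.mpr ?_
  rintro _ ⟨k, f, i, j, x, y, hx, hy, t, rfl⟩
  change mkC A g _ = 0
  rw [map_sub, mkC_br, sub_self]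

variable (A g) in
/-- The inverse of `Φ`. -/
def psiC : CEAlg A g →ₗ[K] (circ A (g.symPois (n - 1))).V :=
  (swapSub A g).liftQ (mkC A g) swapSub_le ∘ₗ psiQ A g

lemma psiC_mem {m : ℤ} {w : CEAlg A g} (hw : w ∈ cgr A g m) :
    psiC A g w ∈ (circ A (g.symPois (n - 1))).gr m := by
  obtain ⟨v, hv, e⟩ := psiQ_mem hw
  refine ⟨v, hv, ?_⟩
  rw [psiC, comp_apply, ← e]
  rfl

lemma circPhi_psiC (hA : A.euler = 0) (w : CEAlg A g) : (circPhi A g hA).f (psiC A g w) = w := by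
  conv_rhs => rw [← phiQ_psiQ w]
  rw [psiC, comp_apply]
  obtain ⟨v, hv⟩ := (swapSub A g).mkQ_surjective (psiQ A g w)
  rw [← hv]
  rfl

variable (A g) in
/-- The tensors `t` such that all `f ⊗ t` belong to the image of `Ψ`. -/
def attained (k : ℕ) : Submodule K (SPow g (n - 1) k) :=
  ⨅ f : LSDual A k, (range (psiC A g)).comap (mkC A g ∘ₗ ci A g k f)

lemma mem_attained {k : ℕ} {t : SPow g (n - 1) k} : t ∈ attained A g k ↔
    ∀ f, mkC A g (ci A g k f t) ∈ range (psiC A g) := by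
  rw [attained, Submodule.mem_iInf]; rfl

lemma gens_attained {k : ℕ} {t : SPow g (n - 1) k} (ht : t ∈ gens g (n - 1) k) :
    t ∈ attained A g k := by
  refine mem_attained.mpr fun f => ?_
  obtain ⟨_, ⟨w, rfl⟩, _, ⟨b, hb, rfl⟩, e⟩ := Submodule.mem_sup.mp (gens_good k f ht)
  refine ⟨w, ?_⟩
  have h := congrArg ((swapSub A g).liftQ (mkC A g) swapSub_le) e
  rw [map_add] at h
  have h2 : mkC A g b = 0 := brSub_le hb
  refine Eq.trans ?_ h
  refine (add_zero _).symm.trans (congrArg _ ?_)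
  exact h2.symm

variable (A g) in
/-- The tensors which become attained after the insertion of `m` generators in the front. -/
def attainedIter : ℕ → (k : ℕ) → Submodule K (SPow g (n - 1) k)
  | 0, k => attained A g k
  | m + 1, k => ⨅ x : Σ i, g.gr i, (attainedIter m (k + 1)).comap (tcons k (g.s (n - 1) x.2.1))

lemma mem_attainedIter_succ {m k : ℕ} {t : SPow g (n - 1) k} : t ∈ attainedIter A g (m + 1) k ↔
    ∀ i, ∀ x ∈ g.gr i, tcons k (g.s (n - 1) x) t ∈ attainedIter A g m (k + 1) := by
  rw [attainedIter, Submodule.mem_iInf]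
  exact ⟨fun h i x hx => h ⟨i, x, hx⟩, fun h x => h x.1 x.2.1 x.2.2⟩

lemma gens_attainedIter (m : ℕ) {k : ℕ} {t : SPow g (n - 1) k} (ht : t ∈ gens g (n - 1) k) :
    t ∈ attainedIter A g m k := by
  induction m generalizing k with
  | zero => exact gens_attained ht
  | succ m ih => exact mem_attainedIter_succ.mpr fun i x hx => ih (gens_cons _ _ hx ht)

lemma attainedIter_swap (m : ℕ) {k : ℕ} (i : Fin k) {t : SPow g (n - 1) (k + 1)}
    (ht : t ∈ attainedIter A g m (k + 1)) : spSwap g (n - 1) k i t ∈ attainedIter A g m (k + 1) := by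
  induction m generalizing k with
  | zero =>
    refine mem_attained.mpr fun f => ?_
    rw [← mkC_swap]
    exact mem_attained.mp ht _
  | succ m ih =>
    refine mem_attainedIter_succ.mpr fun j x hx => ?_
    rw [← spSwap_succ]
    exact ih i.succ (mem_attainedIter_succ.mp ht j x hx)

lemma attainedIter_swap_zero (m : ℕ) {k : ℕ} {i j : ℤ} {X Y : g.Sym (n - 1)}
    (hX : X ∈ g.sgr (n - 1) i) (hY : Y ∈ g.sgr (n - 1) j) {t : SPow g (n - 1) k}
    (ht : tcons (k + 1) X (tcons k Y t) ∈ attainedIter A g m (k + 2)) :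
    tcons (k + 1) Y (tcons k X t) ∈ attainedIter A g m (k + 2) := by
  have h := attainedIter_swap m (0 : Fin (k + 1)) ht
  rw [spSwap_zero, spBraid_apply _ _ hX hY] at h
  have := smul_mem _ (sg K (i * j)) h
  rwa [smul_smul, sg_mul_self, one_smul] at this

lemma attainedIter_one (m : ℕ) {k : ℕ} {t : SPow g (n - 1) k} (ht : t ∈ attainedIter A g m k) :
    tcons k 1 t ∈ attainedIter A g m (k + 1) := by
  induction m generalizing k with
  | zero =>
    refine mem_attained.mpr fun f => ?_
    rw [← mkC_unit]
    exact mem_attained.mp ht _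
  | succ m ih =>
    refine mem_attainedIter_succ.mpr fun j x hx => ?_
    exact attainedIter_swap_zero m (gone_mem (A := g.sgr (n - 1))) (g.s_mem _ hx)
      (ih (mem_attainedIter_succ.mp ht j x hx))

lemma attainedIter_mul (m : ℕ) {k : ℕ} {i j : ℤ} {X Y : g.Sym (n - 1)}
    (hX : X ∈ g.sgr (n - 1) i) (hY : Y ∈ g.sgr (n - 1) j) {t : SPow g (n - 1) k}
    (ht : tcons (k + 1) X (tcons k Y t) ∈ attainedIter A g m (k + 2)) :
    tcons k (X * Y) t ∈ attainedIter A g m (k + 1) := by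
  induction m generalizing k with
  | zero =>
    refine mem_attained.mpr fun f => ?_
    rw [← mkC_mul]
    exact mem_attained.mp ht _
  | succ m ih =>
    refine mem_attainedIter_succ.mpr fun q x hx => ?_
    refine attainedIter_swap_zero m (gmul_mem hX hY) (g.s_mem _ hx) (ih ?_)
    have h1 := attainedIter_swap_zero m (g.s_mem _ hx) hX (mem_attainedIter_succ.mp ht q x hx)
    have h2 := attainedIter_swap m (Fin.succ 0) h1
    rw [spSwap_succ, spSwap_zero, spBraid_apply _ _ (g.s_mem _ hx) hY] at h2
    have := smul_mem _ (sg K ((q - (n - 1)) * j)) h2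
    rwa [map_smul, smul_smul, sg_mul_self, one_smul] at this

lemma mem_attainedIter (m k : ℕ) (t : SPow g (n - 1) k) : t ∈ attainedIter A g m k := by
  induction k generalizing m with
  | zero => exact gens_attainedIter m (by trivial)
  | succ k ih =>
    induction t using tcons_induction with
    | hadd x y hx hy => exact add_mem hx hy
    | h X t =>
      induction X using g.sym_induction (n - 1) generalizing m with
      | h1 => exact attainedIter_one m (ih m t)
      | hadd x y hx hy => rw [map_add, ladd_apply]; exact add_mem (hx m) (hy m)
      | hsmul c x hx => rw [map_smul, lsmul_apply]; exact smul_mem _ _ (hx m)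
      | hmul i x hx j y hy h =>
        exact attainedIter_mul m (g.s_mem _ hx) hy (mem_attainedIter_succ.mp (h (m + 1)) i x hx)

lemma psiC_surjective : Surjective (psiC A g) := by
  intro x
  obtain ⟨v, rfl⟩ := (circSub A (g.symPois (n - 1))).mkQ_surjective x
  change mkC A g v ∈ range (psiC A g)
  induction v using cv_induction with
  | h0 => rw [map_zero]; exact zero_mem _
  | hadd x y hx hy => rw [map_add]; exact add_mem hx hy
  | h k f t => exact mem_attained.mp (mem_attainedIter 0 k t) f

/-- The chain map `Φ` is an isomorphism. -/
lemma psiC_circPhi (hA : A.euler = 0) (x : (circ A (g.symPois (n - 1))).V) :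
    psiC A g ((circPhi A g hA).f x) = x := by
  obtain ⟨w, rfl⟩ := psiC_surjective x
  rw [circPhi_psiC]

lemma Cpx.Hom.isQuasiIso_of_inverse {C D : Cpx K} (f : Cpx.Hom C D) (s : D.V →ₗ[K] C.V)
    (hs : ∀ i, ∀ y ∈ D.gr i, s y ∈ C.gr i) (h1 : ∀ y, f.f (s y) = y) (h2 : ∀ x, s (f.f x) = x) :
    f.IsQuasiIso where
  surj i y hy hd := by
    refine ⟨s y, hs i y hy, ?_, 0, zero_mem _, ?_⟩
    · rw [← h2 (C.d _), f.comm, h1, hd, map_zero]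
    · rw [map_zero, add_zero]; exact h1 y
  inj i x hx hd := by
    rintro ⟨z, hz, e⟩
    refine ⟨s z, hs _ z hz, ?_⟩
    rw [← h2 x, ← h2 (C.d _), f.comm, h1, e]

lemma circPhi_isQuasiIso (hA : A.euler = 0) : (circPhi A g hA).IsQuasiIso :=
  (circPhi A g hA).isQuasiIso_of_inverse (psiC A g) (fun _ _ hy => psiC_mem hy) (circPhi_psiC hA)
    (psiC_circPhi hA)

end PhiIso

section Weights

variable {K : Type u} [Field K]

namespace Cpx.Hom

variable {C D E : Cpx K}

lemma IsQuasiIso.comp {g : Hom D E} {f : Hom C D} (hg : g.IsQuasiIso) (hf : f.IsQuasiIso) :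
    (g.comp f).IsQuasiIso where
  surj i y hy hd := by
    obtain ⟨x, hx, dx, z, hz, e⟩ := hg.surj i y hy hd
    obtain ⟨w, hw, dw, z', hz', e'⟩ := hf.surj i x hx dx
    refine ⟨w, hw, dw, z + g.f z', add_mem hz (g.mem hz'), ?_⟩
    change g.f (f.f w) = _
    rw [e', map_add, e, g.comm, map_add, add_assoc]
  inj i x hx hd h := by
    obtain ⟨z, hz, e⟩ := h
    exact hf.inj i x hx hd (hg.inj i _ (f.mem hx) (by rw [← f.comm, hd, map_zero]) ⟨z, hz, e⟩)

lemma IsQuasiIso.of_comp {g : Hom D E} {f : Hom C D} (hg : g.IsQuasiIso)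
    (h : (g.comp f).IsQuasiIso) : f.IsQuasiIso where
  surj i y hy hd := by
    obtain ⟨x, hx, dx, z, hz, e⟩ := h.surj i _ (g.mem hy) (by rw [← g.comm, hd, map_zero])
    obtain ⟨w, hw, e'⟩ := hg.inj i (f.f x - y) (sub_mem (f.mem hx) hy)
      (by rw [map_sub, ← f.comm, dx, hd, map_zero, sub_zero]) ⟨z, hz, by
        rw [map_sub]; exact sub_eq_of_eq_add' e⟩
    exact ⟨x, hx, dx, w, hw, by rw [← e', add_sub_cancel]⟩
  inj i x hx hd h' := by
    obtain ⟨z, hz, e⟩ := h'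
    exact h.inj i x hx hd ⟨g.f z, g.mem hz, by rw [← g.comm, ← e]; rfl⟩

variable (p : Hom C D) (s : D.V →ₗ[K] C.V) (H : C.V →ₗ[K] C.V)

/-- The commutator of the differential with an operator of degree one. -/
def lap : C.V →ₗ[K] C.V := C.d ∘ₗ H + H ∘ₗ C.d

lemma lap_apply (x : C.V) : lap H x = C.d (H x) + H (C.d x) := rfl

lemma lap_d (x : C.V) : C.d (lap H x) = lap H (C.d x) := by
  rw [lap_apply, lap_apply, map_add, C.d_d, C.d_d, map_zero, zero_add, add_zero]

open Polynomial in
lemma aeval_mem {V : Type u} [AddCommGroup V] [Module K V] {T : Module.End K V} {W : Submodule K V}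
    (h : ∀ x ∈ W, T x ∈ W) (q : K[X]) {x : V} (hx : x ∈ W) : aeval T q x ∈ W := by
  induction q using Polynomial.induction_on generalizing x with
  | C a => rw [aeval_C]; exact smul_mem _ a hx
  | add q r hq hr => rw [map_add]; exact add_mem (hq hx) (hr hx)
  | monomial k a ih =>
    rw [pow_succ, ← mul_assoc, map_mul, aeval_X]
    exact ih (h x hx)

open Polynomial in
lemma aeval_sub_mem {V : Type u} [AddCommGroup V] [Module K V] {T : Module.End K V}
    {W : Submodule K V} (h : ∀ x ∈ W, T x ∈ W) (q : K[X]) (hq : q.eval 0 = 1) {x : V}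
    (hx : T x ∈ W) : aeval T q x - x ∈ W := by
  have h1 : q = 1 + q.divX * X := by
    conv_lhs => rw [← q.divX_mul_X_add]
    rw [coeff_zero_eq_eval_zero, hq, C_1, add_comm]
  rw [h1, map_add, map_one, map_mul, aeval_X]
  change x + aeval T q.divX (T x) - x ∈ W
  rw [add_sub_cancel_left]
  exact aeval_mem h _ hx

/-- The vectors which are eigenvectors of the commutator modulo lower terms. -/
def weightSet (G G' : Submodule K C.V) : Set C.V :=
  {x | x ∈ G ∧ ∃ w : ℕ, lap H x - (w : K) • x ∈ G' ∧ (w = 0 → s (p.f x) - x ∈ G') ∧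
    (w ≠ 0 → s (p.f x) ∈ G')}

open Polynomial in
lemma weight_aux [CharZero K] {G G' : Submodule K C.V} (hle : G' ≤ G) (hG' : ∀ x ∈ G', lap H x ∈ G')
    {x : C.V} (hx : x ∈ span K (weightSet p s H G G')) :
    ∃ a : C.V, lap H a ∈ G' ∧ s (p.f x) - a ∈ G' ∧
      ∃ q : K[X], q.eval 0 = 1 ∧ aeval (lap H : Module.End K C.V) q x - a ∈ G' := by
  induction hx using span_induction with
  | zero => exact ⟨0, by simp, by simp, 1, by simp, by simp⟩
  | smul c x _ h =>
    obtain ⟨a, h1, h2, q, h3, h4⟩ := h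
    refine ⟨c • a, ?_, ?_, q, h3, ?_⟩
    · rw [map_smul]; exact smul_mem _ _ h1
    · rw [map_smul, map_smul, ← smul_sub]; exact smul_mem _ _ h2
    · rw [map_smul, ← smul_sub]; exact smul_mem _ _ h4
  | add x y _ _ hx hy =>
    obtain ⟨a, h1, h2, q, h3, h4⟩ := hx
    obtain ⟨b, k1, k2, r, k3, k4⟩ := hy
    refine ⟨a + b, ?_, ?_, r * q, ?_, ?_⟩
    · rw [map_add]; exact add_mem h1 k1
    · rw [map_add, map_add, add_sub_add_comm]; exact add_mem h2 k2
    · rw [eval_mul, h3, k3, one_mul]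
    · have e1 := add_mem (aeval_mem hG' r h4) (aeval_sub_mem hG' r k3 h1)
      have e2 := add_mem (aeval_mem hG' q k4) (aeval_sub_mem hG' q h3 k1)
      have := add_mem e1 e2
      rw [map_sub, map_sub, sub_add_sub_cancel, sub_add_sub_cancel, ← end_mul_apply,
        ← end_mul_apply, ← map_mul, ← map_mul, mul_comm q r] at this
      rwa [map_add, add_sub_add_comm]
  | mem x hx =>
    obtain ⟨hx, w, h1, h2, h3⟩ := hx
    by_cases hw : w = 0
    · subst hw
      refine ⟨x, by simpa using h1, h2 rfl, 1, by simp, by simp⟩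
    · have hw' : (w : K) ≠ 0 := Nat.cast_ne_zero.mpr hw
      refine ⟨0, by simp, by simpa using h3 hw, 1 - Polynomial.C (w : K)⁻¹ * X, by simp, ?_⟩
      have := smul_mem _ (-(w : K)⁻¹) h1
      rw [smul_sub, smul_smul, neg_mul, inv_mul_cancel₀ hw', neg_smul, neg_smul, one_smul] at this
      rw [sub_zero, map_sub, map_one, map_mul, aeval_C, aeval_X]
      change x - (w : K)⁻¹ • lap H x ∈ G'
      convert this using 1
      abel

open Polynomial in
/-- A chain map with a contraction of its kernel, up to a filtration and up to weights, is a
quasi-isomorphism. -/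
theorem isQuasiIso_of_weights [CharZero K] (hs : ∀ i, ∀ y ∈ D.gr i, s y ∈ C.gr i)
    (hps : ∀ y, p.f (s y) = y) (hH : ∀ i, ∀ x ∈ C.gr i, H x ∈ C.gr (i + 1))
    (hpH : ∀ x, p.f (H x) = 0) (F : ℕ → Submodule K C.V) (hF : F 0 = ⊥) (hF' : Monotone F)
    (hex : ∀ x, ∃ m, x ∈ F m) (hw : ∀ m, F (m + 1) ≤ span K
      (weightSet p s H (F (m + 1)) (F m))) : p.IsQuasiIso := by
  have hlap : ∀ m, ∀ x ∈ F m, lap H x ∈ F m := by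
    intro m
    cases m with
    | zero =>
      intro x hx
      rw [hF, mem_bot] at hx
      rw [hx, map_zero]; exact zero_mem _
    | succ m =>
      intro x hx
      have h := hw m hx
      clear hx
      refine map_mem_of_mem_span (fun x hx => ?_) h
      obtain ⟨hx, w, h1, -⟩ := hx
      have := add_mem (hF' (Nat.le_succ m) h1) (smul_mem _ (w : K) hx)
      rwa [sub_add_cancel] at this
  have hdeg : ∀ i, ∀ x ∈ C.gr i, lap H x ∈ C.gr i := by
    intro i x hx
    rw [lap_apply]
    refine add_mem ?_ ?_
    · have := C.d_mem (hH i x hx); rwa [add_sub_cancel_right] at this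
    · have := hH _ _ (C.d_mem hx); rwa [sub_add_cancel] at this
  have hp : ∀ x, p.f (lap H x) = 0 := by
    intro x
    rw [lap_apply, map_add, hpH, p.comm, hpH, map_zero, add_zero]
  have key : ∀ m i x, x ∈ F m → x ∈ C.gr i → C.d x = 0 → p.f x = 0 →
      ∃ y ∈ C.gr (i + 1), p.f y = 0 ∧ x = C.d y := by
    intro m
    induction m with
    | zero =>
      intro i x hx _ _ _
      rw [hF, mem_bot] at hx
      exact ⟨0, zero_mem _, map_zero _, by rw [hx, map_zero]⟩
    | succ m ih =>
      intro i x hx hi hd h0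
      obtain ⟨a, h1, h2, q, h3, h4⟩ := weight_aux p s H (hF' (Nat.le_succ m)) (hlap m) (hw m hx)
      rw [h0, map_zero, zero_sub] at h2
      have h5 := add_mem h4 (neg_mem h2)
      rw [neg_neg, sub_add_cancel] at h5
      have hq : q = 1 + X * q.divX := by
        conv_lhs => rw [← q.X_mul_divX_add]
        rw [coeff_zero_eq_eval_zero, h3, C_1, add_comm]
      set z := aeval (lap H : Module.End K C.V) q.divX x with hz
      have e1 : aeval (lap H : Module.End K C.V) q x = x + lap H z := by
        rw [hq, map_add, map_one, map_mul, aeval_X]; rfl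
      have hzd : C.d z = 0 := aeval_mem (W := ker C.d)
        (fun x hx => by rw [mem_ker, lap_d, LinearMap.mem_ker.mp hx, map_zero]) _ hd
      have hzi : z ∈ C.gr i := aeval_mem (hdeg i) _ hi
      have e2 : lap H z = C.d (H z) := by rw [lap_apply, hzd, map_zero, add_zero]
      rw [e1] at h5
      obtain ⟨y, hy, py, e⟩ := ih i _ h5 (add_mem hi (hdeg i _ hzi))
        (by rw [map_add, hd, lap_d, hzd, map_zero, add_zero]) (by rw [map_add, h0, hp, add_zero])
      exact ⟨y - H z, sub_mem hy (hH i z hzi), by rw [map_sub, py, hpH, sub_zero], by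
        rw [map_sub, ← e, ← e2, add_sub_cancel_right]⟩
  constructor
  · intro i y hy hd
    obtain ⟨m, hm⟩ := hex (C.d (s y))
    obtain ⟨z, hz, pz, e⟩ := key m (i - 1) _ hm (C.d_mem (hs i y hy)) (C.d_d _)
      (by rw [p.comm, hps, hd])
    rw [sub_add_cancel] at hz
    refine ⟨s y - z, sub_mem (hs i y hy) hz, by rw [map_sub, e, sub_self], 0, zero_mem _, ?_⟩
    rw [map_sub, hps, pz, sub_zero, map_zero, add_zero]
  · rintro i x hx hd ⟨z, hz, e⟩
    obtain ⟨m, hm⟩ := hex (x - C.d (s z))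
    have hz' := C.d_mem (hs _ z hz)
    rw [add_sub_cancel_right] at hz'
    obtain ⟨y, hy, -, e'⟩ := key m i _ hm (sub_mem hx hz') (by rw [map_sub, hd, C.d_d, sub_zero])
      (by rw [map_sub, p.comm, hps, e, sub_self])
    exact ⟨y + s z, add_mem hy (hs _ z hz), by rw [map_add, ← e', sub_add_cancel]⟩

end Cpx.Hom

end Weights

variable {K : Type u} [Field K]

lemma PoisAlg.br_one {N : ℤ} (X : PoisAlg K N) (x : X.B) : X.br x 1 = 0 := by
  have h : X.br.flip 1 = 0 := by
    refine ghom_ext (gr := X.gr) fun i x hx => ?_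
    have h1 : (1 : X.B) ∈ X.gr 0 := gone_mem
    have := X.leibniz hx h1 h1
    rw [mul_one, mul_one, one_mul, mul_zero, sg_zero, one_smul, left_eq_add] at this
    exact this
  exact lcongr_fun h x

namespace DGLie

section Lift

variable (L : DGLie K) (N : ℤ)

section Alg

variable {R : Type u} [Ring R] [Algebra K R] (𝒜 : ℤ → Submodule K R) [GradedAlgebra 𝒜]
  (hc : ∀ {i j x y}, x ∈ 𝒜 i → y ∈ 𝒜 j → x * y = sg K (i * j) • (y * x))
  (f : L.V →ₗ[K] R) (hf : ∀ {i x}, x ∈ L.gr i → f x ∈ 𝒜 (i - N))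

include hc hf in
lemma symLift_aux (a b : FreeAlgebra K (Σ i, L.gr i)) (hab : L.SymRel N a b) :
    FreeAlgebra.lift K (fun x : Σ i, L.gr i => f x.2) a =
      FreeAlgebra.lift K (fun x : Σ i, L.gr i => f x.2) b := by
  cases hab with
  | add i x y => simp
  | smul i c x => simp
  | comm i j x y => simpa using hc (hf x.2) (hf y.2)

/-- The morphism of algebras which extends a graded linear map to the symmetric algebra. -/
def symLift : L.Sym N →ₐ[K] R := (L.symPres N).lift (fun x => f x.2) (L.symLift_aux N 𝒜 hc f hf)

lemma symLift_s (x : L.V) : L.symLift N 𝒜 hc f hf (L.s N x) = f x := by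
  have h : (L.symLift N 𝒜 hc f hf).toLinearMap ∘ₗ L.s N = f := by
    refine ghom_ext (gr := L.gr) fun i x hx => ?_
    rw [comp_apply, s_of_mem L N hx]
    exact (L.symPres N).lift_gen _ _ _
  exact lcongr_fun h x

lemma symLift_mem {i : ℤ} {x : L.Sym N} (hx : x ∈ L.sgr N i) :
    L.symLift N 𝒜 hc f hf x ∈ 𝒜 i := by
  refine map_mem_of_mem_span (f := (L.symLift N 𝒜 hc f hf).toLinearMap) (fun y hy => ?_) hx
  obtain ⟨l, rfl, rfl⟩ := hy
  clear hx
  rw [toLinearMap_apply]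
  induction l with
  | nil => simpa using gone_mem (A := 𝒜)
  | cons a l ih =>
    simp only [List.map_cons, List.prod_cons, List.sum_cons, map_mul]
    refine gmul_mem ?_ ih
    rw [gen_eq, symLift_s]
    exact hf a.2.2

end Alg

lemma sym_algHom_ext {R : Type u} [Ring R] [Algebra K R] {F G : L.Sym N →ₐ[K] R}
    (h : ∀ i, ∀ x ∈ L.gr i, F (L.s N x) = G (L.s N x)) : F = G := by
  refine (L.symPres N).hom_ext fun x => ?_
  rw [gen_eq]
  exact h _ _ x.2.2

section Pois

variable (X : PoisAlg K N) (f : L.V →ₗ[K] X.B) (hf : ∀ {i x}, x ∈ L.gr i → f x ∈ X.gr (i - N))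

/-- The morphism of algebras from the symmetric algebra to a Poisson algebra. -/
abbrev poisAlgHom : L.Sym N →ₐ[K] X.B := L.symLift N X.gr X.mul_comm f hf

lemma poisAlgHom_br_aux {a : L.Sym N} {i : ℤ} (ha : a ∈ L.sgr N i)
    (h : ∀ j, ∀ y ∈ L.gr j, L.poisAlgHom N X f hf (L.symBr N a (L.s N y)) =
      X.br (L.poisAlgHom N X f hf a) (f y)) (b : L.Sym N) :
    L.poisAlgHom N X f hf (L.symBr N a b) =
      X.br (L.poisAlgHom N X f hf a) (L.poisAlgHom N X f hf b) := by
  induction b using L.sym_induction N with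
  | h1 =>
    rw [IsDer.map_one L N (L.isDer_symBr N ha), map_one, map_zero, X.br_one]
  | hadd x y hx hy => rw [map_add, map_add, map_add, map_add, hx, hy]
  | hsmul c x hx => rw [map_smul, map_smul, map_smul, map_smul, hx]
  | hmul j x hx k y hy ih =>
    rw [(L.isDer_symBr N ha).mul (L.s_mem N hx) hy, map_add, map_mul, h j x hx, map_smul, map_mul,
      ih, map_mul, symLift_s,
      X.leibniz (L.symLift_mem N X.gr X.mul_comm f hf ha) (hf hx)
        (L.symLift_mem N X.gr X.mul_comm f hf hy)]

/-- The morphism of Poisson algebras which extends a linear map that is compatible with the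
differentials and the brackets. -/
def symPoisLift (hd : ∀ {i x}, x ∈ L.gr i → f (L.d x) = sg K N • X.d (f x))
    (hbr : ∀ {i j x y}, x ∈ L.gr i → y ∈ L.gr j → sg K (N * i) • f (L.br x y) = X.br (f x) (f y)) :
    PoisAlg.Hom (L.symPois N) X where
  f := L.poisAlgHom N X f hf
  mem hx := L.symLift_mem N X.gr X.mul_comm f hf hx
  d x := by
    change L.poisAlgHom N X f hf (L.symD N x) = _
    induction x using L.sym_induction N with
    | h1 =>
      have h1 : (1 : X.B) ∈ X.gr 0 := gone_mem
      have := X.d_mul h1 h1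
      rw [mul_one, mul_one, one_mul, sg_zero, one_smul, left_eq_add] at this
      refine (congrArg _ (IsDer.map_one L N (L.isDer_symD N))).trans ?_
      rw [map_zero]
      refine Eq.trans this.symm (congrArg X.d (map_one (L.poisAlgHom N X f hf)).symm)
    | hadd x y hx hy =>
      rw [map_add, map_add, hx, hy, ← map_add]
      exact congrArg X.d (map_add (L.poisAlgHom N X f hf) x y).symm
    | hsmul c x hx =>
      rw [map_smul, map_smul, hx, ← map_smul]
      exact congrArg X.d (map_smul (L.poisAlgHom N X f hf) c x).symm
    | hmul i x hx j y hy ih =>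
      refine Eq.trans ?_ (congrArg X.d (map_mul (L.poisAlgHom N X f hf) (L.s N x) y)).symm
      rw [(L.isDer_symD N).mul (L.s_mem N hx) hy, symLift_s, X.d_mul (hf hx)
        (L.symLift_mem N X.gr X.mul_comm f hf hy), map_add, map_mul, map_smul, map_mul, symLift_s,
        L.symD_s N hx, map_smul, symLift_s, hd hx, smul_smul, sg_mul_self, one_smul, ih]
      congr 2
      exact sg_congr ⟨0, by ring⟩
  br x y := by
    revert x y
    change ∀ x y : L.Sym N, L.poisAlgHom N X f hf (L.symBr N x y) =
      X.br (L.poisAlgHom N X f hf x) (L.poisAlgHom N X f hf y)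
    intro x y
    have h1 : ∀ i, ∀ x ∈ L.gr i, ∀ b, L.poisAlgHom N X f hf (L.symBr N (L.s N x) b) =
        X.br (f x) (L.poisAlgHom N X f hf b) := by
      intro i x hx b
      rw [L.poisAlgHom_br_aux N X f hf (L.s_mem N hx), symLift_s]
      intro j y hy
      rw [L.symBr_s_s N hx hy, map_smul, symLift_s, symLift_s, hbr hx hy]
    have h2 : ∀ i, ∀ x ∈ L.sgr N i, ∀ y, L.poisAlgHom N X f hf (L.symBr N x y) =
        X.br (L.poisAlgHom N X f hf x) (L.poisAlgHom N X f hf y) := by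
      intro i x hx y
      refine L.poisAlgHom_br_aux N X f hf hx (fun j y hy => ?_) y
      rw [L.symBr_symm N hx (L.s_mem N hy), map_smul, h1 j y hy,
        X.br_symm (L.symLift_mem N X.gr X.mul_comm f hf hx) (hf hy)]
    induction x using inductionOn (L.sgr N) with
    | zero => rw [map_zero, map_zero, map_zero, lzero_apply, lzero_apply, map_zero]
    | add x x' hx hx' =>
      rw [map_add, map_add, map_add, ladd_apply, ladd_apply, map_add, hx, hx']
    | homogeneous x => exact h2 _ x x.2 y

end Pois

end Lift

/-- Morphisms of dg Lie algebras. -/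
structure Hom (L M : DGLie K) where
  f : L.V →ₗ[K] M.V
  mem : ∀ {i x}, x ∈ L.gr i → f x ∈ M.gr i
  d : ∀ x, f (L.d x) = M.d (f x)
  br : ∀ x y, f (L.br x y) = M.br (f x) (f y)

variable {L M : DGLie K} (φ : Hom L M)

/-- The morphism of Poisson algebras induced by a morphism of Lie algebras. -/
def Hom.sym (N : ℤ) : PoisAlg.Hom (L.symPois N) (M.symPois N) :=
  L.symPoisLift N (M.symPois N) (M.s N ∘ₗ φ.f) (fun hx => M.s_mem N (φ.mem hx))
    (fun {i x} hx => by
      change M.s N (φ.f (L.d x)) = sg K N • M.symD N (M.s N (φ.f x))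
      rw [M.symD_s N (φ.mem hx), smul_smul, sg_mul_self, one_smul, φ.d])
    (fun {i j x y} hx hy => by
      change sg K (N * i) • M.s N (φ.f (L.br x y)) = M.symBr N (M.s N (φ.f x)) (M.s N (φ.f y))
      rw [M.symBr_s_s N (φ.mem hx) (φ.mem hy), φ.br])

/-- The morphism of algebras induced by a morphism of Lie algebras. -/
def Hom.symA (N : ℤ) : L.Sym N →ₐ[K] M.Sym N := (φ.sym N).f

lemma Hom.symA_s (N : ℤ) (x : L.V) : φ.symA N (L.s N x) = M.s N (φ.f x) :=
  L.symLift_s N (M.sgr N) (M.sym_comm N) (M.s N ∘ₗ φ.f) (fun hx => M.s_mem N (φ.mem hx)) x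

lemma Hom.symA_mem {N i : ℤ} {x : L.Sym N} (hx : x ∈ L.sgr N i) : φ.symA N x ∈ M.sgr N i :=
  (φ.sym N).mem hx

lemma Hom.symA_symD (N : ℤ) (x : L.Sym N) : φ.symA N (L.symD N x) = M.symD N (φ.symA N x) :=
  (φ.sym N).d x

lemma Hom.symA_ad (N : ℤ) {i : ℤ} {x : L.V} (hx : x ∈ L.gr i) (y : L.Sym N) :
    φ.symA N (L.ad N x y) = M.ad N (φ.f x) (φ.symA N y) := by
  rw [← L.symBr_s N hx, ← M.symBr_s N (φ.mem hx), ← φ.symA_s N]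
  exact (φ.sym N).br _ y

/-- The map of Chevalley-Eilenberg complexes induced by a morphism of Lie algebras. -/
def Hom.ce : Cpx.Hom L.CE M.CE where
  f := (φ.symA (-1)).toLinearMap
  mem hx := φ.symA_mem hx
  comm x := by
    change φ.symA (-1) (L.ceD x) = M.ceD (φ.symA (-1) x)
    induction x using L.sym_induction (-1) with
    | h1 => rw [ceD_one, map_one, ceD_one, map_zero]
    | hadd x y hx hy => rw [map_add, map_add, map_add, map_add, hx, hy]
    | hsmul c x hx => rw [map_smul, map_smul, map_smul, map_smul, hx]
    | hmul i x hx j y hy ih =>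
      rw [L.ceD_mul hx, map_add, map_add, map_smul, map_mul, map_mul, map_mul, ih,
        φ.symA_ad (-1) hx, φ.symA_symD, φ.symA_s, M.ceD_mul (φ.mem hx)]

/-- The tensor product of a morphism of Lie algebras with an algebra. -/
def Hom.tensor {n : ℕ} (A : PDCDGA K n) : Hom (A.tensor L) (A.tensor M) where
  f := lTensor A.A φ.f
  mem {i x} hx := by
    change x ∈ A.tgr L i at hx
    change lTensor A.A φ.f x ∈ A.tgr M i
    induction hx using PDCDGA.tgr_induction with
    | h0 => rw [map_zero]; exact zero_mem _
    | hadd x y _ _ hx hy => rw [map_add]; exact add_mem hx hy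
    | ht k j hij a ha x hx =>
      rw [lTensor_tmul]
      exact A.tmul_mem' M ha (φ.mem hx) hij
  d x := by
    have h : lTensor A.A φ.f ∘ₗ A.td L = A.td M ∘ₗ lTensor A.A φ.f := by
      apply ext'
      intro a x
      simp [PDCDGA.td, φ.d]
    exact lcongr_fun h x
  br x y := by
    change lTensor A.A φ.f (A.tbr L x y) =
      A.tbr M (lTensor A.A φ.f x) (lTensor A.A φ.f y)
    have h : (A.tbr L).compr₂ (lTensor A.A φ.f) =
        (A.tbr M).compl₁₂ (lTensor A.A φ.f) (lTensor A.A φ.f) := by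
      apply ext'
      intro a x
      apply ext'
      intro b y
      simp only [compr₂_apply, compl₁₂_apply, lTensor_tmul]
      induction x using inductionOn L.gr with
      | zero => simp
      | add x x' hx hx' =>
        simp only [map_add, tmul_add, ladd_apply, hx, hx']
      | homogeneous x =>
        induction b using inductionOn A.gr with
        | zero => simp
        | add b b' hx hx' =>
          simp only [map_add, add_tmul, hx, hx']
        | homogeneous b =>
          rw [A.tbr_tmul L x.2 b.2, A.tbr_tmul M (φ.mem x.2) b.2, map_smul, lTensor_tmul,
            φ.br]
    exact lcongr_fun₂ h x y

end DGLie

section Naturality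

variable {K : Type u} [Field K] {n : ℕ} {A : PDCDGA K n}

section Swap

variable {N : ℤ} {B C : PoisAlg K N} (φ : PoisAlg.Hom B C)

lemma tpMap_tprod (k : ℕ) (b : Fin k → B.B) : tpMap φ k (ptprod K b) =
    ptprod K fun j => φ.f (b j) := by
  rw [tpMap, map_tprod]; rfl

lemma tpMap_tswap (k : ℕ) (i : Fin k) (t : TPow B (k + 1)) :
    tpMap φ (k + 1) (tswap B k i t) = tswap C k i (tpMap φ (k + 1) t) := by
  induction t using tpow_hom_induction with
  | h p b hb =>
    rw [tswap_tprod B k i b p hb, map_smul, tpMap_tprod, tpMap_tprod,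
      tswap_tprod C k i _ p fun j => φ.mem (hb j)]
    rfl
  | hadd x y hx hy => rw [map_add, map_add, map_add, map_add, hx, hy]
  | hsmul c x hx => rw [map_smul, map_smul, map_smul, map_smul, hx]

lemma tpMap_tcons (k : ℕ) (b : B.B) (t : TPow B k) :
    tpMap φ (k + 1) (tcons k b t) = tcons k (φ.f b) (tpMap φ k t) := by
  induction t using tpow_hom_induction with
  | h p c hc =>
    rw [tcons_tprod, tpMap_tprod, tpMap_tprod, tcons_tprod]
    congr 1
    funext j
    refine Fin.cases ?_ (fun j => ?_) j <;> simp
  | hadd x y hx hy => rw [map_add, map_add, map_add, map_add, hx, hy]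
  | hsmul c x hx => rw [map_smul, map_smul, map_smul, map_smul, hx]

end Swap

variable {L M : DGLie K} (φ : DGLie.Hom L M)

/-- The map induced on tensor powers by a morphism of Lie algebras. -/
def spMap (N : ℤ) (k : ℕ) : SPow L N k →ₗ[K] SPow M N k := tpMap (φ.sym N) k

variable (A) in
/-- The map induced on direct sums by a morphism of Lie algebras. -/
def cvMap : CV A L →ₗ[K] CV A M := circMapV A (φ.sym (n - 1))

lemma cvMap_ci (k : ℕ) (f : LSDual A k) (t : SPow L (n - 1) k) :
    cvMap A φ (ci A L k f t) = ci A M k f (spMap φ (n - 1) k t) :=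
  circMapV_cin A (φ.sym (n - 1)) k f t

lemma cvMap_swapSub : swapSub A L ≤ (swapSub A M).comap (cvMap A φ) := by
  refine Submodule.span_le.mpr ?_
  rintro _ ⟨k, i, f, t, rfl⟩
  change cvMap A φ _ ∈ swapSub A M
  rw [map_sub, cvMap_ci, cvMap_ci]
  refine subset_span ⟨k, i, f, spMap φ (n - 1) (k + 1) t, ?_⟩
  exact congrArg (fun t => ci A M (k + 1) (actSwap A k i f) _ - ci A M (k + 1) f t)
    (tpMap_tswap (φ.sym (n - 1)) k i t)

variable (A) in
/-- The map induced on quotients by a morphism of Lie algebras. -/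
def qvMap : QV A L →ₗ[K] QV A M :=
  (swapSub A L).mapQ (swapSub A M) (cvMap A φ) (cvMap_swapSub φ)

lemma cvMap_uT (r : ℤ) (v : A.A ⊗[K] L.V) (y : CV A L) :
    cvMap A φ (uT A L r v y) = uT A M r (lTensor A.A φ.f v) (cvMap A φ y) := by
  have h : (uT A L r).compr₂ (cvMap A φ) =
      (uT A M r).compl₁₂ (lTensor A.A φ.f) (cvMap A φ) := by
    apply ext'
    intro a x
    apply cv_ext
    intro k f t
    simp only [compr₂_apply, compl₁₂_apply, lTensor_tmul]
    rw [uT_ci, map_neg, cvMap_ci, cvMap_ci, uT_ci]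
    have := tpMap_tcons (φ.sym (n - 1)) k (L.s (n - 1) x) t
    have h2 : (φ.sym (n - 1)).f (L.s (n - 1) x) = M.s (n - 1) (φ.f x) := φ.symA_s (n - 1) x
    exact congrArg (fun t => -ci A M (k + 1) (dslant A r k a f) t)
      (this.trans (congrArg (fun b : M.Sym (n - 1) => tcons k b (spMap φ (n - 1) k t)) h2))
  exact lcongr_fun₂ h v y

lemma qvMap_psiL (w : CEAlg A L) (q : QV A L) :
    qvMap A φ (psiL A L w q) = psiL A M ((φ.tensor A).symA (-1) w) (qvMap A φ q) := by
  induction w using (A.tensor L).sym_induction (-1) generalizing q with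
  | h1 => rw [map_one, map_one, map_one]; rfl
  | hadd x y hx hy =>
    rw [map_add, ladd_apply, map_add, hx, hy, map_add, map_add, ladd_apply]
  | hsmul c x hx =>
    rw [map_smul, lsmul_apply, map_smul, hx, map_smul, map_smul, lsmul_apply]
  | hmul i v hv j y hy ih =>
    rw [map_mul, end_mul_apply, map_mul, map_mul, end_mul_apply, ← ih]
    generalize psiL A L y q = q'
    obtain ⟨z, rfl⟩ := (swapSub A L).mkQ_surjective q'
    have h1 := congrArg (qvMap A φ) (psiL_s hv z)
    have h2 := psiL_s ((φ.tensor A).mem hv) (cvMap A φ z)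
    refine h1.trans ?_
    refine (congrArg (swapSub A M).mkQ (cvMap_uT φ (i + 1) v z)).trans ?_
    refine h2.symm.trans ?_
    exact congrArg (fun w => psiL A M w ((swapSub A M).mkQ (cvMap A φ z)))
      ((φ.tensor A).symA_s (-1) v).symm

lemma cvMap_civ : cvMap A φ (civ A L) = civ A M := by
  rw [civ, cvMap_ci]
  refine congrArg (ci A M 0 (lsEmpty A).toLinearMap) ?_
  refine (tpMap_tprod (φ.sym (n - 1)) 0 _).trans ?_
  exact congrArg (ptprod K) (funext fun j => j.elim0)

lemma circMap_psiC (w : CEAlg A L) : (circMap A (φ.sym (n - 1))).f (psiC A L w) =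
    psiC A M ((φ.tensor A).symA (-1) w) := by
  have h : ∀ q : QV A L, (circMap A (φ.sym (n - 1))).f ((swapSub A L).liftQ (mkC A L) swapSub_le q) =
      (swapSub A M).liftQ (mkC A M) swapSub_le (qvMap A φ q) := by
    intro q
    obtain ⟨z, rfl⟩ := (swapSub A L).mkQ_surjective q
    rfl
  refine (h _).trans ?_
  refine congrArg ((swapSub A M).liftQ (mkC A M) swapSub_le) ?_
  rw [psiQ_apply, qvMap_psiL, psiQ_apply]
  exact congrArg (fun z => psiL A M _ ((swapSub A M).mkQ z)) (cvMap_civ φ)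

/-- The isomorphism with the Chevalley-Eilenberg complex is natural. -/
lemma circPhi_naturality (hA : A.euler = 0) (x : (circ A (L.symPois (n - 1))).V) :
    (circPhi A M hA).f ((circMap A (φ.sym (n - 1))).f x) =
      (φ.tensor A).ce.f ((circPhi A L hA).f x) := by
  have h := circMap_psiC φ ((circPhi A L hA).f x)
  rw [psiC_circPhi] at h
  rw [h]
  exact circPhi_psiC hA _

end Naturality

variable {K : Type u} [Field K]

namespace DGLie

section Len

variable (L : DGLie K) (N : ℤ)

/-- The span of the words of length less than `m`. -/
def len : ℕ → Submodule K (L.Sym N)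
  | 0 => ⊥
  | m + 1 => span K ({1} ∪ {w | ∃ v : L.V, ∃ y ∈ len m, w = L.s N v * y})

variable {L N}

lemma one_mem_len (m : ℕ) : (1 : L.Sym N) ∈ L.len N (m + 1) :=
  subset_span (Or.inl rfl)

lemma mul_mem_len {m : ℕ} (v : L.V) {y : L.Sym N} (hy : y ∈ L.len N m) :
    L.s N v * y ∈ L.len N (m + 1) :=
  subset_span (Or.inr ⟨v, y, hy, rfl⟩)

lemma len_succ_induction {m : ℕ} {p : ∀ x, x ∈ L.len N (m + 1) → Prop} (h0 : p 0 (zero_mem _))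
    (h1 : p 1 (one_mem_len m))
    (hadd : ∀ x y hx hy, p x hx → p y hy → p (x + y) (add_mem hx hy))
    (hsmul : ∀ (c : K) x hx, p x hx → p (c • x) (smul_mem _ c hx))
    (hmul : ∀ i, ∀ v ∈ L.gr i, ∀ y, ∀ hy : y ∈ L.len N m, p (L.s N v * y) (mul_mem_len v hy))
    {x : L.Sym N} (hx : x ∈ L.len N (m + 1)) : p x hx := by
  induction hx using span_induction with
  | zero => exact h0
  | add x y hx hy h1 h2 => exact hadd x y hx hy h1 h2
  | smul c x hx h => exact hsmul c x hx h
  | mem x hx =>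
    rcases hx with rfl | ⟨v, y, hy, rfl⟩
    · exact h1
    · have key : ∃ h, p (L.s N v * y) h := by
        induction v using inductionOn L.gr with
        | zero => rw [map_zero, zero_mul]; exact ⟨_, h0⟩
        | add v w hv hw =>
          obtain ⟨a, ha⟩ := hv
          obtain ⟨b, hb⟩ := hw
          rw [map_add, add_mul]
          exact ⟨_, hadd _ _ a b ha hb⟩
        | homogeneous v => exact ⟨_, hmul _ v v.2 y hy⟩
      exact key.2

lemma len_mono : Monotone (L.len N) := by
  refine monotone_nat_of_le_succ fun m => ?_
  induction m with
  | zero => exact bot_le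
  | succ m ih =>
    intro x hx
    induction hx using len_succ_induction with
    | h0 => exact zero_mem _
    | h1 => exact one_mem_len _
    | hadd x y _ _ hx hy => exact add_mem hx hy
    | hsmul c x _ hx => exact smul_mem _ c hx
    | hmul i v hv y hy => exact mul_mem_len v (ih hy)

lemma exists_mem_len (x : L.Sym N) : ∃ m, x ∈ L.len N m := by
  induction x using L.sym_induction N with
  | h1 => exact ⟨1, one_mem_len 0⟩
  | hadd x y hx hy =>
    obtain ⟨a, ha⟩ := hx
    obtain ⟨b, hb⟩ := hy
    exact ⟨max a b, add_mem (len_mono (le_max_left a b) ha) (len_mono (le_max_right a b) hb)⟩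
  | hsmul c x hx => obtain ⟨a, ha⟩ := hx; exact ⟨a, smul_mem _ c ha⟩
  | hmul i v hv j y hy ih => obtain ⟨a, ha⟩ := ih; exact ⟨a + 1, mul_mem_len v ha⟩

lemma IsDer.mul_right {p : ℤ} {D : L.Sym N →ₗ[K] L.Sym N} (hD : IsDer (L.sgr N) p D) {i : ℤ}
    {x : L.Sym N} (hx : x ∈ L.sgr N i) (y : L.Sym N) :
    D (x * y) = D x * y + sg K (p * i) • (x * D y) := by
  induction y using inductionOn (L.sgr N) with
  | zero => simp
  | add y z hy hz => rw [mul_add, map_add, hy, hz, mul_add, map_add, mul_add]; module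
  | homogeneous y => exact hD.mul hx y.2

lemma IsDer.len_mem {p : ℤ} {D : L.Sym N →ₗ[K] L.Sym N} (hD : IsDer (L.sgr N) p D)
    (hs : ∀ i, ∀ v ∈ L.gr i, ∃ w, D (L.s N v) = L.s N w) {m : ℕ} {x : L.Sym N}
    (hx : x ∈ L.len N m) : D x ∈ L.len N m := by
  induction m generalizing x with
  | zero => rw [len, mem_bot] at hx; rw [hx, map_zero]; exact zero_mem _
  | succ m ih =>
    induction hx using len_succ_induction with
    | h0 => rw [map_zero]; exact zero_mem _
    | h1 => rw [DGLie.IsDer.map_one L N hD]; exact zero_mem _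
    | hadd x y _ _ hx hy => rw [map_add]; exact add_mem hx hy
    | hsmul c x _ hx => rw [map_smul]; exact smul_mem _ c hx
    | hmul i v hv y hy =>
      obtain ⟨w, e⟩ := hs i v hv
      rw [DGLie.IsDer.mul_right hD (L.s_mem N hv), e]
      exact add_mem (mul_mem_len w hy) (smul_mem _ _ (mul_mem_len v (ih hy)))

lemma ad_len_mem {m : ℕ} {x : L.Sym N} (hx : x ∈ L.len N m) (v : L.V) :
    L.ad N v x ∈ L.len N m := by
  induction v using inductionOn L.gr with
  | zero => rw [map_zero, lzero_apply]; exact zero_mem _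
  | add v w hv hw => rw [map_add, ladd_apply]; exact add_mem hv hw
  | homogeneous v =>
    refine DGLie.IsDer.len_mem (L.isDer_ad N v.2) (fun j w hw => ?_) hx
    exact ⟨sg K _ • L.br v w, by rw [L.ad_s N v.2 hw, map_smul]⟩

end Len

/-- A section of a morphism of dg Lie algebras, with a contraction of the kernel. -/
structure Contraction {L M : DGLie K} (φ : Hom L M) where
  σ : M.V →ₗ[K] L.V
  h : L.V →ₗ[K] L.V
  σ_mem : ∀ {i x}, x ∈ M.gr i → σ x ∈ L.gr i
  h_mem : ∀ {i x}, x ∈ L.gr i → h x ∈ L.gr (i + 1)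
  φ_σ : ∀ x, φ.f (σ x) = x
  φ_h : ∀ x, φ.f (h x) = 0
  d_h : ∀ x, L.d (h x) + h (L.d x) = x - σ (φ.f x)

namespace Contraction

variable {L M : DGLie K} {φ : Hom L M} (c : Contraction φ) (N : ℤ)

/-- The morphism of symmetric algebras induced by the section. -/
def sec : M.Sym N →ₐ[K] L.Sym N :=
  M.symLift N (L.sgr N) (L.sym_comm N) (L.s N ∘ₗ c.σ) (fun hx => L.s_mem N (c.σ_mem hx))

lemma sec_s (x : M.V) : c.sec N (M.s N x) = L.s N (c.σ x) :=
  M.symLift_s N (L.sgr N) (L.sym_comm N) (L.s N ∘ₗ c.σ) (fun hx => L.s_mem N (c.σ_mem hx)) x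

lemma symA_sec (y : M.Sym N) : φ.symA N (c.sec N y) = y := by
  have h : (φ.symA N).comp (c.sec N) = AlgHom.id K _ := by
    refine M.sym_algHom_ext N fun i x hx => ?_
    rw [AlgHom.comp_apply, sec_s, φ.symA_s, c.φ_σ]; rfl
  exact DFunLike.congr_fun h y

/-- The derivation which extends the contraction. -/
def symH : L.Sym N →ₗ[K] L.Sym N :=
  L.symDer N 1 ⟨sg K N • (L.s N ∘ₗ c.h), fun i x hx => smul_mem _ _ (by
    have := L.s_mem N (c.h_mem hx)
    rwa [add_sub_right_comm] at this)⟩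

lemma isDer_symH : IsDer (L.sgr N) 1 (c.symH N) := L.isDer_symDer N _ _

lemma symH_s {i : ℤ} {x : L.V} (hx : x ∈ L.gr i) :
    c.symH N (L.s N x) = sg K N • L.s N (c.h x) := L.symDer_s N _ _ hx

lemma symH_mul {i : ℤ} {x : L.V} (hx : x ∈ L.gr i) (y : L.Sym N) :
    c.symH N (L.s N x * y) = sg K N • (L.s N (c.h x) * y) +
      sg K (i - N) • (L.s N x * c.symH N y) := by
  rw [DGLie.IsDer.mul_right (c.isDer_symH N) (L.s_mem N hx), c.symH_s N hx, smul_mul_assoc, one_mul]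

lemma symA_symH (x : L.Sym N) : φ.symA N (c.symH N x) = 0 := by
  induction x using L.sym_induction N with
  | h1 => rw [DGLie.IsDer.map_one L N (c.isDer_symH N), map_zero]
  | hadd x y hx hy => rw [map_add, map_add, hx, hy, add_zero]
  | hsmul a x hx => rw [map_smul, map_smul, hx, smul_zero]
  | hmul i x hx j y hy ih =>
    rw [symH_mul c N hx, map_add, map_smul, map_smul, map_mul, map_mul, ih, mul_zero, smul_zero,
      add_zero, φ.symA_s, c.φ_h, map_zero, zero_mul, smul_zero]

lemma symH_len {m : ℕ} {x : L.Sym N} (hx : x ∈ L.len N m) : c.symH N x ∈ L.len N m :=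
  DGLie.IsDer.len_mem (c.isDer_symH N)
    (fun i v hv => ⟨sg K N • c.h v, by rw [c.symH_s N hv, map_smul]⟩) hx

variable {N} (D : L.Sym N →ₗ[K] L.Sym N) (T : L.V →ₗ[K] Module.End K (L.Sym N))
  (hT : ∀ (m : ℕ) (v : L.V), ∀ y ∈ L.len N m, T v y ∈ L.len N m)
  (hD : ∀ {i v}, v ∈ L.gr i → ∀ y, D (L.s N v * y) = sg K N • (L.s N (L.d v) * y) +
    sg K (i - N) • (L.s N v * D y) + T v y)

include hT hD in
lemma lap_mul (m : ℕ) (v : L.V) {y : L.Sym N} (hy : y ∈ L.len N m) :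
    D (c.symH N (L.s N v * y)) + c.symH N (D (L.s N v * y)) -
      (L.s N (v - c.σ (φ.f v)) * y + L.s N v * (D (c.symH N y) + c.symH N (D y))) ∈ L.len N m := by
  induction v using inductionOn L.gr with
  | zero => simp
  | add v w hv hw =>
    convert add_mem hv hw using 1
    simp only [map_add, add_mul, map_sub, sub_mul]
    abel
  | @homogeneous i v =>
    obtain ⟨v, hv⟩ := v
    have e : D (c.symH N (L.s N v * y)) + c.symH N (D (L.s N v * y)) -
        (L.s N (v - c.σ (φ.f v)) * y + L.s N v * (D (c.symH N y) + c.symH N (D y))) =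
        sg K N • T (c.h v) y + sg K (i - N) • T v (c.symH N y) + c.symH N (T v y) := by
      rw [c.symH_mul N hv, map_add, map_smul, map_smul, hD (c.h_mem hv), hD hv, hD hv, map_add,
        map_add, map_smul, map_smul, c.symH_mul N (L.d_mem hv), c.symH_mul N hv, ← c.d_h, map_add,
        add_mul, mul_add]
      have h1 : sg K (i + 1 - N) = -sg K (i - N) := by
        rw [show i + 1 - N = (i - N) + 1 by ring, sg_add, sg_odd odd_one]; ring
      have h2 : sg K (i - 1 - N) = -sg K (i - N) := by
        rw [show i - 1 - N = (i - N) + (-1) by ring, sg_add, sg_odd (i := -1) (by decide)]; ring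
      rw [h1, h2]
      have h3 := sg_mul_self (K := K) N
      have h4 := sg_mul_self (K := K) (i - N)
      generalize sg K N = a at *
      generalize sg K (i - N) = b at *
      simp only [smul_add, smul_smul, h3, h4]
      module
    rw [e]
    exact add_mem (add_mem (smul_mem _ _ (hT m _ y hy))
      (smul_mem _ _ (hT m _ _ (c.symH_len N hy)))) (c.symH_len N (hT m _ y hy))

include c hT hD in
/-- The map of symmetric algebras induced by a contraction is a quasi-isomorphism, for every
differential which extends that of the Lie algebra up to terms that do not increase the word
length. -/
theorem isQuasiIso [CharZero K] (hD1 : D 1 = 0)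
    (hDm : ∀ {i x}, x ∈ L.sgr N i → D x ∈ L.sgr N (i - 1)) (hDD : ∀ x, D (D x) = 0)
    (D' : M.Sym N →ₗ[K] M.Sym N) (hDm' : ∀ {i x}, x ∈ M.sgr N i → D' x ∈ M.sgr N (i - 1))
    (hDD' : ∀ x, D' (D' x) = 0)
    (p : Cpx.Hom (Cpx.mk (L.Sym N) (L.sgr N) D hDm hDD) (Cpx.mk (M.Sym N) (M.sgr N) D' hDm' hDD'))
    (hp : p.f = (φ.symA N).toLinearMap) : p.IsQuasiIso := by
  have hp' : ∀ x : L.Sym N, p.f x = φ.symA N x := fun x => lcongr_fun hp x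
  refine Cpx.Hom.isQuasiIso_of_weights p (c.sec N).toLinearMap (c.symH N) ?_ ?_ ?_ ?_ (L.len N) rfl
    len_mono exists_mem_len ?_
  · intro i y hy
    exact M.symLift_mem N (L.sgr N) (L.sym_comm N) (L.s N ∘ₗ c.σ)
      (fun hx => L.s_mem N (c.σ_mem hx)) hy
  · intro y
    exact (hp' _).trans (c.symA_sec N y)
  · intro i x hx
    exact (c.isDer_symH N).mem hx
  · intro x
    exact (hp' _).trans (c.symA_symH N x)
  · have hlap : ∀ x : L.Sym N, Cpx.Hom.lap (C := Cpx.mk (L.Sym N) (L.sgr N) D hDm hDD) (c.symH N) x =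
        D (c.symH N x) + c.symH N (D x) := fun x => rfl
    have hset : ∀ (m : ℕ) (x : L.Sym N) (w : ℕ), x ∈ L.len N (m + 1) →
        D (c.symH N x) + c.symH N (D x) - (w : K) • x ∈ L.len N m →
        (w = 0 → c.sec N (φ.symA N x) - x ∈ L.len N m) →
        (w ≠ 0 → c.sec N (φ.symA N x) ∈ L.len N m) →
        x ∈ Cpx.Hom.weightSet p (c.sec N).toLinearMap (c.symH N) (L.len N (m + 1)) (L.len N m) := by
      intro m x w h1 h2 h3 h4
      refine ⟨h1, w, h2, fun hw => ?_, fun hw => ?_⟩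
      · rw [hp']; exact h3 hw
      · rw [hp']; exact h4 hw
    have hset' : ∀ (m : ℕ) (x : L.Sym N), 
        x ∈ Cpx.Hom.weightSet p (c.sec N).toLinearMap (c.symH N) (L.len N (m + 1)) (L.len N m) →
        x ∈ L.len N (m + 1) ∧ ∃ w : ℕ, 
        D (c.symH N x) + c.symH N (D x) - (w : K) • x ∈ L.len N m ∧
        (w = 0 → c.sec N (φ.symA N x) - x ∈ L.len N m) ∧
        (w ≠ 0 → c.sec N (φ.symA N x) ∈ L.len N m) := by
      rintro m x ⟨h1, w, h2, h3, h4⟩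
      refine ⟨h1, w, h2, fun hw => ?_, fun hw => ?_⟩
      · have := h3 hw; rw [hp'] at this; exact this
      · have := h4 hw; rw [hp'] at this; exact this
    have h1 : ∀ m, (1 : L.Sym N) ∈ Cpx.Hom.weightSet p (c.sec N).toLinearMap (c.symH N)
        (L.len N (m + 1)) (L.len N m) := by
      intro m
      refine hset m 1 0 (one_mem_len m) ?_ (fun _ => ?_) (fun h => absurd rfl h)
      · rw [DGLie.IsDer.map_one L N (c.isDer_symH N), hD1, map_zero, map_zero, Nat.cast_zero,
          zero_smul, add_zero, sub_zero]
        exact zero_mem _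
      · rw [map_one, map_one, sub_self]; exact zero_mem _
    have key : ∀ m : ℕ, L.len N (m + 1) ≤ span K (Cpx.Hom.weightSet p
        (c.sec N).toLinearMap (c.symH N) (L.len N (m + 1)) (L.len N m)) := by
      intro m
      induction m with
      | zero =>
        intro x hx
        induction hx using len_succ_induction with
        | h0 => exact zero_mem _
        | h1 => exact subset_span (h1 0)
        | hadd x y _ _ hx hy => exact add_mem hx hy
        | hsmul c x _ hx => exact smul_mem _ c hx
        | hmul i v hv y hy =>
          rw [len, mem_bot] at hy
          rw [hy, mul_zero]; exact zero_mem _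
      | succ m ih =>
        intro x hx
        induction hx using len_succ_induction with
        | h0 => exact zero_mem _
        | h1 => exact subset_span (h1 _)
        | hadd x y _ _ hx hy => exact add_mem hx hy
        | hsmul c x _ hx => exact smul_mem _ c hx
        | hmul i v hv y hy =>
          have hy' := ih hy
          clear hy
          induction hy' using span_induction with
          | zero => exact (mul_zero (L.s N v)).symm ▸ zero_mem _
          | add x y _ _ h1 h2 => exact (mul_add (L.s N v) x y).symm ▸ add_mem h1 h2
          | smul a x _ h => exact (mul_smul_comm a (L.s N v) x).symm ▸ smul_mem _ _ h
          | mem y hy =>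
            obtain ⟨hy, w, e1, e2, e3⟩ := hset' m y hy
            have e : v = c.σ (φ.f v) + (v - c.σ (φ.f v)) := by abel
            rw [e, map_add]
            refine (add_mul (L.s N (c.σ (φ.f v))) (L.s N (v - c.σ (φ.f v))) y).symm ▸ add_mem ?_ ?_
            · refine subset_span (hset (m + 1) _ w (mul_mem_len _ hy) ?_ ?_ ?_)
              · have h2 := c.lap_mul D T hT hD (m + 1) (c.σ (φ.f v)) hy
                rw [c.φ_σ, sub_self, map_zero, zero_mul, zero_add] at h2
                have h3 := add_mem h2 (mul_mem_len (c.σ (φ.f v)) e1)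
                rwa [mul_sub, mul_smul_comm, sub_add_sub_cancel] at h3
              · intro hw
                have := mul_mem_len (c.σ (φ.f v)) (e2 hw)
                rwa [map_mul, map_mul, φ.symA_s, c.φ_σ, c.sec_s, ← mul_sub]
              · intro hw
                rw [map_mul, map_mul, φ.symA_s, c.φ_σ, c.sec_s]
                exact mul_mem_len _ (e3 hw)
            · have hφ : φ.f (v - c.σ (φ.f v)) = 0 := by rw [map_sub, c.φ_σ, sub_self]
              refine subset_span (hset (m + 1) _ (w + 1) (mul_mem_len _ hy) ?_ ?_ ?_)
              · have h2 := c.lap_mul D T hT hD (m + 1) (v - c.σ (φ.f v)) hy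
                rw [hφ, map_zero, sub_zero] at h2
                have h3 := add_mem h2 (mul_mem_len (v - c.σ (φ.f v)) e1)
                rw [mul_sub, mul_smul_comm] at h3
                convert h3 using 1
                rw [Nat.cast_add, Nat.cast_one, add_smul, one_smul]
                abel
              · intro hw; omega
              · intro _
                rw [map_mul, map_mul, φ.symA_s, hφ, map_zero, map_zero, zero_mul]
                exact zero_mem _
    exact key

variable (N) in
include c in
lemma sym_isQuasiIso [CharZero K] : (φ.sym N).IsQuasiIso := by
  refine c.isQuasiIso (L.symD N) 0 (fun m v y hy => zero_mem _) (fun {i v} hv y => ?_)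
    (DGLie.IsDer.map_one L N (L.isDer_symD N)) (fun hx => (L.isDer_symD N).mem hx) (L.symD_symD N)
    (M.symD N) (fun hx => (M.isDer_symD N).mem hx) (M.symD_symD N) (φ.sym N).toCpx rfl
  rw [DGLie.IsDer.mul_right (L.isDer_symD N) (L.s_mem N hv), L.symD_s N hv, smul_mul_assoc,
    lzero_apply, lzero_apply, add_zero]
  congr 2
  exact sg_congr ⟨0, by ring⟩

include c in
lemma ce_isQuasiIso [CharZero K] : φ.ce.IsQuasiIso := by
  refine c.isQuasiIso L.ceD (L.ad (-1)) (fun m v y hy => ad_len_mem hy v) (fun {i v} hv y => ?_)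
    L.ceD_one L.ceD_mem L.ceD_ceD M.ceD M.ceD_mem M.ceD_ceD φ.ce rfl
  rw [L.ceD_mul hv, L.symD_s (-1) hv, smul_mul_assoc, sub_neg_eq_add]

include c in
lemma sym_surjective : Surjective (φ.sym N).f := fun y => ⟨c.sec N y, c.symA_sec N y⟩

/-- The tensor product of a contraction with an algebra. -/
def tensor {n : ℕ} (A : PDCDGA K n) : Contraction (φ.tensor A) where
  σ := lTensor A.A c.σ
  h := tmap (tw A.gr 1) c.h
  σ_mem {i x} hx := by
    change x ∈ A.tgr M i at hx
    change lTensor A.A c.σ x ∈ A.tgr L i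
    induction hx using PDCDGA.tgr_induction with
    | h0 => rw [map_zero]; exact zero_mem _
    | hadd x y _ _ hx hy => rw [map_add]; exact add_mem hx hy
    | ht k j hij a ha x hx =>
      rw [lTensor_tmul]
      exact A.tmul_mem' L ha (c.σ_mem hx) hij
  h_mem {i x} hx := by
    change x ∈ A.tgr L i at hx
    change tmap (tw A.gr 1) c.h x ∈ A.tgr L (i + 1)
    induction hx using PDCDGA.tgr_induction with
    | h0 => rw [map_zero]; exact zero_mem _
    | hadd x y _ _ hx hy => rw [map_add]; exact add_mem hx hy
    | ht k j hij a ha x hx =>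
      rw [map_tmul, tw_of_mem _ _ ha, ← smul_tmul']
      exact smul_mem _ _ (A.tmul_mem' L ha (c.h_mem hx) (by omega))
  φ_σ x := by
    have h : lTensor A.A φ.f ∘ₗ lTensor A.A c.σ = lid := by
      apply ext'
      intro a x
      simp [c.φ_σ]
    exact lcongr_fun h x
  φ_h x := by
    have h : lTensor A.A φ.f ∘ₗ tmap (tw A.gr 1) c.h = 0 := by
      apply ext'
      intro a x
      simp [c.φ_h]
    exact lcongr_fun h x
  d_h x := by
    have h : A.td L ∘ₗ tmap (tw A.gr 1) c.h +
        tmap (tw A.gr 1) c.h ∘ₗ A.td L =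
        lid - lTensor A.A c.σ ∘ₗ lTensor A.A φ.f := by
      apply ext'
      intro a x
      induction a using inductionOn A.gr with
      | zero => simp
      | add a b ha hb => simp only [add_tmul, map_add, ha, hb]
      | @homogeneous k a =>
        obtain ⟨a, ha⟩ := a
        have e1 : sg K (1 * (k + 1)) = -sg K (1 * k) := by
          rw [show 1 * (k + 1) = 1 * k + 1 by ring, sg_add, sg_odd odd_one]; ring
        simp only [ladd_apply, LinearMap.sub_apply, comp_apply,
          id_apply, lTensor_tmul]
        rw [A.td_tmul L ha, map_tmul, tw_of_mem _ _ ha, ← smul_tmul',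
          map_smul, A.td_tmul L ha, map_add, map_smul, map_tmul, map_tmul,
          tw_of_mem _ _ ha, tw_of_mem _ _ (A.d_mem ha), ← smul_tmul',
          ← smul_tmul', e1, one_mul, smul_add, smul_smul, smul_smul, sg_mul_self,
          one_smul, one_smul, ← TensorProduct.tmul_sub, ← c.d_h, tmul_add]
        module
    exact lcongr_fun h x

end Contraction

end DGLie

variable {K : Type u} [Field K]

section Projections

variable {V : Type u} [AddCommGroup V] [Module K V] (gr : ℤ → Submodule K V)

/-- A family of subspaces with compatible projections, which spans the space, is a
decomposition. -/
def decompositionOfProj (π : ℤ → V →ₗ[K] V) (h1 : ∀ i, ∀ x ∈ gr i, π i x = x)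
    (h2 : ∀ i j, i ≠ j → ∀ x ∈ gr j, π i x = 0) (h3 : ∀ x, x ∈ ⨆ i, gr i) :
    Decomposition gr := by
  refine DirectSum.IsInternal.chooseDecomposition gr ?_
  have key : ∀ (x : ⨁ i, gr i) (i : ℤ), π i (DirectSum.coeLinearMap gr x) = (x i : V) := by
    intro x i
    induction x using DirectSum.induction_on with
    | zero => simp
    | add x y hx hy => rw [map_add, map_add, hx, hy]; rfl
    | of j x =>
      rw [DirectSum.coeLinearMap_of]
      by_cases h : i = j
      · subst h; rw [h1 i _ x.2, DirectSum.of_eq_same]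
      · rw [h2 i j h _ x.2, DirectSum.of_eq_of_ne _ _ _ h]; rfl
  constructor
  · intro x y hxy
    apply DFinsupp.ext
    intro i
    apply Subtype.ext
    rw [← key x i, ← key y i]
    exact congrArg (π i) hxy
  · intro x
    have h := h3 x
    rw [Submodule.iSup_eq_range_dfinsupp_lsum] at h
    obtain ⟨y, hy⟩ := h
    exact ⟨y, hy⟩

end Projections

/-- Graded Lie algebras with an operator of degree one and a graded linear map from `g`. -/
structure OpLie (g : DGLie K) where
  V : Type u
  [grp : AddCommGroup V]
  [mod : Module K V]
  gr : ℤ → Submodule K V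
  br : V →ₗ[K] V →ₗ[K] V
  σ : g.V →ₗ[K] V
  h : V →ₗ[K] V
  br_mem : ∀ {i j x y}, x ∈ gr i → y ∈ gr j → br x y ∈ gr (i + j)
  br_symm : ∀ {i j x y}, x ∈ gr i → y ∈ gr j → br x y = -(sg K (i * j) • br y x)
  jacobi : ∀ {i j k x y z}, x ∈ gr i → y ∈ gr j → z ∈ gr k →
    br x (br y z) = br (br x y) z + sg K (i * j) • br y (br x z)
  σ_mem : ∀ {i x}, x ∈ g.gr i → σ x ∈ gr i
  h_mem : ∀ {i x}, x ∈ gr i → h x ∈ gr (i + 1)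

attribute [instance] OpLie.grp OpLie.mod

namespace OpLie

/-- The monomials of the free graded Lie algebra with operator. -/
inductive Mon (g : DGLie K) : Type u
  | gen (i : ℤ) (x : g.gr i)
  | op (m : Mon g)
  | br (m m' : Mon g)

variable {g : DGLie K}

/-- The degree of a monomial. -/
def Mon.deg : Mon g → ℤ
  | .gen i _ => i
  | .op m => m.deg + 1
  | .br m m' => m.deg + m'.deg

variable (g) in
/-- The space spanned by the monomials. -/
abbrev Fr : Type u := Mon g →₀ K

/-- A monomial, as an element of the free space. -/
def Mon.e (m : Mon g) : Fr g := Finsupp.single m 1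

lemma linComb_e {W : Type u} [AddCommGroup W] [Module K W] (f : Mon g → W) (m : Mon g) :
    fcomb K f m.e = f m := by
  rw [Mon.e, Finsupp.linearCombination_single, one_smul]

lemma fr_ext {W : Type u} [AddCommGroup W] [Module K W] {F G : Fr g →ₗ[K] W}
    (h : ∀ m : Mon g, F m.e = G m.e) : F = G := by
  apply Finsupp.lhom_ext'
  intro m
  apply LinearMap.ext_ring
  exact h m

/-- The operator of the free space. -/
def opF : Fr g →ₗ[K] Fr g := fcomb K fun m => (Mon.op m).e

/-- The product of the free space. -/
def brF : Fr g →ₗ[K] Fr g →ₗ[K] Fr g :=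
  fcomb K fun m => fcomb K fun m' => (Mon.br m m').e

lemma opF_e (m : Mon g) : opF m.e = (Mon.op m).e := linComb_e _ m

lemma brF_e (m m' : Mon g) : brF m.e m'.e = (Mon.br m m').e := by
  have h : brF m.e = fcomb K fun m' : Mon g => (Mon.br m m').e :=
    linComb_e (fun m : Mon g => fcomb K fun m' : Mon g => (Mon.br m m').e) m
  rw [h, linComb_e]

/-- The relations of the free graded Lie algebra with operator. -/
inductive Rel : ℤ → Fr g → Prop
  | add (i : ℤ) (x y : g.gr i) : Rel i ((Mon.gen i (x + y)).e - ((Mon.gen i x).e + (Mon.gen i y).e))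
  | smul (i : ℤ) (c : K) (x : g.gr i) : Rel i ((Mon.gen i (c • x)).e - c • (Mon.gen i x).e)
  | symm (a b : Mon g) : Rel (a.deg + b.deg) (brF a.e b.e + sg K (a.deg * b.deg) • brF b.e a.e)
  | jacobi (a b c : Mon g) : Rel (a.deg + b.deg + c.deg) (brF a.e (brF b.e c.e) -
      (brF (brF a.e b.e) c.e + sg K (a.deg * b.deg) • brF b.e (brF a.e c.e)))
  | op {i : ℤ} {r : Fr g} (hr : Rel i r) : Rel (i + 1) (opF r)
  | left {i : ℤ} {r : Fr g} (hr : Rel i r) (a : Mon g) : Rel (i + a.deg) (brF r a.e)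
  | right {i : ℤ} {r : Fr g} (hr : Rel i r) (a : Mon g) : Rel (i + a.deg) (brF a.e r)

variable (g) in
/-- The span of the monomials of degree `i`. -/
def frGr (i : ℤ) : Submodule K (Fr g) := span K {x | ∃ m : Mon g, m.deg = i ∧ x = m.e}

lemma e_mem (m : Mon g) : m.e ∈ frGr g m.deg := subset_span ⟨m, rfl, rfl⟩

lemma opF_mem {i : ℤ} {x : Fr g} (hx : x ∈ frGr g i) : opF x ∈ frGr g (i + 1) := by
  refine map_mem_of_mem_span (fun x hx => ?_) hx
  obtain ⟨m, rfl, rfl⟩ := hx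
  rw [opF_e]
  exact e_mem (Mon.op m)

lemma brF_mem {i j : ℤ} {x y : Fr g} (hx : x ∈ frGr g i) (hy : y ∈ frGr g j) :
    brF x y ∈ frGr g (i + j) := by
  induction hx using span_induction with
  | zero => rw [map_zero, lzero_apply]; exact zero_mem _
  | add x y _ _ h1 h2 => rw [map_add, ladd_apply]; exact add_mem h1 h2
  | smul c x _ h1 => rw [map_smul, lsmul_apply]; exact smul_mem _ _ h1
  | mem x hx =>
    obtain ⟨m, rfl, rfl⟩ := hx
    refine map_mem_of_mem_span (fun y hy => ?_) hy
    obtain ⟨m', rfl, rfl⟩ := hy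
    rw [brF_e]
    exact e_mem (Mon.br m m')

lemma Rel.mem {i : ℤ} {r : Fr g} (hr : Rel i r) : r ∈ frGr g i := by
  induction hr with
  | add i x y => exact sub_mem (e_mem (.gen i _)) (add_mem (e_mem (.gen i x)) (e_mem (.gen i y)))
  | smul i c x => exact sub_mem (e_mem (.gen i _)) (smul_mem _ _ (e_mem (.gen i x)))
  | symm a b =>
    refine add_mem (brF_mem (e_mem a) (e_mem b)) (smul_mem _ _ ?_)
    rw [add_comm]; exact brF_mem (e_mem b) (e_mem a)
  | jacobi a b c =>
    refine sub_mem ?_ (add_mem (brF_mem (brF_mem (e_mem a) (e_mem b)) (e_mem c))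
      (smul_mem _ _ ?_))
    · rw [add_assoc]; exact brF_mem (e_mem a) (brF_mem (e_mem b) (e_mem c))
    · rw [add_comm a.deg, add_assoc]; exact brF_mem (e_mem b) (brF_mem (e_mem a) (e_mem c))
  | op _ ih => exact opF_mem ih
  | left _ a ih => exact brF_mem ih (e_mem a)
  | right _ a ih => rw [add_comm]; exact brF_mem (e_mem a) ih

variable (g) in
/-- The span of the relations. -/
def relSub : Submodule K (Fr g) := span K {r | ∃ i, Rel i r}

lemma rel_mem {i : ℤ} {r : Fr g} (hr : Rel i r) : r ∈ relSub g := subset_span ⟨i, hr⟩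

lemma relSub_le {P : Submodule K (Fr g)} (h : ∀ i r, Rel i r → r ∈ P) : relSub g ≤ P :=
  Submodule.span_le.mpr fun r ⟨i, hr⟩ => h i r hr

variable (g) in
/-- The free graded Lie algebra with operator. -/
abbrev Free : Type u := Fr g ⧸ relSub g

/-- A monomial, as an element of the free graded Lie algebra with operator. -/
def Mon.c (m : Mon g) : Free g := (relSub g).mkQ m.e

lemma free_ext {W : Type u} [AddCommGroup W] [Module K W] {F G : Free g →ₗ[K] W}
    (h : ∀ m : Mon g, F m.c = G m.c) : F = G := by
  apply Submodule.linearMap_qext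
  exact fr_ext h

/-- The projection of the free space to the monomials of degree `i`. -/
def prF (i : ℤ) : Fr g →ₗ[K] Fr g :=
  fcomb K fun m => if m.deg = i then m.e else 0

lemma prF_eq {i : ℤ} {x : Fr g} (hx : x ∈ frGr g i) : prF i x = x := by
  induction hx using span_induction with
  | zero => rw [map_zero]
  | add x y _ _ h1 h2 => rw [map_add, h1, h2]
  | smul c x _ h1 => rw [map_smul, h1]
  | mem x hx =>
    obtain ⟨m, hm, rfl⟩ := hx
    rw [prF, linComb_e, if_pos hm]

lemma prF_zero {i j : ℤ} (hij : i ≠ j) {x : Fr g} (hx : x ∈ frGr g j) : prF i x = 0 := by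
  induction hx using span_induction with
  | zero => rw [map_zero]
  | add x y _ _ h1 h2 => rw [map_add, h1, h2, add_zero]
  | smul c x _ h1 => rw [map_smul, h1, smul_zero]
  | mem x hx =>
    obtain ⟨m, hm, rfl⟩ := hx
    rw [prF, linComb_e, if_neg (fun h => hij (h.symm.trans hm))]

variable (g) in
/-- The grading of the free graded Lie algebra with operator. -/
def fgr (i : ℤ) : Submodule K (Free g) := (frGr g i).map (relSub g).mkQ

lemma c_mem (m : Mon g) : m.c ∈ fgr g m.deg := ⟨_, e_mem m, rfl⟩

lemma fgr_induction {i : ℤ} {p : ∀ x, x ∈ fgr g i → Prop} (h0 : p 0 (zero_mem _))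
    (hadd : ∀ x y hx hy, p x hx → p y hy → p (x + y) (add_mem hx hy))
    (hsmul : ∀ (c : K) x hx, p x hx → p (c • x) (smul_mem _ c hx))
    (h : ∀ (m : Mon g) (hm : m.deg = i), p m.c (hm ▸ c_mem m)) {x : Free g}
    (hx : x ∈ fgr g i) : p x hx := by
  obtain ⟨y, hy, rfl⟩ := hx
  suffices ∃ h, p ((relSub g).mkQ y) h from this.2
  induction hy using span_induction with
  | zero => rw [map_zero]; exact ⟨_, h0⟩
  | add x y _ _ h1 h2 => rw [map_add]; exact ⟨_, hadd _ _ h1.1 h2.1 h1.2 h2.2⟩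
  | smul c x _ h1 => rw [map_smul]; exact ⟨_, hsmul _ _ h1.1 h1.2⟩
  | mem x hx =>
    obtain ⟨m, hm, rfl⟩ := hx
    exact ⟨_, h m hm⟩

/-- The projection of the free graded Lie algebra with operator to its degree `i` part. -/
def pr (i : ℤ) : Free g →ₗ[K] Free g := (relSub g).mapQ (relSub g) (prF i) (relSub_le (by
  intro j r hr
  rw [mem_comap]
  by_cases h : i = j
  · subst h; rw [prF_eq hr.mem]; exact rel_mem hr
  · rw [prF_zero h hr.mem]; exact zero_mem _))

instance : Decomposition (fgr g) := decompositionOfProj (fgr g) pr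
  (by
    rintro i _ ⟨x, hx, rfl⟩
    change (relSub g).mkQ (prF i x) = _
    rw [prF_eq hx])
  (by
    rintro i j hij _ ⟨x, hx, rfl⟩
    change (relSub g).mkQ (prF i x) = _
    rw [prF_zero hij hx, map_zero])
  (by
    intro x
    obtain ⟨x, rfl⟩ := (relSub g).mkQ_surjective x
    induction x using Finsupp.induction_linear with
    | zero => rw [map_zero]; exact zero_mem _
    | add x y hx hy => rw [map_add]; exact add_mem hx hy
    | single m a =>
      have h : (Finsupp.single m a : Fr g) = a • m.e := by rw [Mon.e, Finsupp.smul_single_one]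
      rw [h, map_smul]
      exact smul_mem _ _ (mem_iSup_of_mem m.deg (c_mem m)))

/-- The operator of the free graded Lie algebra with operator. -/
def opQ : Free g →ₗ[K] Free g := (relSub g).mapQ (relSub g) opF
  (relSub_le fun _ _ hr => rel_mem hr.op)

/-- The bracket with a monomial. -/
def brM (m : Mon g) : Free g →ₗ[K] Free g := (relSub g).mapQ (relSub g) (brF m.e)
  (relSub_le fun _ _ hr => rel_mem (hr.right m))

/-- The bracket of the free graded Lie algebra with operator. -/
def brQ : Free g →ₗ[K] Free g →ₗ[K] Free g :=
  (relSub g).liftQ (fcomb K brM) (relSub_le (by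
    intro i r hr
    rw [mem_ker]
    apply free_ext
    intro m
    have h : (applyₗ m.c ∘ₗ fcomb K brM : Fr g →ₗ[K] Free g) =
        (relSub g).mkQ ∘ₗ brF.flip m.e := by
      apply fr_ext
      intro a
      rw [comp_apply, linComb_e]
      rfl
    refine (lcongr_fun h r).trans ?_
    rw [lzero_apply, comp_apply, Submodule.mkQ_apply,
      quot_mk_eq_zero]
    exact rel_mem (hr.left m)))

lemma opQ_c (m : Mon g) : opQ m.c = (Mon.op m).c := by
  change (relSub g).mkQ (opF m.e) = _
  rw [opF_e]; rfl

lemma brQ_mk (x y : Fr g) :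
    brQ ((relSub g).mkQ x) ((relSub g).mkQ y) = (relSub g).mkQ (brF x y) := by
  have h : (brQ.compl₁₂ (relSub g).mkQ (relSub g).mkQ : Fr g →ₗ[K] Fr g →ₗ[K] Free g) =
      brF.compr₂ (relSub g).mkQ := by
    apply fr_ext
    intro a
    apply fr_ext
    intro b
    change fcomb K brM a.e b.c = _
    rw [linComb_e]
    rfl
  exact lcongr_fun₂ h x y

lemma brQ_c (m m' : Mon g) : brQ m.c m'.c = (Mon.br m m').c := by
  rw [Mon.c, Mon.c, brQ_mk, brF_e]; rfl

variable (g) in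
/-- The map from `g` to the free graded Lie algebra with operator. -/
def genQ : g.V →ₗ[K] Free g := glift g.gr fun i =>
  { toFun := fun x => (Mon.gen i x).c
    map_add' := fun x y => by
      have := (quot_mk_eq_zero _).mpr (rel_mem (Rel.add i x y))
      change (relSub g).mkQ _ = 0 at this
      rw [map_sub, map_add] at this
      exact sub_eq_zero.mp this
    map_smul' := fun c x => by
      have := (quot_mk_eq_zero _).mpr (rel_mem (Rel.smul i c x))
      change (relSub g).mkQ _ = 0 at this
      rw [map_sub, map_smul] at this
      exact sub_eq_zero.mp this }

lemma genQ_of_mem {i : ℤ} {x : g.V} (hx : x ∈ g.gr i) : genQ g x = (Mon.gen i ⟨x, hx⟩).c :=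
  glift_of_mem _ _ hx

lemma genQ_coe {i : ℤ} (x : g.gr i) : genQ g x = (Mon.gen i x).c := genQ_of_mem x.2

lemma brQ_mem {i j : ℤ} {x y : Free g} (hx : x ∈ fgr g i) (hy : y ∈ fgr g j) :
    brQ x y ∈ fgr g (i + j) := by
  obtain ⟨x, hx, rfl⟩ := hx
  obtain ⟨y, hy, rfl⟩ := hy
  rw [brQ_mk]
  exact ⟨_, brF_mem hx hy, rfl⟩

lemma brQ_symm {i j : ℤ} {x y : Free g} (hx : x ∈ fgr g i) (hy : y ∈ fgr g j) :
    brQ x y = -(sg K (i * j) • brQ y x) := by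
  induction hx using fgr_induction with
  | h0 => simp
  | hadd x x' _ _ h1 h2 => rw [map_add, ladd_apply, h1, h2, map_add]; module
  | hsmul c x _ h => rw [map_smul, lsmul_apply, h, map_smul]; module
  | h a ha =>
    subst ha
    induction hy using fgr_induction with
    | h0 => simp
    | hadd y y' _ _ h1 h2 => rw [map_add, h1, h2, map_add, ladd_apply]; module
    | hsmul c x _ h => rw [map_smul, h, map_smul, lsmul_apply]; module
    | h b hb =>
      subst hb
      have := (quot_mk_eq_zero _).mpr (rel_mem (Rel.symm a b))
      change (relSub g).mkQ _ = 0 at this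
      rw [map_add, map_smul, ← brQ_mk, ← brQ_mk] at this
      exact eq_neg_of_add_eq_zero_left this

lemma brQ_jacobi {i j k : ℤ} {x y z : Free g} (hx : x ∈ fgr g i) (hy : y ∈ fgr g j)
    (hz : z ∈ fgr g k) :
    brQ x (brQ y z) = brQ (brQ x y) z + sg K (i * j) • brQ y (brQ x z) := by
  induction hx using fgr_induction with
  | h0 => simp
  | hadd x x' _ _ h1 h2 => simp only [map_add, ladd_apply, h1, h2]; module
  | hsmul c x _ h => simp only [map_smul, lsmul_apply, h]; module
  | h a ha =>
    subst ha
    induction hy using fgr_induction with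
    | h0 => simp
    | hadd y y' _ _ h1 h2 => simp only [map_add, ladd_apply, h1, h2]; module
    | hsmul c x _ h => simp only [map_smul, lsmul_apply, h]; module
    | h b hb =>
      subst hb
      induction hz using fgr_induction with
      | h0 => simp
      | hadd y y' _ _ h1 h2 => simp only [map_add, ladd_apply, h1, h2]; module
      | hsmul c x _ h => simp only [map_smul, lsmul_apply, h]; module
      | h c hc =>
        have := (quot_mk_eq_zero _).mpr (rel_mem (Rel.jacobi a b c))
        change (relSub g).mkQ _ = 0 at this
        rw [map_sub, map_add, map_smul, ← brQ_mk, ← brQ_mk, ← brQ_mk, ← brQ_mk, ← brQ_mk,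
          ← brQ_mk] at this
        exact sub_eq_zero.mp this

lemma genQ_mem {i : ℤ} {x : g.V} (hx : x ∈ g.gr i) : genQ g x ∈ fgr g i := by
  rw [genQ_of_mem hx]
  exact c_mem (Mon.gen i ⟨x, hx⟩)

lemma opQ_mem {i : ℤ} {x : Free g} (hx : x ∈ fgr g i) : opQ x ∈ fgr g (i + 1) := by
  obtain ⟨x, hx, rfl⟩ := hx
  exact ⟨_, opF_mem hx, rfl⟩

lemma free_induction {p : Free g → Prop} (hadd : ∀ x y, p x → p y → p (x + y))
    (hsmul : ∀ (c : K) x, p x → p (c • x)) (hσ : ∀ i, ∀ x ∈ g.gr i, p (genQ g x))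
    (hop : ∀ i, ∀ t ∈ fgr g i, p t → p (opQ t))
    (hbr : ∀ i, ∀ t ∈ fgr g i, ∀ j, ∀ t' ∈ fgr g j, p t → p t' → p (brQ t t')) (t : Free g) : p t := by
  obtain ⟨x, rfl⟩ := (relSub g).mkQ_surjective t
  have h : ∀ m : Mon g, p m.c := by
    intro m
    induction m with
    | gen i x => rw [← genQ_coe]; exact hσ i x x.2
    | op m ih => rw [← opQ_c]; exact hop _ _ (c_mem m) ih
    | br m m' h1 h2 => rw [← brQ_c]; exact hbr _ _ (c_mem m) _ _ (c_mem m') h1 h2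
  induction x using Finsupp.induction_linear with
  | zero =>
    have := hsmul 0 _ (hσ 0 0 (zero_mem _))
    rwa [zero_smul] at this
  | add x y hx hy => rw [map_add]; exact hadd _ _ hx hy
  | single m a =>
    have e : (Finsupp.single m a : Fr g) = a • m.e := by rw [Mon.e, Finsupp.smul_single_one]
    rw [e, map_smul]
    exact hsmul _ _ (h m)

section Lift

variable (T : OpLie g)

/-- The evaluation of a monomial. -/
def val : Mon g → T.V
  | .gen _ x => T.σ x
  | .op m => T.h (val m)
  | .br m m' => T.br (val m) (val m')

lemma val_mem (m : Mon g) : T.val m ∈ T.gr m.deg := by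
  induction m with
  | gen i x => exact T.σ_mem x.2
  | op m ih => exact T.h_mem ih
  | br m m' h1 h2 => exact T.br_mem h1 h2

/-- The evaluation of elements of the free space. -/
def ev : Fr g →ₗ[K] T.V := fcomb K T.val

lemma ev_e (m : Mon g) : T.ev m.e = T.val m := linComb_e _ m

lemma ev_opF (x : Fr g) : T.ev (opF x) = T.h (T.ev x) := by
  have h : T.ev ∘ₗ opF = T.h ∘ₗ T.ev := by
    apply fr_ext
    intro m
    rw [comp_apply, comp_apply, opF_e, ev_e, ev_e]; rfl
  exact lcongr_fun h x

lemma ev_brF (x y : Fr g) : T.ev (brF x y) = T.br (T.ev x) (T.ev y) := by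
  have h : brF.compr₂ T.ev = T.br.compl₁₂ T.ev T.ev := by
    apply fr_ext
    intro a
    apply fr_ext
    intro b
    rw [compr₂_apply, compl₁₂_apply, brF_e, ev_e, ev_e, ev_e]; rfl
  exact lcongr_fun₂ h x y

lemma ev_rel {i : ℤ} {r : Fr g} (hr : Rel i r) : T.ev r = 0 := by
  induction hr with
  | add i x y => rw [map_sub, map_add, ev_e, ev_e, ev_e, sub_eq_zero]; exact map_add T.σ _ _
  | smul i c x => rw [map_sub, map_smul, ev_e, ev_e, sub_eq_zero]; exact map_smul T.σ _ _
  | symm a b =>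
    rw [map_add, map_smul, ev_brF, ev_brF, ev_e, ev_e, T.br_symm (T.val_mem a) (T.val_mem b),
      neg_add_cancel]
  | jacobi a b c =>
    rw [map_sub, map_add, map_smul, ev_brF, ev_brF, ev_brF, ev_brF, ev_brF, ev_brF, ev_e, ev_e, ev_e,
      T.jacobi (T.val_mem a) (T.val_mem b) (T.val_mem c), sub_self]
  | op _ ih => rw [ev_opF, ih, map_zero]
  | left _ a ih => rw [ev_brF, ih, map_zero, lzero_apply]
  | right _ a ih => rw [ev_brF, ih, map_zero]

/-- The universal property of the free graded Lie algebra with operator. -/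
def lift : Free g →ₗ[K] T.V := (relSub g).liftQ T.ev (relSub_le fun _ _ hr => T.ev_rel hr)

lemma lift_σ (x : g.V) : T.lift (genQ g x) = T.σ x := by
  have h : T.lift ∘ₗ genQ g = T.σ := by
    refine ghom_ext (gr := g.gr) fun i x hx => ?_
    rw [comp_apply, genQ_of_mem hx]
    exact T.ev_e _
  exact lcongr_fun h x

lemma lift_op (t : Free g) : T.lift (opQ t) = T.h (T.lift t) := by
  obtain ⟨x, rfl⟩ := (relSub g).mkQ_surjective t
  exact T.ev_opF x

lemma lift_br (s t : Free g) : T.lift (brQ s t) = T.br (T.lift s) (T.lift t) := by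
  obtain ⟨x, rfl⟩ := (relSub g).mkQ_surjective s
  obtain ⟨y, rfl⟩ := (relSub g).mkQ_surjective t
  rw [brQ_mk]
  exact T.ev_brF x y

lemma lift_mem {i : ℤ} {t : Free g} (ht : t ∈ fgr g i) : T.lift t ∈ T.gr i := by
  induction ht using fgr_induction with
  | h0 => rw [map_zero]; exact zero_mem _
  | hadd x y _ _ hx hy => rw [map_add]; exact add_mem hx hy
  | hsmul c x _ hx => rw [map_smul]; exact smul_mem _ _ hx
  | h m hm =>
    subst hm
    have : T.lift m.c = T.val m := T.ev_e m
    rw [this]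
    exact T.val_mem m

end Lift

end OpLie

variable {K : Type u} [Field K]

namespace OpLie

variable (g : DGLie K)

/-- The Lie algebra `g`, with zero operator. -/
def triv : OpLie g where
  V := g.V
  gr := g.gr
  br := g.br
  σ := lid
  h := 0
  br_mem := g.br_mem
  br_symm := g.br_symm
  jacobi := g.jacobi
  σ_mem hx := hx
  h_mem _ := zero_mem _

/-- The projection of the free Lie algebra with operator to `g`. -/
def proj : Free g →ₗ[K] g.V := (triv g).lift

variable {g}

lemma proj_σ (x : g.V) : proj g (genQ g x) = x := (triv g).lift_σ x

lemma proj_op (t : Free g) : proj g (opQ t) = 0 := (triv g).lift_op t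

lemma proj_br (s t : Free g) : proj g (brQ s t) = g.br (proj g s) (proj g t) := (triv g).lift_br s t

lemma proj_mem {i : ℤ} {t : Free g} (ht : t ∈ fgr g i) : proj g t ∈ g.gr i := (triv g).lift_mem ht

variable (g) in
/-- The bracket of pairs, which encodes derivations of degree `-1`. -/
def dualBr : Free g × Free g →ₗ[K] Free g × Free g →ₗ[K] Free g × Free g :=
  mk₂ K (fun p q => (brQ p.1 q.1, brQ p.2 q.1 + brQ (tw (fgr g) 1 p.1) q.2))
    (fun p p' q => by
      simp only [Prod.fst_add, Prod.snd_add, map_add, ladd_apply, Prod.mk_add_mk]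
      congr 1; abel)
    (fun c p q => by
      simp only [Prod.smul_fst, Prod.smul_snd, map_smul, lsmul_apply, Prod.smul_mk, smul_add])
    (fun p q q' => by
      simp only [Prod.fst_add, Prod.snd_add, map_add, ladd_apply, Prod.mk_add_mk]
      congr 1; abel)
    (fun c p q => by
      simp only [Prod.smul_fst, Prod.smul_snd, map_smul, lsmul_apply, Prod.smul_mk, smul_add])

lemma dualBr_of_mem {i : ℤ} {p : Free g × Free g} (hp : p ∈ (fgr g i).prod (fgr g (i - 1)))
    (q : Free g × Free g) : dualBr g p q = (brQ p.1 q.1, brQ p.2 q.1 + sg K i • brQ p.1 q.2) := by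
  change (brQ p.1 q.1, brQ p.2 q.1 + brQ (tw (fgr g) 1 p.1) q.2) = _
  rw [tw_of_mem _ _ hp.1, map_smul, lsmul_apply, one_mul]

lemma dualBr_mem {i j : ℤ} {x y : Free g × Free g} (hx : x ∈ (fgr g i).prod (fgr g (i - 1)))
    (hy : y ∈ (fgr g j).prod (fgr g (j - 1))) :
    dualBr g x y ∈ (fgr g (i + j)).prod (fgr g (i + j - 1)) := by
  rw [dualBr_of_mem hx]
  refine ⟨brQ_mem hx.1 hy.1, add_mem ?_ (smul_mem _ _ ?_)⟩
  · rw [add_sub_right_comm]; exact brQ_mem hx.2 hy.1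
  · rw [add_sub_assoc]; exact brQ_mem hx.1 hy.2

variable (g) in
/-- The Lie algebra of pairs, which encodes the differential of the free Lie algebra with
operator. -/
def dual : OpLie g where
  V := Free g × Free g
  gr i := (fgr g i).prod (fgr g (i - 1))
  br := dualBr g
  σ := (genQ g).prod (genQ g ∘ₗ g.d)
  h := (opQ ∘ₗ LinearMap.fst K _ _).prod (LinearMap.fst K _ _ -
    genQ g ∘ₗ proj g ∘ₗ LinearMap.fst K _ _ - opQ ∘ₗ LinearMap.snd K _ _)
  br_mem hx hy := dualBr_mem hx hy
  br_symm {i j x y} hx hy := by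
    rw [dualBr_of_mem hx, dualBr_of_mem hy, Prod.smul_mk, Prod.neg_mk, brQ_symm hx.1 hy.1,
      brQ_symm hx.2 hy.1, brQ_symm hx.1 hy.2]
    congr 1
    by_cases hi : Even i <;> by_cases hj : Even j <;>
      simp [sg, -int_not_even, ← int_not_even, Int.even_add, Int.even_sub,
        Int.even_mul, hi, hj] <;> module
  jacobi {i j k x y z} hx hy hz := by
    rw [dualBr_of_mem hx, dualBr_of_mem hy, dualBr_of_mem hy, dualBr_of_mem (dualBr_mem hx hy),
      dualBr_of_mem hx, dualBr_of_mem hx, Prod.smul_mk, Prod.mk_add_mk]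
    simp only [map_add, map_smul, ladd_apply, lsmul_apply]
    rw [brQ_jacobi hx.1 hy.1 hz.1, brQ_jacobi hx.2 hy.1 hz.1, brQ_jacobi hx.1 hy.2 hz.1,
      brQ_jacobi hx.1 hy.1 hz.2]
    congr 1
    by_cases hi : Even i <;> by_cases hj : Even j <;>
      simp [sg, -int_not_even, ← int_not_even, Int.even_add, Int.even_sub,
        Int.even_mul, hi, hj] <;> module
  σ_mem hx := ⟨genQ_mem hx, genQ_mem (g.d_mem hx)⟩
  h_mem {i x} hx := by
    refine ⟨opQ_mem hx.1, ?_⟩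
    rw [add_sub_cancel_right]
    refine sub_mem (sub_mem hx.1 (genQ_mem (proj_mem hx.1))) ?_
    have := opQ_mem hx.2
    rwa [sub_add_cancel] at this

variable (g) in
/-- The differential of the free Lie algebra with operator. -/
def dQ : Free g →ₗ[K] Free g := LinearMap.snd K _ _ ∘ₗ (dual g).lift

lemma dual_lift_fst (t : Free g) : ((dual g).lift t).1 = t := by
  induction t using free_induction with
  | hadd x y hx hy => rw [map_add]; exact congrArg₂ (· + ·) hx hy
  | hsmul c x hx => rw [map_smul]; exact congrArg (c • ·) hx
  | hσ i x hx => rw [lift_σ]; rfl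
  | hop i t ht ih => rw [lift_op]; exact congrArg opQ ih
  | hbr i t ht j t' ht' h1 h2 => rw [lift_br]; exact congrArg₂ (fun s t => brQ s t) h1 h2

lemma dQ_σ (x : g.V) : dQ g (genQ g x) = genQ g (g.d x) :=
  congrArg Prod.snd ((dual g).lift_σ x)

lemma dQ_op (t : Free g) : dQ g (opQ t) = t - genQ g (proj g t) - opQ (dQ g t) := by
  refine (congrArg Prod.snd ((dual g).lift_op t)).trans ?_
  change ((dual g).lift t).1 - genQ g (proj g ((dual g).lift t).1) - opQ (dQ g t) = _
  rw [dual_lift_fst]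

lemma dQ_mem {i : ℤ} {t : Free g} (ht : t ∈ fgr g i) : dQ g t ∈ fgr g (i - 1) :=
  ((dual g).lift_mem ht).2

lemma dQ_br {i : ℤ} {s : Free g} (hs : s ∈ fgr g i) (t : Free g) :
    dQ g (brQ s t) = brQ (dQ g s) t + sg K i • brQ s (dQ g t) := by
  refine (congrArg Prod.snd ((dual g).lift_br s t)).trans ?_
  refine (congrArg Prod.snd (dualBr_of_mem ((dual g).lift_mem hs) ((dual g).lift t))).trans ?_
  change brQ (dQ g s) ((dual g).lift t).1 + sg K i • brQ ((dual g).lift s).1 (dQ g t) = _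
  rw [dual_lift_fst, dual_lift_fst]

lemma proj_dQ (t : Free g) : proj g (dQ g t) = g.d (proj g t) := by
  induction t using free_induction with
  | hadd x y hx hy => simp only [map_add, hx, hy]
  | hsmul c x hx => simp only [map_smul, hx]
  | hσ i x hx => rw [dQ_σ, proj_σ, proj_σ]
  | hop i t ht ih => rw [dQ_op, map_sub, map_sub, proj_σ, proj_op, proj_op, sub_self, map_zero,
      sub_zero]
  | hbr i t ht j t' ht' h1 h2 =>
    rw [dQ_br ht, map_add, map_smul, proj_br, proj_br, proj_br, h1, h2,
      g.d_br (proj_mem ht) (proj_mem ht')]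

lemma dQ_dQ (t : Free g) : dQ g (dQ g t) = 0 := by
  induction t using free_induction with
  | hadd x y hx hy => rw [map_add, map_add, hx, hy, add_zero]
  | hsmul c x hx => rw [map_smul, map_smul, hx, smul_zero]
  | hσ i x hx => rw [dQ_σ, dQ_σ, g.d_d, map_zero]
  | hop i t ht ih =>
    rw [dQ_op, map_sub, map_sub, dQ_σ, dQ_op, ih, map_zero, sub_zero, proj_dQ, sub_self]
  | hbr i t ht j t' ht' h1 h2 =>
    rw [dQ_br ht, map_add, map_smul, dQ_br (dQ_mem ht), dQ_br ht, h1, h2, map_zero, map_zero,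
      lzero_apply, zero_add, smul_zero, add_zero]
    have : sg K (i - 1) = -sg K i := by
      rw [sub_eq_add_neg, sg_add, sg_odd (i := -1) (by decide)]; ring
    rw [this]
    module

lemma dQ_opQ (t : Free g) : dQ g (opQ t) + opQ (dQ g t) = t - genQ g (proj g t) := by
  rw [dQ_op, sub_add_cancel]

end OpLie

/-- The dg Lie algebra freely generated by `g` and a contraction. -/
def DGLie.resol (g : DGLie K) : DGLie K where
  V := OpLie.Free g
  gr := OpLie.fgr g
  d := OpLie.dQ g
  br := OpLie.brQ
  d_mem := OpLie.dQ_mem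
  d_d := OpLie.dQ_dQ
  br_mem := OpLie.brQ_mem
  br_symm := OpLie.brQ_symm
  jacobi := OpLie.brQ_jacobi
  d_br hx _ := OpLie.dQ_br hx _

/-- The projection of the resolution. -/
def DGLie.resolProj (g : DGLie K) : DGLie.Hom g.resol g where
  f := OpLie.proj g
  mem := OpLie.proj_mem
  d := OpLie.proj_dQ
  br := OpLie.proj_br

/-- The contraction of the resolution. -/
def DGLie.resolContraction (g : DGLie K) : DGLie.Contraction g.resolProj where
  σ := OpLie.genQ g
  h := OpLie.opQ
  σ_mem := OpLie.genQ_mem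
  h_mem := OpLie.opQ_mem
  φ_σ := OpLie.proj_σ
  φ_h := OpLie.proj_op
  d_h := OpLie.dQ_opQ

variable {K : Type u} [Field K]

section Sections

variable {V W : Type u} [AddCommGroup V] [Module K V] [AddCommGroup W] [Module K W]
  (gr : ℤ → Submodule K V) [Decomposition gr] (gr' : ℤ → Submodule K W)
  [Decomposition gr']

lemma exists_graded_section (p : V →ₗ[K] W) (hp : ∀ i, ∀ x ∈ gr i, p x ∈ gr' i)
    (hs : Surjective p) :
    ∃ s : W →ₗ[K] V, (∀ y, p (s y) = y) ∧ ∀ i, ∀ y ∈ gr' i, s y ∈ gr i := by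
  have h1 : ∀ i, Surjective (p.restrict (hp i)) := by
    rintro i ⟨y, hy⟩
    obtain ⟨x, rfl⟩ := hs y
    refine ⟨decompose gr x i, Subtype.ext ?_⟩
    change p (decompose gr x i) = p x
    have key : ∀ x : V, p (decompose gr x i) = decompose gr' (p x) i := by
      intro x
      induction x using inductionOn gr with
      | zero => simp
      | add x y hx hy =>
        rw [decompose_add, map_add, decompose_add, DirectSum.add_apply,
          DirectSum.add_apply, Submodule.coe_add, Submodule.coe_add, map_add, hx, hy]
      | @homogeneous j x =>
        by_cases h : j = i
        · subst h
          rw [decompose_of_mem_same gr x.2, decompose_of_mem_same gr' (hp _ _ x.2)]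
        · rw [decompose_of_mem_ne gr x.2 h, decompose_of_mem_ne gr' (hp _ _ x.2) h,
            map_zero]
    rw [key, decompose_of_mem_same gr' hy]
  choose s hs using fun i => (p.restrict (hp i)).exists_rightInverse_of_surjective
    (LinearMap.range_eq_top.mpr (h1 i))
  refine ⟨glift gr' fun i => (gr i).subtype ∘ₗ s i, fun y => ?_, fun i y hy => ?_⟩
  · have : p ∘ₗ glift gr' (fun i => (gr i).subtype ∘ₗ s i) = lid := by
      refine ghom_ext (gr := gr') fun i y hy => ?_
      rw [comp_apply, glift_of_mem _ _ hy]
      exact congrArg Subtype.val (lcongr_fun (hs i) ⟨y, hy⟩)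
    exact lcongr_fun this y
  · rw [glift_of_mem _ _ hy]
    exact (s i ⟨y, hy⟩).2

end Sections

namespace PoisAlg

variable {N : ℤ} {X Y : PoisAlg K N} (p : Hom X Y)

lemma Hom.exists_preimage (hs : Surjective p.f) (hq : p.IsQuasiIso) {i : ℤ} {z : X.B}
    (hz : z ∈ X.gr i) (hd : X.d z = 0) (hp : p.f z = 0) :
    ∃ w ∈ X.gr (i + 1), p.f w = 0 ∧ X.d w = z := by
  obtain ⟨s, ps, hs⟩ := exists_graded_section X.gr Y.gr p.f.toLinearMap (fun i x hx => p.mem hx) hs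
  have ps' : ∀ y, p.f (s y) = y := ps
  have h1 : ∃ w ∈ X.gr (i + 1), z = X.d w :=
    hq.inj i z hz hd ⟨0, zero_mem _, hp.trans (map_zero Y.d).symm⟩
  obtain ⟨w, hw, e⟩ := h1
  have h2 : ∃ x ∈ X.gr (i + 1), X.d x = 0 ∧ ∃ z' ∈ Y.gr (i + 1 + 1), p.f x = p.f w + Y.d z' :=
    hq.surj (i + 1) (p.f w) (p.mem hw) (by
      change Y.d (p.f w) = 0
      rw [← p.d, ← e, hp])
  obtain ⟨x, hx, dx, z', hz', e'⟩ := h2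
  refine ⟨w - x + X.d (s z'), add_mem (sub_mem hw hx) ?_, ?_, ?_⟩
  · have := X.d_mem (hs _ z' hz')
    rwa [add_sub_cancel_right] at this
  · rw [map_add, map_sub, e', p.d, ps']; abel
  · rw [map_add, map_sub, dx, X.d_d, sub_zero, add_zero, e]

/-- A surjective quasi-isomorphism has a graded section and a contraction of its kernel. -/
lemma exists_contraction (hs : Surjective p.f) (hq : p.IsQuasiIso) :
    ∃ (s : Y.B →ₗ[K] X.B) (k : X.B →ₗ[K] X.B), (∀ y, p.f (s y) = y) ∧
      (∀ i, ∀ y ∈ Y.gr i, s y ∈ X.gr i) ∧ (∀ i, ∀ x ∈ X.gr i, k x ∈ X.gr (i + 1)) ∧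
      (∀ x, p.f (k x) = 0) ∧ (∀ y, k (s y) = 0) ∧
      ∀ i, ∀ x ∈ X.gr i, p.f x = 0 → X.d (k x) + k (X.d x) = x := by
  obtain ⟨s, ps, hs'⟩ := exists_graded_section X.gr Y.gr p.f.toLinearMap (fun i x hx => p.mem hx) hs
  have ps' : ∀ y, p.f (s y) = y := ps
  let P : Submodule K X.B := ker p.f.toLinearMap
  let Z : ℤ → Submodule K X.B := fun i => X.gr i ⊓ (ker X.d ⊓ P)
  let B : ℤ → Submodule K X.B := fun i => X.gr (i + 1) ⊓ P
  have hκ : ∀ i, ∃ κ : X.B →ₗ[K] B i, ∀ z ∈ X.gr i, X.d z = 0 → p.f z = 0 → X.d (κ z) = z := by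
    intro i
    let δ : B i →ₗ[K] Z i := codRestrict (Z i) (X.d ∘ₗ (B i).subtype) (by
      rintro ⟨w, hw⟩
      have h := X.d_mem hw.1
      rw [add_sub_cancel_right] at h
      refine ⟨h, X.d_d w, ?_⟩
      change p.f (X.d w) = 0
      rw [p.d, show p.f w = 0 from hw.2, map_zero])
    have hδ : Surjective δ := by
      rintro ⟨z, hz, hd, hp⟩
      obtain ⟨w, hw, pw, e⟩ := p.exists_preimage hs hq hz hd hp
      exact ⟨⟨w, hw, pw⟩, Subtype.ext e⟩
    obtain ⟨r, hr⟩ := δ.exists_rightInverse_of_surjective (LinearMap.range_eq_top.mpr hδ)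
    obtain ⟨κ, hκ⟩ := r.exists_extend
    refine ⟨κ, fun z hz hd hp => ?_⟩
    have h1 : κ z = r ⟨z, hz, hd, hp⟩ := lcongr_fun hκ ⟨z, hz, hd, hp⟩
    rw [h1]
    exact congrArg Subtype.val (lcongr_fun hr ⟨z, hz, hd, hp⟩)
  choose κ' hκ' using hκ
  let κ : X.B →ₗ[K] X.B := glift X.gr fun i => (B i).subtype ∘ₗ κ' i ∘ₗ (X.gr i).subtype
  have κ_of : ∀ i (x : X.B) (hx : x ∈ X.gr i), κ x = κ' i x := fun i x hx => glift_of_mem _ _ hx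
  have κ_mem : ∀ i, ∀ x ∈ X.gr i, κ x ∈ X.gr (i + 1) := by
    intro i x hx
    rw [κ_of i x hx]; exact (κ' i x).2.1
  have κ_p : ∀ x, p.f (κ x) = 0 := by
    have : p.f.toLinearMap ∘ₗ κ = 0 := by
      refine ghom_ext (gr := X.gr) fun i x hx => ?_
      rw [comp_apply, κ_of i x hx]; exact (κ' i x).2.2
    exact fun x => lcongr_fun this x
  have κ_d : ∀ i, ∀ x ∈ X.gr i, X.d x = 0 → p.f x = 0 → X.d (κ x) = x := by
    intro i x hx hd hp
    rw [κ_of i x hx]; exact hκ' i x hx hd hp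
  let v : X.B →ₗ[K] X.B := lid - s ∘ₗ p.f.toLinearMap
  have v_ap : ∀ x, v x = x - s (p.f x) := fun x => rfl
  have v_mem : ∀ i, ∀ x ∈ X.gr i, v x ∈ X.gr i := fun i x hx => sub_mem hx (hs' _ _ (p.mem hx))
  have dκ_mem : ∀ i, ∀ x ∈ X.gr i, κ (X.d x) ∈ X.gr i := by
    intro i x hx
    have := κ_mem _ _ (X.d_mem hx)
    rwa [sub_add_cancel] at this
  refine ⟨s, κ ∘ₗ (lid - κ ∘ₗ X.d) ∘ₗ v, ps, hs', ?_, fun x => κ_p _, ?_, ?_⟩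
  · intro i x hx
    exact κ_mem _ _ (sub_mem (v_mem i x hx) (dκ_mem _ _ (v_mem i x hx)))
  · intro y
    have : v (s y) = 0 := by rw [v_ap, ps', sub_self]
    rw [comp_apply, comp_apply, this, map_zero, map_zero]
  · intro i x hx hp
    have h1 : v x = x := by rw [v_ap, hp, map_zero, sub_zero]
    have hp' : p.f (X.d x) = 0 := by rw [p.d, hp, map_zero]
    have h2 : v (X.d x) = X.d x := by rw [v_ap, hp', map_zero, sub_zero]
    simp only [comp_apply, LinearMap.sub_apply, id_apply, h1, h2]
    rw [X.d_d, map_zero, sub_zero, κ_d i _ (sub_mem hx (dκ_mem i x hx)) _ _, sub_add_cancel]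
    · rw [map_sub, κ_d _ _ (X.d_mem hx) (X.d_d x) hp', sub_self]
    · rw [map_sub, hp, κ_p, sub_self]

section Lie

variable (X)

/-- The Lie bracket of the shift of a Poisson algebra. -/
def lieBr : X.B →ₗ[K] X.B →ₗ[K] X.B := sg K N • X.br ∘ₗ tw X.gr N

variable {X}

lemma lieBr_of_mem {i : ℤ} {x : X.B} (hx : x ∈ X.gr (i - N)) (y : X.B) :
    X.lieBr x y = sg K (N * i) • X.br x y := by
  rw [lieBr, lsmul_apply, comp_apply, tw_of_mem _ _ hx, map_smul, smul_smul,
    lsmul_apply, ← sg_add]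
  congr 1
  refine sg_of_zmod ?_
  push_cast
  generalize (N : ZMod 2) = a
  generalize (i : ZMod 2) = b
  revert a b
  decide

lemma lieBr_mem {i j : ℤ} {x y : X.B} (hx : x ∈ X.gr (i - N)) (hy : y ∈ X.gr (j - N)) :
    X.lieBr x y ∈ X.gr (i + j - N) := by
  rw [lieBr_of_mem hx]
  have := X.br_mem hx hy
  rw [show i - N + (j - N) + N = i + j - N by ring] at this
  exact smul_mem _ _ this

lemma lieBr_symm {i j : ℤ} {x y : X.B} (hx : x ∈ X.gr (i - N)) (hy : y ∈ X.gr (j - N)) :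
    X.lieBr x y = -(sg K (i * j) • X.lieBr y x) := by
  rw [lieBr_of_mem hx, lieBr_of_mem hy, X.br_symm hx hy]
  by_cases hi : Even i <;> by_cases hj : Even j <;> by_cases hN : Even N <;>
    simp [sg, -int_not_even, ← int_not_even, Int.even_add, Int.even_sub,
      Int.even_mul, hi, hj, hN]

lemma lieBr_jacobi {i j k : ℤ} {x y z : X.B} (hx : x ∈ X.gr (i - N)) (hy : y ∈ X.gr (j - N))
    (hz : z ∈ X.gr (k - N)) : X.lieBr x (X.lieBr y z) =
      X.lieBr (X.lieBr x y) z + sg K (i * j) • X.lieBr y (X.lieBr x z) := by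
  rw [lieBr_of_mem (lieBr_mem hx hy), lieBr_of_mem hx, lieBr_of_mem hx, lieBr_of_mem hx,
    lieBr_of_mem hy, lieBr_of_mem hy, map_smul, map_smul, map_smul, lsmul_apply,
    X.jacobi hx hy hz]
  by_cases hi : Even i <;> by_cases hj : Even j <;> by_cases hN : Even N <;>
    simp [sg, -int_not_even, ← int_not_even, Int.even_add, Int.even_sub,
      Int.even_mul, hi, hj, hN] <;> module

lemma lieBr_d {i j : ℤ} {x y : X.B} (hx : x ∈ X.gr (i - N)) (hy : y ∈ X.gr (j - N)) :
    sg K N • X.d (X.lieBr x y) =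
      X.lieBr (sg K N • X.d x) y + sg K i • X.lieBr x (sg K N • X.d y) := by
  have hd := X.d_mem hx
  rw [sub_right_comm] at hd
  rw [lieBr_of_mem hx, lieBr_of_mem hx, lieBr_of_mem (smul_mem _ _ hd), map_smul,
    X.d_br hx hy, map_smul, map_smul, lsmul_apply]
  by_cases hi : Even i <;> by_cases hj : Even j <;> by_cases hN : Even N <;>
    simp [sg, -int_not_even, ← int_not_even, Int.even_add, Int.even_sub,
      Int.even_mul, hi, hj, hN] <;> module

lemma Hom.lieBr {X Y : PoisAlg K N} (p : Hom X Y) (x y : X.B) :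
    p.f (X.lieBr x y) = Y.lieBr (p.f x) (p.f y) := by
  simp only [PoisAlg.lieBr, lsmul_apply, comp_apply]
  rw [map_smul, p.br, p.map_tw]

end Lie

end PoisAlg

variable {K : Type u} [Field K]

namespace DGLie

open OpLie

section Lifting

variable {g : DGLie K} {N : ℤ} {X Y : PoisAlg K N} (p : PoisAlg.Hom X Y)
  (ψ : PoisAlg.Hom (g.resol.symPois N) Y) (s : Y.B →ₗ[K] X.B) (k : X.B →ₗ[K] X.B)

/-- The restriction of a morphism to the generators. -/
def onGen : Free g →ₗ[K] Y.B := ψ.f.toLinearMap ∘ₗ g.resol.s N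

lemma onGen_mem {i : ℤ} {t : Free g} (ht : t ∈ fgr g i) : onGen ψ t ∈ Y.gr (i - N) :=
  ψ.mem (g.resol.s_mem N ht)

lemma onGen_d (t : Free g) : onGen ψ (dQ g t) = sg K N • Y.d (onGen ψ t) := by
  have h : onGen ψ ∘ₗ dQ g = sg K N • Y.d ∘ₗ onGen ψ := by
    refine ghom_ext (gr := fgr g) fun i t ht => ?_
    have h1 : g.resol.symD N (g.resol.s N t) = sg K N • g.resol.s N (dQ g t) :=
      g.resol.symD_s N ht
    have h2 : ψ.f (g.resol.symD N (g.resol.s N t)) = Y.d (ψ.f (g.resol.s N t)) := ψ.d _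
    have h3 : ψ.f (sg K N • g.resol.s N (dQ g t)) = sg K N • ψ.f (g.resol.s N (dQ g t)) :=
      map_smul ψ.f _ _
    change ψ.f (g.resol.s N (dQ g t)) = sg K N • Y.d (ψ.f (g.resol.s N t))
    rw [← h2, h1, h3, smul_smul, sg_mul_self, one_smul]
  exact lcongr_fun h t

lemma onGen_br {i j : ℤ} {t t' : Free g} (ht : t ∈ fgr g i) (ht' : t' ∈ fgr g j) :
    onGen ψ (brQ t t') = Y.lieBr (onGen ψ t) (onGen ψ t') := by
  have h1 : g.resol.symBr N (g.resol.s N t) (g.resol.s N t') = sg K (N * i) • g.resol.s N (brQ t t') :=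
    g.resol.symBr_s_s N ht ht'
  have h2 : ψ.f (g.resol.symBr N (g.resol.s N t) (g.resol.s N t')) =
    Y.br (ψ.f (g.resol.s N t)) (ψ.f (g.resol.s N t')) := ψ.br _ _
  have h3 : ψ.f (sg K (N * i) • g.resol.s N (brQ t t')) = sg K (N * i) • ψ.f (g.resol.s N (brQ t t')) :=
    map_smul ψ.f _ _
  rw [PoisAlg.lieBr_of_mem (onGen_mem ψ ht)]
  change ψ.f (g.resol.s N (brQ t t')) = sg K (N * i) • Y.br (ψ.f (g.resol.s N t)) (ψ.f (g.resol.s N t'))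
  rw [← h2, h1, h3, smul_smul, sg_mul_self, one_smul]

/-- The differential of the shift. -/
def shD (X : PoisAlg K N) : X.B →ₗ[K] X.B := sg K N • X.d

lemma shD_shD (x : X.B) : shD X (shD X x) = 0 := by
  rw [shD, lsmul_apply, lsmul_apply, map_smul, X.d_d, smul_zero, smul_zero]

lemma shD_mem {i : ℤ} {x : X.B} (hx : x ∈ X.gr (i - N)) : shD X x ∈ X.gr (i - 1 - N) := by
  have := X.d_mem hx
  rw [sub_right_comm] at this
  exact smul_mem _ _ this

lemma f_shD (x : X.B) : p.f (shD X x) = shD Y (p.f x) := by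
  rw [shD, shD, lsmul_apply, lsmul_apply, map_smul, p.d]

/-- The lift on `g`. -/
def liftGen : g.V →ₗ[K] X.B :=
  s ∘ₗ onGen ψ ∘ₗ genQ g - sg K N • k ∘ₗ (shD X ∘ₗ s ∘ₗ onGen ψ ∘ₗ genQ g -
    s ∘ₗ onGen ψ ∘ₗ genQ g ∘ₗ g.d)

lemma liftGen_apply (x : g.V) : liftGen ψ s k x = s (onGen ψ (genQ g x)) -
    sg K N • k (shD X (s (onGen ψ (genQ g x))) - s (onGen ψ (genQ g (g.d x)))) := rfl

/-- The value of the lift on `h t`, in terms of its value `x` on `t`. -/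
def liftOp : X.B × Free g →ₗ[K] X.B :=
  s ∘ₗ onGen ψ ∘ₗ opQ ∘ₗ LinearMap.snd K _ _ + sg K N • k ∘ₗ (LinearMap.fst K _ _ -
    (liftGen ψ s k ∘ₗ proj g + shD X ∘ₗ s ∘ₗ onGen ψ ∘ₗ opQ) ∘ₗ LinearMap.snd K _ _)

lemma liftOp_apply (q : X.B × Free g) : liftOp ψ s k q = s (onGen ψ (opQ q.2)) + sg K N • k (q.1 -
    (liftGen ψ s k (proj g q.2) + shD X (s (onGen ψ (opQ q.2))))) := rfl

variable (hs : ∀ i, ∀ y ∈ Y.gr i, s y ∈ X.gr i) (hk : ∀ i, ∀ x ∈ X.gr i, k x ∈ X.gr (i + 1))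

include hs in
lemma s_onGen_mem {i : ℤ} {t : Free g} (ht : t ∈ fgr g i) : s (onGen ψ t) ∈ X.gr (i - N) :=
  hs _ _ (onGen_mem ψ ht)

include hs hk in
lemma liftGen_mem {i : ℤ} {x : g.V} (hx : x ∈ g.gr i) : liftGen ψ s k x ∈ X.gr (i - N) := by
  have h1 := s_onGen_mem ψ s hs (genQ_mem hx)
  rw [liftGen_apply]
  have := hk _ _ (sub_mem (shD_mem h1) (s_onGen_mem ψ s hs (genQ_mem (g.d_mem hx))))
  rw [show i - 1 - N + 1 = i - N by ring] at this
  exact sub_mem h1 (smul_mem _ _ this)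

include hs hk in
lemma liftOp_mem {i : ℤ} {q : X.B × Free g} (hq : q ∈ (X.gr (i - N)).prod (fgr g i)) :
    liftOp ψ s k q ∈ X.gr (i + 1 - N) := by
  have h1 := s_onGen_mem ψ s hs (opQ_mem hq.2)
  rw [liftOp_apply]
  have h2 := shD_mem h1
  rw [add_sub_cancel_right] at h2
  have := hk _ _ (sub_mem hq.1 (add_mem (liftGen_mem ψ s k hs hk (proj_mem hq.2)) h2))
  rw [show i - N + 1 = i + 1 - N by ring] at this
  exact add_mem h1 (smul_mem _ _ this)

/-- The Lie algebra in which the lift takes its values. -/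
def liftLie : OpLie g where
  V := X.B × Free g
  gr i := (X.gr (i - N)).prod (fgr g i)
  br := mk₂ K (fun a b => (X.lieBr a.1 b.1, brQ a.2 b.2))
    (fun a a' b => by simp) (fun c a b => by simp) (fun a b b' => by simp) (fun c a b => by simp)
  σ := (liftGen ψ s k).prod (genQ g)
  h := (liftOp ψ s k).prod (opQ ∘ₗ LinearMap.snd K _ _)
  br_mem hx hy := ⟨PoisAlg.lieBr_mem hx.1 hy.1, brQ_mem hx.2 hy.2⟩
  br_symm hx hy := Prod.ext (PoisAlg.lieBr_symm hx.1 hy.1) (brQ_symm hx.2 hy.2)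
  jacobi hx hy hz := Prod.ext (PoisAlg.lieBr_jacobi hx.1 hy.1 hz.1) (brQ_jacobi hx.2 hy.2 hz.2)
  σ_mem hx := ⟨liftGen_mem ψ s k hs hk hx, genQ_mem hx⟩
  h_mem hx := ⟨liftOp_mem ψ s k hs hk hx, opQ_mem hx.2⟩

/-- The lift on generators. -/
def genLift : Free g →ₗ[K] X.B := LinearMap.fst K _ _ ∘ₗ (liftLie ψ s k hs hk).lift

lemma liftLie_snd (t : Free g) : ((liftLie ψ s k hs hk).lift t).2 = t := by
  induction t using free_induction with
  | hadd x y hx hy => rw [map_add]; exact congrArg₂ (· + ·) hx hy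
  | hsmul c x hx => rw [map_smul]; exact congrArg (c • ·) hx
  | hσ i x hx => rw [lift_σ]; rfl
  | hop i t ht ih => rw [lift_op]; exact congrArg opQ ih
  | hbr i t ht j t' ht' h1 h2 => rw [lift_br]; exact congrArg₂ (fun s t => brQ s t) h1 h2

lemma genLift_σ (x : g.V) : genLift ψ s k hs hk (genQ g x) = liftGen ψ s k x :=
  congrArg Prod.fst ((liftLie ψ s k hs hk).lift_σ x)

lemma genLift_op (t : Free g) : genLift ψ s k hs hk (opQ t) = s (onGen ψ (opQ t)) +
    sg K N • k (genLift ψ s k hs hk t -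
      (liftGen ψ s k (proj g t) + shD X (s (onGen ψ (opQ t))))) := by
  refine (congrArg Prod.fst ((liftLie ψ s k hs hk).lift_op t)).trans ?_
  refine (liftOp_apply ψ s k ((liftLie ψ s k hs hk).lift t)).trans ?_
  rw [liftLie_snd]
  rfl

lemma genLift_br (t t' : Free g) : genLift ψ s k hs hk (brQ t t') =
    X.lieBr (genLift ψ s k hs hk t) (genLift ψ s k hs hk t') :=
  congrArg Prod.fst ((liftLie ψ s k hs hk).lift_br t t')

lemma genLift_mem {i : ℤ} {t : Free g} (ht : t ∈ fgr g i) : genLift ψ s k hs hk t ∈ X.gr (i - N) :=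
  ((liftLie ψ s k hs hk).lift_mem ht).1

variable (ps : ∀ y, p.f (s y) = y) (pk : ∀ x, p.f (k x) = 0)

include ps pk in
lemma f_genLift (t : Free g) : p.f (genLift ψ s k hs hk t) = onGen ψ t := by
  induction t using free_induction with
  | hadd x y hx hy => rw [map_add, map_add, map_add, hx, hy]
  | hsmul c x hx => rw [map_smul, map_smul, map_smul, hx]
  | hσ i x hx => rw [genLift_σ, liftGen_apply, map_sub, map_smul, pk, ps, smul_zero, sub_zero]
  | hop i t ht ih => rw [genLift_op, map_add, map_smul, pk, ps, smul_zero, add_zero]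
  | hbr i t ht j t' ht' h1 h2 => rw [genLift_br, p.lieBr, h1, h2, onGen_br ψ ht ht']

variable (ks : ∀ y, k (s y) = 0) (dk : ∀ i, ∀ x ∈ X.gr i, p.f x = 0 → X.d (k x) + k (X.d x) = x)

include dk in
lemma shD_k {i : ℤ} {x : X.B} (hx : x ∈ X.gr i) (hp : p.f x = 0) :
    shD X (sg K N • k x) = x - sg K N • k (shD X x) := by
  rw [shD, lsmul_apply, lsmul_apply, map_smul, map_smul, smul_smul, smul_smul,
    sg_mul_self, one_smul, one_smul]
  exact eq_sub_of_add_eq (dk i x hx hp)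

include ps dk hs in
lemma shD_liftGen {i : ℤ} {x : g.V} (hx : x ∈ g.gr i) :
    shD X (liftGen ψ s k x) = liftGen ψ s k (g.d x) := by
  rw [liftGen_apply, liftGen_apply, map_sub, shD_k p k dk
    (sub_mem (shD_mem (s_onGen_mem ψ s hs (genQ_mem hx))) (s_onGen_mem ψ s hs (genQ_mem (g.d_mem hx))))]
  · rw [map_sub, shD_shD, zero_sub, g.d_d, map_zero, map_zero, map_zero, sub_zero, map_neg, smul_neg]
    abel
  · rw [map_sub, f_shD, ps, ps, ← dQ_σ, onGen_d, shD, lsmul_apply, sub_self]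

include ps pk ks dk in
lemma shD_genLift (t : Free g) :
    shD X (genLift ψ s k hs hk t) = genLift ψ s k hs hk (dQ g t) := by
  induction t using free_induction with
  | hadd x y hx hy => rw [map_add, map_add, map_add, map_add, hx, hy]
  | hsmul c x hx => rw [map_smul, map_smul, map_smul, map_smul, hx]
  | hσ i x hx => rw [genLift_σ, dQ_σ, genLift_σ, shD_liftGen p ψ s k hs ps dk hx]
  | hop i t ht ih =>
    set χ := genLift ψ s k hs hk with hχ
    have hpt := proj_mem ht
    have hod : opQ (dQ g t) ∈ fgr g i := by
      have := opQ_mem (dQ_mem ht)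
      rwa [sub_add_cancel] at this
    have m1 := s_onGen_mem ψ s hs (opQ_mem ht)
    have m2 := shD_mem m1
    rw [add_sub_cancel_right] at m2
    have hv : χ t - (liftGen ψ s k (proj g t) + shD X (s (onGen ψ (opQ t)))) -
        s (onGen ψ (opQ (dQ g t))) ∈ X.gr (i - N) :=
      sub_mem (sub_mem (genLift_mem ψ s k hs hk ht) (add_mem (liftGen_mem ψ s k hs hk hpt) m2))
        (s_onGen_mem ψ s hs hod)
    have hp : p.f (χ t - (liftGen ψ s k (proj g t) + shD X (s (onGen ψ (opQ t)))) -
        s (onGen ψ (opQ (dQ g t)))) = 0 := by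
      rw [map_sub, map_sub, map_add, f_shD, ps, ps, hχ, f_genLift p ψ s k hs hk ps pk,
        ← genLift_σ ψ s k hs hk, f_genLift p ψ s k hs hk ps pk]
      have h1 := onGen_d ψ (opQ t)
      rw [dQ_op, map_sub, map_sub] at h1
      rw [shD, lsmul_apply, ← h1]
      abel
    have e1 := shD_k p k dk hv hp
    rw [map_sub, ks, sub_zero] at e1
    have e2 : χ (dQ g (opQ t)) = χ t - liftGen ψ s k (proj g t) - χ (opQ (dQ g t)) := by
      rw [dQ_op, map_sub, map_sub, hχ, genLift_σ]
    have e3 : shD X (χ t - (liftGen ψ s k (proj g t) + shD X (s (onGen ψ (opQ t)))) -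
        s (onGen ψ (opQ (dQ g t)))) =
        χ (dQ g t) - (liftGen ψ s k (proj g (dQ g t)) + shD X (s (onGen ψ (opQ (dQ g t))))) := by
      rw [map_sub, map_sub, map_add, shD_shD, ih, shD_liftGen p ψ s k hs ps dk hpt, proj_dQ]
      abel
    have e4 : χ (opQ t) = s (onGen ψ (opQ t)) +
        sg K N • k (χ t - (liftGen ψ s k (proj g t) + shD X (s (onGen ψ (opQ t))))) :=
      genLift_op ψ s k hs hk t
    have e5 : χ (opQ (dQ g t)) = s (onGen ψ (opQ (dQ g t))) +
        sg K N • k (χ (dQ g t) - (liftGen ψ s k (proj g (dQ g t)) +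
          shD X (s (onGen ψ (opQ (dQ g t)))))) := genLift_op ψ s k hs hk (dQ g t)
    rw [e2, e5, e4, map_add, e1, e3]
    abel
  | hbr i t ht j t' ht' h1 h2 =>
    rw [dQ_br ht, map_add, map_smul, genLift_br, genLift_br, genLift_br, ← h1, ← h2]
    exact PoisAlg.lieBr_d (genLift_mem ψ s k hs hk ht) (genLift_mem ψ s k hs hk ht')

end Lifting

lemma resol_cofibrant (g : DGLie K) (N : ℤ) : (g.resol.symPois N).Cofibrant := by
  intro X Y p hp hq ψ
  obtain ⟨s, k, ps, hs, hk, pk, ks, dk⟩ := PoisAlg.exists_contraction p hp hq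
  refine ⟨g.resol.symPoisLift N X (genLift ψ s k hs hk) (genLift_mem ψ s k hs hk)
    (fun {i t} _ => ?_) (fun {i j t t'} ht _ => ?_), fun q => ?_⟩
  · have h := shD_genLift p ψ s k hs hk ps pk ks dk t
    exact h.symm
  · have h := genLift_br ψ s k hs hk t t'
    refine (congrArg (sg K (N * i) • ·) h).trans ?_
    rw [PoisAlg.lieBr_of_mem (genLift_mem ψ s k hs hk ht), smul_smul, sg_mul_self, one_smul]
    rfl
  · have h : p.f.comp (g.resol.poisAlgHom N X (genLift ψ s k hs hk) (genLift_mem ψ s k hs hk)) =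
        ψ.f := by
      refine g.resol.sym_algHom_ext N fun i t ht => ?_
      refine (congrArg p.f (g.resol.symLift_s N X.gr X.mul_comm (genLift ψ s k hs hk)
        (genLift_mem ψ s k hs hk) t)).trans ?_
      exact f_genLift p ψ s k hs hk ps pk t
    exact DFunLike.congr_fun h q

end DGLie

open Polynomial

variable {K : Type u} [Field K]

section Proj

variable {V : Type u} [AddCommGroup V] [Module K V] (gr : ℤ → Submodule K V)
  [Decomposition gr]

/-- The projection to the degree `i` part. -/
def gproj (i : ℤ) : V →ₗ[K] V := glift gr fun j => if j = i then (gr j).subtype else 0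

lemma gproj_same {i : ℤ} {x : V} (hx : x ∈ gr i) : gproj gr i x = x := by
  rw [gproj, glift_of_mem _ _ hx, if_pos rfl]; rfl

lemma gproj_ne {i j : ℤ} (h : i ≠ j) {x : V} (hx : x ∈ gr j) : gproj gr i x = 0 := by
  rw [gproj, glift_of_mem _ _ hx, if_neg h.symm]; rfl

end Proj

namespace PoisAlg

variable {N : ℤ} (B : PoisAlg K N)

/-- The polynomials with values in a Poisson algebra. -/
abbrev PV : Type u := K[X] ⊗[K] B.B

/-- The grading of the polynomials. -/
def pgr (i : ℤ) : Submodule K B.PV := span K {t | ∃ p : K[X], ∃ b ∈ B.gr i, t = p ⊗ₜ b}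

variable {B}

lemma tmul_mem_pgr {i : ℤ} (p : K[X]) {b : B.B} (hb : b ∈ B.gr i) : p ⊗ₜ b ∈ B.pgr i :=
  subset_span ⟨p, b, hb, rfl⟩

lemma pgr_induction {i : ℤ} {P : ∀ x, x ∈ B.pgr i → Prop}
    (hadd : ∀ x y hx hy, P x hx → P y hy → P (x + y) (add_mem hx hy))
    (h : ∀ (p : K[X]) (b : B.B) (hb : b ∈ B.gr i), P (p ⊗ₜ b) (tmul_mem_pgr p hb))
    {x : B.PV} (hx : x ∈ B.pgr i) : P x hx := by
  have key : ∀ c : K, ∃ h, P (c • x) h := by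
    induction hx using span_induction with
    | zero =>
      intro c
      have := h 0 0 (zero_mem _)
      rw [smul_zero]
      simp only [zero_tmul] at this
      exact ⟨_, this⟩
    | add x y _ _ h1 h2 =>
      intro c
      rw [smul_add]
      exact ⟨_, hadd _ _ _ _ (h1 c).2 (h2 c).2⟩
    | smul a x _ h1 => intro c; rw [smul_smul]; exact h1 (c * a)
    | mem x hx =>
      intro c
      obtain ⟨p, b, hb, rfl⟩ := hx
      rw [smul_tmul']
      exact ⟨_, h (c • p) b hb⟩
  have := (key 1).2
  simp only [one_smul] at this
  exact this

lemma pgr_map {i j : ℤ} {F : B.PV →ₗ[K] B.PV} (h : ∀ p, ∀ b ∈ B.gr i, F (p ⊗ₜ b) ∈ B.pgr j)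
    {x : B.PV} (hx : x ∈ B.pgr i) : F x ∈ B.pgr j := by
  induction hx using pgr_induction with
  | hadd x y _ _ h1 h2 => rw [map_add]; exact add_mem h1 h2
  | h p b hb => exact h p b hb

instance : Decomposition B.pgr :=
  decompositionOfProj B.pgr (fun i => lTensor K[X] (gproj B.gr i))
    (fun i x hx => by
      induction hx using pgr_induction with
      | hadd x y _ _ h1 h2 => rw [map_add, h1, h2]
      | h p b hb => rw [lTensor_tmul, gproj_same _ hb])
    (fun i j hij x hx => by
      induction hx using pgr_induction with
      | hadd x y _ _ h1 h2 => rw [map_add, h1, h2, add_zero]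
      | h p b hb => rw [lTensor_tmul, gproj_ne _ hij hb, tmul_zero])
    (fun x => by
      induction x using induction_on with
      | zero => exact zero_mem _
      | add x y hx hy => exact add_mem hx hy
      | tmul p b =>
        induction b using inductionOn B.gr with
        | zero => rw [tmul_zero]; exact zero_mem _
        | add x y hx hy => rw [tmul_add]; exact add_mem hx hy
        | @homogeneous j b => exact mem_iSup_of_mem j (tmul_mem_pgr p b.2))

lemma pmul_mem {i j : ℤ} {x y : B.PV} (hx : x ∈ B.pgr i) (hy : y ∈ B.pgr j) :
    x * y ∈ B.pgr (i + j) := by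
  induction hx using pgr_induction with
  | hadd x y _ _ h1 h2 => rw [add_mul]; exact add_mem h1 h2
  | h p b hb =>
    induction hy using pgr_induction with
    | hadd x y _ _ h1 h2 => rw [mul_add]; exact add_mem h1 h2
    | h q c hc =>
      rw [tmul_mul_tmul]
      exact tmul_mem_pgr _ (gmul_mem hb hc)

instance : GradedAlgebra B.pgr where
  one_mem := tmul_mem_pgr 1 gone_mem
  mul_mem _ _ _ _ hx hy := pmul_mem hx hy

variable (B) in
/-- The bracket of polynomials. -/
def pbr : B.PV →ₗ[K] B.PV →ₗ[K] B.PV := TensorProduct.map₂ (LinearMap.mul K K[X]) B.br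

lemma pbr_tmul (p q : K[X]) (b c : B.B) : B.pbr (p ⊗ₜ b) (q ⊗ₜ c) = (p * q) ⊗ₜ B.br b c := rfl

variable (B) in
/-- The differential of polynomials. -/
def pd : B.PV →ₗ[K] B.PV := lTensor K[X] B.d

lemma pd_mem {i : ℤ} {x : B.PV} (hx : x ∈ B.pgr i) : B.pd x ∈ B.pgr (i - 1) :=
  pgr_map (fun p b hb => tmul_mem_pgr p (B.d_mem hb)) hx

lemma pd_tmul (p : K[X]) (b : B.B) : B.pd (p ⊗ₜ b) = p ⊗ₜ B.d b := rfl

lemma pd_pd (x : B.PV) : B.pd (B.pd x) = 0 := by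
  have h : B.pd ∘ₗ B.pd = 0 := by
    apply ext'
    intro p b
    simp [pd_tmul, B.d_d]
  exact lcongr_fun h x

lemma pmul_comm {i j : ℤ} {x y : B.PV} (hx : x ∈ B.pgr i) (hy : y ∈ B.pgr j) :
    x * y = sg K (i * j) • (y * x) := by
  induction hx using pgr_induction with
  | hadd x x' _ _ h1 h2 => rw [add_mul, mul_add, h1, h2, smul_add]
  | h p b hb =>
    induction hy using pgr_induction with
    | hadd x x' _ _ h1 h2 => rw [add_mul, mul_add, h1, h2, smul_add]
    | h q c hc =>
      rw [tmul_mul_tmul, tmul_mul_tmul,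
        B.mul_comm hb hc, _root_.mul_comm p, tmul_smul]

lemma pd_mul {i j : ℤ} {x y : B.PV} (hx : x ∈ B.pgr i) (hy : y ∈ B.pgr j) :
    B.pd (x * y) = B.pd x * y + sg K i • (x * B.pd y) := by
  induction hx using pgr_induction with
  | hadd x x' _ _ h1 h2 => simp only [add_mul, map_add, h1, h2]; module
  | h p b hb =>
    induction hy using pgr_induction with
    | hadd x x' _ _ h1 h2 => simp only [mul_add, map_add, h1, h2]; module
    | h q c hc =>
      simp only [tmul_mul_tmul, pd_tmul, B.d_mul hb hc,
        tmul_add, tmul_smul]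

lemma pbr_mem {i j : ℤ} {x y : B.PV} (hx : x ∈ B.pgr i) (hy : y ∈ B.pgr j) :
    B.pbr x y ∈ B.pgr (i + j + N) := by
  induction hx using pgr_induction with
  | hadd x x' _ _ h1 h2 => rw [map_add, ladd_apply]; exact add_mem h1 h2
  | h p b hb => exact pgr_map (fun q c hc => tmul_mem_pgr _ (B.br_mem hb hc)) hy

lemma pbr_symm {i j : ℤ} {x y : B.PV} (hx : x ∈ B.pgr i) (hy : y ∈ B.pgr j) :
    B.pbr x y = sg K (N + 1 + i * j) • B.pbr y x := by
  induction hx using pgr_induction with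
  | hadd x x' _ _ h1 h2 => rw [map_add, ladd_apply, h1, h2, map_add, smul_add]
  | h p b hb =>
    induction hy using pgr_induction with
    | hadd x x' _ _ h1 h2 => rw [map_add, h1, h2, map_add, ladd_apply, smul_add]
    | h q c hc => rw [pbr_tmul, pbr_tmul, B.br_symm hb hc, _root_.mul_comm p, tmul_smul]

lemma pd_br {i j : ℤ} {x y : B.PV} (hx : x ∈ B.pgr i) (hy : y ∈ B.pgr j) :
    B.pd (B.pbr x y) = sg K N • (B.pbr (B.pd x) y + sg K i • B.pbr x (B.pd y)) := by
  induction hx using pgr_induction with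
  | hadd x x' _ _ h1 h2 => simp only [ladd_apply, map_add, h1, h2]; module
  | h p b hb =>
    induction hy using pgr_induction with
    | hadd x x' _ _ h1 h2 => simp only [map_add, h1, h2]; module
    | h q c hc =>
      simp only [pbr_tmul, pd_tmul, B.d_br hb hc,
        tmul_add, tmul_smul]

lemma pleibniz {i j k : ℤ} {x y z : B.PV} (hx : x ∈ B.pgr i) (hy : y ∈ B.pgr j)
    (hz : z ∈ B.pgr k) :
    B.pbr x (y * z) = B.pbr x y * z + sg K ((i + N) * j) • (y * B.pbr x z) := by
  induction hx using pgr_induction with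
  | hadd x x' _ _ h1 h2 =>
    simp only [ladd_apply, map_add, h1, h2, add_mul, mul_add]; module
  | h p b hb =>
    induction hy using pgr_induction with
    | hadd x x' _ _ h1 h2 => simp only [map_add, h1, h2, add_mul, mul_add]; module
    | h q c hc =>
      induction hz using pgr_induction with
      | hadd x x' _ _ h1 h2 => simp only [map_add, h1, h2, mul_add]; module
      | h r a ha =>
        simp only [pbr_tmul, tmul_mul_tmul, B.leibniz hb hc ha,
          tmul_add, tmul_smul, mul_assoc, mul_left_comm p]

lemma pjacobi {i j k : ℤ} {x y z : B.PV} (hx : x ∈ B.pgr i) (hy : y ∈ B.pgr j)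
    (hz : z ∈ B.pgr k) :
    B.pbr x (B.pbr y z) = sg K ((i + N) * N) • B.pbr (B.pbr x y) z +
      sg K ((i + N) * (j + N)) • B.pbr y (B.pbr x z) := by
  induction hx using pgr_induction with
  | hadd x x' _ _ h1 h2 => simp only [ladd_apply, map_add, h1, h2]; module
  | h p b hb =>
    induction hy using pgr_induction with
    | hadd x x' _ _ h1 h2 => simp only [ladd_apply, map_add, h1, h2]; module
    | h q c hc =>
      induction hz using pgr_induction with
      | hadd x x' _ _ h1 h2 => simp only [map_add, h1, h2]; module
      | h r a ha =>
        simp only [pbr_tmul, B.jacobi hb hc ha, tmul_add, tmul_smul,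
          mul_assoc, mul_left_comm p]

variable (B) in
/-- The derivative of polynomials. -/
def pder : B.PV →ₗ[K] B.PV := LinearMap.rTensor B.B derivative

lemma pder_tmul (p : K[X]) (b : B.B) : B.pder (p ⊗ₜ b) = derivative p ⊗ₜ b := rfl

lemma pder_mem {i : ℤ} {x : B.PV} (hx : x ∈ B.pgr i) : B.pder x ∈ B.pgr i :=
  pgr_map (fun p _ hb => tmul_mem_pgr (derivative p) hb) hx

lemma pder_pd (x : B.PV) : B.pder (B.pd x) = B.pd (B.pder x) := by
  have h : B.pder ∘ₗ B.pd = B.pd ∘ₗ B.pder := ext' fun p b => rfl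
  exact lcongr_fun h x

lemma pder_mul (x y : B.PV) : B.pder (x * y) = B.pder x * y + x * B.pder y := by
  have h : (LinearMap.mul K B.PV).compr₂ B.pder =
      (LinearMap.mul K B.PV) ∘ₗ B.pder + (LinearMap.mul K B.PV).compl₂ B.pder := by
    apply ext'
    intro p b
    apply ext'
    intro q c
    simp [pder_tmul, add_tmul]
  exact lcongr_fun₂ h x y

lemma pder_br (x y : B.PV) : B.pder (B.pbr x y) = B.pbr (B.pder x) y + B.pbr x (B.pder y) := by
  have h : B.pbr.compr₂ B.pder = B.pbr ∘ₗ B.pder + B.pbr.compl₂ B.pder := by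
    apply ext'
    intro p b
    apply ext'
    intro q c
    simp [pder_tmul, pbr_tmul, add_tmul]
  exact lcongr_fun₂ h x y

variable (B)

/-- Evaluation of polynomials, as a morphism of algebras. -/
def pevA (c : K) : B.PV →ₐ[K] B.B :=
  Algebra.TensorProduct.lift ((Algebra.ofId K B.B).comp (aeval c)) (AlgHom.id K B.B)
    fun p b => Algebra.commutes (aeval c p : K) b

variable {B}

lemma pevA_tmul (c : K) (p : K[X]) (b : B.B) : B.pevA c (p ⊗ₜ b) = p.eval c • b := by
  refine (Algebra.TensorProduct.lift_tmul _ _ _ p b).trans ?_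
  rw [Algebra.smul_def, ← coe_aeval_eq_eval]
  rfl

lemma pevA_mem (c : K) {i : ℤ} {x : B.PV} (hx : x ∈ B.pgr i) : B.pevA c x ∈ B.gr i := by
  induction hx using pgr_induction with
  | hadd x y _ _ h1 h2 => rw [map_add]; exact add_mem h1 h2
  | h p b hb => rw [pevA_tmul]; exact smul_mem _ _ hb

lemma pevA_d (c : K) (x : B.PV) : B.pevA c (B.pd x) = B.d (B.pevA c x) := by
  have h : (B.pevA c).toLinearMap ∘ₗ B.pd = B.d ∘ₗ (B.pevA c).toLinearMap := by
    apply ext'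
    intro p b
    simp only [comp_apply, pd_tmul, toLinearMap_apply, pevA_tmul,
      map_smul]
  exact lcongr_fun h x

lemma pevA_br (c : K) (x y : B.PV) : B.pevA c (B.pbr x y) = B.br (B.pevA c x) (B.pevA c y) := by
  have h : B.pbr.compr₂ (B.pevA c).toLinearMap =
      B.br.compl₁₂ (B.pevA c).toLinearMap (B.pevA c).toLinearMap := by
    apply ext'
    intro p b
    apply ext'
    intro q b'
    simp only [compr₂_apply, compl₁₂_apply, toLinearMap_apply, pbr_tmul,
      pevA_tmul, map_smul, lsmul_apply, eval_mul, mul_smul]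
    rw [smul_comm]
  exact lcongr_fun₂ h x y

end PoisAlg

open Polynomial

variable {K : Type u} [Field K]

namespace PoisAlg

variable {N : ℤ} {Q B : PoisAlg K N} (χ : Hom Q B)

/-- The path space of a morphism `χ`: the triples `(q, u, v)` where `u + η v` is a polynomial
differential form, with values in `B`, such that `u(0) = χ q`. -/
def PathV : Type u := ((B.pevA 0).toLinearMap ∘ₗ LinearMap.fst K B.PV B.PV ∘ₗ
  LinearMap.snd K Q.B (B.PV × B.PV)).eqLocus (χ.f.toLinearMap ∘ₗ LinearMap.fst K Q.B (B.PV × B.PV))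

namespace PathV

variable {χ}

instance : AddCommGroup (PathV χ) := inferInstanceAs (AddCommGroup (LinearMap.eqLocus _ _))

instance : Module K (PathV χ) := inferInstanceAs (Module K (LinearMap.eqLocus _ _))

/-- The components of a path. -/
def q : PathV χ →ₗ[K] Q.B := LinearMap.fst K _ _ ∘ₗ Submodule.subtype _

def u : PathV χ →ₗ[K] B.PV := LinearMap.fst K _ _ ∘ₗ LinearMap.snd K _ _ ∘ₗ Submodule.subtype _

def v : PathV χ →ₗ[K] B.PV := LinearMap.snd K _ _ ∘ₗ LinearMap.snd K _ _ ∘ₗ Submodule.subtype _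

lemma ev (x : PathV χ) : B.pevA 0 (u x) = χ.f (q x) := x.2

lemma ext {x y : PathV χ} (h1 : q x = q y) (h2 : u x = u y) (h3 : v x = v y) : x = y :=
  Subtype.ext (Prod.ext h1 (Prod.ext h2 h3))

/-- A path with given components. -/
def mk (a : Q.B) (b c : B.PV) (h : B.pevA 0 b = χ.f a) : PathV χ := ⟨(a, b, c), h⟩

@[simp] lemma q_mk (a : Q.B) (b c : B.PV) (h : B.pevA 0 b = χ.f a) : q (mk a b c h) = a := rfl
@[simp] lemma u_mk (a : Q.B) (b c : B.PV) (h : B.pevA 0 b = χ.f a) : u (mk a b c h) = b := rfl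
@[simp] lemma v_mk (a : Q.B) (b c : B.PV) (h : B.pevA 0 b = χ.f a) : v (mk a b c h) = c := rfl

instance : Mul (PathV χ) := ⟨fun x y => mk (q x * q y) (u x * u y)
  (v x * u y + tw B.pgr 1 (u x) * v y) (by rw [map_mul, map_mul, ev, ev])⟩

instance : One (PathV χ) := ⟨mk 1 1 0 (by rw [map_one, map_one])⟩

lemma q_mul (x y : PathV χ) : q (x * y) = q x * q y := rfl
lemma u_mul (x y : PathV χ) : u (x * y) = u x * u y := rfl
lemma v_mul' (x y : PathV χ) : v (x * y) = v x * u y + tw B.pgr 1 (u x) * v y := rfl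
lemma q_one : q (1 : PathV χ) = 1 := rfl
lemma u_one : u (1 : PathV χ) = 1 := rfl
lemma v_one : v (1 : PathV χ) = 0 := rfl

instance : Ring (PathV χ) where
  __ := (inferInstance : AddCommGroup (PathV χ))
  mul := (· * ·)
  one := 1
  left_distrib x y z := ext (by simp only [q_mul, map_add, mul_add])
    (by simp only [u_mul, map_add, mul_add])
    (by simp only [v_mul', map_add, mul_add]; abel)
  right_distrib x y z := ext (by simp only [q_mul, map_add, add_mul])
    (by simp only [u_mul, map_add, add_mul])
    (by simp only [v_mul', map_add, add_mul]; abel)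
  zero_mul x := ext (by simp only [q_mul, map_zero, zero_mul])
    (by simp only [u_mul, map_zero, zero_mul])
    (by simp only [v_mul', map_zero, zero_mul, add_zero])
  mul_zero x := ext (by simp only [q_mul, map_zero, mul_zero])
    (by simp only [u_mul, map_zero, mul_zero])
    (by simp only [v_mul', map_zero, mul_zero, add_zero])
  mul_assoc x y z := ext (by simp only [q_mul, mul_assoc])
    (by simp only [u_mul, mul_assoc])
    (by simp only [v_mul', u_mul, tw_mul, add_mul, mul_add, mul_assoc, add_assoc])
  one_mul x := ext (by simp only [q_mul, q_one, one_mul]) (by simp only [u_mul, u_one, one_mul])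
    (by simp only [v_mul', u_one, v_one, tw_one, zero_mul, one_mul, zero_add])
  mul_one x := ext (by simp only [q_mul, q_one, mul_one]) (by simp only [u_mul, u_one, mul_one])
    (by simp only [v_mul', u_one, v_one, mul_one, mul_zero, add_zero])

instance : Algebra K (PathV χ) := Algebra.ofModule
  (fun r x y => by
    refine ext (smul_mul_assoc r (q x) (q y)) (smul_mul_assoc r (u x) (u y)) ?_
    rw [map_smul, v_mul', v_mul', map_smul, map_smul, map_smul, smul_add]
    exact congrArg₂ _ (smul_mul_assoc r (v x) (u y)) (smul_mul_assoc r (tw B.pgr 1 (u x)) (v y)))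
  (fun r x y => by
    refine ext (mul_smul_comm r (q x) (q y)) (mul_smul_comm r (u x) (u y)) ?_
    rw [map_smul, v_mul', v_mul', map_smul, map_smul, smul_add]
    exact congrArg₂ _ (mul_smul_comm r (v x) (u y)) (mul_smul_comm r (tw B.pgr 1 (u x)) (v y)))

variable (χ) in
/-- The grading of the path space. -/
def gr (i : ℤ) : Submodule K (PathV χ) where
  carrier := {x | q x ∈ Q.gr i ∧ u x ∈ B.pgr i ∧ v x ∈ B.pgr (i + 1)}
  add_mem' hx hy := ⟨add_mem hx.1 hy.1, add_mem hx.2.1 hy.2.1, add_mem hx.2.2 hy.2.2⟩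
  zero_mem' := ⟨(Q.gr i).zero_mem, (B.pgr i).zero_mem, (B.pgr (i + 1)).zero_mem⟩
  smul_mem' r _ hx := ⟨(Q.gr i).smul_mem r hx.1, (B.pgr i).smul_mem r hx.2.1,
    (B.pgr (i + 1)).smul_mem r hx.2.2⟩

lemma v_mul {i : ℤ} {x : PathV χ} (hx : x ∈ gr χ i) (y : PathV χ) :
    v (x * y) = v x * u y + sg K i • (u x * v y) := by
  rw [v_mul', tw_of_mem _ _ hx.2.1, one_mul, smul_mul_assoc]

lemma tmul_one_ev (b : B.B) : B.pevA 0 (1 ⊗ₜ b) = b := by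
  rw [pevA_tmul, eval_one, one_smul]

/-- The constant paths. -/
def const (a : Q.B) : PathV χ := mk a (1 ⊗ₜ χ.f a) 0 (tmul_one_ev _)

lemma tmul_X_ev (p : K[X]) (b : B.B) : B.pevA 0 ((X * p) ⊗ₜ b) = χ.f 0 := by
  rw [pevA_tmul, eval_mul, eval_X, zero_mul, zero_smul, map_zero]

/-- The paths without constant term. -/
def incU (k : ℕ) (b : B.B) : PathV χ := mk 0 ((X * X ^ k) ⊗ₜ b) 0 (tmul_X_ev _ b)

variable (χ) in
/-- The paths given by one-forms. -/
def incV : B.PV →ₗ[K] PathV χ := codRestrict _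
    ((0 : B.PV →ₗ[K] Q.B).prod ((0 : B.PV →ₗ[K] B.PV).prod lid)) fun x => by simp

@[simp] lemma q_incV (c : B.PV) : q (incV χ c) = 0 := rfl
@[simp] lemma u_incV (c : B.PV) : u (incV χ c) = 0 := rfl
@[simp] lemma v_incV (c : B.PV) : v (incV χ c) = c := rfl

lemma const_mem {i : ℤ} {a : Q.B} (ha : a ∈ Q.gr i) : const a ∈ gr χ i :=
  ⟨ha, tmul_mem_pgr 1 (χ.mem ha), (B.pgr _).zero_mem⟩

lemma incU_mem (k : ℕ) {i : ℤ} {b : B.B} (hb : b ∈ B.gr i) : incU k b ∈ gr χ i :=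
  ⟨(Q.gr i).zero_mem, tmul_mem_pgr _ hb, (B.pgr _).zero_mem⟩

lemma incV_mem {i : ℤ} {c : B.PV} (hc : c ∈ B.pgr i) : incV χ c ∈ gr χ (i - 1) :=
  ⟨(Q.gr _).zero_mem, (B.pgr _).zero_mem, by rw [sub_add_cancel]; exact hc⟩

lemma pv_induction {P : B.PV → Prop} (h0 : P 0) (hadd : ∀ x y, P x → P y → P (x + y))
    (h : ∀ k i, ∀ b ∈ B.gr i, P ((X ^ k) ⊗ₜ b)) (x : B.PV) : P x := by
  induction x using induction_on with
  | zero => exact h0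
  | add x y hx hy => exact hadd x y hx hy
  | tmul p b =>
    induction b using inductionOn B.gr with
    | zero => rw [tmul_zero]; exact h0
    | add x y hx hy => rw [tmul_add]; exact hadd _ _ hx hy
    | @homogeneous j b =>
      induction p using Polynomial.induction_on' with
      | add p p' h1 h2 => rw [add_tmul]; exact hadd _ _ h1 h2
      | monomial k a =>
        rw [← C_mul_X_pow_eq_monomial, ← smul_eq_C_mul, TensorProduct.smul_tmul]
        exact h k j _ (smul_mem _ _ b.2)

lemma induction {P : PathV χ → Prop} (hadd : ∀ x y, P x → P y → P (x + y))
    (h1 : ∀ i, ∀ a ∈ Q.gr i, P (const a)) (h2 : ∀ k i, ∀ b ∈ B.gr i, P (incU k b))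
    (h3 : ∀ k i, ∀ b ∈ B.gr i, P (incV χ ((X ^ k) ⊗ₜ b))) (x : PathV χ) : P x := by
  have h0 : P 0 := by
    have := h3 0 0 0 (zero_mem _)
    rwa [tmul_zero, map_zero] at this
  have e : x = const (q x) + (mk 0 (u x - 1 ⊗ₜ B.pevA 0 (u x)) 0
      (by rw [map_sub, tmul_one_ev, sub_self, map_zero]) + incV χ (v x)) :=
    ext (by simp [const]) (by simp [const, ev]) (by simp [const])
  rw [e]
  refine hadd _ _ ?_ (hadd _ _ ?_ ?_)
  · induction q x using inductionOn Q.gr with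
    | zero =>
      have : const (χ := χ) 0 = 0 := ext rfl (by rw [const, u_mk, map_zero, map_zero,
        tmul_zero]) rfl
      rw [this]; exact h0
    | add a b ha hb =>
      have : const (a + b) = const (χ := χ) a + const b :=
        ext (by simp [const]) (by simp [const, tmul_add]) (by simp [const])
      rw [this]; exact hadd _ _ ha hb
    | homogeneous a => exact h1 _ a a.2
  · have key : ∀ c : B.PV, P (mk 0 (c - 1 ⊗ₜ B.pevA 0 c) 0
        (by rw [map_sub, tmul_one_ev, sub_self, map_zero])) := by
      intro c
      induction c using pv_induction with
      | h0 =>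
        convert h0 using 1
        exact ext rfl (by simp) rfl
      | hadd c c' hc hc' =>
        have := hadd _ _ hc hc'
        convert this using 1
        exact ext (by simp) (by simp [tmul_add]; abel) (by simp)
      | h k i b hb =>
        cases k with
        | zero =>
          convert h0 using 1
          refine ext rfl ?_ rfl
          rw [u_mk, pow_zero, tmul_one_ev, sub_self]; rfl
        | succ k =>
          convert h2 k i b hb using 1
          refine ext rfl ?_ rfl
          rw [u_mk, pevA_tmul, eval_pow, eval_X, zero_pow (Nat.succ_ne_zero k), zero_smul,
            tmul_zero, sub_zero, pow_succ']
          rfl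
    exact key _
  · induction v x using pv_induction with
    | h0 => rw [map_zero]; exact h0
    | hadd c c' hc hc' => rw [map_add]; exact hadd _ _ hc hc'
    | h k i b hb => exact h3 k i b hb

variable (χ) in
/-- The projections of the path space. -/
def proj (i : ℤ) : PathV χ →ₗ[K] PathV χ := codRestrict _
  ((gproj Q.gr i ∘ₗ q).prod ((gproj B.pgr i ∘ₗ u).prod (gproj B.pgr (i + 1) ∘ₗ v))) fun x => by
    have h1 : ∀ c : B.PV, B.pevA 0 (gproj B.pgr i c) = gproj B.gr i (B.pevA 0 c) := by
      have : (B.pevA 0).toLinearMap ∘ₗ gproj B.pgr i = gproj B.gr i ∘ₗ (B.pevA 0).toLinearMap := by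
        refine ghom_ext (gr := B.pgr) fun j c hc => ?_
        simp only [comp_apply, toLinearMap_apply]
        by_cases h : i = j
        · subst h; rw [gproj_same _ hc, gproj_same _ (pevA_mem 0 hc)]
        · rw [gproj_ne _ h hc, gproj_ne _ h (pevA_mem 0 hc), map_zero]
      exact lcongr_fun this
    have h2 : ∀ a : Q.B, χ.f (gproj Q.gr i a) = gproj B.gr i (χ.f a) := by
      have : χ.f.toLinearMap ∘ₗ gproj Q.gr i = gproj B.gr i ∘ₗ χ.f.toLinearMap := by
        refine ghom_ext (gr := Q.gr) fun j c hc => ?_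
        simp only [comp_apply, toLinearMap_apply]
        by_cases h : i = j
        · subst h; rw [gproj_same _ hc, gproj_same _ (χ.mem hc)]
        · rw [gproj_ne _ h hc, gproj_ne _ h (χ.mem hc), map_zero]
      exact lcongr_fun this
    exact (h1 _).trans ((congrArg _ (ev x)).trans (h2 _).symm)

instance : Decomposition (gr χ) := decompositionOfProj (gr χ) (proj χ)
  (fun i x hx => ext (gproj_same _ hx.1) (gproj_same _ hx.2.1) (gproj_same _ hx.2.2))
  (fun i j h x hx => ext (gproj_ne _ h hx.1) (gproj_ne _ h hx.2.1)
    (gproj_ne _ (fun e => h (by omega)) hx.2.2))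
  (fun x => by
    induction x using induction with
    | hadd x y hx hy => exact add_mem hx hy
    | h1 i a ha => exact mem_iSup_of_mem i (const_mem ha)
    | h2 k i b hb => exact mem_iSup_of_mem i (incU_mem k hb)
    | h3 k i b hb => exact mem_iSup_of_mem (i - 1) (incV_mem (tmul_mem_pgr _ hb)))

lemma mul_mem {i j : ℤ} {x y : PathV χ} (hx : x ∈ gr χ i) (hy : y ∈ gr χ j) :
    x * y ∈ gr χ (i + j) := by
  refine ⟨gmul_mem hx.1 hy.1, pmul_mem hx.2.1 hy.2.1, ?_⟩
  rw [v_mul hx]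
  refine add_mem ?_ (smul_mem _ _ ?_)
  · rw [add_right_comm]; exact pmul_mem hx.2.2 hy.2.1
  · rw [add_assoc]; exact pmul_mem hx.2.1 hy.2.2

instance : GradedAlgebra (gr χ) where
  one_mem := ⟨gone_mem, gone_mem, zero_mem _⟩
  mul_mem _ _ _ _ hx hy := mul_mem hx hy

variable (χ) in
/-- The differential of the path space. -/
def d : PathV χ →ₗ[K] PathV χ := codRestrict _
  ((Q.d ∘ₗ q).prod ((B.pd ∘ₗ u).prod (B.pder ∘ₗ u - B.pd ∘ₗ v)))
  fun x => (pevA_d 0 (u x)).trans ((congrArg B.d (ev x)).trans (χ.d _).symm)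

lemma q_d (x : PathV χ) : q (d χ x) = Q.d (q x) := rfl
lemma u_d (x : PathV χ) : u (d χ x) = B.pd (u x) := rfl
lemma v_d (x : PathV χ) : v (d χ x) = B.pder (u x) - B.pd (v x) := rfl

variable (χ) in
/-- The bracket of the path space. -/
def br : PathV χ →ₗ[K] PathV χ →ₗ[K] PathV χ := mk₂ K
  (fun x y => mk (Q.br (q x) (q y)) (B.pbr (u x) (u y))
    (sg K N • (B.pbr (v x) (u y) + B.pbr (tw B.pgr 1 (u x)) (v y)))
    (by rw [pevA_br, ev, ev, χ.br]))
  (fun x x' y => ext (by simp) (by simp) (by simp; module))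
  (fun c x y => ext (by simp) (by simp) (by simp; module))
  (fun x y y' => ext (by simp) (by simp) (by simp; module))
  (fun c x y => ext (by simp) (by simp) (by simp; module))

lemma u_br (x y : PathV χ) : u (br χ x y) = B.pbr (u x) (u y) := rfl
lemma v_br {i : ℤ} {x : PathV χ} (hx : x ∈ gr χ i) (y : PathV χ) :
    v (br χ x y) = sg K N • (B.pbr (v x) (u y) + sg K i • B.pbr (u x) (v y)) := by
  change sg K N • (B.pbr (v x) (u y) + B.pbr (tw B.pgr 1 (u x)) (v y)) = _
  rw [tw_of_mem _ _ hx.2.1, one_mul, map_smul, lsmul_apply]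

lemma d_mem {i : ℤ} {x : PathV χ} (hx : x ∈ gr χ i) : d χ x ∈ gr χ (i - 1) := by
  refine ⟨Q.d_mem hx.1, pd_mem hx.2.1, ?_⟩
  rw [v_d, sub_add_cancel]
  have := pd_mem hx.2.2
  rw [add_sub_cancel_right] at this
  exact sub_mem (pder_mem hx.2.1) this

lemma br_mem {i j : ℤ} {x y : PathV χ} (hx : x ∈ gr χ i) (hy : y ∈ gr χ j) :
    br χ x y ∈ gr χ (i + j + N) := by
  refine ⟨Q.br_mem hx.1 hy.1, pbr_mem hx.2.1 hy.2.1, ?_⟩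
  rw [v_br hx]
  have h1 := pbr_mem hx.2.2 hy.2.1
  have h2 := pbr_mem hx.2.1 hy.2.2
  rw [show i + 1 + j + N = i + j + N + 1 by ring] at h1
  rw [show i + (j + 1) + N = i + j + N + 1 by ring] at h2
  exact smul_mem _ _ (add_mem h1 (smul_mem _ _ h2))

end PathV

open PathV

set_option maxHeartbeats 1600000 in
/-- The path space of a morphism, as a Poisson algebra. -/
def path : PoisAlg K N where
  B := PathV χ
  gr := PathV.gr χ
  d := PathV.d χ
  br := PathV.br χ
  d_mem := PathV.d_mem
  d_d x := ext (Q.d_d _) (pd_pd _) (by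
    change v (PathV.d χ (PathV.d χ x)) = 0
    rw [v_d, u_d, v_d, map_sub, pd_pd, pder_pd, sub_zero, sub_self])
  mul_comm {i j} {x y : PathV χ} (hx : x ∈ PathV.gr χ i) (hy : y ∈ PathV.gr χ j) := by
    refine ext ?_ ?_ ?_
    · rw [map_smul]; exact Q.mul_comm hx.1 hy.1
    · rw [map_smul]; exact pmul_comm hx.2.1 hy.2.1
    · rw [map_smul, v_mul hx, v_mul hy, pmul_comm hx.2.2 hy.2.1, pmul_comm hx.2.1 hy.2.2]
      by_cases hi : Even i <;> by_cases hj : Even j <;>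
        simp [sg, -int_not_even, ← int_not_even, Int.even_add, Int.even_mul,
          hi, hj] <;> module
  d_mul {i j} {x y : PathV χ} (hx : x ∈ PathV.gr χ i) (hy : y ∈ PathV.gr χ j) := by
    refine ext ?_ ?_ ?_
    · rw [map_add, map_smul]; exact Q.d_mul hx.1 hy.1
    · rw [map_add, map_smul]; exact pd_mul hx.2.1 hy.2.1
    · rw [map_add, map_smul, v_d, v_mul hx, v_mul hx, v_mul (PathV.d_mem hx), u_mul, pder_mul, v_d, v_d,
        u_d, u_d, map_add, map_smul, pd_mul hx.2.2 hy.2.1, pd_mul hx.2.1 hy.2.2]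
      simp only [sub_mul, mul_sub]
      by_cases hi : Even i <;>
        simp [sg, -int_not_even, ← int_not_even, Int.even_add, Int.even_sub,
          hi] <;> module
  br_mem := PathV.br_mem
  br_symm {i j} {x y : PathV χ} (hx : x ∈ PathV.gr χ i) (hy : y ∈ PathV.gr χ j) := by
    refine ext ?_ ?_ ?_
    · rw [map_smul]; exact Q.br_symm hx.1 hy.1
    · rw [map_smul]; exact pbr_symm hx.2.1 hy.2.1
    · rw [map_smul, v_br hx, v_br hy, pbr_symm hx.2.2 hy.2.1, pbr_symm hx.2.1 hy.2.2]
      by_cases hi : Even i <;> by_cases hj : Even j <;> by_cases hN : Even N <;>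
        simp [sg, -int_not_even, ← int_not_even, Int.even_add, Int.even_mul,
          hi, hj, hN] <;> module
  d_br {i j} {x y : PathV χ} (hx : x ∈ PathV.gr χ i) (hy : y ∈ PathV.gr χ j) := by
    refine ext ?_ ?_ ?_
    · rw [map_smul, map_add, map_smul]; exact Q.d_br hx.1 hy.1
    · rw [map_smul, map_add, map_smul]; exact pd_br hx.2.1 hy.2.1
    · rw [map_smul, map_add, map_smul, v_d, v_br hx, v_br hx, v_br (PathV.d_mem hx), u_br, pder_br, v_d,
        v_d, u_d, u_d, map_smul, map_add, map_smul, pd_br hx.2.2 hy.2.1, pd_br hx.2.1 hy.2.2]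
      simp only [map_sub, LinearMap.sub_apply]
      by_cases hi : Even i <;> by_cases hN : Even N <;>
        simp [sg, -int_not_even, ← int_not_even, Int.even_add, Int.even_sub,
          hi, hN] <;> module
  leibniz {i j k} {x y z : PathV χ} (hx : x ∈ PathV.gr χ i)
      (hy : y ∈ PathV.gr χ j) (hz : z ∈ PathV.gr χ k) := by
    refine ext ?_ ?_ ?_
    · rw [map_add, map_smul]; exact Q.leibniz hx.1 hy.1 hz.1
    · rw [map_add, map_smul]; exact pleibniz hx.2.1 hy.2.1 hz.2.1
    · rw [map_add, map_smul, v_br hx, v_mul hy, v_mul (PathV.br_mem hx hy), v_mul hy, v_br hx, v_br hx,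
        u_mul, u_br, u_br, map_add, map_smul, pleibniz hx.2.2 hy.2.1 hz.2.1,
        pleibniz hx.2.1 hy.2.2 hz.2.1, pleibniz hx.2.1 hy.2.1 hz.2.2]
      simp only [add_mul, mul_add, smul_add, smul_mul_assoc, mul_smul_comm, smul_smul]
      generalize B.pbr (v x) (u y) * u z = a₁, u y * B.pbr (v x) (u z) = a₂,
        B.pbr (u x) (v y) * u z = a₃, v y * B.pbr (u x) (u z) = a₄,
        B.pbr (u x) (u y) * v z = a₅, u y * B.pbr (u x) (v z) = a₆
      by_cases hi : Even i <;> by_cases hj : Even j <;> by_cases hN : Even N <;>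
        simp [sg, -int_not_even, ← int_not_even, Int.even_add, Int.even_mul,
          hi, hj, hN] <;> module
  jacobi {i j k} {x y z : PathV χ} (hx : x ∈ PathV.gr χ i)
      (hy : y ∈ PathV.gr χ j) (hz : z ∈ PathV.gr χ k) := by
    refine ext ?_ ?_ ?_
    · rw [map_add, map_smul, map_smul]; exact Q.jacobi hx.1 hy.1 hz.1
    · rw [map_add, map_smul, map_smul]; exact pjacobi hx.2.1 hy.2.1 hz.2.1
    · rw [map_add, map_smul, map_smul, v_br hx, v_br hy, v_br (PathV.br_mem hx hy), v_br hy, v_br hx,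
        v_br hx, u_br, u_br, u_br, map_smul, map_add, map_smul, pjacobi hx.2.2 hy.2.1 hz.2.1,
        pjacobi hx.2.1 hy.2.2 hz.2.1, pjacobi hx.2.1 hy.2.1 hz.2.2]
      simp only [map_add, map_smul, ladd_apply, lsmul_apply, smul_add, smul_smul]
      generalize B.pbr (B.pbr (v x) (u y)) (u z) = a₁, B.pbr (u y) (B.pbr (v x) (u z)) = a₂,
        B.pbr (B.pbr (u x) (v y)) (u z) = a₃, B.pbr (v y) (B.pbr (u x) (u z)) = a₄,
        B.pbr (B.pbr (u x) (u y)) (v z) = a₅, B.pbr (u y) (B.pbr (u x) (v z)) = a₆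
      by_cases hi : Even i <;> by_cases hj : Even j <;> by_cases hN : Even N <;>
        simp [sg, -int_not_even, ← int_not_even, Int.even_add, Int.even_mul,
          hi, hj, hN] <;> module

end PoisAlg

section Theta

variable {K : Type u} [Field K] {n : ℕ} {A : PDCDGA K n}

namespace PoisAlg

/-- The derivations of degree `p` of a Poisson algebra. -/
structure PoisDer {N : ℤ} (B : PoisAlg K N) (p : ℤ) (θ : B.B →ₗ[K] B.B) : Prop
    extends IsDer B.gr p θ where
  br : ∀ {i j x y}, x ∈ B.gr i → y ∈ B.gr j →
    θ (B.br x y) = sg K (p * N) • (B.br (θ x) y + sg K (p * i) • B.br x (θ y))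

namespace PoisDer

variable {N p : ℤ} {B : PoisAlg K N} {θ : B.B →ₗ[K] B.B} (h : PoisDer B p θ)

include h

lemma mul' (x y : B.B) : θ (x * y) = θ x * y + tw B.gr p x * θ y := by
  have e : (LinearMap.mul K B.B).compr₂ θ =
      LinearMap.mul K B.B ∘ₗ θ + (LinearMap.mul K B.B ∘ₗ tw B.gr p).compl₂ θ := by
    refine ghom_ext (gr := B.gr) fun i x hx => ghom_ext (gr := B.gr) fun j y hy => ?_
    change θ (x * y) = θ x * y + tw B.gr p x * θ y
    rw [tw_of_mem _ _ hx, h.mul hx hy, smul_mul_assoc]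
  exact lcongr_fun₂ e x y

lemma br' (x y : B.B) : θ (B.br x y) = sg K (p * N) • (B.br (θ x) y + B.br (tw B.gr p x) (θ y)) := by
  have e : B.br.compr₂ θ = sg K (p * N) • (B.br ∘ₗ θ + (B.br ∘ₗ tw B.gr p).compl₂ θ) := by
    refine ghom_ext (gr := B.gr) fun i x hx => ghom_ext (gr := B.gr) fun j y hy => ?_
    change θ (B.br x y) = sg K (p * N) • (B.br (θ x) y + B.br (tw B.gr p x) (θ y))
    rw [tw_of_mem _ _ hx, h.br hx hy, map_smul, lsmul_apply]
  exact lcongr_fun₂ e x y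

lemma one : θ 1 = 0 := by
  have e := h.mul' 1 1
  rw [mul_one, mul_one, tw_one, one_mul] at e
  exact left_eq_add.mp e

omit h in
lemma commutator (h : PoisDer B 1 θ) : PoisDer B 0 (B.d ∘ₗ θ + θ ∘ₗ B.d) where
  mem {i x} hx := by
    have h1 := B.d_mem (h.mem hx)
    have h2 := h.mem (B.d_mem hx)
    rw [add_sub_cancel_right] at h1
    rw [sub_add_cancel] at h2
    rw [add_zero]
    exact add_mem h1 h2
  mul {i j x y} hx hy := by
    simp only [ladd_apply, comp_apply, h.mul hx hy, B.d_mul hx hy, map_add,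
      map_smul, h.mul (B.d_mem hx) hy, h.mul hx (B.d_mem hy), B.d_mul (h.mem hx) hy,
      B.d_mul hx (h.mem hy), add_mul, mul_add]
    by_cases hi : Even i <;> simp [sg, -int_not_even, ← int_not_even, Int.even_add,
      Int.even_sub, hi] <;> module
  br {i j x y} hx hy := by
    simp only [ladd_apply, comp_apply, h.br hx hy, B.d_br hx hy, map_add,
      map_smul, h.br (B.d_mem hx) hy, h.br hx (B.d_mem hy), B.d_br (h.mem hx) hy,
      B.d_br hx (h.mem hy)]
    by_cases hi : Even i <;> by_cases hN : Even N <;> simp [sg, -int_not_even,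
      ← int_not_even, Int.even_add, Int.even_sub, hi, hN] <;> module

end PoisDer

end PoisAlg

section TP

variable {N : ℤ} {B : PoisAlg K N} (p : ℤ) (θ : B.B →ₗ[K] B.B)

/-- The action of a derivation on the tensor powers. -/
def tpTh (k : ℕ) : TPow B k →ₗ[K] TPow B k := ∑ j, slotOp k (tw B.gr p) θ j

lemma tpTh_tcons (k : ℕ) (b : B.B) (t : TPow B k) : tpTh p θ (k + 1) (tcons k b t) =
    tcons k (θ b) t + tcons k (tw B.gr p b) (tpTh p θ k t) := by
  rw [tpTh, lmsum_apply, Fin.sum_univ_succ, slotOp_zero]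
  simp only [tpTh, lmsum_apply, slotOp_succ, map_sum]

lemma tpTh_comm (hθ : ∀ {i x}, x ∈ B.gr i → θ x ∈ B.gr (i + 1)) (k : ℕ) (t : TPow B k) :
    tpD B k (tpTh 1 θ k t) + tpTh 1 θ k (tpD B k t) =
      tpTh 0 (B.d ∘ₗ θ + θ ∘ₗ B.d) k t := by
  have e : tw B.gr 1 ∘ₗ θ = -(θ ∘ₗ tw B.gr 1) := by
    refine ghom_ext (gr := B.gr) fun i a ha => ?_
    simp only [comp_apply, lneg_apply]
    rw [tw_of_mem _ _ ha, tw_of_mem _ _ (hθ ha), map_smul, mul_add, sg_add,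
      sg_odd (K := K) (i := 1 * 1) (by decide)]
    module
  change tpTh 1 B.d k _ + tpTh 1 θ k (tpTh 1 B.d k t) = _
  induction k with
  | zero => simp [tpTh]
  | succ k ih =>
    induction t using tcons_induction with
    | hadd x y hx hy => simp only [map_add, ← hx, ← hy]; abel
    | h b t =>
      have e' : tw B.gr 1 (θ b) = -θ (tw B.gr 1 b) := lcongr_fun e b
      simp only [tpTh_tcons, map_add, ← ih, tw_tw, tw_zero, ladd_apply, e',
        comp_apply, d_tw, map_neg, lneg_apply]
      abel

end TP

variable {B : PoisAlg K (n - 1)}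

variable (A) in
/-- The action of a derivation on the relative composition product. -/
def thV (p : ℤ) (θ : B.B →ₗ[K] B.B) : CircV A B →ₗ[K] CircV A B :=
  DirectSum.lmap fun k => tmap (tw (lgr A (Fin k)) p).dualMap (tpTh p θ k)

lemma thV_cin (p : ℤ) (θ : B.B →ₗ[K] B.B) (k : ℕ) (f : LSDual A k) (t : TPow B k) :
    thV A p θ (cin A B k (f ⊗ₜ t)) =
      cin A B k ((tw (lgr A (Fin k)) p).dualMap f ⊗ₜ tpTh p θ k t) := DirectSum.lmap_lof _ _ _

lemma c0_tw (k : ℕ) (p : ℤ) (z : LS A (Fin (k + 2))) :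
    c0 A k (tw (lgr A (Fin (k + 2))) p z) = tw (lgr A (Fin (k + 1))) p (c0 A k z) := by
  have h : (c0 A k).toLinearMap ∘ₗ tw (lgr A (Fin (k + 2))) p =
      tw (lgr A (Fin (k + 1))) p ∘ₗ (c0 A k).toLinearMap := by
    refine ghom_ext (gr := lgr A (Fin (k + 2))) fun i a ha => ?_
    simp only [comp_apply, toLinearMap_apply]
    rw [tw_of_mem (lgr A (Fin (k + 2))) p ha, map_smul]
    exact (tw_of_mem (lgr A (Fin (k + 1))) p (lsMap_mem A (collapse k) _ _ ha)).symm
  exact lcongr_fun h z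

lemma thV_rel {p : ℤ} {θ : B.B →ₗ[K] B.B} (h : B.PoisDer p θ) {W : Type u} [AddCommGroup W]
    [Module K W] {P : CircV A B →ₗ[K] W} (hP : ∀ t, CircRel A B t → P t = 0) {t : CircV A B}
    (ht : CircRel A B t) : P (thV A p θ t) = 0 := by
  cases ht with
  | swap k i f b q hb =>
    have e : circTmul A B (k + 1) (actSwap A k i f) b - sg K (q i.castSucc * q i.succ) •
        circTmul A B (k + 1) f (b ∘ eswap i.castSucc i.succ) =
        cin A B _ (actSwap A k i f ⊗ₜ ptprod K b) -
          cin A B _ (f ⊗ₜ tswap B k i (ptprod K b)) := by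
      rw [tswap_tprod B k i b q hb, tmul_smul, map_smul]; rfl
    have e1 : (tw (lgr A (Fin (k + 1))) p).dualMap (actSwap A k i f) =
        actSwap A k i ((tw (lgr A (Fin (k + 1))) p).dualMap f) :=
      lext fun z => congrArg f (push_tw _ _ _ z)
    have e2 : ∀ t, tswap B k i (tpTh p θ (k + 1) t) = tpTh p θ (k + 1) (tswap B k i t) := by
      intro t
      simp only [tpTh, lmsum_apply, map_sum, tswap_slotOp k i (fun hx => h.mem hx)]
      exact Equiv.sum_comp (eswap i.castSucc i.succ)
        fun j => slotOp (k + 1) (tw B.gr p) θ j (tswap B k i t)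
    rw [e, map_sub, map_sub, thV_cin, thV_cin, e1, rel_swap hP, e2, sub_self]
  | unit k f b =>
    have e1 : (tw (lgr A (Fin k)) p).dualMap (actUnit A k f) =
        actUnit A k ((tw (lgr A (Fin (k + 1))) p).dualMap f) :=
      lext fun z => congrArg f (push_tw _ _ _ z)
    rw [circTmul, circTmul, ← tcons_tprod, map_sub, map_sub, thV_cin, thV_cin, e1, rel_unit hP,
      tpTh_tcons, h.one, tw_one, map_zero, lzero_apply, zero_add, sub_self]
  | mul k f x y b =>
    have e1 : (tw (lgr A (Fin (k + 2))) p).dualMap (actMul A k f) =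
        actMul A k ((tw (lgr A (Fin (k + 1))) p).dualMap f) :=
      lext fun z => (actMul_apply k f _).trans ((congrArg f (c0_tw k p z)).trans
        (actMul_apply k ((tw (lgr A (Fin (k + 1))) p).dualMap f) z).symm)
    rw [circTmul, circTmul, ← tcons_tprod, ← tcons_tprod, ← tcons_tprod, map_sub, map_sub, thV_cin,
      thV_cin, e1, tpTh_tcons, tpTh_tcons, tpTh_tcons, h.mul', tw_mul]
    simp only [map_add, ladd_apply, tmul_add, rel_mul hP]
    abel
  | br k f x y b =>
    have e1 : (tw (lgr A (Fin (k + 2))) p).dualMap (actBr A k f) =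
        sg K (p * (n - 1)) • actBr A k ((tw (lgr A (Fin (k + 1))) p).dualMap f) :=
      lext fun z => (congrArg (fun w => f (tw _ (n - 1) w)) (c1_tw A k p z)).trans (by
        rw [map_smul, map_smul, tw_comm_tw]; rfl)
    have e2 : tw B.gr p (B.br x y) = sg K (p * (n - 1)) • B.br (tw B.gr p x) (tw B.gr p y) := by
      have e : B.br.compr₂ (tw B.gr p) =
          sg K (p * (n - 1)) • (B.br ∘ₗ tw B.gr p).compl₂ (tw B.gr p) := by
        refine ghom_ext (gr := B.gr) fun i x hx => ghom_ext (gr := B.gr) fun j y hy => ?_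
        change tw B.gr p (B.br x y) = sg K (p * (n - 1)) • B.br (tw B.gr p x) (tw B.gr p y)
        rw [tw_of_mem _ _ hx, tw_of_mem _ _ hy, tw_of_mem _ _ (B.br_mem hx hy), map_smul, map_smul,
          lsmul_apply, smul_smul, smul_smul, ← sg_add, ← sg_add]
        exact congrArg (· • _) (sg_congr ⟨p * (i + j + n - 1), by ring⟩)
      exact lcongr_fun₂ e x y
    rw [circTmul, circTmul, ← tcons_tprod, ← tcons_tprod, ← tcons_tprod, map_sub, map_sub, thV_cin,
      thV_cin, e1, tpTh_tcons, tpTh_tcons, tpTh_tcons, h.br', e2]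
    simp only [map_add, map_smul, ladd_apply, lsmul_apply, tmul_add,
      tmul_smul, ← smul_tmul', smul_add, rel_br hP]
    abel

lemma thV_comm {θ : B.B →ₗ[K] B.B} (hθ : B.PoisDer 1 θ) (t : CircV A B) :
    circDV A B (thV A 1 θ t) + thV A 1 θ (circDV A B t) =
      thV A 0 (B.d ∘ₗ θ + θ ∘ₗ B.d) t := by
  have h : circDV A B ∘ₗ thV A 1 θ + thV A 1 θ ∘ₗ circDV A B =
      thV A 0 (B.d ∘ₗ θ + θ ∘ₗ B.d) := by
    apply linearMap_ext
    intro k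
    apply ext'
    intro f t
    change circDV A B (thV A 1 θ (cin A B k (f ⊗ₜ t))) + thV A 1 θ (circDV A B (cin A B k (f ⊗ₜ t)))
      = thV A 0 _ (cin A B k (f ⊗ₜ t))
    have e : (tw (lgr A (Fin k)) 0).dualMap f = f := lext fun z => congrArg f (tw_zero _ z)
    rw [circDV_cin, circDk_tmul, thV_cin, map_add, map_add, circDV_cin, circDk_tmul, thV_cin,
      thV_cin, thV_cin, e, ← tpTh_comm θ (fun hx => hθ.mem hx), tmul_add, map_add]
    change cin A B k (dualD A k (dualS A k f) ⊗ₜ _) + cin A B k (dualS A k (dualS A k f) ⊗ₜ _) +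
      (cin A B k (dualS A k (dualD A k f) ⊗ₜ _) + cin A B k (dualS A k (dualS A k f) ⊗ₜ _)) = _
    rw [dualS_dualS, dualD_dualS, TensorProduct.neg_tmul, map_neg (cin A B k), map_add]
    abel
  exact lcongr_fun h t

end Theta

section Weights

variable {K : Type u} [Field K]

open Cpx.Hom in
lemma Cpx.Hom.isQuasiIso_of_eigen [CharZero K] {C D : Cpx K} (p : Hom C D) (s : D.V →ₗ[K] C.V)
    (H : C.V →ₗ[K] C.V) (hs : ∀ i, ∀ y ∈ D.gr i, s y ∈ C.gr i) (hps : ∀ y, p.f (s y) = y)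
    (hH : ∀ i, ∀ x ∈ C.gr i, H x ∈ C.gr (i + 1)) (hpH : ∀ x, p.f (H x) = 0)
    (hw : ∀ x, x ∈ span K {x | ∃ w : ℕ, lap H x = (w : K) • x ∧
      (w = 0 → s (p.f x) = x) ∧ (w ≠ 0 → p.f x = 0)}) : p.IsQuasiIso := by
  refine isQuasiIso_of_weights p s H hs hps hH hpH (fun m => if m = 0 then ⊥ else ⊤) rfl
    (fun a b h => ?_) (fun x => ⟨1, Submodule.mem_top⟩) fun m x _ => ?_
  · by_cases ha : a = 0
    · simp [ha]
    · simp [show b ≠ 0 by omega]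
  · refine Submodule.span_mono ?_ (hw x)
    rintro y ⟨w, h1, h2, h3⟩
    refine ⟨Submodule.mem_top, w, ?_, fun h => ?_, fun h => ?_⟩
    · rw [h1, sub_self]; exact zero_mem _
    · rw [h2 h, sub_self]; exact zero_mem _
    · rw [h3 h, map_zero]; exact zero_mem _

variable {n : ℕ} (A : PDCDGA K n)

/-- The identity of a Poisson algebra. -/
def PoisAlg.Hom.id {N : ℤ} (B : PoisAlg K N) : B.Hom B :=
  ⟨AlgHom.id K B.B, fun hx => hx, fun _ => rfl, fun _ _ => rfl⟩

/-- The composition of morphisms of Poisson algebras. -/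
def PoisAlg.Hom.comp {N : ℤ} {B C D : PoisAlg K N} (φ : C.Hom D) (ψ : B.Hom C) : B.Hom D :=
  ⟨φ.f.comp ψ.f, fun hx => φ.mem (ψ.mem hx), fun x => (congrArg φ.f (ψ.d x)).trans (φ.d _),
    fun x y => (congrArg φ.f (ψ.br x y)).trans (φ.br _ _)⟩

lemma circMap_comp_apply {B C D : PoisAlg K (n - 1)} (φ : C.Hom D) (ψ : B.Hom C) (ρ : B.Hom D)
    (h : ∀ x, φ.f (ψ.f x) = ρ.f x) (x : (circ A B).V) :
    (circMap A φ).f ((circMap A ψ).f x) = (circMap A ρ).f x := by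
  obtain ⟨t, rfl⟩ := (circSub A B).mkQ_surjective x
  have h : circMapV A φ ∘ₗ circMapV A ψ = circMapV A ρ := by
    refine linearMap_ext _ fun k => ext' fun f t => ?_
    change circMapV A φ (circMapV A ψ (cin A B k (f ⊗ₜ t))) = circMapV A ρ (cin A B k (f ⊗ₜ t))
    rw [circMapV_cin, circMapV_cin, circMapV_cin]
    induction t using tpow_hom_induction with
    | h p b hb => rw [tpMap_tprod, tpMap_tprod, tpMap_tprod]; simp only [h]
    | hadd x y hx hy => simp only [map_add, tmul_add, hx, hy]
    | hsmul c x hx => simp only [map_smul, tmul_smul, hx]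
  exact congrArg (circSub A D).mkQ (lcongr_fun h t)

lemma circMap_id {B : PoisAlg K (n - 1)} (x : (circ A B).V) :
    (circMap A (PoisAlg.Hom.id B)).f x = x := by
  obtain ⟨t, rfl⟩ := (circSub A B).mkQ_surjective x
  have h : circMapV A (PoisAlg.Hom.id B) = lid := by
    refine linearMap_ext _ fun k => ext' fun f t => ?_
    change circMapV A _ (cin A B k (f ⊗ₜ t)) = cin A B k (f ⊗ₜ t)
    rw [circMapV_cin, tpMap]
    exact congrArg (fun t => cin A B k (f ⊗ₜ t)) (lcongr_fun PiTensorProduct.map_id t)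
  exact congrArg (circSub A B).mkQ (lcongr_fun h t)

variable {P Q : PoisAlg K (n - 1)} {θ : P.B →ₗ[K] P.B}

/-- The operator on the relative composition product induced by a derivation of degree `1`. -/
def thC (hθ : P.PoisDer 1 θ) : (circ A P).V →ₗ[K] (circ A P).V :=
  (circSub A P).mapQ (circSub A P) (thV A 1 θ) (by
    have hP : ∀ t, CircRel A P t → (circSub A P).mkQ t = 0 := fun t ht =>
      (quot_mk_eq_zero _).mpr (mem_sup_left (subset_span ht))
    have h1 : span K {t | CircRel A P t} ≤ (circSub A P).comap (thV A 1 θ) :=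
      Submodule.span_le.mpr fun t ht =>
        Submodule.mem_comap.mpr ((quot_mk_eq_zero _).mp (thV_rel hθ hP ht))
    have h2 : span K {t | CircRel A P t} ≤
        (circSub A P).comap (thV A 0 (P.d ∘ₗ θ + θ ∘ₗ P.d)) :=
      Submodule.span_le.mpr fun t ht =>
        Submodule.mem_comap.mpr ((quot_mk_eq_zero _).mp (thV_rel hθ.commutator hP ht))
    refine sup_le h1 ?_
    rintro _ ⟨t, ht, rfl⟩
    rw [mem_comap, ← sub_eq_of_eq_add' (thV_comm hθ t).symm]
    exact sub_mem (h2 ht) (circSub_le A P (h1 ht)))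

lemma thV_mem (hθ : P.PoisDer 1 θ) {m : ℤ} {t : CircV A P} (ht : t ∈ circGr A P m) :
    thV A 1 θ t ∈ circGr A P (m + 1) := by
  refine map_mem_of_mem_span (fun x hx => ?_) ht
  obtain ⟨k, i, p, rfl, f, hf, b, hb, rfl⟩ := hx
  have e : (tw (lgr A (Fin k)) 1).dualMap f = sg K i • f := dualS_of_mem A k hf
  rw [circTmul, thV_cin, e, ← smul_tmul', map_smul, tpTh, lmsum_apply,
    TensorProduct.tmul_sum, map_sum]
  refine smul_mem _ _ (Submodule.sum_mem _ fun j _ => ?_)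
  rw [slotOp, map_tprod]
  refine subset_span ⟨k, i, Function.update p j (p j + 1), ?_, f, hf, _,
    fun l => ?_, rfl⟩
  · rw [Finset.sum_update_of_mem (mem_univ j), ← Finset.add_sum_erase _ p
      (mem_univ j), Finset.sdiff_singleton_eq_erase]
    ring
  · rcases lt_trichotomy l j with h | h | h
    · rw [Function.update_of_ne h.ne, if_pos h, tw_of_mem P.gr 1 (hb l)]
      exact smul_mem _ _ (hb l)
    · subst h
      rw [Function.update_self, if_neg (lt_irrefl l), if_pos rfl]
      exact hθ.mem (hb l)
    · rw [Function.update_of_ne h.ne', if_neg h.not_gt, if_neg h.ne']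
      exact hb l

/-- The eigenvectors of an operator, with the behaviour of a projection on them. -/
def eigen (pr : P.Hom Q) (c : Q.Hom P) (L : P.B →ₗ[K] P.B) (k : ℕ) : Set (TPow P k) :=
  {t | ∃ w : ℕ, tpTh 0 L k t = (w : K) • t ∧ (w = 0 → tpMap c k (tpMap pr k t) = t) ∧
    (w ≠ 0 → tpMap pr k t = 0)}

lemma mem_span_eigen {pr : P.Hom Q} {c : Q.Hom P} {L : P.B →ₗ[K] P.B}
    (hw : ∀ x, x ∈ span K {x | ∃ w : ℕ, L x = (w : K) • x ∧
      (w = 0 → c.f (pr.f x) = x) ∧ (w ≠ 0 → pr.f x = 0)}) (k : ℕ) (t : TPow P k) :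
    t ∈ span K (eigen pr c L k) := by
  induction k with
  | zero =>
    obtain ⟨a, rfl⟩ := tpow_zero t
    refine smul_mem _ _ (subset_span ⟨0, ?_, fun _ => ?_, fun h => (h rfl).elim⟩)
    · simp [tpTh]
    · rw [tpMap_tprod, tpMap_tprod]; exact congrArg _ (Subsingleton.elim _ _)
  | succ k ih =>
    induction t using tcons_induction with
    | hadd x y hx hy => exact add_mem hx hy
    | h b t =>
      refine span_induction (p := fun b _ => tcons k b t ∈ _) ?_ ?_ ?_ ?_ (hw b)
      · rintro b ⟨w, h1, h2, h3⟩
        refine span_induction (p := fun t _ => tcons k b t ∈ _) ?_ ?_ ?_ ?_ (ih t)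
        · rintro t ⟨w', k1, k2, k3⟩
          refine subset_span ⟨w + w', ?_, fun h => ?_, fun h => ?_⟩
          · rw [tpTh_tcons, h1, tw_zero, k1, map_smul, map_smul, lsmul_apply, Nat.cast_add,
              add_smul]
          · rw [tpMap_tcons, tpMap_tcons, h2 (by omega), k2 (by omega)]
          · rw [tpMap_tcons]
            by_cases h' : w = 0
            · rw [k3 (by omega), map_zero]
            · rw [h3 h', map_zero, lzero_apply]
        · rw [map_zero]; exact zero_mem _
        · intro x y _ _ hx hy; rw [map_add]; exact add_mem hx hy
        · intro a x _ hx; rw [map_smul]; exact smul_mem _ _ hx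
      · rw [map_zero, lzero_apply]; exact zero_mem _
      · intro x y _ _ hx hy; rw [map_add, ladd_apply]; exact add_mem hx hy
      · intro a x _ hx; rw [map_smul, lsmul_apply]; exact smul_mem _ _ hx

/-- The relative composition product preserves the homotopy equivalences given by derivations with
non-negative integral weights. -/
lemma circMap_isQuasiIso_of_eigen [CharZero K] (pr : P.Hom Q) (c : Q.Hom P)
    (hpc : ∀ x, pr.f (c.f x) = x) (hθ : P.PoisDer 1 θ) (hpθ : ∀ x, pr.f (θ x) = 0)
    (hw : ∀ x, x ∈ span K {x | ∃ w : ℕ, (P.d ∘ₗ θ + θ ∘ₗ P.d) x = (w : K) • x ∧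
      (w = 0 → c.f (pr.f x) = x) ∧ (w ≠ 0 → pr.f x = 0)}) : (circMap A pr).IsQuasiIso := by
  have hcirc : ∀ (R : Submodule K (circ A P).V), (∀ k f, ∀ t ∈ eigen pr c (P.d ∘ₗ θ + θ ∘ₗ P.d) k,
      (circSub A P).mkQ (cin A P k (f ⊗ₜ t)) ∈ R) → ∀ x, x ∈ R := by
    intro R hR x
    obtain ⟨t, rfl⟩ := (circSub A P).mkQ_surjective x
    induction t using DirectSum.induction_on with
    | zero => rw [map_zero]; exact zero_mem _
    | add x y hx hy => rw [map_add]; exact add_mem hx hy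
    | of k z =>
      change (circSub A P).mkQ (cin A P k z) ∈ R
      induction z using induction_on with
      | zero => rw [map_zero, map_zero]; exact zero_mem _
      | add x y hx hy => rw [map_add, map_add]; exact add_mem hx hy
      | tmul f t =>
        have h : span K (eigen pr c (P.d ∘ₗ θ + θ ∘ₗ P.d) k) ≤
            R.comap ((circSub A P).mkQ ∘ₗ cin A P k ∘ₗ TensorProduct.mk K _ _ f) :=
          Submodule.span_le.mpr fun t ht => hR k f t ht
        exact h (mem_span_eigen hw k t)
  have hpt : ∀ k t, tpMap pr k (tpTh 1 θ k t) = 0 := by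
    intro k
    induction k with
    | zero => intro t; simp [tpTh]
    | succ k ih =>
      intro t
      induction t using tcons_induction with
      | hadd x y hx hy => rw [map_add, map_add, hx, hy, add_zero]
      | h b t => rw [tpTh_tcons, map_add, tpMap_tcons, tpMap_tcons, hpθ, ih, map_zero, map_zero,
          lzero_apply, add_zero]
  refine Cpx.Hom.isQuasiIso_of_eigen _ (circMap A c).f (thC A hθ) (fun i y hy => (circMap A c).mem hy)
    (fun y => (circMap_comp_apply A pr c (.id Q) hpc y).trans (circMap_id A y)) ?_ (fun x => ?_)
    (hcirc _ ?_)
  · rintro i _ ⟨t, ht, rfl⟩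
    exact ⟨_, thV_mem A hθ ht, rfl⟩
  · obtain ⟨t, rfl⟩ := (circSub A P).mkQ_surjective x
    have h : circMapV A pr ∘ₗ thV A 1 θ = 0 := by
      refine linearMap_ext _ fun k => ext' fun f t => ?_
      change circMapV A pr (thV A 1 θ (cin A P k (f ⊗ₜ t))) = 0
      rw [thV_cin, circMapV_cin, hpt, tmul_zero, map_zero]
    exact congrArg (circSub A Q).mkQ (lcongr_fun h t)
  · rintro k f t ⟨w, h1, h2, h3⟩
    refine subset_span ⟨w, ?_, fun h => ?_, fun h => ?_⟩
    · refine (congrArg (circSub A P).mkQ (thV_comm hθ _)).trans ?_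
      have e : (tw (lgr A (Fin k)) 0).dualMap f = f :=
        lext fun z => congrArg f (tw_zero _ z)
      rw [thV_cin, h1, e, tmul_smul, map_smul, map_smul]; rfl
    · refine congrArg (circSub A P).mkQ ((congrArg _ (circMapV_cin A pr k f t)).trans
        ((circMapV_cin A c k f _).trans ?_))
      rw [h2 h]
    · refine (congrArg (circSub A Q).mkQ (circMapV_cin A pr k f t)).trans ?_
      rw [h3 h, tmul_zero, map_zero, map_zero]; rfl

end Weights

section PathHom

variable {K : Type u} [Field K]

open Polynomial

lemma Cpx.Hom.ext {C D : Cpx K} {f g : Hom C D} (h : ∀ x, f.f x = g.f x) : f = g := by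
  cases f; cases g
  obtain rfl := lext h
  rfl

lemma Cpx.Hom.IsQuasiIso.of_comp_right {C D E : Cpx K} {g : Hom D E} {f : Hom C D}
    (hf : f.IsQuasiIso) (h : (g.comp f).IsQuasiIso) : g.IsQuasiIso where
  surj i y hy hd := by
    obtain ⟨x, hx, dx, z, hz, e⟩ := h.surj i y hy hd
    exact ⟨f.f x, f.mem hx, by rw [← f.comm, dx, map_zero], z, hz, e⟩
  inj i x hx hd h' := by
    obtain ⟨z, hz, e⟩ := h'
    obtain ⟨y, hy, dy, w, hw, e'⟩ := hf.surj i x hx hd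
    obtain ⟨v, hv, e''⟩ := h.inj i y hy dy ⟨z + g.f w, add_mem hz (g.mem hw), by
      change g.f (f.f y) = _
      rw [e', map_add, e, g.comm, map_add]⟩
    refine ⟨f.f v - w, sub_mem (f.mem hv) hw, ?_⟩
    rw [map_sub, ← f.comm, ← e'', e', add_sub_cancel_right]

namespace PoisAlg

variable {N : ℤ} {Q B : PoisAlg K N} (χ : Hom Q B)

open PathV

/-- The projection of the path space to the domain. -/
def pathPr : Hom (path χ) Q where
  f := ofLinearMap (PathV.q (χ := χ)) rfl fun _ _ => rfl
  mem hx := hx.1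
  d _ := rfl
  br _ _ := rfl

/-- The inclusion of the constant paths, as a linear map. -/
def constL : Q.B →ₗ[K] PathV χ := codRestrict _ (LinearMap.id.prod
  ((TensorProduct.mk K K[X] B.B 1 ∘ₗ χ.f.toLinearMap).prod (0 : Q.B →ₗ[K] B.PV)))
  fun a => (const a : PathV χ).2

/-- The inclusion of the constant paths. -/
def pathConst : Hom Q (path χ) where
  f := ofLinearMap (constL χ)
    (PathV.ext rfl (congrArg (fun z => (1 : K[X]) ⊗ₜ[K] z) (map_one χ.f)) rfl)
    fun a b => PathV.ext rfl (by
      refine (congrArg (fun z => (1 : K[X]) ⊗ₜ[K] z) (map_mul χ.f a b)).trans ?_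
      rw [← mul_one (1 : K[X]), ← tmul_mul_tmul]; rfl)
      (by
        change (0 : B.PV) = 0 * _ + tw B.pgr 1 _ * 0
        rw [zero_mul, mul_zero, add_zero])
  mem hx := const_mem hx
  d a := PathV.ext rfl (congrArg (fun z => (1 : K[X]) ⊗ₜ[K] z) (χ.d a)) (by
    change (0 : B.PV) = B.pder (1 ⊗ₜ χ.f a) - B.pd 0
    rw [pder_tmul, derivative_one, zero_tmul, map_zero, sub_zero])
  br a b := PathV.ext rfl (by
      refine (congrArg (fun z => (1 : K[X]) ⊗ₜ[K] z) (χ.br a b)).trans ?_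
      conv_lhs => rw [← mul_one (1 : K[X])]
      rfl) (by
    change 0 = sg K N • (B.pbr 0 _ + B.pbr (tw B.pgr 1 _) 0)
    rw [map_zero, map_zero, lzero_apply, add_zero, smul_zero])

/-- The evaluation of paths at `1`. -/
def pathEv : Hom (path χ) B where
  f := (B.pevA 1).comp (ofLinearMap (PathV.u (χ := χ)) rfl fun _ _ => rfl)
  mem hx := pevA_mem 1 hx.2.1
  d x := pevA_d 1 (PathV.u x)
  br x y := pevA_br 1 (PathV.u x) (PathV.u y)

lemma pathEv_const (a : Q.B) : (pathEv χ).f ((pathConst χ).f a) = χ.f a := by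
  refine (pevA_tmul 1 1 (χ.f a)).trans ?_
  rw [eval_one, one_smul]

lemma pathEv_surjective : Surjective (pathEv χ).f := fun b =>
  ⟨(incU 0 b : PathV χ), (pevA_tmul 1 (X * X ^ 0) b).trans (by simp)⟩

/-- Multiplication by the variable. -/
def pX : B.PV →ₗ[K] B.PV := LinearMap.rTensor B.B (lmulLeft K X)

lemma pX_tmul (p : K[X]) (b : B.B) : pX (p ⊗ₜ b) = (X * p) ⊗ₜ b := rfl

lemma pX_eq (x : B.PV) : pX x = (X ⊗ₜ 1) * x := by
  induction x using induction_on with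
  | zero => rw [map_zero, mul_zero]
  | add x y hx hy => rw [map_add, mul_add, hx, hy]
  | tmul p b => rw [pX_tmul, tmul_mul_tmul, one_mul]

lemma pX_mem {i : ℤ} {x : B.PV} (hx : x ∈ B.pgr i) : pX x ∈ B.pgr i :=
  pgr_map (fun _ _ hb => tmul_mem_pgr _ hb) hx

lemma pX_comm (x : B.PV) : x * (X ⊗ₜ 1) = (X ⊗ₜ 1) * x := by
  induction x using induction_on with
  | zero => rw [mul_zero, zero_mul]
  | add x y hx hy => rw [add_mul, mul_add, hx, hy]
  | tmul p b => rw [tmul_mul_tmul, tmul_mul_tmul,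
      one_mul, mul_one, _root_.mul_comm p X]

lemma pbr_pX (x y : B.PV) : B.pbr (pX x) y = pX (B.pbr x y) ∧ B.pbr x (pX y) = pX (B.pbr x y) := by
  have h1 : B.pbr ∘ₗ pX = B.pbr.compr₂ pX := by
    refine ext' fun p b => ext' fun q c => ?_
    simp only [comp_apply, compr₂_apply, pX_tmul, pbr_tmul, mul_assoc]
  have h2 : B.pbr.compl₂ pX = B.pbr.compr₂ pX := by
    refine ext' fun p b => ext' fun q c => ?_
    simp only [LinearMap.compl₂_apply, compr₂_apply, pX_tmul, pbr_tmul, mul_left_comm]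
  exact ⟨lcongr_fun₂ h1 x y, lcongr_fun₂ h2 x y⟩

/-- The contraction of the one-forms with the Euler vector field. -/
def pathTh : PathV χ →ₗ[K] PathV χ := codRestrict _
    ((0 : PathV χ →ₗ[K] Q.B).prod ((pX ∘ₗ PathV.v).prod (0 : PathV χ →ₗ[K] B.PV))) fun x => by
  have h : ∀ y : B.PV, B.pevA 0 (pX y) = 0 := fun y => by
    rw [pX_eq, map_mul, pevA_tmul, eval_X, zero_smul, zero_mul]
  exact (h _).trans (map_zero χ.f).symm

/-- The contraction with the Euler vector field, as an operator on the Poisson algebra. -/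
def pathTh' : (path χ).B →ₗ[K] (path χ).B := pathTh χ

lemma pathTh_der : (path χ).PoisDer 1 (pathTh' χ) where
  mem hx := ⟨zero_mem _, pX_mem hx.2.2, zero_mem _⟩
  mul {i j} {x y : PathV χ} (hx : x ∈ PathV.gr χ i) (hy : y ∈ PathV.gr χ j) := by
    refine PathV.ext ?_ ?_ ?_
    · change 0 = 0 * q y + sg K (1 * i) • (q x * 0)
      rw [zero_mul, mul_zero, smul_zero, add_zero]
    · change pX (v (x * y)) = pX (v x) * u y + sg K (1 * i) • (u x * pX (v y))
      rw [v_mul hx, one_mul, map_add, map_smul, pX_eq, pX_eq, pX_eq, pX_eq, ← mul_assoc,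
        ← mul_assoc, ← mul_assoc, pX_comm]
    · change 0 = v ((pathTh χ x : PathV χ) * y) + sg K (1 * i) • v (x * (pathTh χ y : PathV χ))
      rw [v_mul hx, v_mul (i := i + 1) ⟨zero_mem _, pX_mem hx.2.2, zero_mem _⟩]
      change 0 = 0 * u y + sg K (i + 1) • (pX (v x) * v y) +
        sg K (1 * i) • (v x * pX (v y) + sg K i • (u x * 0))
      rw [zero_mul, mul_zero, smul_zero, add_zero, zero_add, one_mul, pX_eq, pX_eq, ← mul_assoc,
        pX_comm, sg_add, sg_odd (K := K) (i := 1) (by decide)]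
      module
  br {i j} {x y : PathV χ} (hx : x ∈ PathV.gr χ i) (hy : y ∈ PathV.gr χ j) := by
    refine PathV.ext ?_ ?_ ?_
    · change 0 = sg K (1 * N) • (Q.br 0 (q y) + sg K (1 * i) • Q.br (q x) 0)
      rw [map_zero, map_zero, lzero_apply, smul_zero, add_zero, smul_zero]
    · change pX (v (PathV.br χ x y)) = sg K (1 * N) • (B.pbr (pX (v x)) (u y) +
        sg K (1 * i) • B.pbr (u x) (pX (v y)))
      rw [v_br hx, (pbr_pX _ _).1, (pbr_pX _ _).2, map_smul, map_add, map_smul, one_mul, one_mul]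
    · change 0 = sg K (1 * N) • (v (PathV.br χ (pathTh χ x) y) +
        sg K (1 * i) • v (PathV.br χ x (pathTh χ y)))
      rw [v_br hx, v_br (i := i + 1) ⟨zero_mem _, pX_mem hx.2.2, zero_mem _⟩]
      change 0 = sg K (1 * N) • (sg K N • (B.pbr 0 (u y) + sg K (i + 1) • B.pbr (pX (v x)) (v y)) +
        sg K (1 * i) • sg K N • (B.pbr (v x) (pX (v y)) + sg K i • B.pbr (u x) 0))
      rw [(pbr_pX _ _).1, (pbr_pX _ _).2, map_zero, map_zero, lzero_apply, one_mul N,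
        one_mul i, sg_add, sg_odd (K := K) (i := 1) (by decide)]
      module

lemma path_eigen (x : (path χ).B) : x ∈ span K {x : (path χ).B | ∃ w : ℕ,
    ((path χ).d ∘ₗ pathTh' χ + pathTh' χ ∘ₗ (path χ).d) x = (w : K) • x ∧
      (w = 0 → (pathConst χ).f ((pathPr χ).f x) = x) ∧ (w ≠ 0 → (pathPr χ).f x = 0)} := by
  have hL : ∀ x : PathV χ, ((path χ).d ∘ₗ pathTh' χ + pathTh' χ ∘ₗ (path χ).d) x =
      (PathV.d χ (pathTh χ x) + pathTh χ (PathV.d χ x) : PathV χ) := fun _ => rfl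
  have hq : ∀ x : PathV χ, q (PathV.d χ (pathTh χ x) + pathTh χ (PathV.d χ x)) = 0 := fun x => by
    rw [map_add, q_d]; change Q.d 0 + 0 = 0; rw [map_zero, add_zero]
  have hu : ∀ x : PathV χ, u (PathV.d χ (pathTh χ x) + pathTh χ (PathV.d χ x)) =
      pX (B.pder (u x)) := fun x => by
    rw [map_add, u_d]
    change B.pd (pX (v x)) + pX (B.pder (u x) - B.pd (v x)) = _
    have h : B.pd ∘ₗ pX = pX ∘ₗ B.pd := ext' fun p b => rfl
    have h' : B.pd (pX (v x)) = pX (B.pd (v x)) := lcongr_fun h (v x)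
    rw [map_sub, h', add_sub_cancel]
  have hv : ∀ x : PathV χ, v (PathV.d χ (pathTh χ x) + pathTh χ (PathV.d χ x)) =
      B.pder (pX (v x)) := fun x => by
    rw [map_add, v_d]
    change B.pder (pX (v x)) - B.pd 0 + 0 = _
    rw [map_zero, sub_zero, add_zero]
  have hder : ∀ (k : ℕ) (b : B.B), B.pder ((X ^ (k + 1)) ⊗ₜ b) = ((k + 1 : ℕ) : K) • ((X ^ k) ⊗ₜ b) := by
    intro k b
    rw [pder_tmul, derivative_X_pow, smul_tmul', smul_eq_C_mul]
    rfl
  induction x using PathV.induction with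
  | hadd x y hx hy => exact add_mem hx hy
  | h1 i a ha =>
    refine subset_span ⟨0, ?_, fun _ => rfl, fun h => (h rfl).elim⟩
    rw [hL, Nat.cast_zero]
    refine Eq.trans ?_ (zero_smul K _).symm
    refine PathV.ext (hq _) ((hu _).trans ?_) ((hv _).trans ?_)
    · change pX (B.pder (1 ⊗ₜ χ.f a)) = 0
      rw [pder_tmul, derivative_one, zero_tmul, map_zero]
    · change B.pder (pX 0) = 0
      rw [map_zero, map_zero]
  | h2 k i b hb =>
    refine subset_span ⟨k + 1, ?_, fun h => by omega, fun _ => rfl⟩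
    rw [hL]
    refine PathV.ext ((hq _).trans (smul_zero ((k + 1 : ℕ) : K)).symm) ((hu _).trans ?_) ((hv _).trans ?_)
    · change pX (B.pder ((X * X ^ k) ⊗ₜ b)) = ((k + 1 : ℕ) : K) • ((X * X ^ k) ⊗ₜ b)
      rw [← pow_succ', hder, map_smul, pX_tmul, pow_succ']
    · change B.pder (pX 0) = ((k + 1 : ℕ) : K) • 0
      rw [map_zero, map_zero, smul_zero]
  | h3 k i b hb =>
    refine subset_span ⟨k + 1, ?_, fun h => by omega, fun _ => rfl⟩
    rw [hL]
    refine PathV.ext ((hq _).trans (smul_zero ((k + 1 : ℕ) : K)).symm) ((hu _).trans ?_) ((hv _).trans ?_)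
    · change pX (B.pder 0) = ((k + 1 : ℕ) : K) • 0
      rw [map_zero, map_zero, smul_zero]
    · change B.pder (pX ((X ^ k) ⊗ₜ b)) = ((k + 1 : ℕ) : K) • ((X ^ k) ⊗ₜ b)
      rw [pX_tmul, ← pow_succ', hder]

lemma pathPr_isQuasiIso [CharZero K] : (pathPr χ).IsQuasiIso :=
  Cpx.Hom.isQuasiIso_of_eigen (pathPr χ).toCpx (pathConst χ).f.toLinearMap (pathTh' χ)
    (fun _ _ hy => (pathConst χ).mem hy) (fun _ => rfl) (fun _ _ hx => (pathTh_der χ).mem hx)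
    (fun _ => rfl) (path_eigen χ)

lemma pathEv_isQuasiIso [CharZero K] (h : χ.IsQuasiIso) : (pathEv χ).IsQuasiIso := by
  have h1 : ((pathPr χ).toCpx.comp (pathConst χ).toCpx).IsQuasiIso :=
    ⟨fun i y hy hd => ⟨y, hy, hd, 0, zero_mem _, by rw [map_zero, add_zero]; rfl⟩,
      fun i x hx hd ⟨z, hz, e⟩ => ⟨z, hz, e⟩⟩
  refine Cpx.Hom.IsQuasiIso.of_comp_right (f := (pathConst χ).toCpx)
    (Cpx.Hom.IsQuasiIso.of_comp (pathPr_isQuasiIso χ) h1) ?_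
  rw [show (pathEv χ).toCpx.comp (pathConst χ).toCpx = χ.toCpx from Cpx.Hom.ext (pathEv_const χ)]
  exact h

end PoisAlg

end PathHom

section Main

variable {K : Type u} [Field K] [CharZero K]

lemma Cpx.Hom.isQuasiIso_of_homologous {C : Cpx K} {f : Hom C C}
    (h : ∀ i, ∀ x ∈ C.gr i, C.d x = 0 → ∃ w ∈ C.gr (i + 1), f.f x = x + C.d w) :
    f.IsQuasiIso where
  surj i y hy hd := ⟨y, hy, hd, h i y hy hd⟩
  inj i x hx hd h' := by
    obtain ⟨z, hz, e⟩ := h'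
    obtain ⟨w, hw, e'⟩ := h i x hx hd
    exact ⟨z - w, sub_mem hz hw, by rw [map_sub, ← e, e', add_sub_cancel_right]⟩

lemma Cpx.Hom.IsQuasiIso.of_comp_comp {B C D E : Cpx K} {g : Hom D E} {f : Hom C D} {e : Hom B C}
    (h : (g.comp f).IsQuasiIso) (h' : (f.comp e).IsQuasiIso) : f.IsQuasiIso where
  surj i y hy hd := by
    obtain ⟨x, hx, dx, z, hz, e'⟩ := h'.surj i y hy hd
    exact ⟨e.f x, e.mem hx, by rw [← e.comm, dx, map_zero], z, hz, e'⟩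
  inj i x hx hd h'' := by
    obtain ⟨z, hz, e'⟩ := h''
    exact h.inj i x hx hd ⟨g.f z, g.mem hz, by rw [← g.comm, ← e']; rfl⟩

variable {n : ℕ} (A : PDCDGA K n) {Q B : PoisAlg K (n - 1)}

lemma exists_circMap_inverse (χ : Q.Hom B) (hχ : χ.IsQuasiIso) (hB : B.Cofibrant) :
    ∃ ψ : B.Hom Q, ψ.IsQuasiIso ∧ ((circMap A χ).comp (circMap A ψ)).IsQuasiIso := by
  obtain ⟨r, hr⟩ := hB _ _ (PoisAlg.pathEv χ) (PoisAlg.pathEv_surjective χ)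
    (PoisAlg.pathEv_isQuasiIso χ hχ) (.id B)
  refine ⟨(PoisAlg.pathPr χ).comp r, ?_, ?_⟩
  · refine Cpx.Hom.IsQuasiIso.comp (g := (PoisAlg.pathPr χ).toCpx) (f := r.toCpx)
      (PoisAlg.pathPr_isQuasiIso χ) (Cpx.Hom.IsQuasiIso.of_comp (PoisAlg.pathEv_isQuasiIso χ hχ)
        (Cpx.Hom.isQuasiIso_of_homologous fun i x _ _ => ⟨0, zero_mem _, ?_⟩))
    rw [map_zero, add_zero]
    exact hr x
  · refine Cpx.Hom.isQuasiIso_of_homologous fun i x hx hd => ?_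
    have hp : (circMap A (PoisAlg.pathPr χ)).IsQuasiIso :=
      circMap_isQuasiIso_of_eigen A _ (PoisAlg.pathConst χ) (fun _ => rfl)
        (PoisAlg.pathTh_der χ) (fun _ => rfl) (PoisAlg.path_eigen χ)
    set y := (circMap A r).f x with hy
    have hy' : (circ A _).d y = 0 := by rw [hy, ← (circMap A r).comm, hd, map_zero]
    set z := (circMap A (PoisAlg.pathConst χ)).f ((circMap A (PoisAlg.pathPr χ)).f y) with hz
    have hz' : (circ A _).d z = 0 := by
      rw [hz, ← Cpx.Hom.comm, ← Cpx.Hom.comm, hy', map_zero, map_zero]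
    have hpz : (circMap A (PoisAlg.pathPr χ)).f (z - y) = 0 := by
      rw [map_sub, hz, circMap_comp_apply A _ (PoisAlg.pathConst χ) (.id Q) (fun _ => rfl),
        circMap_id, sub_self]
    obtain ⟨w, hw, e⟩ := hp.inj i (z - y) (sub_mem ((circMap A _).mem ((circMap A _).mem
      ((circMap A r).mem hx))) ((circMap A r).mem hx)) (by rw [map_sub, hy', hz', sub_zero])
      ⟨0, zero_mem _, by rw [hpz, map_zero]⟩
    refine ⟨(circMap A (PoisAlg.pathEv χ)).f w, Cpx.Hom.mem _ hw, ?_⟩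
    have e1 : (circMap A χ).f ((circMap A ((PoisAlg.pathPr χ).comp r)).f x) =
        (circMap A (PoisAlg.pathEv χ)).f z := by
      rw [hz, circMap_comp_apply A _ _ χ (PoisAlg.pathEv_const χ), hy,
        circMap_comp_apply A (PoisAlg.pathPr χ) r ((PoisAlg.pathPr χ).comp r) fun _ => rfl]
    have e2 : (circMap A (PoisAlg.pathEv χ)).f y = x := by
      rw [hy, circMap_comp_apply A _ r (.id B) hr, circMap_id]
    refine e1.trans ?_
    rw [← Cpx.Hom.comm, ← e, map_sub, e2, add_sub_cancel]

/-- The relative composition product preserves the quasi-isomorphisms of cofibrant algebras. -/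
lemma circMap_isQuasiIso (χ : Q.Hom B) (hχ : χ.IsQuasiIso) (hQ : Q.Cofibrant) (hB : B.Cofibrant) :
    (circMap A χ).IsQuasiIso := by
  obtain ⟨ψ, hψ, h⟩ := exists_circMap_inverse A χ hχ hB
  obtain ⟨ρ, hρ, h'⟩ := exists_circMap_inverse A ψ hψ hQ
  exact Cpx.Hom.IsQuasiIso.of_comp_right (.of_comp_comp h h') h

end Main

end GradedLS

end

theorem mainTheorem4 {K : Type u} [Field K] [CharZero K] (n : ℕ) (hn : 2 ≤ n)
    (A : GradedLS.PDCDGA K n) (hA : A.euler = 0) (g : GradedLS.DGLie K) :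
    (∃ (Q : GradedLS.PoisAlg K (n - 1)) (φ : GradedLS.PoisAlg.Hom Q (g.symPois (n - 1))),
      Q.Cofibrant ∧ φ.IsQuasiIso) ∧
    ∃ Φ : GradedLS.Cpx.Hom (GradedLS.circ A (g.symPois (n - 1))) (A.tensor g).CE,
      ∀ (Q : GradedLS.PoisAlg K (n - 1)) (φ : GradedLS.PoisAlg.Hom Q (g.symPois (n - 1))),
        Q.Cofibrant → φ.IsQuasiIso → (Φ.comp (GradedLS.circMap A φ)).IsQuasiIso := by
  have hR := g.resol_cofibrant ((n : ℤ) - 1)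
  have hS := g.resolContraction.sym_isQuasiIso ((n : ℤ) - 1)
  refine ⟨⟨_, g.resolProj.sym ((n : ℤ) - 1), hR, hS⟩, GradedLS.circPhi A g hA, fun Q φ hQ hφ => ?_⟩
  obtain ⟨χ, hχ⟩ := hQ _ _ (g.resolProj.sym ((n : ℤ) - 1))
    g.resolContraction.sym_surjective hS φ
  have h : χ.IsQuasiIso := .of_comp hS (by
    rw [show (g.resolProj.sym ((n : ℤ) - 1)).toCpx.comp χ.toCpx = φ.toCpx from
      GradedLS.Cpx.Hom.ext hχ]
    exact hφ)
  have e : (GradedLS.circPhi A g hA).comp (GradedLS.circMap A φ) =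
      (g.resolProj.tensor A).ce.comp
        ((GradedLS.circPhi A g.resol hA).comp (GradedLS.circMap A χ)) :=
    GradedLS.Cpx.Hom.ext fun x => (congrArg (GradedLS.circPhi A g hA).f
      (GradedLS.circMap_comp_apply A _ χ φ hχ x).symm).trans
        (GradedLS.circPhi_naturality g.resolProj hA _)
  rw [e]
  exact .comp (g.resolContraction.tensor A).ce_isQuasiIso
    (.comp (GradedLS.circPhi_isQuasiIso hA) (GradedLS.circMap_isQuasiIso A χ h hQ hR))
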